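/- **Setting.** Let $C$ be a smooth projective geometrically irreducible curve over the finite field $\mathbb F_q$, let $\infty\in C(\mathbb F_q)$, and put $A=\Gamma(C\setminus\{\infty\},\mathcal O_C)$. Let $L\supset\mathbb F_q$ be a field, $C_L=C\times_{\mathbb F_q}L$, $A_L=A\otimes_{\mathbb F_q}L$. Write $\sigma=\mathrm{id}_C\times\operatorname{Spec}(\mathrm{Frob}_q)$ for the endomorphism of $C_L$ that is the $q$-Frobenius on $L$, and $\sigma^*$ for the pullback of sheaves and of $A_L$-modules ($\sigma^*M=M\otimes_{A_L,\sigma^*}A_L$ with $\sigma^*(a\otimes b)=a\otimes b^q$). The point $\infty\times\operatorname{Spec}L$ of $C_L$ is again denoted $\infty$; $r,d\ge 0$ are integers. *Pure $A$-motives.* Let $c^*:A\to L$ be an $\mathbb F_q$-homomorphism and let $J\subset A_L$ be the ideal generated by all $a\otimes1-1\otimes c^*(a)$. A pure $A$-motive of rank $r$, dimension $d$ and characteristic $c^*$ over $L$ is a locally free $A_L$-module $M$ of rank $r$ with an injective $A_L$-linear map $\tau:\sigma^*M\to M$ such that $\operatorname{coker}\tau$ has $L$-dimension $d$ and is annihilated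 by $J^d$, and such that $M$ extends to a locally free sheaf $\mathcal M$ of rank $r$ on $C_L$ for which, for some integers $k,l>0$, the map $\tau^l=\tau\circ\sigma^*\tau\circ\dots\circ(\sigma^*)^{l-1}\tau$ induces an isomorphism of stalks $(\sigma^*)^l\mathcal M_\infty\to\mathcal M(k\cdot\infty)_\infty$. A morphism $(M,\tau)\to(M',\tau')$ is an $A_L$-linear map $f$ with $f\circ\tau=\tau'\circ\sigma^*f$. *Abelian $\tau$-sheaves.* Let $c:\operatorname{Spec}L\to C$ be an $\mathbb F_q$-morphism and let $\mathcal I$ be the ideal sheaf of its graph in $C_L$. An abelian $\tau$-sheaf of rank $r$, dimension $d$ and characteristic $c$ over $L$ is a family $\underline{\mathcal F}=(\mathcal F_i,\Pi_i,\tau_i)_{i\in\mathbb Z}$ of locally free sheaves $\mathcal F_i$ of rank $r$ on $C_L$ and injective morphisms $\Pi_i:\mathcal F_i\to\mathcal F_{i+1}$, $\tau_i:\sigma^*\mathcal F_i\to\mathcal F_{i+1}$ such that (i) $\Pi_{i+1}\circ\tau_i=\tau_{i+1}\circ\sigma^*\Pi_i$; (ii) there are integers $k,l>0$ with $ld=kr$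 such that $\Pi_{i+l-1}\circ\dots\circ\Pi_i$ identifies $\mathcal F_i$ with $\mathcal F_{i+l}(-k\cdot\infty)\subset\mathcal F_{i+l}$ for all $i$; (iii) $\dim_L\operatorname{coker}\Pi_i=d$; (iv) $\dim_L\operatorname{coker}\tau_i=d$ and $\mathcal I^d\operatorname{coker}\tau_i=0$. Its weight is $d/r$ if $r>0$, and $0$ if $r=0$. A morphism $f:\underline{\mathcal F}\to\underline{\mathcal F}'$ is a family of morphisms $f_i:\mathcal F_i\to\mathcal F'_i$ commuting with the $\Pi$'s and the $\tau$'s (that is, $f_{i+1}\circ\tau_i=\tau'_i\circ\sigma^*f_i$). For $m\in\mathbb Z$ put $\underline{\mathcal F}(m\cdot\infty)=(\mathcal F_i(m\cdot\infty),\Pi_i\otimes\mathrm{id},\tau_i\otimes\mathrm{id})$. Put $$\underline M(\underline{\mathcal F})=\bigl(\Gamma(C_L\setminus\{\infty\},\mathcal F_0),\ \Pi_0^{-1}\circ\tau_0\bigr),$$ and for $f:\underline{\mathcal F}\to\underline{\mathcal F}'(m\cdot\infty)$ let $\underline M(f):\underline M(\underline{\mathcal F})\to\underline M(\underline{\mathcal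 F}')$ be the map induced by $f_0$ on sections over $C_L\setminus\{\infty\}$, where $\mathcal F'_0(m\cdot\infty)$ and $\mathcal F'_0$ agree. **Theorem.** 1. Let $(M,\tau)$ be a pure $A$-motive of rank $r$, dimension $d$ and characteristic $c^*:A\to L$ over $L$. Then $(M,\tau)\cong\underline M(\underline{\mathcal F})$ for an abelian $\tau$-sheaf $\underline{\mathcal F}$ over $L$ of the same rank $r$ and dimension $d$ and of characteristic $c=\operatorname{Spec}c^*:\operatorname{Spec}L\to\operatorname{Spec}A\subset C$. One can even find $\underline{\mathcal F}$ such that (ii) holds with $k,l$ relatively prime. 2. Let $\underline{\mathcal F}$ and $\underline{\mathcal F}'$ be abelian $\tau$-sheaves over $L$ of the same characteristic $c$ and of the same weight, and let $f_0:\underline M(\underline{\mathcal F})\to\underline M(\underline{\mathcal F}')$ be a morphism. Then there are an integer $m$ and a morphism $f:\underline{\mathcal F}\to\underline{\mathcal F}'(m\cdot\infty)$ with $f_0=\underline M(f)$. -/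

import Mathlib

universe u

open AlgebraicGeometry CategoryTheory TopologicalSpace Opposite

noncomputable section

/-- A smooth proper (equivalently, smooth projective) geometrically irreducible curve `X` over
`Fq` with an `Fq`-rational point `∞`, given as a section `inf` of the structure morphism. -/
structure PointedCurve (Fq : Type u) [Field Fq] where
  X : Scheme.{u}
  str : X ⟶ Spec (CommRingCat.of Fq)
  proper : IsProper str
  smooth : SmoothOfRelativeDimension 1 str
  geomIrred : GeometricallyIrreducible str
  inf : Spec (CommRingCat.of Fq) ⟶ X
  inf_str : inf ≫ str = 𝟙 _

namespace PointedCurve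

variable {Fq : Type u} [Field Fq] (C : PointedCurve Fq)

/-- The closed point `∞` of the curve. -/
def infPt : C.X := C.inf (IsLocalRing.closedPoint Fq)

lemma isClosed_infPt : IsClosed ({C.infPt} : Set C.X) := by
  have := C.proper
  have : IsClosedImmersion (C.inf ≫ C.str) := by rw [C.inf_str]; infer_instance
  have : IsClosedImmersion C.inf := MorphismProperty.of_postcomp (W := @IsClosedImmersion)
    (W' := @IsSeparated) C.inf C.str inferInstance inferInstance
  have h := C.inf.isClosedEmbedding.isClosed_range
  convert h
  ext x
  constructor
  · rintro rfl
    exact ⟨_, rfl⟩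
  · rintro ⟨y, rfl⟩
    have : y = IsLocalRing.closedPoint Fq := Subsingleton.elim (α := PrimeSpectrum Fq) _ _
    rw [this]; rfl

/-- The open complement `C ∖ {∞}`. -/
def U : C.X.Opens := ⟨{C.infPt}ᶜ, C.isClosed_infPt.isOpen_compl⟩

/-- A local equation of `∞`: a function `z` on an open neighbourhood `W` of `∞`, invertible on
`W ∖ {∞}`, whose germ at `∞` generates the maximal ideal of the local ring. -/
structure Uniformizer where
  W : C.X.Opens
  mem : C.infPt ∈ W
  z : Γ(C.X, W)
  basicOpen_eq : C.X.basicOpen z = W ⊓ C.U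
  span_germ : Ideal.span {C.X.presheaf.germ W C.infPt mem z} =
    IsLocalRing.maximalIdeal (C.X.presheaf.stalk C.infPt)

/-- The ring `A = Γ(C ∖ {∞}, 𝒪_C)`. -/
def A : Type u := Γ(C.X, C.U)

instance : CommRing C.A := inferInstanceAs (CommRing Γ(C.X, C.U))

/-- The structure map `Fq → A`. -/
def toA : Fq →+* C.A :=
  (C.X.presheaf.map (homOfLE (le_top : C.U ≤ ⊤)).op).hom.comp
    (C.str.appTop.hom.comp (Scheme.ΓSpecIso (CommRingCat.of Fq)).inv.hom)

instance : Algebra Fq C.A := C.toA.toAlgebra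

section BaseChange

variable (L : Type u) [Field L] [Algebra Fq L]

/-- `Spec L → Spec Fq`. -/
def specMap : Spec (CommRingCat.of L) ⟶ Spec (CommRingCat.of Fq) :=
  Spec.map (CommRingCat.ofHom (algebraMap Fq L))

/-- The base change `C_L = C ×_{Fq} L`. -/
def CL : Scheme.{u} := Limits.pullback C.str (specMap (Fq := Fq) L)

/-- The projection `C_L → C`. -/
def pr : C.CL L ⟶ C.X := Limits.pullback.fst _ _

/-- The projection `C_L → Spec L`. -/
def prL : C.CL L ⟶ Spec (CommRingCat.of L) := Limits.pullback.snd _ _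

lemma pr_str : C.pr L ≫ C.str = C.prL L ≫ specMap L := Limits.pullback.condition

/-- `C_L ∖ {∞}`, the preimage of `C ∖ {∞}`. -/
def UL : (C.CL L).Opens := C.pr L ⁻¹ᵁ C.U

lemma inf_condition : (specMap L ≫ C.inf) ≫ C.str = 𝟙 _ ≫ specMap (Fq := Fq) L := by
  rw [Category.assoc, C.inf_str]; simp

/-- The point `∞` of `C_L`. -/
def infLPt : C.CL L :=
  (Limits.pullback.lift (specMap L ≫ C.inf) (𝟙 _) (C.inf_condition L) :
    Spec (CommRingCat.of L) ⟶ C.CL L) (IsLocalRing.closedPoint L)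

variable {L} in
/-- The pullback of a local equation of `∞` to an open subset of `C_L`. -/
def Uniformizer.onCL {C : PointedCurve Fq} (z : C.Uniformizer) (V : (C.CL L).Opens)
    (h : V ≤ C.pr L ⁻¹ᵁ z.W) : Γ(C.CL L, V) :=
  (C.CL L).presheaf.map (homOfLE h).op ((C.pr L).app z.W z.z)

/-- The structure map `L → Γ(V, 𝒪_{C_L})`. -/
def toGammaL (V : (C.CL L).Opens) : L →+* Γ(C.CL L, V) :=
  ((C.CL L).presheaf.map (homOfLE (le_top : V ≤ ⊤)).op).hom.comp
    ((C.prL L).appTop.hom.comp (Scheme.ΓSpecIso (CommRingCat.of L)).inv.hom)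

/-- The pullback `A → Γ(C_L ∖ {∞}, 𝒪_{C_L})`. -/
def toGammaA : C.A →+* Γ(C.CL L, C.UL L) := ((C.pr L).app C.U).hom

open scoped TensorProduct

/-- `A_L = A ⊗_{Fq} L`. -/
abbrev AL : Type u := C.A ⊗[Fq] L

lemma toGamma_comm (a : Fq) :
    C.toGammaA L (algebraMap Fq C.A a) = C.toGammaL L (C.UL L) (algebraMap Fq L a) := by
  have h : (C.str.appTop ≫ C.X.presheaf.map (homOfLE (le_top : C.U ≤ ⊤)).op) ≫ (C.pr L).app C.U =
      (specMap (Fq := Fq) L).appTop ≫ (C.prL L).appTop ≫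
        (C.CL L).presheaf.map (homOfLE (le_top : C.UL L ≤ ⊤)).op := by
    rw [← Category.assoc (specMap (Fq := Fq) L).appTop, ← Scheme.Hom.comp_appTop, ← C.pr_str L,
      Scheme.Hom.comp_appTop, Category.assoc, Category.assoc, Scheme.Hom.naturality]
    rfl
  have h2 : CommRingCat.ofHom (algebraMap Fq L) ≫ (Scheme.ΓSpecIso (CommRingCat.of L)).inv =
      (Scheme.ΓSpecIso (CommRingCat.of Fq)).inv ≫ (specMap (Fq := Fq) L).appTop :=
    Scheme.ΓSpecIso_inv_naturality _
  have e1 := congr($(h).hom ((Scheme.ΓSpecIso (CommRingCat.of Fq)).inv.hom a))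
  have e2 := congr($(h2).hom a)
  simp only [CommRingCat.hom_comp, RingHom.comp_apply, CommRingCat.hom_ofHom] at e1 e2
  rw [← e2] at e1
  exact e1

/-- The canonical map `A_L → Γ(C_L ∖ {∞}, 𝒪_{C_L})`, through which sections over `C_L ∖ {∞}`
are `A_L`-modules. -/
def ALtoGamma : C.AL L →+* Γ(C.CL L, C.UL L) :=
  letI : Algebra Fq Γ(C.CL L, C.UL L) :=
    ((C.toGammaL L (C.UL L)).comp (algebraMap Fq L)).toAlgebra
  (Algebra.TensorProduct.lift
    ({ C.toGammaA L with commutes' := C.toGamma_comm L } : C.A →ₐ[Fq] Γ(C.CL L, C.UL L))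
    ({ C.toGammaL L (C.UL L) with commutes' := fun _ => rfl } : L →ₐ[Fq] Γ(C.CL L, C.UL L))
    (fun _ _ => mul_comm _ _)).toRingHom

lemma ALtoGamma_tmul (x : C.A) (y : L) :
    C.ALtoGamma L (x ⊗ₜ y) = C.toGammaA L x * C.toGammaL L (C.UL L) y := rfl

/-- `F ↦ j_* j^* F` for the inclusion `j : C_L ∖ {∞} → C_L`. -/
def away : (C.CL L).Modules ⥤ (C.CL L).Modules :=
  Scheme.Modules.restrictFunctor (C.UL L).ι ⋙ Scheme.Modules.pushforward (C.UL L).ι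

/-- The natural map `F → j_* j^* F`. -/
def toAway (F : (C.CL L).Modules) : F ⟶ (C.away L).obj F :=
  (Scheme.Modules.restrictAdjunction (C.UL L).ι).unit.app F

variable {L} in
/-- A section `s` of `j_* j^* F` over `V` lies in `F(n·∞)` if near `∞` the section `z ^ n • s` of
`F` away from `∞` extends to a section `t` of `F`, where `z` is a local equation of `∞`. For `n < 0`
the equation `t = z ^ n • s` is written `z ^ (-n) • t = s`. (The condition does not depend
on the choice of `z`, and it is empty if `∞ ∉ V`.) -/
def InTwist (F : (C.CL L).Modules) (n : ℤ) (V : (C.CL L).Opens)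
    (s : Γ((C.away L).obj F, V)) : Prop :=
  ∀ x ∈ V, x ∉ C.UL L → ∀ z : C.Uniformizer, ∃ (V' : (C.CL L).Opens) (_ : x ∈ V')
    (hV : V' ≤ V) (hz : V' ≤ C.pr L ⁻¹ᵁ z.W) (t : Γ(F, V')),
      z.onCL V' hz ^ (-n).toNat • (C.toAway L F).app V' t =
        z.onCL V' hz ^ n.toNat • ((C.away L).obj F).presheaf.map (homOfLE hV).op s

variable {L}
lemma Uniformizer.map_onCL {C : PointedCurve Fq} (z : C.Uniformizer) {V V' : (C.CL L).Opens}
    (h : V ≤ C.pr L ⁻¹ᵁ z.W) (h' : V' ≤ V) :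
    (C.CL L).presheaf.map (homOfLE h').op (z.onCL V h) = z.onCL V' (h'.trans h) := by
  simp only [Uniformizer.onCL]
  rw [← CommRingCat.comp_apply, ← Functor.map_comp]
  rfl

lemma map_map_apply {X : Scheme.{u}} (F : X.Modules) {V V' V'' : X.Opens} (h : V' ≤ V) (h' : V'' ≤ V')
   (s : Γ(F, V)) : F.presheaf.map (homOfLE h').op (F.presheaf.map (homOfLE h).op s) =
     F.presheaf.map (homOfLE (h'.trans h)).op s := by
  rw [← ConcreteCategory.comp_apply, ← Functor.map_comp]
  rfl

lemma app_map_apply {X : Scheme.{u}} {F G : X.Modules} (f : F ⟶ G) {V V' : X.Opens} (h : V' ≤ V)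
   (s : Γ(F, V)) : f.app V' (F.presheaf.map (homOfLE h).op s) =
     G.presheaf.map (homOfLE h).op (f.app V s) := by
  exact congr($(f.mapPresheaf.naturality (homOfLE h).op) s)

lemma twist_shrink (F : (C.CL L).Modules) (a b : ℕ) {V V' V'' : (C.CL L).Opens} (z : C.Uniformizer)
   (hV : V' ≤ V) (hz : V' ≤ C.pr L ⁻¹ᵁ z.W) (h : V'' ≤ V') {t : Γ(F, V')} {s : Γ((C.away L).obj F, V)}
   (e : z.onCL V' hz ^ a • (C.toAway L F).app V' t =
        z.onCL V' hz ^ b • ((C.away L).obj F).presheaf.map (homOfLE hV).op s) :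
   z.onCL V'' (h.trans hz) ^ a • (C.toAway L F).app V'' (F.presheaf.map (homOfLE h).op t) =
        z.onCL V'' (h.trans hz) ^ b • ((C.away L).obj F).presheaf.map (homOfLE (h.trans hV)).op s := by
  have := congr(((C.away L).obj F).presheaf.map (homOfLE h).op $e)
  rw [Scheme.Modules.map_smul, Scheme.Modules.map_smul, map_map_apply, map_pow, map_pow,
    Uniformizer.map_onCL, ← app_map_apply] at this
  exact this

lemma InTwist.add {F : (C.CL L).Modules} {n : ℤ} {V : (C.CL L).Opens} {s s' : Γ((C.away L).obj F, V)}
   (h : C.InTwist F n V s) (h' : C.InTwist F n V s') : C.InTwist F n V (s + s') := by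
  intro x hx hxU z
  obtain ⟨V₁, hx1, hV1, hz1, t1, e1⟩ := h x hx hxU z
  obtain ⟨V₂, hx2, hV2, hz2, t2, e2⟩ := h' x hx hxU z
  refine ⟨V₁ ⊓ V₂, ⟨hx1, hx2⟩, inf_le_left.trans hV1, inf_le_left.trans hz1,
    F.presheaf.map (homOfLE inf_le_left).op t1 + F.presheaf.map (homOfLE inf_le_right).op t2, ?_⟩
  rw [map_add, map_add, smul_add, smul_add, C.twist_shrink F _ _ z hV1 hz1 inf_le_left e1,
    C.twist_shrink F _ _ z hV2 hz2 inf_le_right e2]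

lemma InTwist.smul {F : (C.CL L).Modules} {n : ℤ} {V : (C.CL L).Opens} (r : Γ(C.CL L, V))
   {s : Γ((C.away L).obj F, V)} (h : C.InTwist F n V s) : C.InTwist F n V (r • s) := by
  intro x hx hxU z
  obtain ⟨V₁, hx1, hV1, hz1, t1, e1⟩ := h x hx hxU z
  refine ⟨V₁, hx1, hV1, hz1, (C.CL L).presheaf.map (homOfLE hV1).op r • t1, ?_⟩
  rw [Scheme.Modules.map_smul, Scheme.Modules.Hom.app_smul, smul_comm, e1, smul_comm]

lemma InTwist.zero (F : (C.CL L).Modules) (n : ℤ) (V : (C.CL L).Opens) :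
    C.InTwist F n V 0 := by
  intro x hx hxU z
  have hz : C.pr L x ∈ z.W := by
    have h : C.pr L x = C.infPt := by by_contra h; exact hxU h
    rw [h]; exact z.mem
  exact ⟨V ⊓ C.pr L ⁻¹ᵁ z.W, ⟨hx, hz⟩, inf_le_left, inf_le_right, 0, by simp⟩

lemma InTwist.map {F : (C.CL L).Modules} {n : ℤ} {V V' : (C.CL L).Opens} (hV : V' ≤ V)
   {s : Γ((C.away L).obj F, V)} (h : C.InTwist F n V s) :
   C.InTwist F n V' (((C.away L).obj F).presheaf.map (homOfLE hV).op s) := by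
  intro x hx hxU z
  obtain ⟨V₁, hx1, hV1, hz1, t1, e1⟩ := h x (hV hx) hxU z
  refine ⟨V₁ ⊓ V', ⟨hx1, hx⟩, inf_le_right, inf_le_left.trans hz1, F.presheaf.map (homOfLE inf_le_left).op t1, ?_⟩
  rw [C.twist_shrink F _ _ z hV1 hz1 inf_le_left e1, map_map_apply]

/-- The subsheaf `F(n·∞)` of `j_* j^* F`, as a family of submodules. -/
def twistSubmodule (F : (C.CL L).Modules) (n : ℤ) :
   PresheafOfModules.Submodule ((C.away L).obj F).val where
  obj V :=
    { carrier := {s | C.InTwist F n V.unop s}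
      add_mem' := InTwist.add C
      zero_mem' := InTwist.zero C F n V.unop
      smul_mem' := fun r _ h => InTwist.smul C r h }
  map f := fun _ hs => InTwist.map C (leOfHom f.unop) hs

lemma twistSubmodule_local (F : (C.CL L).Modules) (n : ℤ) (V : (C.CL L).Opens)
    (s : Γ((C.away L).obj F, V))
    (h : ∀ x ∈ V, ∃ (V' : (C.CL L).Opens) (_ : x ∈ V') (hV : V' ≤ V),
      C.InTwist F n V' (((C.away L).obj F).presheaf.map (homOfLE hV).op s)) : C.InTwist F n V s := by
  intro x hx hxU z
  obtain ⟨V', hx', hV', h'⟩ := h x hx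
  obtain ⟨V₁, hx1, hV1, hz1, t1, e1⟩ := h' x hx' hxU z
  refine ⟨V₁, hx1, hV1.trans hV', hz1, t1, ?_⟩
  rw [e1, map_map_apply]


lemma twist_isSheaf (F : (C.CL L).Modules) (n : ℤ) :
    Presheaf.IsSheaf (Opens.grothendieckTopology (C.CL L))
      (C.twistSubmodule F n).toPresheafOfModules.presheaf := by
  let M := (C.away L).obj F
  let N := (C.twistSubmodule F n).toPresheafOfModules.presheaf
  have hM : TopCat.Presheaf.IsSheafUniqueGluing M.presheaf :=
    (TopCat.Presheaf.isSheaf_iff_isSheafUniqueGluing _).1 M.isSheaf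
  refine (TopCat.Presheaf.isSheaf_iff_isSheafUniqueGluing N).2 ?_
  intro ι V sf hsf
  obtain ⟨s, hs, hu⟩ := hM V (fun i => (sf i).1) (fun i j => congrArg Subtype.val (hsf i j))
  have hs' : C.InTwist F n (iSup V) s := by
    apply C.twistSubmodule_local
    intro x hx
    obtain ⟨i, hi⟩ := Opens.mem_iSup.1 hx
    refine ⟨V i, hi, le_iSup V i, ?_⟩
    have e : M.presheaf.map (homOfLE (le_iSup V i)).op s = (sf i).1 := hs i
    rw [e]
    exact (sf i).2
  refine ⟨⟨s, hs'⟩, fun i => Subtype.ext (hs i), ?_⟩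
  intro y hy
  exact Subtype.ext (hu y.1 fun i => congrArg Subtype.val (hy i))

/-- The sheaf of modules `F(n·∞)`, for `F` locally free on `C_L`. -/
def twistObj (F : (C.CL L).Modules) (n : ℤ) : (C.CL L).Modules :=
  (⟨(C.twistSubmodule F n).toPresheafOfModules, C.twist_isSheaf F n⟩ :
    SheafOfModules (C.CL L).ringCatSheaf)

/-- The inclusion `F(n·∞) → j_* j^* F`. -/
def twistIncl (F : (C.CL L).Modules) (n : ℤ) : C.twistObj F n ⟶ (C.away L).obj F :=
  (⟨(C.twistSubmodule F n).ι⟩ :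
    SheafOfModules.Hom (R := (C.CL L).ringCatSheaf) _ _)

/-- A morphism of sheaves of modules from its maps on sections. -/
def modHom {X : Scheme.{u}} {M N : X.Modules} (app : ∀ V : X.Opens, Γ(M, V) →+ Γ(N, V))
    (nat : ∀ (V V' : X.Opens) (h : V' ≤ V) (s : Γ(M, V)),
      app V' (M.presheaf.map (homOfLE h).op s) = N.presheaf.map (homOfLE h).op (app V s))
    (smul : ∀ (V : X.Opens) (r : Γ(X, V)) (s : Γ(M, V)), app V (r • s) = r • app V s) : M ⟶ N :=
  (⟨PresheafOfModules.homMk (M₁ := M.val) (M₂ := N.val)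
      { app := fun V => AddCommGrpCat.ofHom (app V.unop)
        naturality := fun V V' f => by ext s; exact nat V.unop V'.unop (leOfHom f.unop) s }
      (fun V r s => smul V.unop r s)⟩ : SheafOfModules.Hom (R := X.ringCatSheaf) M N)

lemma modHom_app {X : Scheme.{u}} {M N : X.Modules} (app : ∀ V : X.Opens, Γ(M, V) →+ Γ(N, V))
    (nat smul) (V : X.Opens) (s : Γ(M, V)) : (modHom app nat smul).app V s = app V s := rfl

lemma twistIncl_injective (F : (C.CL L).Modules) (n : ℤ) (V : (C.CL L).Opens) :
    Function.Injective ((C.twistIncl F n).app V) := Subtype.val_injective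

lemma InTwist.hom {F G : (C.CL L).Modules} (f : F ⟶ G) {n : ℤ} {V : (C.CL L).Opens}
    {s : Γ((C.away L).obj F, V)} (h : C.InTwist F n V s) :
    C.InTwist G n V (((C.away L).map f).app V s) := by
  intro x hx hxU z
  obtain ⟨V₁, hx1, hV1, hz1, t1, e1⟩ := h x hx hxU z
  refine ⟨V₁, hx1, hV1, hz1, f.app V₁ t1, ?_⟩
  have e2 := congr(((C.away L).map f).app V₁ $e1)
  rw [Scheme.Modules.Hom.app_smul, Scheme.Modules.Hom.app_smul, app_map_apply] at e2
  rw [← e2]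
  congr 1
  exact congr(($((Scheme.Modules.restrictAdjunction (C.UL L).ι).unit.naturality f)).app V₁ t1)

/-- The functor `F ↦ F(n·∞)`. -/
def twist (n : ℤ) : (C.CL L).Modules ⥤ (C.CL L).Modules where
  obj F := C.twistObj F n
  map {F G} f := modHom (M := C.twistObj F n) (N := C.twistObj G n)
    (fun V =>
      { toFun := fun s => ⟨((C.away L).map f).app V s.1, InTwist.hom C f s.2⟩
        map_zero' := Subtype.ext (map_zero (((C.away L).map f).app V).hom)
        map_add' := fun s s' => Subtype.ext (map_add (((C.away L).map f).app V).hom s.1 s'.1) })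
    (fun _ _ h s => Subtype.ext (app_map_apply ((C.away L).map f) h s.1))
    (fun V r s => Subtype.ext (Scheme.Modules.Hom.app_smul (φ := (C.away L).map f) (U := V) r s.1))
  map_id F := by
    ext V s
    refine Subtype.ext ?_
    exact congr(($((C.away L).map_id F)).app V s.1)
  map_comp f g := by
    ext V s
    refine Subtype.ext ?_
    exact congr(($((C.away L).map_comp f g)).app V s.1)

lemma toAway_injective (F : (C.CL L).Modules) {V : (C.CL L).Opens} (hV : V ≤ C.UL L) :
    Function.Injective ((C.toAway L F).app V) := by
  intro s s' h
  have k : V ≤ (C.UL L).ι ''ᵁ ((C.UL L).ι ⁻¹ᵁ V) := by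
    rw [Scheme.Hom.image_preimage_eq_opensRange_inf, Scheme.Opens.opensRange_ι]
    exact le_inf hV le_rfl
  have key : ∀ u : Γ(F, V), F.presheaf.map (homOfLE k).op ((C.toAway L F).app V u) = u := by
    intro u
    refine (map_map_apply F ((C.UL L).ι.image_preimage_le V) k u).trans ?_
    exact congr($(F.presheaf.map_id (op V)) u)
  rw [← key s, ← key s', h]

lemma away_smul (F : (C.CL L).Modules) (V : (C.CL L).Opens) (r : Γ(C.CL L, V))
    (s : Γ((C.away L).obj F, V)) :
    (show Γ(F, (C.UL L).ι ''ᵁ ((C.UL L).ι ⁻¹ᵁ V)) from r • s) =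
      (C.CL L).presheaf.map (homOfLE ((C.UL L).ι.image_preimage_le V)).op r •
        (show Γ(F, (C.UL L).ι ''ᵁ ((C.UL L).ι ⁻¹ᵁ V)) from s) := by
  have := congr($((C.UL L).ι.app_appIso_inv V) r)
  exact congr($this • (show Γ(F, (C.UL L).ι ''ᵁ ((C.UL L).ι ⁻¹ᵁ V)) from s))

variable (L) [Fintype Fq]

/-- `σ^*` on `A_L`: `a ⊗ b ↦ a ⊗ b ^ q`. -/
def sigmaA : C.AL L →+* C.AL L :=
  (Algebra.TensorProduct.map (AlgHom.id Fq C.A) (FiniteField.frobeniusAlgHom Fq L)).toRingHom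

lemma sigma_condition : C.pr L ≫ C.str =
    (C.prL L ≫ Spec.map (CommRingCat.ofHom (FiniteField.frobeniusAlgHom Fq L).toRingHom)) ≫
      specMap L := by
  have h : Spec.map (CommRingCat.ofHom (FiniteField.frobeniusAlgHom Fq L).toRingHom) ≫
      specMap (Fq := Fq) L = specMap L := by
    rw [specMap, ← Spec.map_comp, ← CommRingCat.ofHom_comp]
    congr 2
    exact (FiniteField.frobeniusAlgHom Fq L).comp_algebraMap
  rw [Category.assoc, h, pr_str]

/-- The endomorphism `σ = id_C × Spec(Frob_q)` of `C_L`. -/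
def sigma : C.CL L ⟶ C.CL L :=
  Limits.pullback.lift (C.pr L) _ (C.sigma_condition L)

lemma sigma_pr : C.sigma L ≫ C.pr L = C.pr L := Limits.pullback.lift_fst _ _ _

lemma sigma_prL : C.sigma L ≫ C.prL L =
    C.prL L ≫ Spec.map (CommRingCat.ofHom (FiniteField.frobeniusAlgHom Fq L).toRingHom) :=
  Limits.pullback.lift_snd _ _ _

lemma sigma_UL : C.sigma L ⁻¹ᵁ C.UL L = C.UL L := by
  rw [UL, ← Scheme.Hom.comp_preimage, sigma_pr]



lemma awayPush_le (V : (C.CL L).Opens) :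
    (C.UL L).ι ''ᵁ ((C.UL L).ι ⁻¹ᵁ (C.sigma L ⁻¹ᵁ V)) ≤
      C.sigma L ⁻¹ᵁ ((C.UL L).ι ''ᵁ ((C.UL L).ι ⁻¹ᵁ V)) := by
  rw [Scheme.Hom.image_preimage_eq_opensRange_inf, Scheme.Hom.image_preimage_eq_opensRange_inf,
    Scheme.Opens.opensRange_ι, Scheme.Hom.preimage_inf, sigma_UL]

variable {L}

lemma map_map_comm {X : Scheme.{u}} (F : X.Modules) {V V₁ V₂ W : X.Opens} (h₁ : V₁ ≤ V)
    (k₁ : W ≤ V₁) (h₂ : V₂ ≤ V) (k₂ : W ≤ V₂) (s : Γ(F, V)) :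
    F.presheaf.map (homOfLE k₁).op (F.presheaf.map (homOfLE h₁).op s) =
      F.presheaf.map (homOfLE k₂).op (F.presheaf.map (homOfLE h₂).op s) := by
  rw [map_map_apply, map_map_apply]

lemma app_map_ring {X Y : Scheme.{u}} (f : X ⟶ Y) {V V' : Y.Opens} (h : V' ≤ V)
    {W : X.Opens} (k : W ≤ f ⁻¹ᵁ V') (k' : W ≤ f ⁻¹ᵁ V) (r : Γ(Y, V)) :
    X.presheaf.map (homOfLE k).op (f.app V' (Y.presheaf.map (homOfLE h).op r)) =
      X.presheaf.map (homOfLE k').op (f.app V r) := by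
  have := congr(X.presheaf.map (homOfLE k).op ($(f.naturality (homOfLE h).op) r))
  refine this.trans ?_
  rw [CommRingCat.comp_apply, ← CommRingCat.comp_apply, ← Functor.map_comp]
  rfl

/-- The natural map `j_* j^* σ_* G → σ_* j_* j^* G`. -/
def awayPush (G : (C.CL L).Modules) :
    (C.away L).obj ((Scheme.Modules.pushforward (C.sigma L)).obj G) ⟶
      (Scheme.Modules.pushforward (C.sigma L)).obj ((C.away L).obj G) :=
  modHom (fun V => (G.presheaf.map (homOfLE (C.awayPush_le L V)).op).hom)
    (fun V V' h s => map_map_comm G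
      (V := C.sigma L ⁻¹ᵁ ((C.UL L).ι ''ᵁ ((C.UL L).ι ⁻¹ᵁ V)))
      (V₁ := C.sigma L ⁻¹ᵁ ((C.UL L).ι ''ᵁ ((C.UL L).ι ⁻¹ᵁ V')))
      (V₂ := (C.UL L).ι ''ᵁ ((C.UL L).ι ⁻¹ᵁ (C.sigma L ⁻¹ᵁ V)))
      (W := (C.UL L).ι ''ᵁ ((C.UL L).ι ⁻¹ᵁ (C.sigma L ⁻¹ᵁ V')))
      (Scheme.Hom.preimage_mono _ (Scheme.Hom.image_mono _ (Scheme.Hom.preimage_mono _ h)))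
      (C.awayPush_le L V') (C.awayPush_le L V)
      (Scheme.Hom.image_mono _ (Scheme.Hom.preimage_mono _ (Scheme.Hom.preimage_mono _ h))) s)
    (fun V r s => by
      have h1 := C.away_smul ((Scheme.Modules.pushforward (C.sigma L)).obj G) V r s
      have h2 := C.away_smul G (C.sigma L ⁻¹ᵁ V) ((C.sigma L).app V r)
        (G.presheaf.map (homOfLE (C.awayPush_le L V)).op s)
      have h3 := app_map_ring (C.sigma L) ((C.UL L).ι.image_preimage_le V) (C.awayPush_le L V)
        ((C.UL L).ι.image_preimage_le (C.sigma L ⁻¹ᵁ V)) r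
      refine (congrArg (G.presheaf.map (homOfLE (C.awayPush_le L V)).op) h1).trans
        (Eq.trans ?_ h2.symm)
      refine (Scheme.Modules.map_smul G (homOfLE (C.awayPush_le L V)) _ _).trans ?_
      exact congrArg (· • (G.presheaf.map (homOfLE (C.awayPush_le L V)).op s)) h3)

lemma awayPush_map {G G' : (C.CL L).Modules} (g : G ⟶ G') :
    C.awayPush G ≫ (Scheme.Modules.pushforward (C.sigma L)).map ((C.away L).map g) =
      (C.away L).map ((Scheme.Modules.pushforward (C.sigma L)).map g) ≫ C.awayPush G' := by
  ext V s
  exact app_map_apply g (C.awayPush_le L V) s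

/-- The extension of `φ : F → σ_* G` to `j_* j^* F → σ_* j_* j^* G`. -/
def awaySemi {F G : (C.CL L).Modules} (φ : F ⟶ (Scheme.Modules.pushforward (C.sigma L)).obj G) :
    (C.away L).obj F ⟶ (Scheme.Modules.pushforward (C.sigma L)).obj ((C.away L).obj G) :=
  (C.away L).map φ ≫ C.awayPush G

lemma app_congr_map {X Y : Scheme.{u}} {f g : X ⟶ Y} (h : f = g) (V : Y.Opens) (r : Γ(Y, V))
    {W : X.Opens} (k : W ≤ f ⁻¹ᵁ V) (k' : W ≤ g ⁻¹ᵁ V) :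
    X.presheaf.map (homOfLE k).op (f.app V r) = X.presheaf.map (homOfLE k').op (g.app V r) := by
  subst h; rfl

lemma InTwist.semi {F G : (C.CL L).Modules}
    (φ : F ⟶ (Scheme.Modules.pushforward (C.sigma L)).obj G) {n : ℤ} {V : (C.CL L).Opens}
    {s : Γ((C.away L).obj F, V)} (h : C.InTwist F n V s) :
    C.InTwist G n (C.sigma L ⁻¹ᵁ V) ((C.awaySemi φ).app V s) := by
  intro x hx hxU z
  have hxU' : C.sigma L x ∉ C.UL L := by
    intro h
    apply hxU
    rw [← C.sigma_UL L]
    exact h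
  obtain ⟨V₁, hx1, hV1, hz1, t1, e1⟩ := h (C.sigma L x) hx hxU' z
  have hz1' : C.sigma L ⁻¹ᵁ V₁ ≤ C.pr L ⁻¹ᵁ z.W := by
    intro y hy
    have := hz1 hy
    rw [← C.sigma_pr L, Scheme.Hom.comp_preimage]
    exact this
  refine ⟨C.sigma L ⁻¹ᵁ V₁, hx1, fun y hy => hV1 hy, hz1', φ.app V₁ t1, ?_⟩
  have e2 := congr((C.awaySemi φ).app V₁ $e1)
  rw [Scheme.Modules.Hom.app_smul, Scheme.Modules.Hom.app_smul, app_map_apply] at e2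
  have hz : (C.sigma L).app V₁ (z.onCL V₁ hz1) = z.onCL (C.sigma L ⁻¹ᵁ V₁) hz1' := by
    have h1 := congr($((C.sigma L).naturality (homOfLE hz1).op) ((C.pr L).app z.W z.z))
    refine h1.trans ?_
    have h2 := app_congr_map (C.sigma_pr L) z.W z.z (W := C.sigma L ⁻¹ᵁ V₁)
      (by rw [C.sigma_pr]; exact hz1') hz1'
    rw [Scheme.Hom.comp_app] at h2
    exact h2
  have ht : (C.awaySemi φ).app V₁ ((C.toAway L F).app V₁ t1) =
      (C.toAway L G).app (C.sigma L ⁻¹ᵁ V₁) (φ.app V₁ t1) := by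
    have h1 := congr(($((Scheme.Modules.restrictAdjunction (C.UL L).ι).unit.naturality φ)).app V₁ t1)
    have h2 := congr((C.awayPush G).app V₁ $h1)
    refine h2.symm.trans ?_
    exact map_map_apply G (V := C.sigma L ⁻¹ᵁ V₁)
      (V' := C.sigma L ⁻¹ᵁ ((C.UL L).ι ''ᵁ ((C.UL L).ι ⁻¹ᵁ V₁)))
      (V'' := (C.UL L).ι ''ᵁ ((C.UL L).ι ⁻¹ᵁ (C.sigma L ⁻¹ᵁ V₁)))
      (Scheme.Hom.preimage_mono _ ((C.UL L).ι.image_preimage_le V₁)) (C.awayPush_le L V₁)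
      (φ.app V₁ t1)
  rw [ht] at e2
  rw [← hz, ← map_pow, ← map_pow]
  exact e2

/-- The map `F(n·∞) → σ_* (G(n·∞))` induced by `φ : F → σ_* G`. -/
def twistSemi {F G : (C.CL L).Modules} (n : ℤ)
    (φ : F ⟶ (Scheme.Modules.pushforward (C.sigma L)).obj G) :
    (C.twist n).obj F ⟶ (Scheme.Modules.pushforward (C.sigma L)).obj ((C.twist n).obj G) :=
  modHom (M := C.twistObj F n)
    (N := (Scheme.Modules.pushforward (C.sigma L)).obj (C.twistObj G n))
    (fun V =>
      { toFun := fun s => ⟨(C.awaySemi φ).app V s.1, InTwist.semi C φ s.2⟩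
        map_zero' := Subtype.ext (map_zero ((C.awaySemi φ).app V).hom)
        map_add' := fun s s' => Subtype.ext (map_add ((C.awaySemi φ).app V).hom s.1 s'.1) })
    (fun _ _ h s => Subtype.ext (app_map_apply (C.awaySemi φ) h s.1))
    (fun V r s => Subtype.ext (Scheme.Modules.Hom.app_smul (φ := C.awaySemi φ) (U := V) r s.1))

/-- The map `τ ⊗ id : σ^* (F(n·∞)) → G(n·∞)` induced by `τ : σ^* F → G`, where `σ^*` is treated
through its adjunction with `σ_*`. -/
def twistTau {F G : (C.CL L).Modules} (n : ℤ)
    (τ : (Scheme.Modules.pullback (C.sigma L)).obj F ⟶ G) :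
    (Scheme.Modules.pullback (C.sigma L)).obj ((C.twist n).obj F) ⟶ (C.twist n).obj G :=
  ((Scheme.Modules.pullbackPushforwardAdjunction (C.sigma L)).homEquiv _ _).symm
    (C.twistSemi n
      ((Scheme.Modules.pullbackPushforwardAdjunction (C.sigma L)).homEquiv _ _ τ))

lemma twistTau_comm {F G F' G' : (C.CL L).Modules} (n : ℤ)
    (τ : (Scheme.Modules.pullback (C.sigma L)).obj F ⟶ G)
    (τ' : (Scheme.Modules.pullback (C.sigma L)).obj F' ⟶ G') (f : F ⟶ F') (g : G ⟶ G')
    (h : (Scheme.Modules.pullback (C.sigma L)).map f ≫ τ' = τ ≫ g) :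
    (Scheme.Modules.pullback (C.sigma L)).map ((C.twist n).map f) ≫ C.twistTau n τ' =
      C.twistTau n τ ≫ (C.twist n).map g := by
  let adj := Scheme.Modules.pullbackPushforwardAdjunction (C.sigma L)
  have h' : f ≫ adj.homEquiv _ _ τ' = adj.homEquiv _ _ τ ≫
      (Scheme.Modules.pushforward (C.sigma L)).map g := by
    rw [← Adjunction.homEquiv_naturality_left, ← Adjunction.homEquiv_naturality_right, h]
  rw [twistTau, twistTau, ← Adjunction.homEquiv_naturality_left_symm,
    ← Adjunction.homEquiv_naturality_right_symm]
  congr 1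
  have h2 : (C.away L).map f ≫ C.awaySemi (adj.homEquiv _ _ τ') =
      C.awaySemi (adj.homEquiv _ _ τ) ≫
        (Scheme.Modules.pushforward (C.sigma L)).map ((C.away L).map g) := by
    rw [awaySemi, awaySemi, Category.assoc, awayPush_map, ← Functor.map_comp_assoc, h',
      Functor.map_comp_assoc]
  ext V s
  exact Subtype.ext (congr(($h2).app V s.1))


variable (L)

lemma sigmaA_compat (a : C.AL L) :
    C.ALtoGamma L (C.sigmaA L a) =
      (C.CL L).presheaf.map (homOfLE (C.sigma_UL L).ge).op
        ((C.sigma L).app (C.UL L) (C.ALtoGamma L a)) := by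
  let ρ : Γ(C.CL L, C.UL L) →+* Γ(C.CL L, C.UL L) :=
    ((C.CL L).presheaf.map (homOfLE (C.sigma_UL L).ge).op).hom.comp
      ((C.sigma L).app (C.UL L)).hom
  suffices h : (C.ALtoGamma L).comp (C.sigmaA L) = ρ.comp (C.ALtoGamma L) from
    congr($h a)
  have hA : ∀ x : C.A, C.toGammaA L x = ρ (C.toGammaA L x) := by
    intro x
    have h := app_congr_map (C.sigma_pr L) C.U x (W := C.UL L)
      (by rw [C.sigma_pr]; exact le_rfl) le_rfl
    rw [Scheme.Hom.comp_app] at h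
    refine Eq.trans ?_ h.symm
    exact congr($((C.CL L).presheaf.map_id (op (C.UL L))) (C.toGammaA L x)).symm
  have hL : ∀ y : L, C.toGammaL L (C.UL L) (FiniteField.frobeniusAlgHom Fq L y) =
      ρ (C.toGammaL L (C.UL L) y) := by
    intro y
    let w := (Scheme.ΓSpecIso (CommRingCat.of L)).inv y
    have h1 := congr($(Scheme.ΓSpecIso_inv_naturality
      (CommRingCat.ofHom (FiniteField.frobeniusAlgHom Fq L).toRingHom)) y)
    have h2 := app_congr_map (C.sigma_prL L) ⊤ w (W := C.UL L) le_top le_top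
    rw [Scheme.Hom.comp_app, Scheme.Hom.comp_app] at h2
    have h3 := app_map_ring (C.sigma L) (le_top : C.UL L ≤ ⊤) (C.sigma_UL L).ge le_top
      ((C.prL L).appTop w)
    refine Eq.trans ?_ (h2.symm.trans h3.symm)
    exact congrArg (fun v => (C.CL L).presheaf.map (homOfLE (le_top : C.UL L ≤ ⊤)).op
      ((C.prL L).appTop v)) h1
  apply Algebra.TensorProduct.ringHom_ext
  · ext x
    change C.ALtoGamma L (x ⊗ₜ FiniteField.frobeniusAlgHom Fq L 1) =
      ρ (C.ALtoGamma L (x ⊗ₜ 1))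
    rw [ALtoGamma_tmul, ALtoGamma_tmul, map_one, map_one, mul_one]
    exact hA x
  · ext y
    change C.ALtoGamma L (1 ⊗ₜ FiniteField.frobeniusAlgHom Fq L y) =
      ρ (C.ALtoGamma L (1 ⊗ₜ y))
    rw [ALtoGamma_tmul, ALtoGamma_tmul, map_one, one_mul, one_mul]
    exact hL y

/-- The functor `F ↦ Γ(C_L ∖ {∞}, F)` to `A_L`-modules. -/
def gammaU : (C.CL L).Modules ⥤ ModuleCat.{u} (C.AL L) where
  obj F := (ModuleCat.restrictScalars (C.ALtoGamma L)).obj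
    (ModuleCat.of Γ(C.CL L, C.UL L) Γ(F, C.UL L))
  map f := (ModuleCat.restrictScalars (C.ALtoGamma L)).map (ModuleCat.ofHom
    { toFun := fun s => f.app (C.UL L) s
      map_add' := map_add (f.app (C.UL L)).hom
      map_smul' := Scheme.Modules.Hom.app_smul f })

variable {L}

/-- The `σ^*`-semilinear map `Γ(C_L ∖ {∞}, F) → Γ(C_L ∖ {∞}, G)` given by `φ : F → σ_* G`. -/
def gammaSemi {F G : (C.CL L).Modules}
    (φ : F ⟶ (Scheme.Modules.pushforward (C.sigma L)).obj G) :
    (C.gammaU L).obj F ⟶ (ModuleCat.restrictScalars (C.sigmaA L)).obj ((C.gammaU L).obj G) :=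
  ModuleCat.semilinearMapAddEquiv (C.sigmaA L) ((C.gammaU L).obj F) ((C.gammaU L).obj G)
    { toFun := fun s => G.presheaf.map (homOfLE (C.sigma_UL L).ge).op (φ.app (C.UL L) s)
      map_add' := fun s s' =>
        (congrArg (G.presheaf.map (homOfLE (C.sigma_UL L).ge).op)
          (map_add (φ.app (C.UL L)).hom s s')).trans
            (map_add (G.presheaf.map (homOfLE (C.sigma_UL L).ge).op).hom _ _)
      map_smul' := fun a s => by
        have h1 := Scheme.Modules.Hom.app_smul φ (U := C.UL L) (C.ALtoGamma L a) s
        refine (congrArg (G.presheaf.map (homOfLE (C.sigma_UL L).ge).op) h1).trans ?_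
        refine (Scheme.Modules.map_smul G (homOfLE (C.sigma_UL L).ge) _ _).trans ?_
        exact congrArg (· • G.presheaf.map (homOfLE (C.sigma_UL L).ge).op (φ.app (C.UL L) s))
          (C.sigmaA_compat L a).symm }

/-- The identification `Γ(C_L ∖ {∞}, F(n·∞)) = Γ(C_L ∖ {∞}, F)`. -/
def untwist (F : (C.CL L).Modules) (n : ℤ) : Γ((C.twist n).obj F, C.UL L) ⟶ Γ(F, C.UL L) :=
  (C.twistIncl F n).app (C.UL L) ≫ F.presheaf.map (homOfLE (by
    rw [Scheme.Hom.image_preimage_eq_opensRange_inf, Scheme.Opens.opensRange_ι, inf_idem] :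
      C.UL L ≤ (C.UL L).ι ''ᵁ ((C.UL L).ι ⁻¹ᵁ C.UL L))).op

/-- The iterate `σ^l` of `σ`. -/
def sigmaIter (L : Type u) [Field L] [Algebra Fq L] : ℕ → (C.CL L ⟶ C.CL L)
  | 0 => 𝟙 _
  | l + 1 => sigmaIter L l ≫ C.sigma L

lemma sigmaIter_UL (l : ℕ) : C.sigmaIter L l ⁻¹ᵁ C.UL L = C.UL L := by
  induction l with
  | zero => rfl
  | succ l ih => rw [sigmaIter, Scheme.Hom.comp_preimage, sigma_UL, ih]

variable (L) in
/-- The `L`-dimension of the space of global sections of a sheaf of modules on `C_L`; for a torsion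
sheaf this is its dimension as an `L`-vector space. -/
def lDim (G : (C.CL L).Modules) : Cardinal :=
  letI : Module L Γ(G, ⊤) := Module.compHom Γ(G, ⊤) (C.toGammaL L ⊤)
  Module.rank L Γ(G, ⊤)

end BaseChange
end PointedCurve

/-- Every point has an open neighbourhood `V` with sections `s₁, …, s_r` that restrict to a basis
of the sections over every open `V' ⊆ V`, that is, define an isomorphism `𝒪_V ^ r ≅ F|_V`. -/
def IsLocallyFreeOfRank {X : Scheme.{u}} (F : X.Modules) (r : ℕ) : Prop :=
  ∀ x : X, ∃ (V : X.Opens) (_ : x ∈ V) (s : Fin r → Γ(F, V)),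
    ∀ (V' : X.Opens) (h : V' ≤ V),
      LinearIndependent Γ(X, V') (fun j => F.presheaf.map (homOfLE h).op (s j)) ∧
      Submodule.span Γ(X, V') (Set.range fun j => F.presheaf.map (homOfLE h).op (s j)) = ⊤

section

variable {Fq : Type u} [Field Fq] [Fintype Fq] (C : PointedCurve Fq) (L : Type u) [Field L]
  [Algebra Fq L]

/-- A morphism `c : Spec L → C` over `Fq` (a characteristic). -/
structure LPoint where
  c : Spec (CommRingCat.of L) ⟶ C.X
  c_str : c ≫ C.str = PointedCurve.specMap L

variable {C L} in
/-- The graph `Spec L → C_L` of `c`. -/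
def LPoint.graph (c : LPoint C L) : Spec (CommRingCat.of L) ⟶ C.CL L :=
  Limits.pullback.lift c.c (𝟙 _) (by rw [c.c_str, Category.id_comp])

variable {C L} in
/-- `c` is the composite `Spec L → Spec A ⊂ C` defined by `c^* : A → L`: it maps into `C ∖ {∞}`,
and the pullback of functions along it is `c^*`. -/
def LPoint.IsSpecOf (c : LPoint C L) (cstar : C.A →ₐ[Fq] L) : Prop :=
  ∃ h : ⊤ ≤ c.c ⁻¹ᵁ C.U, ∀ a : Γ(C.X, C.U),
    (Scheme.ΓSpecIso (CommRingCat.of L)).hom (c.c.appLE C.U ⊤ h a) = cstar a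

/-- A pair `(M, τ)` of an `A_L`-module `M` and an `A_L`-linear map `τ : σ^* M → M`, where
`σ^* M = M ⊗_{A_L, σ^*} A_L`. -/
structure TauModule where
  M : ModuleCat.{u} (C.AL L)
  τ : (ModuleCat.extendScalars (C.sigmaA L)).obj M ⟶ M

namespace TauModule
variable {C L}

/-- A morphism `f : (M, τ) → (N, τ)`: an `A_L`-linear map with `f ∘ τ = τ ∘ σ^* f`. -/
structure Hom (M N : TauModule C L) where
  f : M.M ⟶ N.M
  comm : M.τ ≫ f = (ModuleCat.extendScalars (C.sigmaA L)).map f ≫ N.τ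

/-- An isomorphism of pairs `(M, τ)`. -/
structure Iso (M N : TauModule C L) where
  e : M.M ≅ N.M
  comm : M.τ ≫ e.hom = (ModuleCat.extendScalars (C.sigmaA L)).map e.hom ≫ N.τ

/-- The semilinear map `m ↦ τ (m ⊗ 1)`; its `l`-th iterate is `m ↦ τ^l (m ⊗ 1)`, where
`τ^l = τ ∘ σ^* τ ∘ ⋯ ∘ (σ^*)^{l-1} τ`. -/
def semi (M : TauModule C L) : M.M ⟶ (ModuleCat.restrictScalars (C.sigmaA L)).obj M.M :=
  (ModuleCat.extendRestrictScalarsAdj (C.sigmaA L)).homEquiv _ _ M.τ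

end TauModule


/-- A sequence of sheaves of modules `F_i` on `C_L` with maps `Π_i : F_i → F_{i+1}` and
`τ_i : σ^* F_i → F_{i+1}` with `τ_{i+1} ∘ σ^* Π_i = Π_{i+1} ∘ τ_i`. The `F_i` and `Π_i` are a functor from
the ordered set `ℤ`, so that `i ≤ j` is mapped to `Π_{j-1} ∘ ⋯ ∘ Π_i`. -/
structure TauSheafData where
  F : ℤ ⥤ (C.CL L).Modules
  τ (i : ℤ) : (Scheme.Modules.pullback (C.sigma L)).obj (F.obj i) ⟶ F.obj (i + 1)
  comm (i : ℤ) :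
    (Scheme.Modules.pullback (C.sigma L)).map (F.map (homOfLE (lt_add_one i).le)) ≫ τ (i + 1) =
      τ i ≫ F.map (homOfLE (lt_add_one (i + 1)).le)

namespace TauSheafData
variable {C L}

/-- The map `Π_i : F_i → F_{i+1}`. -/
abbrev Pi (S : TauSheafData C L) (i : ℤ) : S.F.obj i ⟶ S.F.obj (i + 1) :=
  S.F.map (homOfLE (lt_add_one i).le)

/-- A collection of maps `f_i : F_i → F'_i` that commute with the `Π`'s (naturality) and
with the `τ`'s. -/
structure Hom (S T : TauSheafData C L) where
  f : S.F ⟶ T.F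
  comm (i : ℤ) : S.τ i ≫ f.app (i + 1) =
    (Scheme.Modules.pullback (C.sigma L)).map (f.app i) ≫ T.τ i

/-- The twist `(F_i(m·∞), Π_i ⊗ id, τ_i ⊗ id)`. -/
def twist (S : TauSheafData C L) (m : ℤ) : TauSheafData C L where
  F := S.F ⋙ C.twist m
  τ i := C.twistTau m (S.τ i)
  comm i := C.twistTau_comm m (S.τ i) (S.τ (i + 1)) _ _ (S.comm i)

/-- `Π_{i+l-1} ∘ ⋯ ∘ Π_i : F_i → F_{i+l}` has the image `F_{i+l}(-k·∞)` for every `i`; both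
are read inside `j_* j^* F_{i+l}`, in which `F_{i+l}` is contained when it is locally free. -/
def IsPeriodic (S : TauSheafData C L) (k l : ℕ) : Prop :=
  ∀ (i : ℤ) (V : (C.CL L).Opens),
    Set.range ((S.F.map (homOfLE (show i ≤ i + l by omega)) ≫ C.toAway L _).app V) =
      {s | C.InTwist (S.F.obj (i + l)) (-(k : ℤ)) V s}

/-- The axioms of an abelian `τ`-sheaf of rank `r`, dimension `d` and characteristic `c`. -/
structure IsAbelian (S : TauSheafData C L) (c : LPoint C L) (r d : ℕ) : Prop where
  locallyFree (i : ℤ) : IsLocallyFreeOfRank (S.F.obj i) r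
  mono_Pi (i : ℤ) : Mono (S.Pi i)
  mono_τ (i : ℤ) : Mono (S.τ i)
  periodic : ∃ k l : ℕ, 0 < k ∧ 0 < l ∧ l * d = k * r ∧ S.IsPeriodic k l
  dim_coker_Pi (i : ℤ) : C.lDim L (Limits.cokernel (S.Pi i)) = d
  dim_coker_τ (i : ℤ) : C.lDim L (Limits.cokernel (S.τ i)) = d
  /-- `coker τ_i` is annihilated by the `d`-th power of the ideal sheaf of the graph of `c`. -/
  annihilated (i : ℤ) (V : (C.CL L).affineOpens) (a : Γ(C.CL L, V.1))
    (x : Γ(Limits.cokernel (S.τ i), V.1)) : a ∈ (Scheme.Hom.ker c.graph).ideal V ^ d → a • x = 0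

lemma Pi_bijective {S : TauSheafData C L} {k l : ℕ} (hl : 0 < l) (h : S.IsPeriodic k l)
    (hm : ∀ i, Mono (S.Pi i)) (i : ℤ) :
    IsIso ((C.gammaU L).map (S.Pi i)) := by
  have hinj : Function.Injective ((S.Pi i).app (C.UL L)) := by
    have := hm i
    have h1 : Mono ((Scheme.Modules.toPresheaf (C.CL L)).map (S.Pi i)) := inferInstance
    have h2 : Mono (((Scheme.Modules.toPresheaf (C.CL L)).map (S.Pi i)).app (op (C.UL L))) :=
      inferInstance
    exact (AddCommGrpCat.mono_iff_injective _).1 h2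
  have hsurj : Function.Surjective ((S.Pi i).app (C.UL L)) := by
    intro s
    let j : ℤ := i + 1 - l
    have hj : j + l = i + 1 := by omega
    have : ∀ (m : ℤ) (hm : j + l = m) (hjm : j ≤ m) (s : Γ(S.F.obj m, C.UL L)),
        ∃ t : Γ(S.F.obj j, C.UL L), (S.F.map (homOfLE hjm)).app (C.UL L) t = s := by
      rintro _ rfl hjm s
      have hs : (C.toAway L _).app (C.UL L) s ∈
          Set.range ((S.F.map (homOfLE hjm) ≫ C.toAway L _).app (C.UL L)) := by
        rw [h j (C.UL L)]
        intro x hx hxU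
        exact absurd hx hxU
      obtain ⟨t, ht⟩ := hs
      exact ⟨t, C.toAway_injective _ le_rfl ht⟩
    obtain ⟨t, ht⟩ := this (i + 1) hj (by omega) s
    refine ⟨(S.F.map (homOfLE (show j ≤ i by omega))).app _ t, ?_⟩
    rw [← ht, ← ConcreteCategory.comp_apply, ← Scheme.Modules.Hom.comp_app, ← Functor.map_comp]
    rfl
  rw [ConcreteCategory.isIso_iff_bijective]
  exact ⟨hinj, hsurj⟩

end TauSheafData

variable {C L} in
/-- Abelian `τ`-sheaves of rank `r`, dimension `d` and characteristic `c`. -/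
structure AbelianTauSheaf (c : LPoint C L) (r d : ℕ) extends TauSheafData C L where
  isAbelian : toTauSheafData.IsAbelian c r d

namespace AbelianTauSheaf
variable {C L} {c : LPoint C L} {r d : ℕ}

/-- The weight `d / r` (and `0` for the zero sheaf, which is the case `r = 0`). -/
def weight (_ : AbelianTauSheaf c r d) : ℚ := if r = 0 then 0 else d / r

lemma isIso_Pi (S : AbelianTauSheaf c r d) (i : ℤ) : IsIso ((C.gammaU L).map (S.Pi i)) := by
  obtain ⟨k, l, -, hl, -, h⟩ := S.isAbelian.periodic
  exact TauSheafData.Pi_bijective hl h S.isAbelian.mono_Pi i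

/-- The pair `M(F) = (Γ(C_L ∖ {∞}, F_0), Π_0⁻¹ ∘ τ_0)`. -/
def motive (S : AbelianTauSheaf c r d) : TauModule C L where
  M := (C.gammaU L).obj (S.F.obj 0)
  τ :=
    haveI := S.isIso_Pi 0
    ((ModuleCat.extendRestrictScalarsAdj (C.sigmaA L)).homEquiv _ _).symm
      (C.gammaSemi ((Scheme.Modules.pullbackPushforwardAdjunction (C.sigma L)).homEquiv _ _
        (S.τ 0))) ≫ inv ((C.gammaU L).map (S.Pi 0))

/-- The map `M(f) : M(F) → M(F')` defined by a morphism `f : F → F'(m·∞)`: the map `f_0` on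
sections over `C_L ∖ {∞}`, where `F'_0` and `F'_0(m·∞)` agree. -/
def motiveMap {r' d' : ℕ} (S : AbelianTauSheaf c r d) (T : AbelianTauSheaf c r' d')
    (m : ℤ) (f : S.toTauSheafData.Hom (T.toTauSheafData.twist m)) :
    Γ(S.F.obj 0, C.UL L) → Γ(T.F.obj 0, C.UL L) :=
  fun s => C.untwist (T.F.obj 0) m ((f.f.app 0).app (C.UL L) s)

end AbelianTauSheaf

namespace TauModule
variable {C L}

/-- The ideal `J` generated by all `a ⊗ 1 - 1 ⊗ c^*(a)`. -/
def idealJ (cstar : C.A →ₐ[Fq] L) : Ideal (C.AL L) :=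
  Ideal.span (Set.range fun a : C.A => TensorProduct.tmul Fq a (1 : L) - TensorProduct.tmul Fq (1 : C.A) (cstar a))

/-- `E` is a locally free sheaf of rank `r` on `C_L` that extends `M` (via `e`), such that `τ^l` induces
an isomorphism `(σ^*)^l E_∞ → E(k·∞)_∞` of stalks at `∞`: there is a map `φ : (σ^l)^* E → E(k·∞)` that
is `τ^l` on sections over `C_L ∖ {∞}` and an isomorphism on the stalks at `∞`. -/
structure IsPurityExtension (M : TauModule C L) (r k l : ℕ) (E : (C.CL L).Modules) (e : M.M ≅ (C.gammaU L).obj E) : Prop where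
  locallyFree : IsLocallyFreeOfRank E r
  exists_iso : ∃ φ : (Scheme.Modules.pullback (C.sigmaIter L l)).obj E ⟶ (C.twist k).obj E,
    (∀ m : M.M, C.untwist E k (((C.twist k).obj E).presheaf.map (homOfLE (C.sigmaIter_UL l).ge).op
      (((Scheme.Modules.pullbackPushforwardAdjunction (C.sigmaIter L l)).homEquiv _ _ φ).app
        (C.UL L) (e.hom m))) = e.hom (M.semi^[l] m)) ∧
    IsIso ((Scheme.Modules.toPresheaf (C.CL L) ⋙
      TopCat.Presheaf.stalkFunctor AddCommGrpCat.{u} (C.infLPt L)).map φ)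

/-- `(M, τ)` is a pure `A`-motive of rank `r`, dimension `d` and characteristic `c^*`. Locally free
of rank `r` means finitely generated projective of constant rank `r`. -/
structure IsPureAMotive (M : TauModule C L) (cstar : C.A →ₐ[Fq] L) (r d : ℕ) : Prop where
  finite : Module.Finite (C.AL L) M.M
  projective : Module.Projective (C.AL L) M.M
  rank (p : PrimeSpectrum (C.AL L)) : Module.rankAtStalk M.M p = r
  injective : Function.Injective M.τ
  dim_coker :
    letI : Module L (M.M ⧸ LinearMap.range M.τ.hom) :=
      Module.compHom _ (Algebra.TensorProduct.includeRight : L →ₐ[Fq] C.AL L).toRingHom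
    Module.rank L (M.M ⧸ LinearMap.range M.τ.hom) = d
  annihilated (a : C.AL L) (x : M.M ⧸ LinearMap.range M.τ.hom) : a ∈ idealJ cstar ^ d → a • x = 0
  pure : ∃ (E : (C.CL L).Modules) (e : M.M ≅ (C.gammaU L).obj E) (k l : ℕ), 0 < k ∧ 0 < l ∧
    M.IsPurityExtension r k l E e

end TauModule

end

end

/-! Let `K` be the function field of `C_L`. The local rings of `C_L` are principal ideal domains
inside `K`. So a locally free sheaf of rank `r` amounts to a family of lattices, one at each point,
in an `r`-dimensional `K`-space `W`, and a morphism of sheaves is a linear map that respects the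
lattices; `GenEmb` records such an embedding. For an abelian `τ`-sheaf the `Π_i` become inclusions
of lattices and all `τ_i` become one `σ`-semilinear operator `T` on `W`. Away from `∞` the lattices
do not depend on `i`; at `∞` periodicity reads `Λ_{i+l} = z^{-k} Λ_i`, where the local equation `z`
comes from `C` and is therefore fixed by `σ`. This needs `C ∖ {∞}` to be affine. A substitute for
Riemann-Roch (`finite_quotient_of_ratfunc`) yields a function with a pole only at `∞`, and the map
to the line that it defines is proper and quasi-finite, hence finite (`isAffineOpen_compl_ratPt`).
Part 2: a morphism of motives extends to a `K`-linear map `W → W'` commuting with the operators `T`.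
It respects all lattices away from `∞`. At `∞` equal weights make both chains scale by the same
power of `z` over a common period, so one bound on the pole order serves for all `i`
(`exists_lat_bound`, `exists_hom_twist`). Part 1: purity says that `T^{gl}` carries the lattice `Λ`
of the extension at `∞` to generators of `z^{-gk} Λ`, with `k`, `l` coprime. The lattices `Λ_i = ∑_j
z^⌊(j-i)k/l⌋ T^j Λ` form a chain in which `T` generates `Λ_{i+1}` from `Λ_i` and `Λ_{i+l} = z^{-k}
Λ_i` (`isLatChain_iterLat`). Gluing `M` with `Λ_i` at `∞` gives `F_i`. Then `τ_i` is surjective on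
lattices at `∞`, and its cokernel is that of `τ`. The dimension of `Λ_{i+1}/Λ_i` is independent of
`i`; comparing the finite-dimensional spaces `M ∩ Λ_j` and `M ∩ Λ_{j+1}` for large `j` shows that it
equals `dim coker τ = d` (`IsTauFiltration.relDim_eq_finrank`). Counting `z^{-k}Λ_0/Λ_0` in two ways
gives `ld = kr`. -/

section

/-! ### Étale coordinates and local rings of étale algebras. -/

open TensorProduct Algebra KaehlerDifferential Polynomial

/-- In the Jacobi-Zariski sequence of `R → S → T`, surjectivity of the base change map kills
`Ω[T⁄S]`; injectivity kills the connecting map, so that `H1Cotangent S T` is a quotient of the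
trivial module `H1Cotangent R T`. -/
theorem Algebra.FormallyEtale.of_bijective_mapBaseChange {R S T : Type u} [CommRing R] [CommRing S]
    [CommRing T] [Algebra R S] [Algebra R T] [Algebra S T] [IsScalarTower R S T]
    [Subsingleton (H1Cotangent R T)]
    (h : Function.Bijective (KaehlerDifferential.mapBaseChange R S T)) : FormallyEtale S T := by
  have h0 : Subsingleton Ω[T⁄S] := by
    have := KaehlerDifferential.exact_mapBaseChange_map R S T
    refine subsingleton_of_forall_eq 0 fun y => ?_
    obtain ⟨x, rfl⟩ := KaehlerDifferential.map_surjective R S T y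
    exact (this x).2 (h.2 x)
  refine ⟨h0, ?_⟩
  · refine subsingleton_of_forall_eq 0 fun y => ?_
    have h1 : H1Cotangent.δ R S T y = 0 := by
      apply h.1
      rw [map_zero]
      exact (H1Cotangent.exact_δ_mapBaseChange R S T _).2 ⟨y, rfl⟩
    obtain ⟨x, rfl⟩ := (H1Cotangent.exact_map_δ R S T y).1 h1
    rw [Subsingleton.elim x 0, map_zero]

/-- A standard smooth algebra of relative dimension one has an étale coordinate, which may be
translated by constants. -/
theorem exists_etale_coordinate (k B : Type u) [CommRing k] [CommRing B] [Nontrivial B] [Algebra k B]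
    [IsStandardSmoothOfRelativeDimension 1 k B] :
    ∃ x : B, ∀ c : k, letI := (aeval (R := k) (x - algebraMap k B c)).toRingHom.toAlgebra
      Algebra.Etale k[X] B := by
  have hs : IsStandardSmooth k B := IsStandardSmoothOfRelativeDimension.isStandardSmooth 1
  obtain ⟨h1, I, b, hb⟩ := IsStandardSmooth.iff_exists_basis_kaehlerDifferential.1 hs
  have hr := IsStandardSmoothOfRelativeDimension.rank_kaehlerDifferential (R := k) (S := B) 1
  have hr' := b.mk_eq_rank
  rw [hr, Nat.cast_one, Cardinal.lift_one, Cardinal.lift_eq_one, Cardinal.eq_one_iff_unique] at hr'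
  obtain ⟨_, ⟨i⟩⟩ := hr'
  obtain ⟨x, hx⟩ := hb ⟨i, rfl⟩
  refine ⟨x, fun c => ?_⟩
  let := (aeval (R := k) (x - algebraMap k B c)).toRingHom.toAlgebra
  have : IsScalarTower k k[X] B := IsScalarTower.of_algebraMap_eq fun y =>
    ((aeval (R := k) (x - algebraMap k B c)).commutes y).symm
  -- A constant has zero differential, so every translate of `x` has as its differential the same
  -- basis element of `Ω[B⁄k]`.
  have hD : KaehlerDifferential.map k k k[X] B (D k k[X] X) = b i := by
    rw [map_D, ← hx]
    have : algebraMap k[X] B X = x - algebraMap k B c := aeval_X _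
    rw [this, map_sub, Derivation.map_algebraMap, sub_zero]
  have hf : FormallyEtale k[X] B := by
    apply FormallyEtale.of_bijective_mapBaseChange (R := k)
    let e : B ⊗[k[X]] Ω[k[X]⁄k] ≃ₗ[B] B :=
      (AlgebraTensorModule.congr (LinearEquiv.refl B B) (polynomialEquiv k)).trans
        (AlgebraTensorModule.rid k[X] B B)
    let e' : B ≃ₗ[B] Ω[B⁄k] := (Finsupp.uniqueLinearEquiv B B i).symm.trans b.repr.symm
    have he : ∀ m : Ω[k[X]⁄k], e (1 ⊗ₜ m) = algebraMap k[X] B (polynomialEquiv k m) := fun m => by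
      change (polynomialEquiv k m) • (1 : B) = _
      rw [Algebra.smul_def, mul_one]
    have he' : ∀ y : B, e' y = y • b i := fun y => by
      change b.repr.symm _ = _
      have : (Finsupp.uniqueLinearEquiv B B i).symm y = Finsupp.single i y :=
        Finsupp.uniqueLinearEquiv_symm_apply ..
      exact (congrArg b.repr.symm this).trans (b.repr_symm_single i y)
    have : (mapBaseChange k k[X] B) = (e.trans e').toLinearMap := by
      refine TensorProduct.AlgebraTensorModule.curry_injective (LinearMap.ext_ring (LinearMap.ext fun m => ?_))
      obtain ⟨f, rfl⟩ := (polynomialEquiv k).symm.surjective m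
      change mapBaseChange k k[X] B (1 ⊗ₜ _) = e' (e (1 ⊗ₜ _))
      rw [he, he', LinearEquiv.apply_symm_apply, polynomialEquiv_symm, mapBaseChange_tmul, one_smul,
        LinearMap.map_smul, hD, algebraMap_smul]
    rw [this]; exact (e.trans e').bijective
  have : FinitePresentation k[X] B := by
    have : FinitePresentation k B := inferInstance
    exact FinitePresentation.of_restrict_scalars_finitePresentation k k[X] B
  exact { finitePresentation := this }

/-- By Krull's intersection theorem a nonzero element is a unit times a power of `ϖ`, and a product
of two such elements is nonzero when `ϖ` is a nonzerodivisor. For `ϖ = 0` the ring is a field; this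
case occurs at a generic point. -/
theorem isDomain_of_maximalIdeal_eq_span {S : Type*} [CommRing S] [IsLocalRing S] [IsNoetherianRing S]
    {ϖ : S} (h : IsLocalRing.maximalIdeal S = Ideal.span {ϖ}) (hϖ : ϖ ∈ nonZeroDivisors S ∨ ϖ = 0) :
    IsDomain S ∧ IsPrincipalIdealRing S := by
  have hd : IsDomain S := by
    rcases hϖ with hϖ | rfl
    · have key : ∀ a : S, a ≠ 0 → ∃ (n : ℕ) (v : S), IsUnit v ∧ a = v * ϖ ^ n := by
        intro a ha
        have := Ideal.iInf_pow_eq_bot_of_isLocalRing (IsLocalRing.maximalIdeal S) (IsLocalRing.maximalIdeal.isMaximal S).ne_top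
        have h2 : ∃ n, a ∉ IsLocalRing.maximalIdeal S ^ n := by
          by_contra! hh
          apply ha
          rw [← Ideal.mem_bot, ← this]
          simpa [Ideal.mem_iInf] using hh
        classical
        have h3 := Nat.find_spec h2
        rcases hn : Nat.find h2 with _ | n
        · rw [hn] at h3; simp at h3
        · have h4 := Nat.find_min h2 (m := n) (by omega)
          rw [not_not, h, Ideal.span_singleton_pow, Ideal.mem_span_singleton'] at h4
          obtain ⟨v, rfl⟩ := h4
          refine ⟨n, v, ?_, rfl⟩
          by_contra hv
          apply h3
          rw [hn, pow_succ']
          refine Ideal.mul_mem_mul ((IsLocalRing.mem_maximalIdeal _).2 hv) (Ideal.pow_mem_pow ?_ n)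
          rw [h]; exact Ideal.mem_span_singleton_self _
      have : NoZeroDivisors S := ⟨fun {a b} hab => by
        by_contra! hh
        obtain ⟨n, v, hv, rfl⟩ := key a hh.1
        obtain ⟨m, w, hw, rfl⟩ := key b hh.2
        have : v * w * ϖ ^ (n + m) = 0 := by rw [← hab]; ring
        have h5 := (mem_nonZeroDivisors_iff_right.1 (pow_mem hϖ (n+m))) _ this
        exact (hv.mul hw).ne_zero h5⟩
      exact NoZeroDivisors.to_isDomain S
    · have : IsField S := by
        rw [IsLocalRing.isField_iff_maximalIdeal_eq, h]; simp
      exact this.isDomain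
  refine ⟨hd, ?_⟩
  refine ⟨fun I => ?_⟩
  by_cases hI : I = ⊥
  · rw [hI]; infer_instance
  obtain ⟨n, rfl⟩ := exists_maximalIdeal_pow_eq_of_principal S ⟨ϖ, h⟩ I hI
  exact ⟨ϖ ^ n, by rw [h, Ideal.span_singleton_pow]⟩

/-- The local map from the localization of `R` at the contracted prime to `S` is formally unramified
and essentially of finite type, so the maximal ideal below generates the maximal ideal of `S`. -/
theorem maximalIdeal_eq_span_of_etale {R B S : Type u} [CommRing R] [CommRing B] [CommRing S]
    [Algebra R B] [Algebra B S] [Algebra R S] [IsScalarTower R B S] [Algebra.Etale R B]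
    [IsLocalRing S] (q : Ideal B) [q.IsPrime] [IsLocalization.AtPrime S q] {g : R}
    (hg : q.comap (algebraMap R B) = Ideal.span {g}) :
    IsLocalRing.maximalIdeal S = Ideal.span {algebraMap R S g} := by
  let p := q.comap (algebraMap R B)
  have hp : p.IsPrime := inferInstance
  let Rp := Localization.AtPrime p
  let φ : Rp →+* S := IsLocalization.lift (M := p.primeCompl) (g := algebraMap R S) (by
    rintro ⟨y, hy⟩
    rw [IsScalarTower.algebraMap_apply R B S]
    exact IsLocalization.map_units S (⟨algebraMap R B y, hy⟩ : q.primeCompl))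
  let := φ.toAlgebra
  have : IsScalarTower R Rp S := IsScalarTower.of_algebraMap_eq fun y =>
    (IsLocalization.lift_eq (M := p.primeCompl) _ y).symm
  have : IsLocalHom (algebraMap Rp S) := by
    constructor
    intro a ha
    obtain ⟨x, s, rfl⟩ := IsLocalization.exists_mk'_eq p.primeCompl a
    have h1 : IsUnit (algebraMap R S x) := by
      have := IsLocalization.mk'_spec Rp x s
      rw [IsScalarTower.algebraMap_apply R Rp S, ← this, map_mul]
      exact ha.mul ((IsLocalization.map_units Rp s).map _)
    rw [IsScalarTower.algebraMap_apply R B S, IsLocalization.AtPrime.isUnit_to_map_iff S q] at h1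
    exact (IsLocalization.AtPrime.isUnit_mk'_iff (S := Rp) (I := p) x s).2 h1
  have : FormallyEtale B S := FormallyEtale.of_isLocalization q.primeCompl
  have : FormallyUnramified R S := FormallyUnramified.comp R B S
  have : FormallyUnramified Rp S := FormallyUnramified.of_restrictScalars R Rp S
  have : EssFiniteType B S := EssFiniteType.of_isLocalization S q.primeCompl
  have : EssFiniteType R S := EssFiniteType.comp R B S
  have : EssFiniteType Rp S := EssFiniteType.of_comp R Rp S
  rw [← FormallyUnramified.map_maximalIdeal (R := Rp), ← Localization.AtPrime.map_eq_maximalIdeal,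
    Ideal.map_map, ← IsScalarTower.algebraMap_eq]
  change Ideal.map _ (q.comap (algebraMap R B)) = _
  rw [hg, Ideal.map_span, Set.image_singleton]

/-- The local rings of an étale algebra over a principal ideal domain. -/
theorem isDomain_localization_of_etale {R B S : Type u} [CommRing R] [IsDomain R] [IsPrincipalIdealRing R]
    [CommRing B] [CommRing S]
    [Algebra R B] [Algebra B S] [Algebra R S] [IsScalarTower R B S] [Algebra.Etale R B]
    (q : Ideal B) [q.IsPrime] [IsLocalization.AtPrime S q] :
    IsDomain S ∧ IsPrincipalIdealRing S := by
  have : IsLocalRing S := IsLocalization.AtPrime.isLocalRing S q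
  have : IsNoetherianRing B := FiniteType.isNoetherianRing R B
  have : IsNoetherianRing S := IsLocalization.isNoetherianRing q.primeCompl S inferInstance
  obtain ⟨g, hg⟩ := IsPrincipalIdealRing.principal (q.comap (algebraMap R B))
  refine isDomain_of_maximalIdeal_eq_span (maximalIdeal_eq_span_of_etale (S := S) q hg) ?_
  by_cases h : g = 0
  · right; rw [h, map_zero]
  · left
    have : Module.Flat B S := IsLocalization.flat S q.primeCompl
    have : Module.Flat R S := Module.Flat.trans R B S
    -- `S` is flat over `R`, so the nonzero `g` remains a nonzerodivisor on `S`.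
    have := Module.Flat.isSMulRegular_of_nonZeroDivisors (M := S) (mem_nonZeroDivisors_of_ne_zero h)
    refine mem_nonZeroDivisors_iff_right.2 fun y hy => this ?_
    change g • y = g • 0
    rw [smul_zero, Algebra.smul_def, mul_comm, hy]

end

/-! ### Smooth curves over a field and their function fields. -/

noncomputable section

section SmoothCurve

open Polynomial

variable {k : Type u} [Field k] {X : Scheme.{u}} (f : X ⟶ Spec (CommRingCat.of k))

/-- The structure map `k → Γ(V, 𝒪_X)` of a scheme over `k`. -/
def structMap (V : X.Opens) : k →+* Γ(X, V) :=
  (X.presheaf.map (homOfLE (le_top : V ≤ ⊤)).op).hom.comp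
    (f.appTop.hom.comp (Scheme.ΓSpecIso (CommRingCat.of k)).inv.hom)

lemma structMap_map {V W : X.Opens} (h : W ≤ V) (c : k) :
    X.presheaf.map (homOfLE h).op (structMap f V c) = structMap f W c := by
  simp only [structMap, RingHom.comp_apply]
  rw [← CommRingCat.comp_apply, ← Functor.map_comp]
  rfl

/-- All translates `t - c` are provided so that the coordinate can later be made to vanish at a
given rational point. -/
lemma exists_etale_chart [SmoothOfRelativeDimension 1 f] (x : X) :
    ∃ (V : X.Opens) (_ : IsAffineOpen V) (_ : x ∈ V) (t : Γ(X, V)), ∀ c : k,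
      (eval₂RingHom (structMap f V) (t - structMap f V c)).Etale := by
  obtain ⟨W, hW, V, hV, hx, e, h⟩ :=
    SmoothOfRelativeDimension.exists_isStandardSmoothOfRelativeDimension (n := 1) (f := f) x
  -- The spectrum of a field has a single point.
  have hWt : W = ⊤ := by
    have h1 : f x ∈ W := e hx
    refine eq_top_iff.2 fun y _ => ?_
    have : y = f x := Subsingleton.elim (α := PrimeSpectrum k) _ _
    rw [this]; exact h1
  subst hWt
  have : Nonempty V := ⟨⟨x, hx⟩⟩
  have h2 : (structMap f V).IsStandardSmoothOfRelativeDimension 1 := by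
    have := RingHom.isStandardSmoothOfRelativeDimension_respectsIso.2 _
      (Scheme.ΓSpecIso (CommRingCat.of k)).symm.commRingCatIsoToRingEquiv h
    exact this
  algebraize [structMap f V]
  obtain ⟨t, ht⟩ := exists_etale_coordinate k Γ(X, V)
  refine ⟨V, hV, hx, t, fun c => ?_⟩
  exact ht c

/-- The stalk is a local ring of an étale algebra over the principal ideal domain `k[X]`. Any
translate of the coordinate would do. -/
lemma isDomain_stalk_of_smooth [SmoothOfRelativeDimension 1 f] (x : X) :
    IsDomain (X.presheaf.stalk x) ∧ IsPrincipalIdealRing (X.presheaf.stalk x) := by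
  obtain ⟨V, hV, hx, t, ht⟩ := exists_etale_chart f x
  have h := ht 0
  algebraize [eval₂RingHom (structMap f V) (t - structMap f V 0)]
  letI : Algebra Γ(X, V) (X.presheaf.stalk x) := (X.presheaf.germ V x hx).hom.toAlgebra
  letI : Algebra k[X] (X.presheaf.stalk x) := ((algebraMap Γ(X, V) (X.presheaf.stalk x)).comp
    (algebraMap k[X] Γ(X, V))).toAlgebra
  have : IsScalarTower k[X] Γ(X, V) (X.presheaf.stalk x) := IsScalarTower.of_algebraMap_eq' rfl
  have : IsLocalization.AtPrime (X.presheaf.stalk x) (hV.primeIdealOf ⟨x, hx⟩).asIdeal :=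
    hV.isLocalization_stalk ⟨x, hx⟩
  exact isDomain_localization_of_etale (R := k[X]) (hV.primeIdealOf ⟨x, hx⟩).asIdeal

lemma isIntegral_of_smooth [SmoothOfRelativeDimension 1 f] [IrreducibleSpace X] : IsIntegral X := by
  have : ∀ x : X, _root_.IsReduced (X.presheaf.stalk x) := fun x => by
    have := (isDomain_stalk_of_smooth f x).1
    infer_instance
  have := isReduced_of_isReduced_stalk X
  exact isIntegral_of_irreducibleSpace_of_isReduced X

end SmoothCurve

section FunctionField

variable (X : Scheme.{u}) [IsIntegral X]

/-- The local ring at `x` as a subring of the function field. -/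
def locRing (x : X) : Subring X.functionField :=
  (algebraMap (X.presheaf.stalk x) X.functionField).range

variable {X}

lemma genericPoint_mem (V : X.Opens) [h : Nonempty V] : genericPoint X ∈ V :=
  ((genericPoint_spec X).mem_open_set_iff V.isOpen).mpr (by simpa using h)

lemma specializes_genericPoint (x : X) : genericPoint X ⤳ x :=
  (genericPoint_spec X).specializes trivial

/-- The equivalence between the stalk at `x` and the local ring. -/
def locRingEquiv (x : X) : X.presheaf.stalk x ≃+* locRing X x :=
  RingEquiv.ofBijective (algebraMap (X.presheaf.stalk x) X.functionField).rangeRestrict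
    ⟨fun _ _ h => IsFractionRing.injective (X.presheaf.stalk x) X.functionField
      (congrArg Subtype.val h), fun ⟨_, a, h⟩ => ⟨a, Subtype.ext h⟩⟩

lemma germ_mem_locRing (V : X.Opens) [Nonempty V] {x : X} (hx : x ∈ V) (a : Γ(X, V)) :
    X.germToFunctionField V a ∈ locRing X x :=
  ⟨X.presheaf.germ V x hx a, X.algebraMap_germ_eq_germToFunctionField hx a⟩

lemma germ_map {V W : X.Opens} [Nonempty V] [Nonempty W] (h : W ≤ V) (a : Γ(X, V)) :
    X.germToFunctionField W (X.presheaf.map (homOfLE h).op a) = X.germToFunctionField V a :=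
  X.presheaf.germ_res_apply (homOfLE h) _ (genericPoint_mem W) a

lemma exists_germ_of_mem_locRing {x : X} {a : X.functionField} (ha : a ∈ locRing X x) :
    ∃ (V : X.Opens) (_ : x ∈ V) (_ : Nonempty V) (b : Γ(X, V)), X.germToFunctionField V b = a := by
  obtain ⟨s, rfl⟩ := ha
  obtain ⟨V, hx, b, rfl⟩ := X.presheaf.exists_germ_eq s
  have : Nonempty V := ⟨⟨x, hx⟩⟩
  exact ⟨V, hx, this, b, (X.algebraMap_germ_eq_germToFunctionField hx b).symm⟩

/-- Local representatives of `a` agree on overlaps because they have the same generic germ and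
generic germs are injective on an integral scheme; hence they glue. -/
lemma exists_section_of_forall_mem_locRing (V : X.Opens) [Nonempty V] {a : X.functionField}
    (ha : ∀ x ∈ V, a ∈ locRing X x) : ∃ b : Γ(X, V), X.germToFunctionField V b = a := by
  choose W hxW hne b hb using fun x : V => exists_germ_of_mem_locRing (ha x x.2)
  have hne' : ∀ x, Nonempty (W x ⊓ V : X.Opens) := fun x => ⟨⟨x, hxW x, x.2⟩⟩
  obtain ⟨s, hs, -⟩ := TopCat.Sheaf.existsUnique_gluing' X.sheaf (fun x : V => W x ⊓ V) V
    (fun x => homOfLE inf_le_right)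
    (fun x hx => Opens.mem_iSup.2 ⟨⟨x, hx⟩, hxW ⟨x, hx⟩, hx⟩)
    (fun x => X.presheaf.map (homOfLE (inf_le_left : W x ⊓ V ≤ W x)).op (b x))
    (fun x y => by
      have : Nonempty ((W x ⊓ V) ⊓ (W y ⊓ V) : X.Opens) :=
        ⟨⟨genericPoint X, ⟨genericPoint_mem (W x ⊓ V), genericPoint_mem (W y ⊓ V)⟩⟩⟩
      apply Scheme.germToFunctionField_injective X ((W x ⊓ V) ⊓ (W y ⊓ V))
      refine (germ_map (X := X) inf_le_left _).trans ?_
      refine Eq.trans ?_ (germ_map (X := X) inf_le_right _).symm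
      rw [germ_map, germ_map, hb, hb])
  refine ⟨s, ?_⟩
  obtain ⟨x⟩ := ‹Nonempty V›
  have hx := hs x
  have := hne x
  have := hne' x
  rw [← hb x, ← germ_map (inf_le_left : W x ⊓ V ≤ W x), ← hx]
  exact (germ_map (X := X) inf_le_right s).symm

lemma isUnit_germ_iff {V : X.Opens} [Nonempty V] {x : X} (hx : x ∈ V) (a : Γ(X, V)) :
    x ∈ X.basicOpen a ↔ X.germToFunctionField V a ≠ 0 ∧
      (X.germToFunctionField V a)⁻¹ ∈ locRing X x := by
  rw [Scheme.mem_basicOpen X a x hx, ← X.algebraMap_germ_eq_germToFunctionField hx a]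
  constructor
  · intro h
    refine ⟨(h.map (algebraMap _ _)).ne_zero, ?_⟩
    obtain ⟨u, hu⟩ := h
    refine ⟨((u⁻¹ : (X.presheaf.stalk x)ˣ) : X.presheaf.stalk x), ?_⟩
    rw [← hu]
    refine eq_inv_of_mul_eq_one_left ?_
    rw [← map_mul, Units.inv_mul, map_one]
  · rintro ⟨h0, b, hb⟩
    refine IsUnit.of_mul_eq_one b ?_
    apply IsFractionRing.injective (X.presheaf.stalk x) X.functionField
    rw [map_mul, hb, map_one, mul_inv_cancel₀ h0]

lemma locRing_genericPoint : locRing X (genericPoint X) = ⊤ := by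
  refine eq_top_iff.2 fun a _ => ⟨a, ?_⟩
  change X.presheaf.stalkSpecializes _ a = a
  rw [TopCat.Presheaf.stalkSpecializes_refl]
  rfl

end FunctionField

end

/-! ### Weak approximation and finiteness in function fields. -/

section

section Fields

open Polynomial
open scoped IntermediateField IntermediateField.algebraAdjoinAdjoin

/-- Weak approximation: a common element of large value at one place and of small value at
finitely many others. -/
theorem exists_notMem_forall_valuation_lt {K ι : Type*} [Field K] (V₀ : ValuationSubring K)
    (V : ι → ValuationSubring K) (h₀ : ∃ t, t ∉ V₀) (s : Finset ι)
    (hpair : ∀ i ∈ s, ∃ t, t ∉ V₀ ∧ (V i).valuation t < 1)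
    (arch : ∀ i ∈ s, ∀ a b, (V i).valuation a < 1 → ∃ N, ∀ n ≥ N, (V i).valuation (a ^ n * b) < 1) :
    ∃ t, t ∉ V₀ ∧ ∀ i ∈ s, (V i).valuation t < 1 := by
  classical
  induction s using Finset.induction_on with
  | empty => obtain ⟨t, ht⟩ := h₀; exact ⟨t, ht, by simp⟩
  | insert j s hj ih =>
    obtain ⟨t, ht, hts⟩ := ih (fun i hi => hpair i (Finset.mem_insert_of_mem hi))
      (fun i hi => arch i (Finset.mem_insert_of_mem hi))
    obtain ⟨u, hu, huj⟩ := hpair j (Finset.mem_insert_self j s)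
    have hN : ∃ N, ∀ n ≥ N, ∀ i ∈ s, (V i).valuation (t ^ n * u) < 1 := by
      have h1 : ∀ i : s, ∃ N, ∀ n ≥ N, (V i).valuation (t ^ n * u) < 1 :=
        fun i => arch i (Finset.mem_insert_of_mem i.2) t u (hts i i.2)
      choose N hN using h1
      exact ⟨Finset.univ.sup N, fun n hn i hi => hN ⟨i, hi⟩ n
        ((Finset.le_sup (f := N) (Finset.mem_univ _)).trans hn)⟩
    obtain ⟨N, hN⟩ := hN
    rw [← ValuationSubring.valuation_le_one_iff, not_le] at ht hu
    -- The factor `t^(N+1) / (1 + t^(N+1))` has value one where `t` is large, and has the value of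
    -- `t^(N+1)` where `t` is small. According as `t` is small, a unit or large at `V j`, the
    -- witness is `t`, `t^N * u`, or this factor times `u`.
    have hlt : ∀ W : ValuationSubring K, 1 < W.valuation t →
        W.valuation (t ^ (N + 1) / (1 + t ^ (N + 1)) * u) = W.valuation u := fun W hW => by
      have h1 : 1 < W.valuation (t ^ (N + 1)) := by
        rw [map_pow]; exact one_lt_pow₀ hW (by omega)
      have h2 : W.valuation (1 + t ^ (N + 1)) = W.valuation (t ^ (N + 1)) :=
        Valuation.map_add_eq_of_lt_right _ ((Valuation.map_one _).trans_lt h1)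
      rw [map_mul, map_div₀, h2, div_self (ne_of_gt (zero_lt_one.trans h1)), one_mul]
    rcases lt_trichotomy ((V j).valuation t) 1 with h | h | h
    · refine ⟨t, by rwa [← ValuationSubring.valuation_le_one_iff, not_le], fun i hi => ?_⟩
      rcases Finset.mem_insert.1 hi with rfl | hi
      exacts [h, hts i hi]
    · refine ⟨t ^ N * u, ?_, fun i hi => ?_⟩
      · rw [← ValuationSubring.valuation_le_one_iff, not_le, map_mul, map_pow]
        exact hu.trans_le (le_mul_of_one_le_left' (one_le_pow₀ ht.le))
      · rcases Finset.mem_insert.1 hi with rfl | hi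
        · rw [map_mul, map_pow, h, one_pow, one_mul]; exact huj
        · exact hN N le_rfl i hi
    · refine ⟨t ^ (N + 1) / (1 + t ^ (N + 1)) * u, ?_, fun i hi => ?_⟩
      · rw [← ValuationSubring.valuation_le_one_iff, not_le, hlt _ ht]; exact hu
      · rcases Finset.mem_insert.1 hi with rfl | hi
        · rw [hlt _ h]; exact huj
        · have h1 : (V i).valuation (t ^ (N + 1)) < 1 := by
            rw [map_pow]; exact pow_lt_one₀ zero_le (hts i hi) (by omega)
          have h2 : (V i).valuation (1 + t ^ (N + 1)) = 1 := 
            (Valuation.map_add_eq_of_lt_left _ (h1.trans_eq (Valuation.map_one _).symm)).trans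
              (Valuation.map_one _)
          rw [map_mul, map_div₀, h2, div_one, ← map_mul]
          exact hN (N + 1) (by omega) i hi

/-- A substitute for the finiteness of `H¹`. In the applications `O` consists of the functions
regular at some or all of the poles of `y`, `M` of those regular at the remaining points, and `N` is
large enough that all `y⁻¹ ^ N * e i` lie in `O`. Division with remainder puts each rational
multiple of `e i` into `M + O`, up to the finitely many monomials `y⁻¹ ^ N * y ^ j * e i` with `j <
N`. -/
theorem finite_quotient_of_ratfunc {k K ι : Type*} [Field k] [Field K] [Algebra k K] [Fintype ι]
    {y : K} (hy : Transcendental k y) (M O : Submodule k K) (e : ι → K)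
    (he : Submodule.span k⟮y⟯ (Set.range e) = ⊤) (hM : ∀ i (p : k[X]), aeval y p * e i ∈ M) (N : ℕ)
    (hO : ∀ i (p q : k[X]), q ≠ 0 → p.natDegree ≤ q.natDegree →
      aeval y p / aeval y q * (y⁻¹ ^ N * e i) ∈ O) :
    Module.Finite k (K ⧸ (M ⊔ O)) := by
  have hy0 : y ≠ 0 := fun h => hy (h ▸ isAlgebraic_zero)
  let π := (M ⊔ O).mkQ
  let S : Submodule k (K ⧸ (M ⊔ O)) :=
    Submodule.span k (Set.range fun p : Fin N × ι => π (y⁻¹ ^ N * y ^ (p.1 : ℕ) * e p.2))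
  have key : ∀ (g : k⟮y⟯) i, π (g • e i) ∈ S := by
    intro g i
    obtain ⟨a, b, hab⟩ := (IntermediateField.mem_adjoin_simple_iff k _).1 g.2
    by_cases hb : b = 0
    · have : (g : K) = 0 := by rw [hab, hb]; simp
      rw [Algebra.smul_def]
      change π ((g : K) * e i) ∈ S
      rw [this, zero_mul, map_zero]; exact zero_mem _
    have hb' : aeval y b ≠ 0 := fun h => hb ((transcendental_iff.1 hy) b h)
    -- With `X ^ N * a = b * p + r`, the function `a/b` is `y⁻¹ ^ N` times `p + r/b`. The fraction
    -- `r/b` has nonnegative order at the poles of `y`, so its contribution lies in `O`.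
    let p := (X ^ N * a) / b
    let r := (X ^ N * a) % b
    have hd : b * p + r = X ^ N * a := EuclideanDomain.div_add_mod _ _
    have hr : r.natDegree ≤ b.natDegree := by
      by_cases hr0 : r = 0
      · rw [hr0]; simp
      · exact natDegree_le_natDegree (EuclideanDomain.mod_lt (X ^ N * a) hb).le
    have hd' := congrArg (aeval y) hd
    simp only [map_add, map_mul, map_pow, aeval_X] at hd'
    have hg : (g : K) * e i = y⁻¹ ^ N * aeval y p * e i + aeval y r / aeval y b * (y⁻¹ ^ N * e i) := by
      rw [hab]
      have h1 : aeval y a = y⁻¹ ^ N * (y ^ N * aeval y a) := by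
        rw [← mul_assoc, ← mul_pow, inv_mul_cancel₀ hy0, one_pow, one_mul]
      rw [h1, ← hd']
      field_simp
    change π ((g : K) * e i) ∈ S
    rw [hg, map_add]
    have h2 : π (aeval y r / aeval y b * (y⁻¹ ^ N * e i)) = 0 :=
      (Submodule.Quotient.mk_eq_zero _).2 (Submodule.mem_sup_right (hO i r b hb hr))
    rw [h2, add_zero, aeval_eq_sum_range, Finset.mul_sum, Finset.sum_mul, map_sum]
    refine sum_mem fun j _ => ?_
    rw [mul_smul_comm, smul_mul_assoc, map_smul]
    refine S.smul_mem _ ?_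
    -- From degree `N` on the factor `y⁻¹ ^ N` is absorbed and a polynomial multiple of `e i`
    -- remains, which lies in `M`.
    by_cases hj : j < N
    · exact Submodule.subset_span ⟨(⟨j, hj⟩, i), rfl⟩
    · have h3 : y⁻¹ ^ N * y ^ j * e i = aeval y (X ^ (j - N) : k[X]) * e i := by
        rw [map_pow, aeval_X]
        congr 1
        obtain ⟨m, rfl⟩ := Nat.exists_eq_add_of_le (not_lt.1 hj)
        rw [Nat.add_sub_cancel_left, pow_add, ← mul_assoc, ← mul_pow, inv_mul_cancel₀ hy0]
        simp
      rw [h3]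
      have : π (aeval y (X ^ (j - N) : k[X]) * e i) = 0 :=
        (Submodule.Quotient.mk_eq_zero _).2 (Submodule.mem_sup_left (hM i _))
      rw [this]; exact zero_mem _
  have hS : S = ⊤ := by
    refine eq_top_iff.2 fun x _ => ?_
    obtain ⟨x, rfl⟩ := (M ⊔ O).mkQ_surjective x
    have hx : x ∈ Submodule.span k⟮y⟯ (Set.range e) := he ▸ Submodule.mem_top
    obtain ⟨c, rfl⟩ := (Submodule.mem_span_range_iff_exists_fun _).1 hx
    rw [map_sum]
    exact sum_mem fun i _ => key (c i) i
  exact ⟨hS ▸ Submodule.fg_span (Set.finite_range _)⟩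

/-- The infinite-dimensional `k[X]` cannot embed in a finite-dimensional quotient. Multiplying by
`X` before evaluating excludes constant polynomials. -/
theorem exists_aeval_mem_of_finite_quotient {k K : Type*} [Field k] [Field K] [Algebra k K]
    (N : Submodule k K) [Module.Finite k (K ⧸ N)] (t : K) :
    ∃ p : k[X], 0 < p.natDegree ∧ aeval t p ∈ N := by
  let φ : k[X] →ₗ[k] K ⧸ N := N.mkQ ∘ₗ (aeval t).toLinearMap ∘ₗ LinearMap.mulLeft k X
  have h : ¬ Function.Injective φ := fun h => Polynomial.not_finite (Module.Finite.of_injective φ h)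
  rw [injective_iff_map_eq_zero] at h
  push Not at h
  obtain ⟨p, hp, hp0⟩ := h
  refine ⟨X * p, ?_, ?_⟩
  · rw [natDegree_X_mul hp0]; omega
  · rw [← Submodule.ker_mkQ N]; exact hp

theorem isAlgebraic_adjoin_of_trdeg_le_one {k K : Type u} [Field k] [Field K] [Algebra k K]
    (h : Algebra.trdeg k K ≤ 1) {y : K} (hy : Transcendental k y) :
    Algebra.IsAlgebraic k⟮y⟯ K := by
  have h1 : AlgebraicIndependent k (fun _ : PUnit.{u+1} => y) :=
    algebraicIndependent_unique_type_iff.2 hy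
  have h2 := h1.isTranscendenceBasis_of_trdeg_le (h.trans_lt Cardinal.one_lt_aleph0) (by simpa using h)
  have := h2.isAlgebraic_field
  rwa [Set.range_const] at this

theorem finite_adjoin_of_trdeg_le_one {k K : Type u} [Field k] [Field K] [Algebra k K]
    [Algebra.EssFiniteType k K]
    (h : Algebra.trdeg k K ≤ 1) {y : K} (hy : Transcendental k y) :
    Module.Finite k⟮y⟯ K := by
  have := isAlgebraic_adjoin_of_trdeg_le_one h hy
  have : Algebra.EssFiniteType k⟮y⟯ K := Algebra.EssFiniteType.of_comp k _ _
  exact Algebra.finite_of_essFiniteType_of_isAlgebraic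

/-- A basis of integral elements. -/
theorem exists_integral_span {k K : Type*} [Field k] [Field K] [Algebra k K] {y : K}
    [Module.Finite k⟮y⟯ K] : ∃ (n : ℕ) (e : Fin n → K), Submodule.span k⟮y⟯ (Set.range e) = ⊤ ∧
      ∀ i, IsIntegral (Algebra.adjoin k {y}) (e i) := by
  classical
  let b := Module.finBasis k⟮y⟯ K
  obtain ⟨a, ha, h⟩ := exists_integral_multiples (Algebra.adjoin k {y}) k⟮y⟯ (Finset.univ.image b)
  have ha' : algebraMap (Algebra.adjoin k {y}) k⟮y⟯ a ≠ 0 := by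
    rwa [Ne, FaithfulSMul.algebraMap_eq_zero_iff]
  refine ⟨_, fun i => a • b i, ?_, fun i => h _ (by simp)⟩
  refine eq_top_iff.2 (b.span_eq ▸ Submodule.span_le.2 ?_)
  rintro _ ⟨i, rfl⟩
  have : b i = (algebraMap (Algebra.adjoin k {y}) k⟮y⟯ a)⁻¹ • a • b i := by
    rw [← algebraMap_smul k⟮y⟯ a (b i), smul_smul, inv_mul_cancel₀ ha', one_smul]
  rw [this]
  exact Submodule.smul_mem _ _ (Submodule.subset_span ⟨i, rfl⟩)

end Fields

end

/-! ### Points of a curve as valuation rings of the function field. -/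

noncomputable section

/-- All local rings are principal ideal domains, as they are on a smooth curve. -/
class IsLocallyPID (X : Scheme.{u}) : Prop where
  isPrincipalIdealRing (x : X) : IsPrincipalIdealRing (X.presheaf.stalk x)

attribute [instance] IsLocallyPID.isPrincipalIdealRing

section Points

variable {X : Scheme.{u}} [IsIntegral X] [IsLocallyPID X]

/-- The generizations of `y` are the primes of its stalk. In a principal ideal domain a nonzero
prime is maximal, so besides `y` only the generic point occurs. -/
lemma eq_of_specializes {x y : X} (h : x ⤳ y) (hx : x ≠ genericPoint X) : x = y := by
  have hpt : ∀ p : Spec (X.presheaf.stalk y), p.asIdeal ≠ ⊥ → X.fromSpecStalk y p = y := by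
    intro p hp
    have : p.asIdeal.IsPrime := PrimeSpectrum.isPrime p
    have := IsPrime.to_maximal_ideal hp
    have h1 : p = IsLocalRing.closedPoint (X.presheaf.stalk y) :=
      PrimeSpectrum.ext (IsLocalRing.eq_maximalIdeal this)
    rw [h1, Scheme.fromSpecStalk_closedPoint]
  have h1 : x ∈ Set.range (X.fromSpecStalk y) := by rw [Scheme.range_fromSpecStalk]; exact h
  have h2 : genericPoint X ∈ Set.range (X.fromSpecStalk y) := by
    rw [Scheme.range_fromSpecStalk]; exact specializes_genericPoint y
  obtain ⟨p, rfl⟩ := h1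
  obtain ⟨p', hp'⟩ := h2
  by_cases hp : p.asIdeal = ⊥
  · by_cases hq : p'.asIdeal = ⊥
    · exact absurd (by rw [← hp']; congr 1; exact PrimeSpectrum.ext (hp.trans hq.symm)) hx
    · have h3 := hpt p' hq
      rw [hp'] at h3
      refine absurd ?_ hx
      refine (Specializes.antisymm ?_ (specializes_genericPoint _)).eq
      conv_rhs => rw [h3]
      exact h
  · exact hpt p hp

lemma isClosed_singleton_of_ne_genericPoint {x : X} (hx : x ≠ genericPoint X) :
    IsClosed ({x} : Set X) := by
  have : closure {x} = {x} := by
    ext y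
    rw [← specializes_iff_mem_closure]
    exact ⟨fun h => (eq_of_specializes h hx).symm, fun h => h ▸ specializes_rfl⟩
  rw [← this]; exact isClosed_closure

/-- A closed set in a Noetherian space has finitely many irreducible components, and each has a
generic point which, not being that of `X`, is closed. -/
lemma finite_of_genericPoint_notMem [NoetherianSpace X] {S : Set X} (hS : IsClosed S)
    (h : genericPoint X ∉ S) : S.Finite := by
  obtain ⟨T, hT, hc, hi, rfl⟩ := NoetherianSpace.exists_finite_set_isClosed_irreducible hS
  refine hT.sUnion fun t ht => ?_
  obtain ⟨x, hx⟩ := QuasiSober.sober (hi t ht) (hc t ht)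
  have hxt : x ∈ t := hx.mem
  have hx' : x ≠ genericPoint X := fun e => h (e ▸ ⟨t, ht, hxt⟩)
  rw [← hx.def, (isClosed_singleton_of_ne_genericPoint hx').closure_eq]
  exact Set.finite_singleton x

/-- The local ring at `x` as a valuation ring of the function field. -/
def locVal (x : X) : ValuationSubring X.functionField where
  __ := locRing X x
  mem_or_inv_mem' a := (ValuationRing.isInteger_or_isInteger (X.presheaf.stalk x) a).imp
    (fun ⟨b, hb⟩ => ⟨b, hb⟩) (fun ⟨b, hb⟩ => ⟨b, hb⟩)

lemma locVal_val_le_one_iff {x : X} {a : X.functionField} :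
    (locVal x).valuation a ≤ 1 ↔ a ∈ locRing X x := (locVal x).valuation_le_one_iff a

lemma locVal_val_algebraMap_lt_one_iff {x : X} (a : X.presheaf.stalk x) :
    (locVal x).valuation (algebraMap _ X.functionField a) < 1 ↔
      a ∈ IsLocalRing.maximalIdeal (X.presheaf.stalk x) := by
  rw [IsLocalRing.mem_maximalIdeal, mem_nonunits_iff]
  constructor
  · rintro h ⟨u, rfl⟩
    have h1 : (locVal x).valuation (algebraMap _ X.functionField
        ((u⁻¹ : (X.presheaf.stalk x)ˣ) : X.presheaf.stalk x)) ≤ 1 :=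
      locVal_val_le_one_iff.2
        ⟨((u⁻¹ : (X.presheaf.stalk x)ˣ) : X.presheaf.stalk x), rfl⟩
    have h2 := mul_lt_one_of_lt_of_le h h1
    rw [← map_mul, ← map_mul, Units.mul_inv, map_one, map_one] at h2
    exact lt_irrefl _ h2
  · intro h
    have h1 : (locVal x).valuation (algebraMap _ X.functionField a) ≤ 1 :=
      locVal_val_le_one_iff.2 ⟨_, rfl⟩
    refine lt_of_le_of_ne h1 fun h2 => h ?_
    have h0 : algebraMap (X.presheaf.stalk x) X.functionField a ≠ 0 := by
      intro h0; rw [h0, map_zero] at h2; exact zero_ne_one h2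
    have h3 : (algebraMap (X.presheaf.stalk x) X.functionField a)⁻¹ ∈ locRing X x := by
      rw [← locVal_val_le_one_iff, map_inv₀, h2, inv_one]
    obtain ⟨b, hb⟩ := h3
    refine IsUnit.of_mul_eq_one b (IsFractionRing.injective (X.presheaf.stalk x) X.functionField ?_)
    rw [map_mul, hb, map_one, mul_inv_cancel₀ h0]

/-- The valuation is discrete or trivial: the ideal of the denominator `q` of `b` is a power of the
maximal ideal, so a power of `a` is divisible by `q`. -/
lemma exists_pow_mul_val_lt_one (x : X) (a b : X.functionField) (ha : (locVal x).valuation a < 1) :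
    ∃ N, ∀ n ≥ N, (locVal x).valuation (a ^ n * b) < 1 := by
  obtain ⟨a, rfl⟩ := locVal_val_le_one_iff.1 ha.le
  rw [locVal_val_algebraMap_lt_one_iff] at ha
  obtain ⟨p, q, hq, rfl⟩ := IsFractionRing.div_surjective (A := X.presheaf.stalk x) b
  have hq0 := nonZeroDivisors.ne_zero hq
  obtain ⟨n, hn⟩ := exists_maximalIdeal_pow_eq_of_principal (X.presheaf.stalk x)
    (IsPrincipalIdealRing.principal _) (Ideal.span {q}) (by simpa using hq0)
  refine ⟨n + 1, fun m hm => ?_⟩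
  obtain ⟨m, rfl⟩ : ∃ j, m = n + 1 + j := ⟨m - (n + 1), by omega⟩
  have h1 : a ^ n ∈ Ideal.span {q} := hn ▸ Ideal.pow_mem_pow ha n
  obtain ⟨c, hc⟩ := Ideal.mem_span_singleton'.1 h1
  have hq' : algebraMap (X.presheaf.stalk x) X.functionField q ≠ 0 := by
    rwa [Ne, FaithfulSMul.algebraMap_eq_zero_iff]
  have h2 : algebraMap _ X.functionField a ^ (n + 1 + m) * (algebraMap _ X.functionField p /
      algebraMap _ X.functionField q) = algebraMap _ X.functionField (a * (a ^ m * c * p)) := by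
    rw [mul_div_assoc', div_eq_iff hq', ← map_pow, ← map_mul, ← map_mul]
    congr 1
    rw [pow_add, pow_add, ← hc]; ring
  rw [h2, locVal_val_algebraMap_lt_one_iff]
  exact Ideal.mul_mem_right _ _ ha

omit [IsLocallyPID X] in
/-- On a separated scheme an inclusion of local rings comes from a specialization. -/
lemma eq_of_locRing_le [X.IsSeparated] {x y : X} (h : locRing X x ≤ locRing X y) :
    y ⤳ x := by
  let φ : X.presheaf.stalk x →+* X.presheaf.stalk y :=
    (locRingEquiv y).symm.toRingHom.comp ((Subring.inclusion h).comp (locRingEquiv x).toRingHom)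
  have hφ : (algebraMap (X.presheaf.stalk y) X.functionField).comp φ =
      algebraMap (X.presheaf.stalk x) X.functionField := by
    ext a
    exact congrArg Subtype.val ((locRingEquiv y).apply_symm_apply
      (Subring.inclusion h (locRingEquiv x a)))
  -- Both morphisms from the spectrum of the stalk at `y` agree on the spectrum of the function
  -- field, which is dominant; the target is separated, so they are equal.
  have key : Spec.map (CommRingCat.ofHom φ) ≫ X.fromSpecStalk x = X.fromSpecStalk y := by
    have : IsDominant (Spec.map (X.presheaf.stalkSpecializes (specializes_genericPoint y))) := by
      constructor
      refine (PrimeSpectrum.denseRange_comap_iff_ker_le_nilRadical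
        (algebraMap (X.presheaf.stalk y) X.functionField)).2 ?_
      rw [(RingHom.injective_iff_ker_eq_bot _).1 (IsFractionRing.injective (X.presheaf.stalk y)
        X.functionField)]
      exact bot_le
    refine ext_of_isDominant_of_isSeparated (Limits.terminal.from X)
      (Limits.terminal.hom_ext _ _)
      (Spec.map (X.presheaf.stalkSpecializes (specializes_genericPoint y))) ?_
    rw [Scheme.SpecMap_stalkSpecializes_fromSpecStalk, ← Spec.map_comp_assoc,
      ← Scheme.SpecMap_stalkSpecializes_fromSpecStalk (specializes_genericPoint x)]
    congr 2
    ext a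
    exact congr($hφ a)
  have h2 : y ∈ Set.range (X.fromSpecStalk x) := by
    refine ⟨Spec.map (CommRingCat.ofHom φ) (IsLocalRing.closedPoint (X.presheaf.stalk y)), ?_⟩
    exact congr($key (IsLocalRing.closedPoint (X.presheaf.stalk y))).trans
      Scheme.fromSpecStalk_closedPoint
  rw [Scheme.range_fromSpecStalk] at h2
  exact h2

/-- Neither of the two local rings contains the other. The quotient of an element witnessing one
non-inclusion by one witnessing the other has a pole at `x` and a zero at `y`. -/
lemma exists_notMem_val_lt_one [X.IsSeparated] {x y : X} (hxy : x ≠ y) (hx : x ≠ genericPoint X)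
    (hy : y ≠ genericPoint X) : ∃ t, t ∉ locVal x ∧ (locVal y).valuation t < 1 := by
  have h1 : ∃ a, a ∈ locRing X y ∧ a ∉ locRing X x := by
    by_contra! h
    exact hxy (eq_of_specializes (eq_of_locRing_le h) hx)
  have h2 : ∃ a, a ∈ locRing X x ∧ a ∉ locRing X y := by
    by_contra! h
    exact hxy (eq_of_specializes (eq_of_locRing_le h) hy).symm
  obtain ⟨a, hay, hax⟩ := h1
  obtain ⟨b, hbx, hby⟩ := h2
  rw [← locVal_val_le_one_iff] at *
  rw [not_le] at hax hby
  refine ⟨a / b, ?_, ?_⟩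
  · rw [← ValuationSubring.valuation_le_one_iff, not_le, map_div₀]
    rcases eq_or_ne ((locVal x).valuation b) 0 with h | h
    · rw [map_eq_zero] at h
      rw [h, map_zero] at hby
      exact absurd hby (not_lt.2 zero_le_one)
    · rw [lt_div_iff₀ (zero_lt_iff.2 h), one_mul]
      exact hbx.trans_lt hax
  · rw [map_div₀, div_lt_one₀ (zero_lt_one.trans hby)]
    exact hay.trans_lt hby

end Points

end

/-! ### Rational points: evaluation, coordinates, transcendence degree. -/

noncomputable section

section RationalPoint

open Polynomial
open scoped IntermediateField IntermediateField.algebraAdjoinAdjoin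

variable {k : Type u} [Field k] {X : Scheme.{u}} (f : X ⟶ Spec (CommRingCat.of k))
  (s : Spec (CommRingCat.of k) ⟶ X)

/-- The image of a `k`-valued point. -/
def ratPt : X := s (IsLocalRing.closedPoint k)

lemma le_preimage_of_ratPt_mem {V : X.Opens} (hV : ratPt s ∈ V) : ⊤ ≤ s ⁻¹ᵁ V := fun y _ => by
  have : y = IsLocalRing.closedPoint k := Subsingleton.elim (α := PrimeSpectrum k) _ _
  rw [this]; exact hV

/-- The value of a function at a `k`-valued point. -/
def evalAt (V : X.Opens) (hV : ratPt s ∈ V) : Γ(X, V) →+* k :=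
  (Scheme.ΓSpecIso (CommRingCat.of k)).hom.hom.comp
    (s.appLE V ⊤ (le_preimage_of_ratPt_mem s hV)).hom

lemma evalAt_map {V W : X.Opens} (h : W ≤ V) (hW : ratPt s ∈ W) (a : Γ(X, V)) :
    evalAt s W hW (X.presheaf.map (homOfLE h).op a) = evalAt s V (h hW) a := by
  simp only [evalAt, RingHom.comp_apply]
  congr 1
  exact congr($(s.map_appLE (le_preimage_of_ratPt_mem s hW) (homOfLE h).op) a)

lemma evalAt_structMap (hs : s ≫ f = 𝟙 _) (V : X.Opens) (hV : ratPt s ∈ V) (c : k) :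
    evalAt s V hV (structMap f V c) = c := by
  refine (evalAt_map s (V := ⊤) le_top hV _).trans ?_
  simp only [evalAt, RingHom.comp_apply]
  have h1 : s.appLE ⊤ ⊤ (le_preimage_of_ratPt_mem s trivial) = s.appTop := Scheme.Hom.appLE_eq_app ..
  rw [h1]
  have h2 : s.appTop (f.appTop ((Scheme.ΓSpecIso (CommRingCat.of k)).inv c)) =
      (Scheme.ΓSpecIso (CommRingCat.of k)).inv c := by
    rw [← CommRingCat.comp_apply, ← Scheme.Hom.comp_appTop, hs]
    rfl
  refine (congrArg _ h2).trans ?_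
  rw [← CommRingCat.comp_apply, Iso.inv_hom_id]
  rfl

lemma ratPt_mem_basicOpen {V : X.Opens} (hV : ratPt s ∈ V) (a : Γ(X, V)) :
    ratPt s ∈ X.basicOpen a ↔ evalAt s V hV a ≠ 0 := by
  have h1 : ratPt s ∈ X.basicOpen a ↔ IsLocalRing.closedPoint k ∈
      (Spec (CommRingCat.of k)).basicOpen (s.appLE V ⊤ (le_preimage_of_ratPt_mem s hV) a) := by
    change IsLocalRing.closedPoint k ∈ s ⁻¹ᵁ X.basicOpen a ↔ _
    rw [Scheme.preimage_basicOpen, Scheme.Hom.appLE, CommRingCat.comp_apply, Scheme.basicOpen_res]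
    simp
  rw [h1]
  set b := s.appLE V ⊤ (le_preimage_of_ratPt_mem s hV) a with hb
  have h2 : evalAt s V hV a = (Scheme.ΓSpecIso (CommRingCat.of k)).hom b := rfl
  rw [h2]
  constructor
  · intro h h0
    have : b = 0 := (Scheme.ΓSpecIso (CommRingCat.of k)).commRingCatIsoToRingEquiv.injective
      (h0.trans (map_zero _).symm)
    rw [this, Scheme.basicOpen_zero] at h
    exact h
  · intro h
    have h3 : IsUnit b := by
      have h4 : IsUnit ((Scheme.ΓSpecIso (CommRingCat.of k)).hom b) :=
        isUnit_iff_ne_zero (G₀ := k).2 h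
      have := h4.map (Scheme.ΓSpecIso (CommRingCat.of k)).inv.hom
      rwa [← CommRingCat.comp_apply, Iso.hom_inv_id] at this
    rw [Scheme.basicOpen_of_isUnit _ h3]; trivial

lemma germ_mem_maximalIdeal_iff {V : X.Opens} (hV : ratPt s ∈ V) (a : Γ(X, V)) :
    X.presheaf.germ V (ratPt s) hV a ∈ IsLocalRing.maximalIdeal (X.presheaf.stalk (ratPt s)) ↔
      evalAt s V hV a = 0 := by
  rw [IsLocalRing.mem_maximalIdeal, mem_nonunits_iff, ← Scheme.mem_basicOpen,
    ratPt_mem_basicOpen, not_not]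

/-- An étale coordinate vanishing at a rational point of a smooth curve. -/
theorem exists_coordinate [SmoothOfRelativeDimension 1 f] (hs : s ≫ f = 𝟙 _) :
    ∃ (V : X.Opens) (_ : IsAffineOpen V) (hx : ratPt s ∈ V) (z : Γ(X, V)),
      (eval₂RingHom (structMap f V) z).Etale ∧
      IsLocalRing.maximalIdeal (X.presheaf.stalk (ratPt s)) =
        Ideal.span {X.presheaf.germ V (ratPt s) hx z} := by
  obtain ⟨V, hV, hx, t, ht⟩ := exists_etale_chart f (ratPt s)
  have h := ht (evalAt s V hx t)
  -- Subtracting the value at the rational point gives a coordinate vanishing there that is still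
  -- étale.
  set z := t - structMap f V (evalAt s V hx t) with hz
  have hz0 : evalAt s V hx z = 0 := by rw [hz, map_sub, evalAt_structMap f s hs, sub_self]
  refine ⟨V, hV, hx, z, h, ?_⟩
  algebraize [eval₂RingHom (structMap f V) z]
  let : Algebra Γ(X, V) (X.presheaf.stalk (ratPt s)) := (X.presheaf.germ V (ratPt s) hx).hom.toAlgebra
  let : Algebra k[X] (X.presheaf.stalk (ratPt s)) :=
    ((algebraMap Γ(X, V) (X.presheaf.stalk (ratPt s))).comp (algebraMap k[X] Γ(X, V))).toAlgebra
  have : IsScalarTower k[X] Γ(X, V) (X.presheaf.stalk (ratPt s)) := IsScalarTower.of_algebraMap_eq' rfl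
  have hloc : IsLocalization.AtPrime (X.presheaf.stalk (ratPt s)) (hV.primeIdealOf ⟨ratPt s, hx⟩).asIdeal :=
    hV.isLocalization_stalk ⟨ratPt s, hx⟩
  have hzX : algebraMap k[X] Γ(X, V) Polynomial.X = z := eval₂_X _ _
  -- The prime of the point contracts to a proper ideal of `k[X]` containing the coordinate, hence
  -- to the maximal ideal generated by it.
  have hmax : (hV.primeIdealOf ⟨ratPt s, hx⟩).asIdeal.comap (algebraMap k[X] Γ(X, V)) =
      Ideal.span {Polynomial.X} := by
    have h1 : (Ideal.span {(Polynomial.X : k[X])}).IsMaximal :=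
      PrincipalIdealRing.isMaximal_of_irreducible irreducible_X
    refine (h1.eq_of_le (Ideal.IsPrime.ne_top inferInstance) ?_).symm
    rw [Ideal.span_singleton_le_iff_mem, Ideal.mem_comap, hzX,
      ← IsLocalization.AtPrime.to_map_mem_maximal_iff (X.presheaf.stalk (ratPt s))
        (hV.primeIdealOf ⟨ratPt s, hx⟩).asIdeal]
    exact (germ_mem_maximalIdeal_iff s hx z).2 hz0
  have := maximalIdeal_eq_span_of_etale (R := k[X]) (S := X.presheaf.stalk (ratPt s)) _ hmax
  rw [this, IsScalarTower.algebraMap_apply k[X] Γ(X, V), hzX]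
  rfl

variable [IsIntegral X]

instance nonempty_top : Nonempty (⊤ : X.Opens) := ⟨⟨genericPoint X, trivial⟩⟩

/-- The structure map to the function field. -/
def kToK : k →+* X.functionField := (X.germToFunctionField ⊤).hom.comp (structMap f ⊤)

lemma germ_structMap (V : X.Opens) [Nonempty V] (c : k) :
    X.germToFunctionField V (structMap f V c) = kToK f c := by
  rw [← structMap_map f (le_top : V ≤ ⊤), germ_map]; rfl

lemma kToK_mem_locRing (c : k) (x : X) : kToK f c ∈ locRing X x :=
  germ_mem_locRing ⊤ trivial _

/-- Flatness over `k[X]` makes the coordinate transcendental. Since `K` is formally unramified and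
essentially of finite type over the subfield generated by the coordinate, it is finite over it, and
the transcendence degree is at most one. -/
theorem transcendental_of_etale {V : X.Opens} (hV : IsAffineOpen V) [Nonempty V] (z : Γ(X, V))
    (h : (eval₂RingHom (structMap f V) z).Etale) :
    let := (kToK f).toAlgebra
    Transcendental k (X.germToFunctionField V z) ∧
      Algebra.EssFiniteType k X.functionField ∧ Algebra.trdeg k X.functionField ≤ 1 := by
  let := (kToK f).toAlgebra
  let K := X.functionField
  let ζ : K := X.germToFunctionField V z
  let : Algebra k Γ(X, V) := (structMap f V).toAlgebra
  let : Algebra k[X] Γ(X, V) := (eval₂RingHom (structMap f V) z).toAlgebra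
  have : Algebra.Etale k[X] Γ(X, V) := h
  let : Algebra k[X] K := (aeval ζ).toAlgebra
  have : IsScalarTower k Γ(X, V) K := IsScalarTower.of_algebraMap_eq fun c =>
    (germ_structMap f V c).symm
  have haev : ∀ p : k[X], X.germToFunctionField V (algebraMap k[X] Γ(X, V) p) = aeval ζ p := by
    intro p
    change X.germToFunctionField V (eval₂ (structMap f V) z p) = eval₂ (kToK f) ζ p
    rw [← CommRingCat.Hom.hom, hom_eval₂]
    congr 1
    ext c
    exact germ_structMap f V c
  have : IsScalarTower k[X] Γ(X, V) K := IsScalarTower.of_algebraMap_eq fun p => (haev p).symm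
  have : IsScalarTower k k[X] Γ(X, V) := IsScalarTower.of_algebraMap_eq fun c =>
    (eval₂_C (structMap f V) z).symm
  have : IsScalarTower k k[X] K := IsScalarTower.of_algebraMap_eq fun c =>
    (aeval_C ζ c).symm
  have htr : Transcendental k ζ := by
    rw [transcendental_iff]
    intro p hp
    by_contra hp0
    rw [← haev, ← map_zero (X.germToFunctionField V).hom] at hp
    have h1 := Scheme.germToFunctionField_injective X V hp
    have h2 := Module.Flat.isSMulRegular_of_nonZeroDivisors (M := Γ(X, V))
      (mem_nonZeroDivisors_of_ne_zero hp0)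
    have h3 : p • (1 : Γ(X, V)) = p • 0 := by rw [Algebra.smul_def, h1]; simp
    exact one_ne_zero (h2 h3)
  have hfr : IsFractionRing Γ(X, V) K := functionField_isFractionRing_of_isAffineOpen X V hV
  have : Algebra.FiniteType k Γ(X, V) := Algebra.FiniteType.trans (S := k[X]) inferInstance inferInstance
  have : Algebra.EssFiniteType Γ(X, V) K := Algebra.EssFiniteType.of_isLocalization K
    (nonZeroDivisors Γ(X, V))
  have hess : Algebra.EssFiniteType k K := Algebra.EssFiniteType.comp k Γ(X, V) K
  refine ⟨htr, hess, ?_⟩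
  have : Algebra.FormallyUnramified Γ(X, V) K :=
    Algebra.FormallyUnramified.of_isLocalization (nonZeroDivisors Γ(X, V))
  have : Algebra.FormallyUnramified k[X] K := Algebra.FormallyUnramified.comp k[X] Γ(X, V) K
  let : Algebra k[X] k⟮ζ⟯ := (aeval (IntermediateField.AdjoinSimple.gen k ζ)).toAlgebra
  have : IsScalarTower k[X] k⟮ζ⟯ K := IsScalarTower.of_algebraMap_eq fun p => by
    change aeval ζ p = algebraMap k⟮ζ⟯ K (aeval (IntermediateField.AdjoinSimple.gen k ζ) p)
    rw [← aeval_algebraMap_apply]; rfl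
  have : Algebra.FormallyUnramified k⟮ζ⟯ K := Algebra.FormallyUnramified.of_restrictScalars k[X] _ _
  have : Algebra.EssFiniteType k⟮ζ⟯ K := Algebra.EssFiniteType.of_comp k _ _
  have : Module.Finite k⟮ζ⟯ K := Algebra.FormallyUnramified.finite_of_free _ _
  have : Algebra.IsAlgebraic (Algebra.adjoin k {ζ}) K := Algebra.IsAlgebraic.trans _ k⟮ζ⟯ _
  simpa using Algebra.IsAlgebraic.trdeg_le_cardinalMk k (A := K) {ζ}

end RationalPoint

open Polynomial in
-- Nonzero constants have value one, since their inverses are constants too; as `y` has value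
-- greater than one, the leading term strictly dominates.
theorem Valuation.map_aeval_eq {k K Γ₀ : Type*} [Field k] [Field K] [Algebra k K]
    [LinearOrderedCommGroupWithZero Γ₀] (v : Valuation K Γ₀) (hk : ∀ c : k, v (algebraMap k K c) ≤ 1)
    {y : K} (hy : 1 < v y) {p : k[X]} (hp : p ≠ 0) : v (aeval y p) = v y ^ p.natDegree := by
  have hk1 : ∀ c : k, c ≠ 0 → v (algebraMap k K c) = 1 := fun c hc => by
    refine le_antisymm (hk c) ?_
    have := hk c⁻¹
    rw [map_inv₀, map_inv₀] at this
    exact (inv_le_one₀ (zero_lt_iff.2 (by simpa using hc))).1 this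
  rw [aeval_eq_sum_range, Finset.sum_range_succ]
  have h1 : v (p.coeff p.natDegree • y ^ p.natDegree) = v y ^ p.natDegree := by
    rw [Algebra.smul_def, map_mul, hk1 _ (by simpa using hp), one_mul, map_pow]
  rw [Valuation.map_add_eq_of_lt_right, h1]
  rw [h1]
  refine v.map_sum_lt (pow_ne_zero _ (zero_lt_one.trans hy).ne') fun i hi => ?_
  rw [Algebra.smul_def, map_mul, map_pow]
  refine (mul_le_of_le_one_left' (hk _)).trans_lt ?_
  exact pow_lt_pow_right₀ hy (Finset.mem_range.1 hi)

end

/-! ### The complement of a rational point is affine. -/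

noncomputable section

section Affine

open Polynomial
open scoped IntermediateField IntermediateField.algebraAdjoinAdjoin

lemma isLocallyPID_of_smooth {k : Type u} [Field k] {X : Scheme.{u}}
    (f : X ⟶ Spec (CommRingCat.of k)) [SmoothOfRelativeDimension 1 f] : IsLocallyPID X :=
  ⟨fun x => (isDomain_stalk_of_smooth f x).2⟩

lemma isSeparated_of_field {k : Type u} [Field k] {X : Scheme.{u}}
    (f : X ⟶ Spec (CommRingCat.of k)) [IsSeparated f] : X.IsSeparated := by
  constructor
  rw [← Limits.terminal.comp_from f]
  infer_instance

lemma noetherianSpace_of_proper {k : Type u} [Field k] {X : Scheme.{u}}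
    (f : X ⟶ Spec (CommRingCat.of k)) [IsProper f] : NoetherianSpace X := by
  have : CompactSpace X := (quasiCompact_iff_compactSpace f).1 inferInstance
  have : IsNoetherian X := { __ := LocallyOfFiniteType.isLocallyNoetherian f }
  infer_instance

variable {k : Type u} [Field k] {X : Scheme.{u}} [IsIntegral X] (f : X ⟶ Spec (CommRingCat.of k))
  (s : Spec (CommRingCat.of k) ⟶ X)

lemma isClosed_notMem_locRing (y : X.functionField) : IsClosed {x : X | y ∉ locRing X x} := by
  rw [← isOpen_compl_iff, isOpen_iff_forall_mem_open]
  intro x hx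
  simp only [Set.mem_compl_iff, Set.mem_ofPred_eq, not_not] at hx
  obtain ⟨V, hV, _, b, rfl⟩ := exists_germ_of_mem_locRing hx
  exact ⟨V, fun x' hx' => not_not.2 (germ_mem_locRing V hx' b), V.isOpen, hV⟩

lemma mem_locRing_of_isIntegral [IsLocallyPID X] (x : X) (R : Subring X.functionField)
    (hR : R ≤ locRing X x) {a : X.functionField} (ha : _root_.IsIntegral R a) : a ∈ locRing X x := by
  have := IsIntegral.map_of_comp_eq (T := X.presheaf.stalk x)
    ((locRingEquiv x).symm.toRingHom.comp (Subring.inclusion hR)) (RingHom.id X.functionField) (by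
      ext r
      exact congrArg Subtype.val ((locRingEquiv x).apply_symm_apply (Subring.inclusion hR r))) ha
  exact IsIntegrallyClosed.algebraMap_eq_of_integral this

/-- There is a function with poles only at a given rational point. -/
theorem exists_section_notMem_locRing [IsProper f] [SmoothOfRelativeDimension 1 f] (hs : s ≫ f = 𝟙 _)
    (U : X.Opens) [Nonempty U] (hU : ∀ x, x ∈ U ↔ x ≠ ratPt s) :
    ∃ a : Γ(X, U), X.germToFunctionField U a ∉ locRing X (ratPt s) := by
  have := isLocallyPID_of_smooth f
  have := isSeparated_of_field f
  have := noetherianSpace_of_proper f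
  obtain ⟨V, hV, hx, z, hz, hmax⟩ := exists_coordinate f s hs
  have : Nonempty V := ⟨⟨_, hx⟩⟩
  letI := (kToK f).toAlgebra
  obtain ⟨htr, hess, htrdeg⟩ := transcendental_of_etale f hV z hz
  let K := X.functionField
  set ζ : K := X.germToFunctionField V z
  let y : K := ζ⁻¹
  have hζ0 : ζ ≠ 0 := fun h => htr (h ▸ isAlgebraic_zero)
  have hζ1 : (locVal (ratPt s)).valuation ζ < 1 := by
    rw [show ζ = _ from (X.algebraMap_germ_eq_germToFunctionField hx z).symm,
      locVal_val_algebraMap_lt_one_iff, hmax]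
    exact Ideal.mem_span_singleton_self _
  have hy : Transcendental k y := fun h => htr (inv_inv ζ ▸ h.inv)
  have hval : ∀ (x : X) (c : k), (locVal x).valuation (algebraMap k K c) ≤ 1 := fun x c =>
    locVal_val_le_one_iff.2 (kToK_mem_locRing f c x)
  have hfin := finite_adjoin_of_trdeg_le_one htrdeg hy
  obtain ⟨n, e, he, hint⟩ := exists_integral_span (k := k) (y := y)
  -- The poles of `y = ζ⁻¹`: finitely many points, among them the rational point, where the
  -- coordinate `ζ` vanishes.
  let Z : Set X := {x | y ∉ locRing X x}
  have hZ : Z.Finite := finite_of_genericPoint_notMem (isClosed_notMem_locRing y) (by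
    simp only [Z, Set.mem_ofPred_eq, locRing_genericPoint, not_not]; trivial)
  have hZy : ∀ x ∈ Z, 1 < (locVal x).valuation y := fun x hx => by
    rw [← not_le, locVal_val_le_one_iff]; exact hx
  have hZ0 : ∀ x ∈ Z, x ≠ genericPoint X := by
    rintro x hx rfl
    exact hx (by rw [locRing_genericPoint]; trivial)
  have hinf : ratPt s ∈ Z := by
    change ¬ _
    rw [← locVal_val_le_one_iff, not_le, map_inv₀]
    exact (one_lt_inv₀ (zero_lt_iff.2 (by simpa using hζ0))).2 hζ1
  -- The other poles of `y` must not become poles of the function sought; weak approximation gives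
  -- `t` small at these and large at the rational point.
  obtain ⟨t, ht, htZ⟩ : ∃ t, t ∉ locVal (ratPt s) ∧
      ∀ x ∈ Z, x ≠ ratPt s → (locVal x).valuation t < 1 := by
    classical
    suffices h : ∃ t, t ∉ locVal (ratPt s) ∧
        ∀ x ∈ hZ.toFinset.filter (· ≠ ratPt s), (locVal x).valuation t < 1 by
      obtain ⟨t, h1, h2⟩ := h
      exact ⟨t, h1, fun x hx hx' => h2 x (Finset.mem_filter.2 ⟨hZ.mem_toFinset.2 hx, hx'⟩)⟩
    refine exists_notMem_forall_valuation_lt (locVal (ratPt s)) (fun x : X => locVal x) ⟨y, hinf⟩ _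
      (fun x hx => ?_) (fun x _ a b hab => exists_pow_mul_val_lt_one x a b hab)
    have hx := Finset.mem_filter.1 hx
    exact exists_notMem_val_lt_one hx.2.symm (hZ0 _ hinf) (hZ0 _ (hZ.mem_toFinset.1 hx.1))
  have hsub : ∀ (x : X) (c : k) (a : K), a ∈ locRing X x → c • a ∈ locRing X x := fun x c a ha => by
    rw [Algebra.smul_def]; exact mul_mem (kToK_mem_locRing f c x) ha
  let M : Submodule k K :=
    { carrier := {a | ∀ x ∉ Z, a ∈ locRing X x}
      add_mem' := fun ha hb x hx => add_mem (ha x hx) (hb x hx)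
      zero_mem' := fun x _ => zero_mem _
      smul_mem' := fun c a ha x hx => hsub x c a (ha x hx) }
  let O : Submodule k K :=
    { carrier := {a | ∀ x ∈ Z, a ∈ locRing X x}
      add_mem' := fun ha hb x hx => add_mem (ha x hx) (hb x hx)
      zero_mem' := fun x _ => zero_mem _
      smul_mem' := fun c a ha x hx => hsub x c a (ha x hx) }
  have hpoly : ∀ (x : X) (a : K) (p : k[X]), a ∈ locRing X x → aeval a p ∈ locRing X x := by
    intro x a p ha
    rw [aeval_eq_sum_range]
    exact sum_mem fun i _ => hsub x _ _ (pow_mem ha i)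
  have hM : ∀ i (p : k[X]), aeval y p * e i ∈ M := by
    intro i p x hx
    have hyx : y ∈ locRing X x := not_not.1 hx
    refine mul_mem (hpoly x y p hyx) ?_
    refine mem_locRing_of_isIntegral x (Algebra.adjoin k {y}).toSubring (fun a ha => ?_) (hint i)
    have ha' : a ∈ Algebra.adjoin k {y} := ha
    rw [Algebra.adjoin_singleton_eq_range_aeval] at ha'
    obtain ⟨p, rfl⟩ := ha'
    exact hpoly x y p hyx
  obtain ⟨N, hN⟩ : ∃ N, ∀ i, ∀ x ∈ Z, (locVal x).valuation (y⁻¹ ^ N * e i) < 1 := by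
    have h1 : ∀ p : Fin n × hZ.toFinset, ∃ N, ∀ m ≥ N, (locVal (p.2 : X)).valuation (y⁻¹ ^ m * e p.1) < 1 :=
      fun p => exists_pow_mul_val_lt_one _ _ _ (by
        rw [map_inv₀]; exact inv_lt_one_of_one_lt₀ (hZy _ ((Set.Finite.mem_toFinset hZ).1 p.2.2)))
    choose N hN using h1
    exact ⟨Finset.univ.sup N, fun i x hx => hN (i, ⟨x, (Set.Finite.mem_toFinset hZ).2 hx⟩) _
      (Finset.le_sup (f := N) (Finset.mem_univ _))⟩
  have hO : ∀ i (p q : k[X]), q ≠ 0 → p.natDegree ≤ q.natDegree →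
      aeval y p / aeval y q * (y⁻¹ ^ N * e i) ∈ O := by
    intro i p q hq hpq x hx
    refine mul_mem ?_ (locVal_val_le_one_iff.1 (hN i x hx).le)
    rcases eq_or_ne p 0 with rfl | hp
    · simp [zero_mem]
    · have hy1 := hZy x hx
      rw [← locVal_val_le_one_iff, map_div₀, Valuation.map_aeval_eq _ (hval x) hy1 hp,
        Valuation.map_aeval_eq _ (hval x) hy1 hq]
      exact (div_le_one₀ (pow_pos (zero_lt_one.trans hy1) _)).2 (pow_le_pow_right₀ hy1.le hpq)
  have := finite_quotient_of_ratfunc hy M O e he hM N hO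
  obtain ⟨p, hp, hpt⟩ := exists_aeval_mem_of_finite_quotient (M ⊔ O) t
  -- The summand `m` of `p(t)` is the function sought. Outside `Z` it is regular by definition. At
  -- the other points of `Z` both `p(t)` and `o` are regular. At the rational point `p(t)` has a
  -- pole, because `p` is nonconstant, while `o` has none.
  obtain ⟨m, hm, o, ho, hmo⟩ := Submodule.mem_sup.1 hpt
  have hm' : m = aeval t p - o := by rw [← hmo]; ring
  obtain ⟨a, ha⟩ := exists_section_of_forall_mem_locRing U (a := m) (fun x hx => by
    by_cases hxZ : x ∈ Z
    · rw [hm']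
      refine sub_mem (hpoly x t p (locVal_val_le_one_iff.1 (htZ x hxZ ((hU x).1 hx)).le))
        (ho x hxZ)
    · exact hm x hxZ)
  refine ⟨a, fun h => ?_⟩
  rw [ha] at h
  have h1 : aeval t p ∈ locRing X (ratPt s) := hmo ▸ add_mem h (ho _ hinf)
  have h2 : 1 < (locVal (ratPt s)).valuation t := by
    rw [← not_le, locVal_val_le_one_iff]; exact ht
  rw [← locVal_val_le_one_iff, Valuation.map_aeval_eq _ (hval _) h2 (by rintro rfl; simp at hp)] at h1
  exact not_lt.2 h1 (one_lt_pow₀ h2 hp.ne')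

lemma exists_mem_maximalIdeal_ne_zero [IsLocallyPID X] {x : X} (hx : x ≠ genericPoint X) :
    ∃ a ∈ IsLocalRing.maximalIdeal (X.presheaf.stalk x), a ≠ 0 := by
  by_contra! h
  have h0 : IsLocalRing.maximalIdeal (X.presheaf.stalk x) = ⊥ := (Submodule.eq_bot_iff _).2 h
  have h1 : genericPoint X ∈ Set.range (X.fromSpecStalk x) := by
    rw [Scheme.range_fromSpecStalk]; exact specializes_genericPoint x
  obtain ⟨p, hp⟩ := h1
  have hp' : p.asIdeal.IsPrime := PrimeSpectrum.isPrime p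
  have h2 : p = IsLocalRing.closedPoint (X.presheaf.stalk x) := by
    refine PrimeSpectrum.ext ?_
    change _ = IsLocalRing.maximalIdeal _
    refine le_antisymm (IsLocalRing.le_maximalIdeal hp'.ne_top) (h0 ▸ bot_le)
  rw [h2, Scheme.fromSpecStalk_closedPoint] at hp
  exact hx hp

section Gamma

variable {Y : Scheme.{u}} {R : Type u} [CommRing R] (ψ : R →+* Γ(Y, ⊤))

/-- The morphism to an affine scheme given by a map to global functions. -/
def toSpecOf : Y ⟶ Spec (CommRingCat.of R) := Y.toSpecΓ ≫ Spec.map (CommRingCat.ofHom ψ)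

lemma toSpecOf_appTop (p : R) : (toSpecOf ψ).appTop ((Scheme.ΓSpecIso (CommRingCat.of R)).inv p) = ψ p := by
  rw [toSpecOf, Scheme.Hom.comp_appTop, Scheme.toSpecΓ_appTop]
  have h1 := congr($(Scheme.ΓSpecIso_inv_naturality (CommRingCat.ofHom ψ)) p)
  rw [CommRingCat.comp_apply, CommRingCat.comp_apply] at h1
  refine (congrArg (Scheme.ΓSpecIso Γ(Y, ⊤)).hom h1.symm).trans ?_
  exact congr($((Scheme.ΓSpecIso Γ(Y, ⊤)).inv_hom_id) (ψ p))

lemma toSpecOf_comp {S : Type u} [CommRing S] (θ : S →+* R) :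
    toSpecOf ψ ≫ Spec.map (CommRingCat.ofHom θ) = toSpecOf (ψ.comp θ) := by
  rw [toSpecOf, Category.assoc, ← Spec.map_comp]
  rfl

lemma mem_toSpecOf_iff (y : Y) (p : R) : p ∈ (toSpecOf ψ y).asIdeal ↔ y ∉ Y.basicOpen (ψ p) := by
  rw [iff_not_comm, ← Scheme.toSpecΓ_preimage_basicOpen]
  rfl

lemma toSpecOf_structMap {k : Type u} [Field k] (f : Y ⟶ Spec (CommRingCat.of k)) :
    toSpecOf (structMap f ⊤) = f := by
  have h1 : CommRingCat.ofHom (structMap f ⊤) = (Scheme.ΓSpecIso (CommRingCat.of k)).inv ≫ f.appTop := by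
    ext c
    exact congr($((Y.presheaf.map_id _)) _)
  rw [toSpecOf, h1, Spec.map_comp, ← Scheme.toSpecΓ_naturality_assoc]
  simp

end Gamma

section Coordinate

variable (U : X.Opens) (a : Γ(X, U))

omit [IsIntegral X] in
lemma le_ι_preimage : (⊤ : U.toScheme.Opens) ≤ U.ι ⁻¹ᵁ U := by
  intro y _; exact y.2

/-- The morphism from an open subset to the affine line given by a function. -/
def lineMap : U.toScheme ⟶ Spec (CommRingCat.of k[X]) :=
  toSpecOf (eval₂RingHom (structMap (U.ι ≫ f) ⊤) (U.ι.appLE U ⊤ (le_ι_preimage U) a))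

lemma eval₂_appLE (p : k[X]) :
    eval₂ (structMap (U.ι ≫ f) ⊤) (U.ι.appLE U ⊤ (le_ι_preimage U) a) p =
      U.ι.appLE U ⊤ (le_ι_preimage U) (eval₂ (structMap f U) a p) := by
  refine Eq.trans ?_ (hom_eval₂ p (structMap f U) (U.ι.appLE U ⊤ (le_ι_preimage U)).hom a).symm
  congr 1
  ext c
  have h1 := congr($(U.ι.map_appLE (le_ι_preimage U) (homOfLE (le_top : U ≤ ⊤)).op)
    (f.appTop ((Scheme.ΓSpecIso (CommRingCat.of k)).inv c)))
  refine Eq.trans ?_ h1.symm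
  have h2 : structMap (U.ι ≫ f) ⊤ c = (U.ι ≫ f).appTop ((Scheme.ΓSpecIso (CommRingCat.of k)).inv c) :=
    congr($((U.toScheme.presheaf.map_id _)) _)
  rw [h2, Scheme.Hom.comp_appTop, CommRingCat.comp_apply, Scheme.Hom.appTop, Scheme.Hom.appTop,
    ← Scheme.Hom.appLE_eq_app (f := U.ι)]
  rfl

lemma mem_lineMap_iff (y : U.toScheme) (p : k[X]) :
    p ∈ (lineMap f U a y).asIdeal ↔ U.ι y ∉ X.basicOpen (eval₂ (structMap f U) a p) := by
  refine (mem_toSpecOf_iff _ _ _).trans (not_iff_not.2 ?_)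
  have h2 : U.ι ⁻¹ᵁ X.basicOpen (eval₂ (structMap f U) a p) =
      U.toScheme.basicOpen (U.ι.appLE U ⊤ (le_ι_preimage U) (eval₂ (structMap f U) a p)) := by
    rw [Scheme.preimage_basicOpen, Scheme.Hom.appLE, CommRingCat.comp_apply, Scheme.basicOpen_res,
      top_inf_eq]
  rw [← eval₂_appLE] at h2
  rw [coe_eval₂RingHom, ← h2]; rfl

lemma lineMap_appTop (p : k[X]) : (lineMap f U a).appTop ((Scheme.ΓSpecIso (CommRingCat.of k[X])).inv p) =
    U.ι.appLE U ⊤ (le_ι_preimage U) (eval₂ (structMap f U) a p) := by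
  rw [← eval₂_appLE]
  exact toSpecOf_appTop _ p

lemma lineMap_C : lineMap f U a ≫ Spec.map (CommRingCat.ofHom C) = U.ι ≫ f := by
  rw [lineMap, toSpecOf_comp]
  refine Eq.trans ?_ (toSpecOf_structMap (U.ι ≫ f))
  congr 1
  ext c
  exact eval₂_C _ _

end Coordinate

lemma comp_appTop_apply {Y Z W : Scheme.{u}} (g : Y ⟶ Z) (l : Z ⟶ W) (a : Γ(W, ⊤)) :
    (g ≫ l).appTop a = g.appTop (l.appTop a) := by
  rw [Scheme.Hom.comp_appTop]; rfl

lemma appTop_appLE {Y Z W : Scheme.{u}} (g : Y ⟶ Z) (l : Z ⟶ W) {N : W.Opens} (h : ⊤ ≤ l ⁻¹ᵁ N)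
    {l' : Y ⟶ W} (e : g ≫ l = l') (h' : ⊤ ≤ l' ⁻¹ᵁ N) (a : Γ(W, N)) :
    g.appTop (l.appLE N ⊤ h a) = l'.appLE N ⊤ h' a := by
  subst e
  have h1 : g.appTop = g.appLE ⊤ ⊤ (show (⊤ : Y.Opens) ≤ g ⁻¹ᵁ ⊤ from le_rfl) :=
    (Scheme.Hom.appLE_eq_app g).symm
  have h2 := Scheme.Hom.appLE_comp_appLE g l N ⊤ ⊤ h (show (⊤ : Y.Opens) ≤ g ⁻¹ᵁ ⊤ from le_rfl)
  exact congr($((congrArg (l.appLE N ⊤ h ≫ ·) h1).trans h2) a)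

lemma isUnit_of_map_mul_eq_one {R S : Type*} [CommRing R] [CommRing S] (φ : R →+* S)
    (h : Function.Injective φ) {x y : R} (hxy : φ x * φ y = 1) : IsUnit x :=
  IsUnit.of_mul_eq_one y (h (by rw [map_mul, hxy, map_one]))

lemma specMap_appTop_injective {R K : Type u} [CommRing R] [CommRing K] (φ : R →+* K)
    (h : Function.Injective φ) : Function.Injective (Spec.map (CommRingCat.ofHom φ)).appTop := by
  intro x y hxy
  have h1 := (Scheme.ΓSpecIso_naturality (CommRingCat.ofHom φ))
  have h2 : φ ((Scheme.ΓSpecIso (CommRingCat.of R)).hom x) =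
      φ ((Scheme.ΓSpecIso (CommRingCat.of R)).hom y) :=
    (congr($h1 x)).symm.trans ((congrArg _ hxy).trans (congr($h1 y)))
  exact (Scheme.ΓSpecIso (CommRingCat.of R)).commRingCatIsoToRingEquiv.injective (h h2)

/-- Valuative criterion: properness of `X` extends the given point to the valuation ring, and only
the possibility that the closed point goes to the removed point must be excluded. There `a⁻¹`
vanishes, while the image of `a` is integral over the valuation ring by the map to the line; their
product being one is absurd. -/
lemma universallyClosed_lineMap [IsLocallyPID X] [NoetherianSpace X] [IsProper f] (U : X.Opens) [Nonempty U]
    (hU : ∀ x, x ∈ U ↔ x ≠ ratPt s) (a : Γ(X, U)) (ha : X.germToFunctionField U a ∉ locRing X (ratPt s))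
    [QuasiCompact (lineMap f U a)] : UniversallyClosed (lineMap f U a) := by
  have hC := lineMap_C f U a
  set α := X.germToFunctionField U a with hα
  have hα1 : 1 < (locVal (ratPt s)).valuation α := by
    rw [← not_le, locVal_val_le_one_iff]; exact ha
  apply UniversallyClosed.of_valuativeCriterion
  intro S
  let R := S.R
  let g := Spec.map (CommRingCat.ofHom (algebraMap S.R S.K))
  have hginj : Function.Injective (algebraMap S.R S.K) := IsFractionRing.injective _ _
  have hdom : IsDominant g := by
    constructor
    refine (PrimeSpectrum.denseRange_comap_iff_ker_le_nilRadical (algebraMap S.R S.K)).2 ?_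
    rw [(RingHom.injective_iff_ker_eq_bot _).1 hginj]
    exact bot_le
  have hex : ValuativeCriterion.Existence f := by
    have h : UniversallyClosed f := inferInstance
    rw [UniversallyClosed.eq_valuativeCriterion] at h
    exact h.1
  obtain ⟨⟨l, hl₁, hl₂⟩⟩ := hex
    { R := S.R, K := S.K, i₁ := S.i₁ ≫ U.ι, i₂ := S.i₂ ≫ Spec.map (CommRingCat.ofHom C)
      commSq := ⟨by rw [Category.assoc, ← hC, ← Category.assoc, ← Category.assoc, S.commSq.w]⟩ }
  change g ≫ l = S.i₁ ≫ U.ι at hl₁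
  have hclosed : l (IsLocalRing.closedPoint S.R) ∈ U := by
    rw [hU]
    intro hcl
    have hα0 : α ≠ 0 := by
      intro h; rw [h, map_zero] at hα1; exact absurd hα1 (not_lt.2 zero_le_one)
    obtain ⟨N, hN, _, ρ, hρ⟩ := exists_germ_of_mem_locRing (x := ratPt s) (a := α⁻¹) (by
      rw [← locVal_val_le_one_iff, map_inv₀]; exact inv_le_one_of_one_le₀ hα1.le)
    have : Nonempty (N ⊓ U : X.Opens) := ⟨⟨genericPoint X, genericPoint_mem N, genericPoint_mem U⟩⟩
    have hmul : X.presheaf.map (homOfLE (inf_le_left : N ⊓ U ≤ N)).op ρ *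
        X.presheaf.map (homOfLE (inf_le_right : N ⊓ U ≤ U)).op a = 1 := by
      apply Scheme.germToFunctionField_injective X (N ⊓ U)
      rw [map_mul, germ_map, germ_map, hρ, map_one]
      exact inv_mul_cancel₀ hα0
    have hlN : ⊤ ≤ l ⁻¹ᵁ N := fun y _ =>
      (IsLocalRing.specializes_closedPoint (R := S.R) y).mem_open (l ⁻¹ᵁ N).isOpen (by
        change l _ ∈ N; rw [hcl]; exact hN)
    -- A unit here would make `ρ` invertible at the rational point, so that its inverse `a` would be
    -- regular there.
    have hnu : ¬ IsUnit (l.appLE N ⊤ hlN ρ) := by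
      intro hu
      have h1 : IsLocalRing.closedPoint S.R ∈ (Spec (CommRingCat.of S.R)).basicOpen (l.appLE N ⊤ hlN ρ) := by
        rw [Scheme.basicOpen_of_isUnit _ hu]; trivial
      rw [Scheme.Hom.appLE, CommRingCat.comp_apply, Scheme.basicOpen_res, top_inf_eq,
        ← Scheme.preimage_basicOpen] at h1
      have h2 : ratPt s ∈ X.basicOpen ρ := hcl ▸ h1
      rw [isUnit_germ_iff hN, hρ, inv_inv] at h2
      exact ha h2.2
    have h3 : g.appTop (S.i₂.appTop ((Scheme.ΓSpecIso (CommRingCat.of k[X])).inv Polynomial.X)) =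
        (S.i₁ ≫ U.ι).appLE U ⊤ (fun y _ => (S.i₁ y).2) a := by
      refine (comp_appTop_apply g S.i₂ _).symm.trans ?_
      refine (congr(($(S.commSq.w)).appTop _)).symm.trans ?_
      refine (comp_appTop_apply S.i₁ (lineMap f U a) _).trans ?_
      refine (congrArg S.i₁.appTop ((lineMap_appTop f U a Polynomial.X).trans (congrArg _ (eval₂_X _ _)))).trans ?_
      exact appTop_appLE S.i₁ U.ι (le_ι_preimage U) rfl _ a
    have h4 : g.appTop (l.appLE N ⊤ hlN ρ) =
        (S.i₁ ≫ U.ι).appLE N ⊤ (by rw [← hl₁]; exact fun y _ => hlN (x := g y) trivial) ρ :=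
      appTop_appLE g l hlN hl₁ _ ρ
    have hle : ⊤ ≤ (S.i₁ ≫ U.ι) ⁻¹ᵁ (N ⊓ U) :=
      fun y _ => ⟨by rw [← hl₁]; exact hlN (x := g y) trivial, (S.i₁ y).2⟩
    have h5 := congrArg ((S.i₁ ≫ U.ι).appLE (N ⊓ U) ⊤ hle) hmul
    rw [map_mul, map_one, ← CommRingCat.comp_apply, ← CommRingCat.comp_apply,
      Scheme.Hom.map_appLE, Scheme.Hom.map_appLE] at h5
    -- The inverse of `ρ` on the valuation ring is the pullback of the coordinate of the line; the
    -- identity is checked in the fraction field.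
    refine hnu (isUnit_of_map_mul_eq_one g.appTop.hom (specMap_appTop_injective _ hginj)
      (y := S.i₂.appTop ((Scheme.ΓSpecIso (CommRingCat.of k[X])).inv Polynomial.X)) ?_)
    exact (congrArg₂ (· * ·) h4 h3).trans h5
  have hrange : Set.range l ⊆ Set.range U.ι := by
    rintro _ ⟨y, rfl⟩
    rw [Scheme.Opens.range_ι]
    exact (IsLocalRing.specializes_closedPoint (R := S.R) y).mem_open (l ⁻¹ᵁ U).isOpen hclosed
  refine ⟨⟨IsOpenImmersion.lift U.ι l hrange, ?_, ?_⟩⟩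
  · rw [← cancel_mono U.ι, Category.assoc, IsOpenImmersion.lift_fac]; exact hl₁
  · refine ext_of_isDominant_of_isSeparated (Limits.terminal.from _) (Limits.terminal.hom_ext _ _) g ?_
    rw [← S.commSq.w, ← Category.assoc]
    congr 1
    rw [← cancel_mono U.ι, Category.assoc, IsOpenImmersion.lift_fac]; exact hl₁

lemma mem_basicOpen_iff_val [IsLocallyPID X] {V : X.Opens} [Nonempty V] {x : X} (hx : x ∈ V) (a : Γ(X, V)) :
    x ∈ X.basicOpen a ↔ ¬ (locVal x).valuation (X.germToFunctionField V a) < 1 := by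
  rw [Scheme.mem_basicOpen X a x hx, ← X.algebraMap_germ_eq_germToFunctionField hx a,
    locVal_val_algebraMap_lt_one_iff, IsLocalRing.mem_maximalIdeal, mem_nonunits_iff, not_not]

/-- The complement of a rational point in a smooth proper curve is affine. -/
theorem isAffineOpen_compl_ratPt [IsProper f] [SmoothOfRelativeDimension 1 f] (hs : s ≫ f = 𝟙 _)
    (U : X.Opens) [Nonempty U] (hU : ∀ x, x ∈ U ↔ x ≠ ratPt s) : IsAffineOpen U := by
  have := isLocallyPID_of_smooth f
  have := isSeparated_of_field f
  have := noetherianSpace_of_proper f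
  obtain ⟨a, ha⟩ := exists_section_notMem_locRing f s hs U hU
  obtain ⟨V₀, hV₀, hx₀, z₀, hz₀, hmax₀⟩ := exists_coordinate f s hs
  have : Nonempty V₀ := ⟨⟨_, hx₀⟩⟩
  letI := (kToK f).toAlgebra
  obtain ⟨-, hess, htrdeg⟩ := transcendental_of_etale f hV₀ z₀ hz₀
  let K := X.functionField
  set α : K := X.germToFunctionField U a with hα
  have hα1 : 1 < (locVal (ratPt s)).valuation α := by
    rw [← not_le, locVal_val_le_one_iff]; exact ha
  have hval : ∀ (x : X) (c : k), (locVal x).valuation (algebraMap k K c) ≤ 1 := fun x c =>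
    locVal_val_le_one_iff.2 (kToK_mem_locRing f c x)
  have htr : Transcendental k α := by
    rw [transcendental_iff]
    intro p hp
    by_contra hp0
    have := Valuation.map_aeval_eq _ (hval (ratPt s)) hα1 hp0
    rw [hp, map_zero] at this
    exact pow_ne_zero _ (zero_lt_one.trans hα1).ne' this.symm
  have halg := isAlgebraic_adjoin_of_trdeg_le_one htrdeg htr
  have haev : ∀ p : k[X], X.germToFunctionField U (eval₂ (structMap f U) a p) = aeval α p := by
    intro p
    change (X.germToFunctionField U).hom _ = eval₂ (kToK f) α p
    rw [hom_eval₂]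
    congr 1
    ext c
    exact germ_structMap f U c
  let φ := lineMap f U a
  have hC := lineMap_C f U a
  have : NoetherianSpace U := U.isOpenEmbedding'.isInducing.noetherianSpace
  have hqc : QuasiCompact U.ι := ⟨fun _ _ _ => NoetherianSpace.isCompact (α := U) _⟩
  have : LocallyOfFiniteType φ := by
    have : LocallyOfFiniteType (φ ≫ Spec.map (CommRingCat.ofHom C)) := by rw [hC]; infer_instance
    exact locallyOfFiniteType_of_comp φ (Spec.map (CommRingCat.ofHom C))
  have : IsSeparated φ := by
    have : IsSeparated (φ ≫ Spec.map (CommRingCat.ofHom C)) := by rw [hC]; infer_instance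
    exact IsSeparated.of_comp φ (Spec.map (CommRingCat.ofHom C))
  have : QuasiCompact φ := by
    have : QuasiCompact (φ ≫ Spec.map (CommRingCat.ofHom C)) := by rw [hC]; infer_instance
    exact QuasiCompact.of_comp φ (Spec.map (CommRingCat.ofHom C))
  have huc : UniversallyClosed φ := by
    exact universallyClosed_lineMap f s U hU a ha
  have : IsProper φ := {}
  have : LocallyQuasiFinite φ := by
    refine LocallyQuasiFinite.of_finite_preimage_singleton φ fun P => ?_
    refine Set.Finite.of_finite_image (f := fun y : U => (y : X)) ?_ Subtype.val_injective.injOn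
    -- Over a prime containing some `p ≠ 0` the fibre lies in the zero set of `p(a)`. This is finite
    -- because `a` is transcendental.
    by_cases hP : ∃ p ∈ P.asIdeal, p ≠ 0
    · obtain ⟨p, hpP, hp⟩ := hP
      refine (finite_of_genericPoint_notMem (X.basicOpen (eval₂ (structMap f U) a p)).isOpen.isClosed_compl
        (not_not.2 ?_)).subset ?_
      · change genericPoint X ∈ X.basicOpen _
        rw [isUnit_germ_iff (genericPoint_mem U), haev, locRing_genericPoint]
        exact ⟨fun h => hp (transcendental_iff.1 htr p h), trivial⟩
      · rintro _ ⟨y, rfl, rfl⟩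
        exact (mem_lineMap_iff f U a y p).1 hpP
    -- Over the zero prime only the generic point occurs: at another point a nonzero element `u` of
    -- the maximal ideal is algebraic over `k[X]`, hence divides a nonzero polynomial in `a`, which
    -- then vanishes at that point.
    · push Not at hP
      refine (Set.finite_singleton (genericPoint X)).subset ?_
      rintro _ ⟨⟨y, hyU⟩, rfl, rfl⟩
      by_contra hy
      obtain ⟨u, hu, hu0⟩ := exists_mem_maximalIdeal_ne_zero (x := y) hy
      letI : Algebra k[X] (X.presheaf.stalk y) := ((X.presheaf.germ U y hyU).hom.comp
        (eval₂RingHom (structMap f U) a)).toAlgebra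
      have hcomp : ∀ p : k[X], algebraMap (X.presheaf.stalk y) K (algebraMap k[X] _ p) = aeval α p :=
        fun p => (X.algebraMap_germ_eq_germToFunctionField hyU _).trans (haev p)
      have halgu : IsAlgebraic k[X] u := by
        have h1 : IsAlgebraic (Algebra.adjoin k {α}) (algebraMap (X.presheaf.stalk y) K u) :=
          (Algebra.IsAlgebraic.trans (Algebra.adjoin k {α}) k⟮α⟯ K).isAlgebraic _
        refine IsAlgebraic.of_ringHom_of_comp_eq
          ((aeval α).codRestrict (Algebra.adjoin k {α}) (fun p => aeval_mem_adjoin_singleton k α))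
          (algebraMap (X.presheaf.stalk y) K) h1 ?_ (IsFractionRing.injective _ _) ?_
        · rintro ⟨b, hb⟩
          rw [Algebra.adjoin_singleton_eq_range_aeval] at hb
          obtain ⟨p, rfl⟩ := hb
          exact ⟨p, rfl⟩
        · refine RingHom.ext fun p => (hcomp p).symm
      obtain ⟨r, hr, hur⟩ := halgu.exists_nonzero_dvd (mem_nonZeroDivisors_of_ne_zero hu0)
      refine hr (hP r ?_)
      refine (mem_lineMap_iff f U a ⟨y, hyU⟩ r).2 ?_
      refine (Scheme.mem_basicOpen X _ y hyU).not.2 ?_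
      exact (IsLocalRing.mem_maximalIdeal _).1 (Ideal.mem_of_dvd _ hur hu)
  have : IsFinite φ := IsFinite.of_isProper_of_locallyQuasiFinite φ
  exact isAffine_of_isAffineHom φ

end Affine

end

/-! ### The curve `C_L`, its point `∞` and the ring `A_L`. -/

noncomputable section

namespace PointedCurve

variable {Fq : Type u} [Field Fq] (C : PointedCurve Fq) (L : Type u) [Field L] [Algebra Fq L]

instance : IsProper C.str := C.proper
instance : SmoothOfRelativeDimension 1 C.str := C.smooth
instance : GeometricallyIrreducible C.str := C.geomIrred
instance : SmoothOfRelativeDimension 1 (C.prL L) := by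
  unfold prL
  have := smoothOfRelativeDimension_isStableUnderBaseChange 1
  exact MorphismProperty.of_isPullback (P := @SmoothOfRelativeDimension 1)
    (IsPullback.of_hasPullback C.str (specMap L)) C.smooth
instance : IsProper (C.prL L) := by
  unfold prL
  exact MorphismProperty.of_isPullback (P := @IsProper)
    (IsPullback.of_hasPullback C.str (specMap L)) C.proper
instance : GeometricallyIrreducible (C.prL L) := by
  unfold prL
  exact MorphismProperty.of_isPullback (P := @GeometricallyIrreducible)
    (IsPullback.of_hasPullback C.str (specMap L)) C.geomIrred
instance : IsAffineHom (C.pr L) := by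
  unfold pr
  exact MorphismProperty.of_isPullback (P := @IsAffineHom)
    (IsPullback.of_hasPullback C.str (specMap L)).flip (by unfold specMap; infer_instance)
instance : IrreducibleSpace C.X := GeometricallyIrreducible.irreducibleSpace_of_subsingleton C.str
instance : IrreducibleSpace (C.CL L) :=
  GeometricallyIrreducible.irreducibleSpace_of_subsingleton (C.prL L)
instance : IsIntegral C.X := isIntegral_of_smooth C.str
instance : IsIntegral (C.CL L) := isIntegral_of_smooth (C.prL L)
instance : IsLocallyPID C.X := isLocallyPID_of_smooth C.str
instance : IsLocallyPID (C.CL L) := isLocallyPID_of_smooth (C.prL L)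
instance : NoetherianSpace C.X := noetherianSpace_of_proper C.str
instance : NoetherianSpace (C.CL L) := noetherianSpace_of_proper (C.prL L)

/-- The point `∞` of `C_L` as a section. -/
def infL : Spec (CommRingCat.of L) ⟶ C.CL L :=
  Limits.pullback.lift (specMap L ≫ C.inf) (𝟙 _) (C.inf_condition L)

lemma infL_prL : C.infL L ≫ C.prL L = 𝟙 _ := Limits.pullback.lift_snd _ _ _
lemma infL_pr : C.infL L ≫ C.pr L = specMap L ≫ C.inf := Limits.pullback.lift_fst _ _ _

lemma infLPt_eq : C.infLPt L = ratPt (C.infL L) := rfl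

lemma pr_infLPt : C.pr L (C.infLPt L) = C.infPt := by
  refine (Scheme.Hom.comp_apply (C.infL L) (C.pr L) (IsLocalRing.closedPoint L)).symm.trans ?_
  rw [infL_pr]
  refine (Scheme.Hom.comp_apply _ _ _).trans (congrArg C.inf ?_)
  exact Subsingleton.elim (α := PrimeSpectrum Fq) _ _

lemma isPullback_infL : IsPullback (C.infL L) (specMap L) (C.pr L) C.inf := by
  refine IsPullback.of_right ?_ (C.infL_pr L) (IsPullback.of_hasPullback C.str (specMap L)).flip
  have h : IsPullback (𝟙 _) (specMap (Fq := Fq) L) (specMap L) (𝟙 _) := IsPullback.of_id_fst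
  rw [← C.infL_prL L, ← C.inf_str] at h
  exact h

lemma mem_U_iff (x : C.X) : x ∈ C.U ↔ x ≠ C.infPt := Iff.rfl

/-- As `∞` is rational, its base change along `C_L → C` is `Spec L`; thus exactly one point of `C_L`
lies over it. -/
lemma mem_UL_iff (x : C.CL L) : x ∈ C.UL L ↔ x ≠ C.infLPt L := by
  refine (C.mem_U_iff _).trans (not_congr ⟨fun h => ?_, fun h => h ▸ C.pr_infLPt L⟩)
  have hx : x ∈ Set.range (C.infL L) := by
    have e : C.infL L = (C.isPullback_infL L).isoPullback.hom ≫ Limits.pullback.fst _ _ :=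
      ((C.isPullback_infL L).isoPullback_hom_fst).symm
    rw [e, Scheme.Hom.comp_base, TopCat.coe_comp, Set.range_comp, Set.range_eq_univ.2
      (C.isPullback_infL L).isoPullback.hom.surjective, Set.image_univ, Scheme.Pullback.range_fst]
    exact ⟨_, h.symm⟩
  obtain ⟨y, rfl⟩ := hx
  rw [infLPt_eq, ratPt]
  congr 1
  exact Subsingleton.elim (α := PrimeSpectrum L) _ _

lemma infLPt_notMem : C.infLPt L ∉ C.UL L := fun h => (C.mem_UL_iff L _).1 h rfl

/-- There is a nonconstant coordinate at `∞`. -/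
lemma infPt_ne_genericPoint : C.infPt ≠ genericPoint C.X := by
  intro h
  obtain ⟨V, hV, hx, z, hz, hmax⟩ := exists_coordinate C.str C.inf C.inf_str
  have : Nonempty V := ⟨⟨_, hx⟩⟩
  have htr := (transcendental_of_etale C.str hV z hz).1
  have h1 := (isUnit_germ_iff hx z).not.1 (by
    rw [Scheme.mem_basicOpen _ _ _ hx]
    intro hu
    have := (IsLocalRing.maximalIdeal.isMaximal (C.X.presheaf.stalk (ratPt C.inf))).ne_top
    rw [hmax] at this
    exact this (Ideal.span_singleton_eq_top.2 hu))
  rw [show ratPt C.inf = genericPoint C.X from h, locRing_genericPoint] at h1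
  push Not at h1
  exact h1 (fun h0 => htr (by rw [h0]; exact @isAlgebraic_zero _ _ _ _ (_) _)) trivial

instance : Nonempty C.U := ⟨⟨genericPoint C.X, fun h => C.infPt_ne_genericPoint h.symm⟩⟩

lemma isAffineOpen_U : IsAffineOpen C.U :=
  isAffineOpen_compl_ratPt C.str C.inf C.inf_str C.U C.mem_U_iff

lemma isAffineOpen_UL : IsAffineOpen (C.UL L) := C.isAffineOpen_U.preimage (C.pr L)

instance : Surjective (specMap (Fq := Fq) L) :=
  ⟨fun y => ⟨IsLocalRing.closedPoint L, Subsingleton.elim (α := PrimeSpectrum Fq) _ _⟩⟩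

instance : Surjective (C.pr L) := by
  unfold pr
  exact MorphismProperty.of_isPullback (P := @Surjective)
    (IsPullback.of_hasPullback C.str (specMap L)).flip inferInstance

instance nonempty_preimage_pr (V : C.X.Opens) [h : Nonempty V] : Nonempty (C.pr L ⁻¹ᵁ V : (C.CL L).Opens) := by
  obtain ⟨x, hx⟩ := h
  obtain ⟨y, rfl⟩ := (C.pr L).surjective x
  exact ⟨⟨y, hx⟩⟩

instance : Nonempty (C.UL L) := C.nonempty_preimage_pr L C.U

lemma infLPt_ne_genericPoint : C.infLPt L ≠ genericPoint (C.CL L) := fun h =>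
  C.infLPt_notMem L (h ▸ genericPoint_mem (C.UL L))

open TensorProduct in
-- Base change of functions on an affine open set. The explicit formula on pure tensors serves to
-- recognize `ALtoGamma` and to compute values at `∞`.
lemma exists_tensor (V : C.X.Opens) (hV : IsAffineOpen V) :
    letI := (structMap C.str V).toAlgebra
    ∃ e : (Γ(C.X, V) ⊗[Fq] L) ≃+* Γ(C.CL L, C.pr L ⁻¹ᵁ V), ∀ a l,
      e (a ⊗ₜ l) = (C.pr L).app V a * structMap (C.prL L) (C.pr L ⁻¹ᵁ V) l := by
  letI := (structMap C.str V).toAlgebra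
  have H : IsPullback (C.pr L) (C.prL L) C.str (specMap L) := IsPullback.of_hasPullback C.str (specMap L)
  have h1 := (isIso_pushoutSection_iff H (US := ⊤) (UT := ⊤) (UX := V) (UY := C.pr L ⁻¹ᵁ V)
    (show ⊤ ≤ specMap L ⁻¹ᵁ ⊤ from le_rfl) (show V ≤ C.str ⁻¹ᵁ ⊤ from le_top)
    (show _ = C.pr L ⁻¹ᵁ V ⊓ ⊤ from (inf_top_eq _).symm)).1
    (isIso_pushoutSection_of_isAffineOpen H _ _ _ (isAffineOpen_top _) (isAffineOpen_top _) hV)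
  have h2 : IsPushout (CommRingCat.ofHom (structMap C.str V)) (CommRingCat.ofHom (algebraMap Fq L))
      ((C.pr L).app V) (CommRingCat.ofHom (structMap (C.prL L) (C.pr L ⁻¹ᵁ V))) := by
    refine IsPushout.of_iso h1 (Scheme.ΓSpecIso (CommRingCat.of Fq)) (Iso.refl _)
      (Scheme.ΓSpecIso (CommRingCat.of L)) (Iso.refl _) ?_ ?_ ?_ ?_
    · rw [← Iso.inv_comp_eq]
      rfl
    · have := Scheme.ΓSpecIso_naturality (CommRingCat.ofHom (algebraMap Fq L))
      refine Eq.trans ?_ this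
      congr 1
    · simp [Scheme.Hom.appLE_eq_app]
    · rw [← Iso.inv_comp_eq]
      rfl
  have h3 := CommRingCat.isPushout_tensorProduct Fq Γ(C.X, V) L
  let e := h3.isoIsPushout _ _ h2
  refine ⟨e.commRingCatIsoToRingEquiv, fun a l => ?_⟩
  have e1 := congr($(h3.inl_isoIsPushout_hom _ _ h2) a)
  have e2 := congr($(h3.inr_isoIsPushout_hom _ _ h2) l)
  rw [← mul_one a, ← one_mul l, ← Algebra.TensorProduct.tmul_mul_tmul, map_mul, mul_one, one_mul]
  exact congrArg₂ (· * ·) e1 e2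

/-- `A_L` is the ring of functions on `C_L ∖ {∞}`. -/
lemma ALtoGamma_bijective : Function.Bijective (C.ALtoGamma L) := by
  obtain ⟨e, he⟩ := C.exists_tensor L C.U C.isAffineOpen_U
  have : C.ALtoGamma L = e.toRingHom := by
    apply Algebra.TensorProduct.ringHom_ext
    · ext a
      exact (he a 1).symm
    · ext a
      exact (he 1 a).symm
  rw [this]
  exact e.bijective

variable {C} in
/-- There is a local equation of `∞`. -/
lemma nonempty_uniformizer : Nonempty C.Uniformizer := by
  obtain ⟨V, hV, hx, z, hz, hmax⟩ := exists_coordinate C.str C.inf C.inf_str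
  have : Nonempty V := ⟨⟨_, hx⟩⟩
  have htr := (transcendental_of_etale C.str hV z hz).1
  have hz0 : genericPoint C.X ∈ C.X.basicOpen z := by
    rw [isUnit_germ_iff (genericPoint_mem V), locRing_genericPoint]
    refine ⟨fun h0 => htr ?_, trivial⟩
    rw [h0]
    exact @isAlgebraic_zero _ _ _ _ (_) _
  -- A coordinate at `∞` may vanish elsewhere, but only at finitely many further points, and these
  -- are removed from the chart.
  let Z : Set C.X := (C.X.basicOpen z : Set C.X)ᶜ \ {C.infPt}
  have hfin := finite_of_genericPoint_notMem (C.X.basicOpen z).isOpen.isClosed_compl (not_not.2 hz0)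
  have hZ : IsClosed Z := by
    rw [← Set.biUnion_of_singleton Z]
    refine (hfin.subset Set.sdiff_subset).isClosed_biUnion fun x hx => ?_
    exact isClosed_singleton_of_ne_genericPoint fun h => hx.1 (h ▸ hz0)
  let W : C.X.Opens := V ⊓ ⟨Zᶜ, hZ.isOpen_compl⟩
  have hW : C.infPt ∈ W := ⟨hx, fun h => h.2 rfl⟩
  have hzinf : C.infPt ∉ C.X.basicOpen z := by
    refine fun hu => ?_
    replace hu := (Scheme.mem_basicOpen C.X z (ratPt C.inf) hx).1 hu
    have := (IsLocalRing.maximalIdeal.isMaximal (C.X.presheaf.stalk (ratPt C.inf))).ne_top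
    rw [hmax] at this
    exact this (Ideal.span_singleton_eq_top.2 hu)
  refine ⟨⟨W, hW, C.X.presheaf.map (homOfLE (inf_le_left : W ≤ V)).op z, ?_, ?_⟩⟩
  · rw [Scheme.basicOpen_res]
    ext x
    constructor
    · rintro ⟨h1, h2⟩
      exact ⟨h1, fun h => hzinf (h ▸ h2)⟩
    · rintro ⟨h1, h2⟩
      refine ⟨h1, ?_⟩
      by_contra h
      exact h1.2 ⟨h, h2⟩
  · rw [TopCat.Presheaf.germ_res_apply]
    exact hmax.symm

end PointedCurve

end

/-! ### Pullback of rational functions, and the local equation of `∞` on `C_L`. -/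

noncomputable section

section GenericMap

variable {X : Scheme.{u}} [IsIntegral X]

lemma exists_fraction_of_mem_locRing {V : X.Opens} [Nonempty V] (hV : IsAffineOpen V) {x : X}
    (hx : x ∈ V) {a : X.functionField} (ha : a ∈ locRing X x) :
    ∃ g h : Γ(X, V), x ∈ X.basicOpen h ∧
      a * X.germToFunctionField V h = X.germToFunctionField V g := by
  letI : Algebra Γ(X, V) (X.presheaf.stalk x) := (X.presheaf.germ V x hx).hom.toAlgebra
  obtain ⟨y, rfl⟩ : ∃ y : X.presheaf.stalk x, algebraMap _ X.functionField y = a := ha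
  have hloc := hV.isLocalization_stalk ⟨x, hx⟩
  obtain ⟨⟨g, h⟩, e⟩ := IsLocalization.surj (hV.primeIdealOf ⟨x, hx⟩).asIdeal.primeCompl y
  refine ⟨g, h, ?_, ?_⟩
  · rw [Scheme.mem_basicOpen _ _ _ hx]
    exact IsLocalization.map_units (X.presheaf.stalk x) h
  · rw [← X.algebraMap_germ_eq_germToFunctionField hx, ← X.algebraMap_germ_eq_germToFunctionField hx,
      ← map_mul]
    exact congrArg _ e

section

variable {Y : Scheme.{u}} [IsIntegral Y] (f : X ⟶ Y) [Surjective f]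

instance nonempty_preimage (V : Y.Opens) [h : Nonempty V] : Nonempty (f ⁻¹ᵁ V : X.Opens) := by
  obtain ⟨x, hx⟩ := h
  obtain ⟨y, rfl⟩ := f.surjective x
  exact ⟨⟨y, hx⟩⟩

lemma specializes_map_genericPoint : f (genericPoint X) ⤳ genericPoint Y := by
  obtain ⟨y, hy⟩ := f.surjective (genericPoint Y)
  rw [← hy]
  exact (specializes_genericPoint y).map f.continuous

/-- The map of function fields given by a surjective morphism. -/
def genMap : Y.functionField →+* X.functionField :=
  (f.stalkMap (genericPoint X)).hom.comp
    (Y.presheaf.stalkSpecializes (specializes_map_genericPoint f)).hom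

lemma genMap_germ (V : Y.Opens) [Nonempty V] (a : Γ(Y, V)) :
    genMap f (Y.germToFunctionField V a) = X.germToFunctionField (f ⁻¹ᵁ V) (f.app V a) := by
  change (f.stalkMap (genericPoint X)) (Y.presheaf.stalkSpecializes _
    (Y.presheaf.germ V (genericPoint Y) (genericPoint_mem V) a)) = _
  rw [TopCat.Presheaf.germ_stalkSpecializes_apply]
  exact Scheme.Hom.germ_stalkMap_apply f V _ _ a

lemma genMap_mem_locRing {x : X} {a : Y.functionField} (ha : a ∈ locRing Y (f x)) :
    genMap f a ∈ locRing X x := by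
  obtain ⟨V, hV, _, b, rfl⟩ := exists_germ_of_mem_locRing ha
  rw [genMap_germ]
  exact germ_mem_locRing (f ⁻¹ᵁ V) hV _

end

lemma exists_germ (a : X.functionField) : ∃ (V : X.Opens) (_ : Nonempty V) (b : Γ(X, V)),
    X.germToFunctionField V b = a := by
  obtain ⟨V, _, h, b, e⟩ := exists_germ_of_mem_locRing (x := genericPoint X) (a := a)
    (by rw [locRing_genericPoint]; trivial)
  exact ⟨V, h, b, e⟩

lemma genMap_id : genMap (𝟙 X) = RingHom.id X.functionField := by
  ext a
  obtain ⟨V, _, b, rfl⟩ := exists_germ a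
  rw [genMap_germ]
  rfl

lemma genMap_comp (f g : X ⟶ X) [Surjective f] [Surjective g] :
    genMap (f ≫ g) = (genMap f).comp (genMap g) := by
  ext a
  obtain ⟨V, _, b, rfl⟩ := exists_germ a
  rw [RingHom.comp_apply, genMap_germ, genMap_germ, genMap_germ, Scheme.Hom.comp_app]
  rfl

omit [IsIntegral X] in
lemma germ_sub_evalAt_mem {k : Type u} [Field k] (f : X ⟶ Spec (CommRingCat.of k))
    (s : Spec (CommRingCat.of k) ⟶ X) (hs : s ≫ f = 𝟙 _) {V : X.Opens} (hV : ratPt s ∈ V)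
    (a : Γ(X, V)) : X.presheaf.germ V (ratPt s) hV (a - structMap f V (evalAt s V hV a)) ∈
      IsLocalRing.maximalIdeal (X.presheaf.stalk (ratPt s)) :=
  (germ_mem_maximalIdeal_iff s hV _).2 (by rw [map_sub, evalAt_structMap _ _ hs, sub_self])

end GenericMap

namespace PointedCurve

variable {Fq : Type u} [Field Fq] {C : PointedCurve Fq} (L : Type u) [Field L] [Algebra Fq L]

instance (z : C.Uniformizer) : Nonempty z.W := ⟨⟨C.infPt, z.mem⟩⟩

/-- A local equation of `∞` as a function on `C_L`. -/
def Uniformizer.zK (z : C.Uniformizer) : (C.CL L).functionField :=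
  (C.CL L).germToFunctionField (C.pr L ⁻¹ᵁ z.W) ((C.pr L).app z.W z.z)

variable {L}

lemma Uniformizer.germ_onCL (z : C.Uniformizer) (V : (C.CL L).Opens) [Nonempty V]
    (h : V ≤ C.pr L ⁻¹ᵁ z.W) : (C.CL L).germToFunctionField V (z.onCL V h) = z.zK L :=
  germ_map h _

lemma Uniformizer.infLPt_mem (z : C.Uniformizer) : C.infLPt L ∈ C.pr L ⁻¹ᵁ z.W := by
  change C.pr L _ ∈ z.W
  rw [C.pr_infLPt]; exact z.mem

lemma Uniformizer.zK_mem (z : C.Uniformizer) : z.zK L ∈ locRing (C.CL L) (C.infLPt L) :=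
  germ_mem_locRing _ z.infLPt_mem _

lemma Uniformizer.basicOpen_onCL (z : C.Uniformizer) :
    (C.CL L).basicOpen ((C.pr L).app z.W z.z) = C.pr L ⁻¹ᵁ z.W ⊓ C.UL L := by
  rw [← Scheme.preimage_basicOpen, z.basicOpen_eq]; rfl

lemma Uniformizer.val_zK_lt_one (z : C.Uniformizer) :
    (locVal (C.infLPt L)).valuation (z.zK L) < 1 := by
  by_contra h
  have := (mem_basicOpen_iff_val (z.infLPt_mem (L := L)) ((C.pr L).app z.W z.z)).2 h
  rw [z.basicOpen_onCL] at this
  exact C.infLPt_notMem L this.2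

lemma Uniformizer.zK_ne_zero (z : C.Uniformizer) : z.zK L ≠ 0 := by
  have h : genericPoint (C.CL L) ∈ (C.CL L).basicOpen ((C.pr L).app z.W z.z) := by
    rw [z.basicOpen_onCL]
    exact ⟨genericPoint_mem _, genericPoint_mem _⟩
  exact ((isUnit_germ_iff (genericPoint_mem _) _).1 h).1

lemma kToK_val {a : L} (h : (locVal (C.infLPt L)).valuation (kToK (C.prL L) a) < 1) : a = 0 := by
  by_contra ha
  have h1 : (locVal (C.infLPt L)).valuation (kToK (C.prL L) a⁻¹) ≤ 1 :=
    locVal_val_le_one_iff.2 (kToK_mem_locRing _ _ _)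
  rw [map_inv₀, map_inv₀] at h1
  have h0 : (locVal (C.infLPt L)).valuation (kToK (C.prL L) a) ≠ 0 := by
    rw [Valuation.ne_zero_iff]
    exact (map_ne_zero _).2 ha
  exact absurd h1 (not_le.2 ((one_lt_inv₀ (zero_lt_iff.2 h0)).2 h))

lemma exists_residue {a : (C.CL L).functionField} (ha : a ∈ locRing (C.CL L) (C.infLPt L)) :
    ∃ c : L, (locVal (C.infLPt L)).valuation (a - kToK (C.prL L) c) < 1 := by
  obtain ⟨V, hV, _, b, rfl⟩ := exists_germ_of_mem_locRing ha
  refine ⟨evalAt (C.infL L) V hV b, ?_⟩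
  rw [← germ_structMap (C.prL L) V, ← map_sub]
  by_contra h
  have h1 := (mem_basicOpen_iff_val hV _).2 h
  rw [Scheme.mem_basicOpen _ _ _ hV] at h1
  exact germ_sub_evalAt_mem (C.prL L) (C.infL L) (C.infL_prL L) hV b h1

/-- First half of the proof that a local equation of `∞` on `C` still generates the maximal ideal at
`∞` on `C_L`. By additivity it suffices to treat `b ⊗ l`, and on `C` the difference of `b` and its
value at `∞` is divisible by `z`. -/
lemma Uniformizer.exists_sub_eq_zK_mul (z : C.Uniformizer) {V : C.X.Opens} (hV : IsAffineOpen V)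
    (hx : C.infPt ∈ V) [Nonempty V] (a : Γ(C.CL L, C.pr L ⁻¹ᵁ V)) :
    ∃ c : L, ∃ b ∈ locRing (C.CL L) (C.infLPt L),
      (C.CL L).germToFunctionField _ a - kToK (C.prL L) c = z.zK L * b := by
  obtain ⟨e, he⟩ := C.exists_tensor L V hV
  letI := (structMap C.str V).toAlgebra
  obtain ⟨t, rfl⟩ := e.surjective a
  induction t using TensorProduct.induction_on with
  | zero => exact ⟨0, 0, zero_mem _, by rw [map_zero, map_zero, map_zero, mul_zero, sub_zero]⟩
  | add t₁ t₂ h₁ h₂ =>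
    obtain ⟨c₁, b₁, hb₁, e₁⟩ := h₁
    obtain ⟨c₂, b₂, hb₂, e₂⟩ := h₂
    refine ⟨c₁ + c₂, b₁ + b₂, add_mem hb₁ hb₂, ?_⟩
    rw [map_add, map_add, map_add, mul_add, ← e₁, ← e₂]; ring
  | tmul b l =>
    let c := evalAt C.inf V hx b
    have h3 : C.X.presheaf.germ V C.infPt hx (b - structMap C.str V c) ∈
      IsLocalRing.maximalIdeal (C.X.presheaf.stalk C.infPt) :=
      germ_sub_evalAt_mem C.str C.inf C.inf_str hx b
    rw [← z.span_germ, Ideal.mem_span_singleton'] at h3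
    obtain ⟨y, hy⟩ := h3
    let w := algebraMap _ C.X.functionField y
    have hw : w ∈ locRing C.X (C.pr L (C.infLPt L)) := by
      rw [C.pr_infLPt]; exact ⟨y, rfl⟩
    have h4 : w * C.X.germToFunctionField z.W z.z =
        C.X.germToFunctionField V (b - structMap C.str V c) := by
      rw [← C.X.algebraMap_germ_eq_germToFunctionField z.mem,
        ← C.X.algebraMap_germ_eq_germToFunctionField hx, ← hy, map_mul]
    have h5 := congrArg (genMap (C.pr L)) h4
    have h6 : (C.pr L).app V (structMap C.str V c) =
        structMap (C.prL L) (C.pr L ⁻¹ᵁ V) (algebraMap Fq L c) := by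
      have e1 := he (structMap C.str V c) 1
      have e2 := he 1 (algebraMap Fq L c)
      rw [map_one, mul_one] at e1
      rw [map_one, one_mul] at e2
      rw [← e1, ← e2]
      congr 1
      have := TensorProduct.smul_tmul (R := Fq) c (1 : Γ(C.X, V)) (1 : L)
      rwa [Algebra.smul_def, Algebra.smul_def, mul_one, mul_one] at this
    rw [map_mul, genMap_germ, genMap_germ, map_sub, map_sub, h6, germ_structMap] at h5
    refine ⟨algebraMap Fq L c * l, genMap (C.pr L) w * kToK (C.prL L) l,
      mul_mem (genMap_mem_locRing _ hw) (kToK_mem_locRing _ _ _), ?_⟩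
    rw [he, map_mul, map_mul, germ_structMap, ← sub_mul, ← h5]
    change _ * z.zK L * _ = _
    ring

/-- Write `a = g / h` with `g`, `h` on the preimage of an affine neighbourhood of `∞` in `C` and `h`
a unit at `∞`. Since `a` vanishes at `∞`, so does the constant term of `g`, and `g` is divisible by
`z`. -/
lemma Uniformizer.exists_eq_zK_mul (z : C.Uniformizer) {a : (C.CL L).functionField}
    (ha : (locVal (C.infLPt L)).valuation a < 1) :
    ∃ b ∈ locRing (C.CL L) (C.infLPt L), a = z.zK L * b := by
  have ha' := locVal_val_le_one_iff.1 ha.le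
  obtain ⟨V, hV, hx, -⟩ := (TopologicalSpace.Opens.isBasis_iff_nbhd.1 C.X.isBasis_affineOpens)
    (show C.infPt ∈ (⊤ : C.X.Opens) from trivial)
  have : Nonempty V := ⟨⟨C.infPt, hx⟩⟩
  have hx' : C.infLPt L ∈ C.pr L ⁻¹ᵁ V := by
    change C.pr L _ ∈ V
    rw [C.pr_infLPt]; exact hx
  obtain ⟨g, h, h1, h2⟩ := exists_fraction_of_mem_locRing (hV.preimage (C.pr L)) hx' ha'
  obtain ⟨c, b, hb, e⟩ := z.exists_sub_eq_zK_mul hV hx g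
  obtain ⟨h0, hinv⟩ := (isUnit_germ_iff hx' h).1 h1
  have hc : c = 0 := by
    apply kToK_val (C := C)
    have e' : kToK (C.prL L) c = a * (C.CL L).germToFunctionField _ h + - (z.zK L * b) := by
      rw [h2, ← e]; ring
    rw [e']
    refine Valuation.map_add_lt _ ?_ ?_
    · rw [map_mul]
      exact mul_lt_one_of_lt_of_le ha (locVal_val_le_one_iff.2 (germ_mem_locRing _ hx' h))
    · rw [Valuation.map_neg, map_mul]
      exact mul_lt_one_of_lt_of_le z.val_zK_lt_one (locVal_val_le_one_iff.2 hb)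
  rw [hc, map_zero, sub_zero, ← h2] at e
  refine ⟨b * ((C.CL L).germToFunctionField _ h)⁻¹, mul_mem hb hinv, ?_⟩
  rw [← mul_assoc, ← e, mul_assoc, mul_inv_cancel₀ h0, mul_one]

end PointedCurve

end

/-! ### `A_L` in the function field, and the action of `σ`. -/

noncomputable section

namespace PointedCurve

variable {Fq : Type u} [Field Fq] {C : PointedCurve Fq} {L : Type u} [Field L] [Algebra Fq L]

variable (C L) in
/-- `A_L` as a subring of the function field. -/
def ALtoK : C.AL L →+* (C.CL L).functionField :=
  ((C.CL L).germToFunctionField (C.UL L)).hom.comp (C.ALtoGamma L)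

lemma ALtoK_injective : Function.Injective (C.ALtoK L) :=
  (Scheme.germToFunctionField_injective _ _).comp (C.ALtoGamma_bijective L).1

lemma ALtoK_tmul_one (l : L) : C.ALtoK L (TensorProduct.tmul Fq 1 l) = kToK (C.prL L) l := by
  rw [← germ_structMap (C.prL L) (C.UL L)]
  change (C.CL L).germToFunctionField (C.UL L) (C.ALtoGamma L _) = _
  rw [ALtoGamma_tmul, map_one, one_mul]
  rfl

lemma exists_ALtoK_div (a : (C.CL L).functionField) : ∃ g h : C.AL L, h ≠ 0 ∧
    a * C.ALtoK L h = C.ALtoK L g := by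
  have := functionField_isFractionRing_of_isAffineOpen (C.CL L) (C.UL L) (C.isAffineOpen_UL L)
  obtain ⟨⟨g, h⟩, e⟩ := IsLocalization.surj (nonZeroDivisors Γ(C.CL L, C.UL L)) a
  obtain ⟨g, rfl⟩ := (C.ALtoGamma_bijective L).2 g
  obtain ⟨h', hh'⟩ := (C.ALtoGamma_bijective L).2 h
  refine ⟨g, h', ?_, ?_⟩
  · rintro rfl
    rw [map_zero] at hh'
    exact nonZeroDivisors.ne_zero h.2 hh'.symm
  · rw [← hh'] at e
    exact e

lemma exists_ALtoK_div_of_mem {x : C.CL L} (hx : x ∈ C.UL L) {a : (C.CL L).functionField}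
    (ha : a ∈ locRing (C.CL L) x) : ∃ g h : C.AL L, h ≠ 0 ∧ (C.ALtoK L h)⁻¹ ∈ locRing (C.CL L) x ∧
    a * C.ALtoK L h = C.ALtoK L g := by
  obtain ⟨g, h, h1, h2⟩ := exists_fraction_of_mem_locRing (C.isAffineOpen_UL L) hx ha
  obtain ⟨g, rfl⟩ := (C.ALtoGamma_bijective L).2 g
  obtain ⟨h, rfl⟩ := (C.ALtoGamma_bijective L).2 h
  obtain ⟨h3, h4⟩ := (isUnit_germ_iff hx _).1 h1
  exact ⟨g, h, fun e => h3 (by rw [e, map_zero, map_zero]), h4, h2⟩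

lemma ALtoK_mem_locRing {x : C.CL L} (hx : x ∈ C.UL L) (a : C.AL L) :
    C.ALtoK L a ∈ locRing (C.CL L) x := germ_mem_locRing _ hx _

/-- A function without poles that vanishes at `∞` is zero. -/
lemma ALtoK_eq_zero {a : C.AL L}
    (h : (locVal (C.infLPt L)).valuation (C.ALtoK L a) < 1) : a = 0 := by
  obtain ⟨b, hb⟩ := exists_section_of_forall_mem_locRing (⊤ : (C.CL L).Opens) (a := C.ALtoK L a)
    (fun x _ => by
      by_cases hx : x ∈ C.UL L
      · exact ALtoK_mem_locRing hx a
      · rw [not_not.1 (fun h => hx ((C.mem_UL_iff L x).2 h))]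
        exact locVal_val_le_one_iff.1 h.le)
  by_contra ha
  have hb0 : b ≠ 0 := by
    rintro rfl
    rw [map_zero] at hb
    exact ha (ALtoK_injective (by rw [← hb, map_zero]))
  -- Global functions on the proper integral scheme `C_L` form a field, so a nonzero one has a
  -- regular inverse and cannot vanish at `∞`.
  have hf := isField_of_universallyClosed L (C.prL L)
  obtain ⟨c, hc⟩ := hf.mul_inv_cancel hb0
  have h1 := congrArg ((C.CL L).germToFunctionField ⊤) hc
  rw [map_mul, hb, map_one] at h1
  have h2 : (locVal (C.infLPt L)).valuation ((C.CL L).germToFunctionField ⊤ c) ≤ 1 :=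
    locVal_val_le_one_iff.2 (germ_mem_locRing ⊤ trivial c)
  have h3 := mul_lt_one_of_lt_of_le h h2
  rw [← map_mul, h1, map_one] at h3
  exact lt_irrefl _ h3

variable (C L) [Fintype Fq]

lemma isPullback_sigma : IsPullback (C.sigma L) (C.prL L) (C.prL L)
    (Spec.map (CommRingCat.ofHom (FiniteField.frobeniusAlgHom Fq L).toRingHom)) := by
  refine IsPullback.of_right ?_ (C.sigma_prL L) (IsPullback.of_hasPullback C.str (specMap L))
  have h : Spec.map (CommRingCat.ofHom (FiniteField.frobeniusAlgHom Fq L).toRingHom) ≫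
      specMap (Fq := Fq) L = specMap L := by
    rw [specMap, ← Spec.map_comp, ← CommRingCat.ofHom_comp]
    congr 2
    exact (FiniteField.frobeniusAlgHom Fq L).comp_algebraMap
  rw [h]
  change IsPullback (C.sigma L ≫ C.pr L) _ _ _
  rw [sigma_pr]
  exact IsPullback.of_hasPullback C.str (specMap L)

instance : Surjective (C.sigma L) :=
  MorphismProperty.of_isPullback (P := @Surjective) (C.isPullback_sigma L).flip
    ⟨fun y => ⟨IsLocalRing.closedPoint L, Subsingleton.elim (α := PrimeSpectrum L) _ _⟩⟩

instance surjective_sigmaIter (l : ℕ) : Surjective (C.sigmaIter L l) := by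
  induction l with
  | zero => exact inferInstanceAs (Surjective (𝟙 (C.CL L)))
  | succ l ih => exact inferInstanceAs (Surjective (C.sigmaIter L l ≫ C.sigma L))

lemma sigma_mem_UL_iff (x : C.CL L) : C.sigma L x ∈ C.UL L ↔ x ∈ C.UL L := by
  conv_rhs => rw [← C.sigma_UL L]
  rfl

lemma sigma_infLPt : C.sigma L (C.infLPt L) = C.infLPt L := by
  by_contra h
  exact C.infLPt_notMem L ((C.sigma_mem_UL_iff L _).1 ((C.mem_UL_iff L _).2 h))

/-- The endomorphism `σ` of the function field of `C_L`. -/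
def sigmaK : (C.CL L).functionField →+* (C.CL L).functionField := genMap (C.sigma L)

lemma genMap_sigmaIter (l : ℕ) (a : (C.CL L).functionField) :
    genMap (C.sigmaIter L l) a = (C.sigmaK L)^[l] a := by
  induction l generalizing a with
  | zero => exact congr($(genMap_id (X := C.CL L)) a)
  | succ l ih =>
    rw [Function.iterate_succ_apply, ← ih]
    exact congr($(genMap_comp (C.sigmaIter L l) (C.sigma L)) a)

lemma sigmaIter_infLPt (l : ℕ) : C.sigmaIter L l (C.infLPt L) = C.infLPt L := by
  induction l with
  | zero => rfl
  | succ l ih =>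
    refine (Scheme.Hom.comp_apply (C.sigmaIter L l) (C.sigma L) _).trans ?_
    rw [ih, sigma_infLPt]

variable {C L}

lemma germ_app_congr {X Y : Scheme.{u}} [IsIntegral X] {f g : X ⟶ Y} (h : f = g) (V : Y.Opens)
    [Nonempty (f ⁻¹ᵁ V)] [Nonempty (g ⁻¹ᵁ V)] (r : Γ(Y, V)) :
    X.germToFunctionField (f ⁻¹ᵁ V) (f.app V r) = X.germToFunctionField (g ⁻¹ᵁ V) (g.app V r) := by
  subst h; rfl

/-- `z` is pulled back from `C`, on which `σ` is the identity. Hence scaling lattices by powers of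
`z` commutes with Frobenius. -/
lemma sigmaK_zK (z : C.Uniformizer) : C.sigmaK L (z.zK L) = z.zK L := by
  rw [Uniformizer.zK, sigmaK, genMap_germ]
  have : Nonempty (((C.sigma L ≫ C.pr L) ⁻¹ᵁ z.W : (C.CL L).Opens)) := by
    rw [C.sigma_pr]; infer_instance
  refine Eq.trans ?_ (germ_app_congr (C.sigma_pr L) z.W z.z)
  rw [Scheme.Hom.comp_app]
  rfl

lemma sigmaK_germ_UL (a : C.AL L) :
    C.sigmaK L ((C.CL L).germToFunctionField (C.UL L) (C.ALtoGamma L a)) =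
      (C.CL L).germToFunctionField (C.UL L) (C.ALtoGamma L (C.sigmaA L a)) := by
  rw [sigmaA_compat, germ_map, sigmaK, genMap_germ]

lemma sigmaK_ALtoK (a : C.AL L) : C.sigmaK L (C.ALtoK L a) = C.ALtoK L (C.sigmaA L a) :=
  sigmaK_germ_UL a

lemma sigmaK_kToK (c : L) :
    C.sigmaK L (kToK (C.prL L) c) = kToK (C.prL L) (FiniteField.frobeniusAlgHom Fq L c) := by
  rw [← ALtoK_tmul_one, sigmaK_ALtoK, ← ALtoK_tmul_one]
  rfl

end PointedCurve

end

/-! ### Sheaves of modules as families of lattices. -/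

noncomputable section

open PointedCurve (map_map_apply map_map_comm app_map_apply modHom modHom_app)

section Sections

variable {X : Scheme.{u}} (F : X.Modules)

lemma section_eq_zero {V : X.Opens} (s : Γ(F, V))
    (h : ∀ x ∈ V, ∃ (V' : X.Opens) (_ : x ∈ V') (hV : V' ≤ V), F.presheaf.map (homOfLE hV).op s = 0) :
    s = 0 := by
  choose N hx hN hs using fun x : V => h x x.2
  refine TopCat.Sheaf.eq_of_locally_eq' (⟨F.presheaf, F.isSheaf⟩ : TopCat.Sheaf Ab X) N V
    (fun x => homOfLE (hN x)) (fun x hxV => Opens.mem_iSup.2 ⟨⟨x, hxV⟩, hx ⟨x, hxV⟩⟩) s 0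
    (fun x => (hs x).trans (map_zero (F.presheaf.map (homOfLE (hN x)).op).hom).symm)

lemma subsingleton_sections {V : X.Opens} (h : ¬ Nonempty V) : Subsingleton Γ(F, V) :=
  subsingleton_of_forall_eq 0 fun s => section_eq_zero F s fun x hx => (h ⟨⟨x, hx⟩⟩).elim

lemma exists_glue {V : X.Opens} {ι : Type u} (N : ι → X.Opens) (hN : ∀ i, N i ≤ V)
    (hc : V ≤ iSup N) (t : ∀ i, Γ(F, N i))
    (h : ∀ i j, F.presheaf.map (homOfLE (inf_le_left : N i ⊓ N j ≤ N i)).op (t i) =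
      F.presheaf.map (homOfLE (inf_le_right : N i ⊓ N j ≤ N j)).op (t j)) :
    ∃ s : Γ(F, V), ∀ i, F.presheaf.map (homOfLE (hN i)).op s = t i := by
  obtain ⟨s, hs, -⟩ := TopCat.Sheaf.existsUnique_gluing' (⟨F.presheaf, F.isSheaf⟩ : TopCat.Sheaf Ab X)
    N V (fun i => homOfLE (hN i)) hc t h
  exact ⟨s, hs⟩

end Sections

section GenEmb

variable {X : Scheme.{u}} [IsIntegral X]

lemma nonempty_inf (V V' : X.Opens) [Nonempty V] [Nonempty V'] : Nonempty (V ⊓ V' : X.Opens) :=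
  ⟨⟨genericPoint X, genericPoint_mem V, genericPoint_mem V'⟩⟩

/-- An embedding of a sheaf of modules into a vector space over the function field. -/
structure GenEmb (F : X.Modules) (W : Type*) [AddCommGroup W] [Module X.functionField W] where
  γ (V : X.Opens) : Γ(F, V) →+ W
  γ_map {V V' : X.Opens} [Nonempty V'] (h : V' ≤ V) (s : Γ(F, V)) :
    γ V' (F.presheaf.map (homOfLE h).op s) = γ V s
  γ_smul {V : X.Opens} [Nonempty V] (a : Γ(X, V)) (s : Γ(F, V)) :
    γ V (a • s) = X.germToFunctionField V a • γ V s
  inj (V : X.Opens) : Function.Injective (γ V)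

variable {F : X.Modules} {W : Type*} [AddCommGroup W] [Module X.functionField W]

namespace GenEmb

variable (γ : GenEmb F W)

/-- The germs at `x`. -/
def lat (x : X) : Submodule (locRing X x) W where
  carrier := {w | ∃ (V : X.Opens) (_ : x ∈ V) (s : Γ(F, V)), γ.γ V s = w}
  zero_mem' := ⟨⊤, trivial, 0, map_zero _⟩
  add_mem' := by
    rintro _ _ ⟨V, hV, s, rfl⟩ ⟨V', hV', s', rfl⟩
    have : Nonempty (V ⊓ V' : X.Opens) := ⟨⟨x, hV, hV'⟩⟩
    refine ⟨V ⊓ V', ⟨hV, hV'⟩, F.presheaf.map (homOfLE inf_le_left).op s +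
      F.presheaf.map (homOfLE inf_le_right).op s', ?_⟩
    rw [map_add, γ.γ_map, γ.γ_map]
  smul_mem' := by
    rintro ⟨a, ha⟩ _ ⟨V, hV, s, rfl⟩
    obtain ⟨V', hV', _, b, rfl⟩ := exists_germ_of_mem_locRing ha
    have : Nonempty (V ⊓ V' : X.Opens) := ⟨⟨x, hV, hV'⟩⟩
    refine ⟨V ⊓ V', ⟨hV, hV'⟩, X.presheaf.map (homOfLE (inf_le_right : V ⊓ V' ≤ V')).op b •
      F.presheaf.map (homOfLE inf_le_left).op s, ?_⟩
    rw [γ.γ_smul, γ.γ_map, germ_map]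
    rfl

lemma γ_mem_lat {V : X.Opens} {x : X} (hx : x ∈ V) (s : Γ(F, V)) : γ.γ V s ∈ γ.lat x :=
  ⟨V, hx, s, rfl⟩

lemma exists_of_mem_lat {x : X} {w : W} (hw : w ∈ γ.lat x) :
    ∃ (V : X.Opens) (_ : x ∈ V) (s : Γ(F, V)), γ.γ V s = w := hw

lemma smul_mem_lat {x : X} {a : X.functionField} (ha : a ∈ locRing X x) {w : W} (hw : w ∈ γ.lat x) :
    a • w ∈ γ.lat x := (γ.lat x).smul_mem ⟨a, ha⟩ hw

/-- The sheaf is recovered from its lattices: sections over `V` are the vectors lying in the lattice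
at every point of `V`. Local sections with the same vector agree on overlaps by injectivity, and
glue. -/
lemma exists_section (V : X.Opens) [Nonempty V] {w : W} (h : ∀ x ∈ V, w ∈ γ.lat x) :
    ∃ s : Γ(F, V), γ.γ V s = w := by
  choose N hN t ht using fun x : V => γ.exists_of_mem_lat (h x x.2)
  have hne' : ∀ x, Nonempty (N x ⊓ V : X.Opens) := fun x => ⟨⟨x, hN x, x.2⟩⟩
  obtain ⟨s, hs⟩ := exists_glue F (fun x : V => N x ⊓ V) (fun x => inf_le_right)
    (fun x hx => Opens.mem_iSup.2 ⟨⟨x, hx⟩, hN ⟨x, hx⟩, hx⟩)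
    (fun x => F.presheaf.map (homOfLE (inf_le_left : N x ⊓ V ≤ N x)).op (t x))
    (fun x y => by
      have : Nonempty ((N x ⊓ V) ⊓ (N y ⊓ V) : X.Opens) := nonempty_inf _ _
      apply γ.inj ((N x ⊓ V) ⊓ (N y ⊓ V))
      rw [γ.γ_map, γ.γ_map, γ.γ_map, γ.γ_map, ht, ht])
  refine ⟨s, ?_⟩
  obtain ⟨x⟩ : Nonempty V := ‹Nonempty V›
  have := hne' x
  rw [← γ.γ_map (inf_le_right : N x ⊓ V ≤ V), hs x, γ.γ_map]
  exact ht x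

/-- A basis of `W` that is a basis of the germs at all points of `V`. -/
def IsFrame {r : ℕ} (V : X.Opens) (b : Module.Basis (Fin r) X.functionField W) : Prop :=
  ∀ x ∈ V, ∀ w, w ∈ γ.lat x ↔ ∀ j, b.repr w j ∈ locRing X x

lemma isLocallyFreeOfRank {r : ℕ}
    (h : ∀ x : X, ∃ (V : X.Opens) (_ : x ∈ V) (b : Module.Basis (Fin r) X.functionField W), γ.IsFrame V b) :
    IsLocallyFreeOfRank F r := by
  intro x
  obtain ⟨V, hx, b, hb⟩ := h x
  have hV : Nonempty V := ⟨⟨x, hx⟩⟩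
  choose s hs using fun j => γ.exists_section V (w := b j) fun y hy => (hb y hy _).2 fun i => by
    rw [b.repr_self, Finsupp.single_apply]
    split_ifs
    · exact one_mem _
    · exact zero_mem _
  refine ⟨V, hx, s, fun V' h => ?_⟩
  by_cases hne : Nonempty V'
  · have hcomb : ∀ c : Fin r → Γ(X, V'), γ.γ V' (∑ j, c j • F.presheaf.map (homOfLE h).op (s j)) =
        ∑ j, X.germToFunctionField V' (c j) • b j := by
      intro c
      rw [map_sum]
      refine Finset.sum_congr rfl fun j _ => ?_
      rw [γ.γ_smul, γ.γ_map, hs]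
    constructor
    · rw [Fintype.linearIndependent_iff]
      intro c hc j
      have h1 := hcomb c
      rw [hc, map_zero] at h1
      have h2 := Fintype.linearIndependent_iff.1 b.linearIndependent _ h1.symm j
      exact (map_eq_zero_iff _ (Scheme.germToFunctionField_injective X V')).1 h2
    · refine eq_top_iff.2 fun t _ => ?_
      choose c hc using fun j => exists_section_of_forall_mem_locRing V' (a := b.repr (γ.γ V' t) j)
        fun y hy => (hb y (h hy) _).1 (γ.γ_mem_lat hy t) j
      have h1 : t = ∑ j, c j • F.presheaf.map (homOfLE h).op (s j) := by
        apply γ.inj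
        rw [hcomb, ← b.sum_repr (γ.γ V' t)]
        exact Finset.sum_congr rfl fun j _ => by rw [hc]
      rw [h1]
      exact Submodule.sum_mem _ fun j _ => Submodule.smul_mem _ _ (Submodule.subset_span ⟨j, rfl⟩)
  · have := subsingleton_sections F hne
    have h1 : Subsingleton Γ(X, V') := by
      have : V' = ⊥ := by
        ext y; exact ⟨fun hy => (hne ⟨⟨y, hy⟩⟩).elim, fun hy => hy.elim⟩
      subst this; infer_instance
    exact ⟨linearIndependent_of_subsingleton, Subsingleton.elim _ _⟩

end GenEmb

/-- The germ at the generic point, extended by zero. -/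
def germOrZero (V : X.Opens) : Γ(X, V) →+ X.functionField := by
  classical
  exact if h : Nonempty V then (X.germToFunctionField V).hom.toAddMonoidHom else 0

lemma germOrZero_eq (V : X.Opens) [h : Nonempty V] (a : Γ(X, V)) :
    germOrZero V a = X.germToFunctionField V a := by
  rw [germOrZero, dif_pos h]; rfl

omit [IsIntegral X] in
lemma IsLocallyFreeOfRank.exists_coord {r : ℕ} {V₀ : X.Opens} {s : Fin r → Γ(F, V₀)}
    (hs : ∀ (V' : X.Opens) (h : V' ≤ V₀),
      LinearIndependent Γ(X, V') (fun j => F.presheaf.map (homOfLE h).op (s j)) ∧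
      Submodule.span Γ(X, V') (Set.range fun j => F.presheaf.map (homOfLE h).op (s j)) = ⊤)
    {V' : X.Opens} (h : V' ≤ V₀) (t : Γ(F, V')) :
    ∃ c : Fin r → Γ(X, V'), t = ∑ j, c j • F.presheaf.map (homOfLE h).op (s j) := by
  have h1 : t ∈ Submodule.span Γ(X, V') (Set.range fun j => F.presheaf.map (homOfLE h).op (s j)) := by
    rw [(hs V' h).2]; trivial
  obtain ⟨c, hc⟩ := (Submodule.mem_span_range_iff_exists_fun _).1 h1
  exact ⟨c, hc.symm⟩

/-- A locally free sheaf of rank `r` on an integral scheme embeds into `K ^ r`. -/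
theorem exists_genEmb {r : ℕ} (hF : IsLocallyFreeOfRank F r) :
    Nonempty (GenEmb F (Fin r → X.functionField)) := by
  obtain ⟨V₀, hV₀, s, hs⟩ := hF (genericPoint X)
  have : Nonempty V₀ := ⟨⟨_, hV₀⟩⟩
  -- The embedding sends a section to its coordinates in one frame, chosen near the generic point,
  -- after restriction to the domain `V₀` of that frame.
  choose c hc using fun (V : X.Opens) (t : Γ(F, V)) =>
    IsLocallyFreeOfRank.exists_coord hs (inf_le_right : V ⊓ V₀ ≤ V₀)
      (F.presheaf.map (homOfLE inf_le_left).op t)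
  have huniq : ∀ (V V' : X.Opens) [Nonempty V'] (h : V' ≤ V) (h₀ : V' ≤ V₀) (t : Γ(F, V))
      (d : Fin r → Γ(X, V')), F.presheaf.map (homOfLE h).op t =
        ∑ j, d j • F.presheaf.map (homOfLE h₀).op (s j) →
      (fun j => germOrZero (V ⊓ V₀) (c V t j)) = fun j => X.germToFunctionField V' (d j) := by
    intro V V' hne h h₀ t d hd
    have hle : V' ≤ V ⊓ V₀ := le_inf h h₀
    have hne' : Nonempty (V ⊓ V₀ : X.Opens) := ⟨⟨genericPoint X, hle (genericPoint_mem V')⟩⟩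
    have h1 := congrArg (F.presheaf.map (homOfLE hle).op) (hc V t)
    rw [map_map_apply, hd, map_sum] at h1
    simp only [Scheme.Modules.map_smul, map_map_apply] at h1
    rw [← sub_eq_zero, ← Finset.sum_sub_distrib] at h1
    simp only [← sub_smul] at h1
    have h2 := Fintype.linearIndependent_iff.1 (hs V' h₀).1 _ h1
    funext j
    have h3 := sub_eq_zero.1 (h2 j)
    rw [h3, germ_map, germOrZero_eq]
  have hzero : ∀ (V : X.Opens), ¬ Nonempty V → ∀ t : Γ(F, V), t = 0 := fun V hV t =>
    (subsingleton_sections F hV).elim _ _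
  have hc0 : ∀ (V : X.Opens), ¬ Nonempty V → ∀ t : Γ(F, V),
      (fun j => germOrZero (V ⊓ V₀) (c V t j)) = 0 := by
    intro V hV t
    have : ¬ Nonempty (V ⊓ V₀ : X.Opens) := fun ⟨⟨x, hx⟩⟩ => hV ⟨⟨x, hx.1⟩⟩
    funext j
    rw [germOrZero, dif_neg this]; rfl
  refine ⟨⟨fun V => AddMonoidHom.mk' (fun t j => germOrZero (V ⊓ V₀) (c V t j)) fun t t' => ?_,
    fun {V V'} _ h t => ?_, fun {V} _ a t => ?_, fun V => ?_⟩⟩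
  · by_cases hV : Nonempty V
    · have := nonempty_inf V V₀
      refine (huniq V (V ⊓ V₀) inf_le_left inf_le_right (t + t') (c V t + c V t') ?_).trans ?_
      · rw [map_add, hc V t, hc V t', ← Finset.sum_add_distrib]
        exact Finset.sum_congr rfl fun j _ => (add_smul _ _ _).symm
      · funext j
        simp only [Pi.add_apply, map_add, germOrZero_eq]
    · rw [hc0 V hV, hc0 V hV, hc0 V hV, add_zero]
  · have := nonempty_inf V' V₀
    refine Eq.trans ?_ (huniq V (V' ⊓ V₀) (inf_le_left.trans h) inf_le_right t (c V' (F.presheaf.map (homOfLE h).op t)) ?_).symm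
    · funext j
      exact germOrZero_eq _ _
    · rw [← hc, map_map_apply]
  · have := nonempty_inf V V₀
    refine (huniq V (V ⊓ V₀) inf_le_left inf_le_right (a • t)
      (fun j => X.presheaf.map (homOfLE inf_le_left).op a * c V t j) ?_).trans ?_
    · rw [Scheme.Modules.map_smul, hc V t, Finset.smul_sum]
      exact Finset.sum_congr rfl fun j _ => (mul_smul _ _ _).symm
    · funext j
      change _ = _ * germOrZero (V ⊓ V₀) (c V t j)
      rw [map_mul, germ_map, germOrZero_eq]
  · rw [injective_iff_map_eq_zero]
    intro t ht
    by_cases hV : Nonempty V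
    swap
    · exact hzero V hV t
    have hne := nonempty_inf V V₀
    have ht0 : F.presheaf.map (homOfLE (inf_le_left : V ⊓ V₀ ≤ V)).op t = 0 := by
      rw [hc V t]
      refine Finset.sum_eq_zero fun j _ => ?_
      have h1 : germOrZero (V ⊓ V₀) (c V t j) = 0 := congrFun ht j
      rw [germOrZero_eq, map_eq_zero_iff _ (Scheme.germToFunctionField_injective X _)] at h1
      rw [h1, zero_smul]
    refine section_eq_zero F t fun x hx => ?_
    -- A section vanishing on `V ⊓ V₀` has, in a frame near any `x`, coordinates that vanish on a
    -- nonempty open set, hence vanish.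
    obtain ⟨V₁, hx₁, s₁, hs₁⟩ := hF x
    have : Nonempty V₁ := ⟨⟨_, hx₁⟩⟩
    have := nonempty_inf (V ⊓ V₀) V₁
    refine ⟨V ⊓ V₁, ⟨hx, hx₁⟩, inf_le_left, ?_⟩
    have := nonempty_inf V V₁
    obtain ⟨d, hd⟩ := IsLocallyFreeOfRank.exists_coord hs₁ (inf_le_right : V ⊓ V₁ ≤ V₁)
      (F.presheaf.map (homOfLE inf_le_left).op t)
    have hle : V ⊓ V₀ ⊓ V₁ ≤ V ⊓ V₁ := inf_le_inf_right _ inf_le_left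
    have h1 := congrArg (F.presheaf.map (homOfLE hle).op) hd
    rw [map_map_comm F _ _ (inf_le_left : V ⊓ V₀ ≤ V) inf_le_left, ht0, map_zero, map_sum] at h1
    simp only [Scheme.Modules.map_smul, map_map_apply] at h1
    have h2 := Fintype.linearIndependent_iff.1 (hs₁ _ (hle.trans inf_le_right)).1 _ h1.symm
    rw [hd]
    refine Finset.sum_eq_zero fun j _ => ?_
    have h3 : d j = 0 := by
      apply Scheme.germToFunctionField_injective X (V ⊓ V₁)
      rw [← germ_map hle, h2 j, map_zero, map_zero]
    rw [h3, zero_smul]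

end GenEmb

end

/-! ### Frames, and morphisms as linear maps that respect lattices. -/

noncomputable section

open PointedCurve (map_map_apply map_map_comm app_map_apply modHom modHom_app)

section Frames

variable {X : Scheme.{u}} [IsIntegral X] {F : X.Modules} {W : Type*} [AddCommGroup W]
  [Module X.functionField W]

lemma exists_open_forall_mem_locRing {ι : Type*} [Finite ι] (c : ι → X.functionField) {x : X}
    (h : ∀ j, c j ∈ locRing X x) :
    ∃ (V : X.Opens) (_ : x ∈ V), ∀ y ∈ V, ∀ j, c j ∈ locRing X y := by
  have hc : IsClosed (⋃ j, {y : X | c j ∉ locRing X y}) :=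
    isClosed_iUnion_of_finite fun j => isClosed_notMem_locRing (c j)
  refine ⟨⟨_, hc.isOpen_compl⟩, ?_, ?_⟩
  · intro hx
    obtain ⟨j, hj⟩ := Set.mem_iUnion.1 hx
    exact hj (h j)
  · intro y hy j
    by_contra hj
    exact hy (Set.mem_iUnion.2 ⟨j, hj⟩)

namespace GenEmb

variable (γ : GenEmb F W)

/-- A `K`-linear relation among the vectors of a local basis has coefficients regular on a smaller
open set, where it contradicts independence of the sections. The rank condition makes the
independent vectors a basis of `W`. -/
theorem exists_frame [FiniteDimensional X.functionField W] {r : ℕ} (hF : IsLocallyFreeOfRank F r)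
    (hr : Module.finrank X.functionField W = r) (x : X) :
    ∃ (V : X.Opens) (_ : x ∈ V) (b : Module.Basis (Fin r) X.functionField W), γ.IsFrame V b := by
  obtain ⟨V, hx, s, hs⟩ := hF x
  have : Nonempty V := ⟨⟨x, hx⟩⟩
  have hcomb : ∀ {V' : X.Opens} [Nonempty V'] (h : V' ≤ V) (c : Fin r → Γ(X, V')),
      γ.γ V' (∑ j, c j • F.presheaf.map (homOfLE h).op (s j)) =
        ∑ j, X.germToFunctionField V' (c j) • γ.γ V (s j) := by
    intro V' _ h c
    rw [map_sum]
    refine Finset.sum_congr rfl fun j _ => ?_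
    rw [γ.γ_smul, γ.γ_map]
  have hli : LinearIndependent X.functionField (fun j => γ.γ V (s j)) := by
    rw [Fintype.linearIndependent_iff]
    intro c hc j
    obtain ⟨V', hV', h'⟩ := exists_open_forall_mem_locRing c (x := genericPoint X)
      (fun j => by rw [locRing_genericPoint]; trivial)
    have hne' : Nonempty V' := ⟨⟨_, hV'⟩⟩
    have := nonempty_inf V V'
    choose a ha using fun j => exists_section_of_forall_mem_locRing (V ⊓ V') (a := c j)
      (fun y hy => h' y hy.2 j)
    have h1 := hcomb (inf_le_left : V ⊓ V' ≤ V) a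
    simp only [ha] at h1
    rw [hc, map_eq_zero_iff _ (γ.inj _)] at h1
    have h2 := Fintype.linearIndependent_iff.1 (hs _ inf_le_left).1 _ h1 j
    rw [← ha j, h2, map_zero]
  let b := basisOfLinearIndependentOfCardEqFinrank' _ hli (by rw [Fintype.card_fin, hr])
  have hb : ∀ j, b j = γ.γ V (s j) := fun j => by
    simp only [b, coe_basisOfLinearIndependentOfCardEqFinrank']
  refine ⟨V, hx, b, fun y hy w => ⟨fun hw j => ?_, fun h => ?_⟩⟩
  · obtain ⟨V', hV', t, rfl⟩ := γ.exists_of_mem_lat hw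
    have : Nonempty (V ⊓ V' : X.Opens) := ⟨⟨y, hy, hV'⟩⟩
    obtain ⟨c, hc⟩ := IsLocallyFreeOfRank.exists_coord hs (inf_le_left : V ⊓ V' ≤ V)
      (F.presheaf.map (homOfLE inf_le_right).op t)
    have h1 := hcomb (inf_le_left : V ⊓ V' ≤ V) c
    rw [← hc, γ.γ_map] at h1
    simp only [← hb] at h1
    rw [h1, b.repr_sum_self]
    exact germ_mem_locRing (V ⊓ V') ⟨hy, hV'⟩ _
  · rw [← b.sum_repr w]
    refine Submodule.sum_mem _ fun j _ => γ.smul_mem_lat (h j) ?_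
    rw [hb]
    exact γ.γ_mem_lat hy _

variable {γ} in
lemma IsFrame.basis_mem {r : ℕ} {V : X.Opens} {b : Module.Basis (Fin r) X.functionField W}
    (h : γ.IsFrame V b) {x : X} (hx : x ∈ V) (j : Fin r) : b j ∈ γ.lat x :=
  (h x hx _).2 fun i => by
    rw [b.repr_self, Finsupp.single_apply]
    split_ifs
    · exact one_mem _
    · exact zero_mem _

section

variable [FiniteDimensional X.functionField W] {r : ℕ} (hF : IsLocallyFreeOfRank F r)
  (hr : Module.finrank X.functionField W = r)
include hF hr

lemma mem_lat_genericPoint (w : W) : w ∈ γ.lat (genericPoint X) := by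
  obtain ⟨V, hx, b, h⟩ := γ.exists_frame hF hr (genericPoint X)
  exact (h _ hx w).2 fun j => by rw [locRing_genericPoint]; trivial

lemma exists_pow_smul_mem_lat [IsLocallyPID X] {x : X} {a : X.functionField}
    (ha : (locVal x).valuation a < 1) (w : W) : ∃ N, ∀ n ≥ N, a ^ n • w ∈ γ.lat x := by
  obtain ⟨V, hx, b, h⟩ := γ.exists_frame hF hr x
  choose N hN using fun j => exists_pow_mul_val_lt_one x a (b.repr w j) ha
  refine ⟨Finset.univ.sup N, fun n hn => (h x hx _).2 fun j => ?_⟩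
  rw [map_smul, Finsupp.smul_apply, smul_eq_mul, ← locVal_val_le_one_iff]
  exact (hN j n ((Finset.le_sup (Finset.mem_univ j)).trans hn)).le

/-- The sections over an affine open subset generate the germs. -/
theorem exists_smul_mem_range [IsLocallyPID X] [NoetherianSpace X] {U : X.Opens} [Nonempty U]
    (hU : IsAffineOpen U) {x : X} (hx : x ∈ U) {w : W} (hw : w ∈ γ.lat x) :
    ∃ a : Γ(X, U), x ∈ X.basicOpen a ∧ ∃ s, γ.γ U s = X.germToFunctionField U a • w := by
  obtain ⟨V, hV, s, rfl⟩ := γ.exists_of_mem_lat hw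
  obtain ⟨V₁, hV₁, s₁, hs₁⟩ := γ.exists_of_mem_lat (γ.mem_lat_genericPoint hF hr (γ.γ V s))
  have : Nonempty V := ⟨⟨x, hV⟩⟩
  have hfin := finite_of_genericPoint_notMem V.isOpen.isClosed_compl (not_not.2 (genericPoint_mem V))
  obtain ⟨a, haV, hxa⟩ := hU.exists_basicOpen_le (V := V) ⟨x, hV⟩ hx
  have hval : ∀ y ∈ U, y ∉ V → (locVal y).valuation (X.germToFunctionField U a) < 1 := by
    intro y hy hyV
    by_contra h
    exact hyV (haV ((mem_basicOpen_iff_val hy a).2 h))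
  -- Only finitely many points lie outside the domain `V` of the section, and at those in `U` the
  -- function `a` vanishes; a high power of `a` clears all the poles.
  have hpow : ∀ y : X, ∃ N, y ∈ U → ∀ n ≥ N, X.germToFunctionField U a ^ n • γ.γ V s ∈ γ.lat y := by
    intro y
    by_cases hy : y ∈ U
    · by_cases hyV : y ∈ V
      · exact ⟨0, fun _ n _ => γ.smul_mem_lat (pow_mem (germ_mem_locRing U hy a) n)
          (γ.γ_mem_lat hyV s)⟩
      · obtain ⟨N, hN⟩ := γ.exists_pow_smul_mem_lat hF hr (hval y hy hyV) (γ.γ V s)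
        exact ⟨N, fun _ => hN⟩
    · exact ⟨0, fun h => (hy h).elim⟩
  choose N hN using hpow
  let n := hfin.toFinset.sup N
  obtain ⟨t, ht⟩ := γ.exists_section U (w := X.germToFunctionField U (a ^ n) • γ.γ V s) (by
    intro y hy
    rw [map_pow]
    by_cases hyV : y ∈ V
    · exact γ.smul_mem_lat (pow_mem (germ_mem_locRing U hy a) n) (γ.γ_mem_lat hyV s)
    · exact hN y hy n (Finset.le_sup (f := N) (hfin.mem_toFinset.2 hyV)))
  refine ⟨a ^ n, ?_, t, ht⟩
  by_cases hn : n = 0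
  · rw [hn, pow_zero, Scheme.basicOpen_one]; exact hx
  · rwa [Scheme.basicOpen_pow _ _ (Nat.pos_of_ne_zero hn)]

end

section Maps

variable {G : X.Modules} {W' : Type*} [AddCommGroup W'] [Module X.functionField W']
  (δ : GenEmb G W')

lemma exists_app (f : X ⟶ X) [Surjective f] (T : W →+ W')
    (h : ∀ x, ∀ w ∈ γ.lat (f x), T w ∈ δ.lat x) :
    ∃ app : ∀ V : X.Opens, Γ(F, V) →+ Γ(G, f ⁻¹ᵁ V), ∀ V s, δ.γ _ (app V s) = T (γ.γ V s) := by
  have hex : ∀ (V : X.Opens) (s : Γ(F, V)), ∃ t : Γ(G, f ⁻¹ᵁ V), δ.γ _ t = T (γ.γ V s) := by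
    intro V s
    by_cases hV : Nonempty V
    · exact δ.exists_section (f ⁻¹ᵁ V) fun x hx => h x _ (γ.γ_mem_lat (x := f x) hx s)
    · have := subsingleton_sections F hV
      refine ⟨0, ?_⟩
      rw [Subsingleton.elim s 0, map_zero, map_zero, map_zero]
  choose app happ using hex
  refine ⟨fun V => AddMonoidHom.mk' (app V) fun s t => ?_, happ⟩
  apply δ.inj
  rw [map_add, happ, happ, happ, map_add, map_add]

/-- This produces morphisms `F → f_* G`, and by adjunction `f^* F → G`, from a semilinear map on
generic fibres, without any description of the sections of `f^* F`. -/
theorem exists_homPush (f : X ⟶ X) [Surjective f] (T : W →+ W')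
    (hT : ∀ c w, T (c • w) = genMap f c • T w)
    (h : ∀ x, ∀ w ∈ γ.lat (f x), T w ∈ δ.lat x) :
    ∃ φ : F ⟶ (Scheme.Modules.pushforward f).obj G,
      ∀ V s, δ.γ (f ⁻¹ᵁ V) (φ.app V s) = T (γ.γ V s) := by
  obtain ⟨app, happ⟩ := γ.exists_app δ f T h
  refine ⟨modHom (N := (Scheme.Modules.pushforward f).obj G) app (fun V V' hV s => ?_)
    (fun V a s => ?_), happ⟩
  · by_cases hne : Nonempty V'
    · apply δ.inj (f ⁻¹ᵁ V')
      refine (happ _ _).trans (Eq.trans ?_ (δ.γ_map (Scheme.Hom.preimage_mono f hV) (app V s)).symm)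
      rw [happ, γ.γ_map]
    · have := subsingleton_sections ((Scheme.Modules.pushforward f).obj G) hne
      exact Subsingleton.elim _ _
  · by_cases hne : Nonempty V
    · apply δ.inj (f ⁻¹ᵁ V)
      refine (happ _ _).trans (Eq.trans ?_ (δ.γ_smul (f.app V a) (app V s)).symm)
      rw [happ, γ.γ_smul, hT, genMap_germ]
    · have := subsingleton_sections ((Scheme.Modules.pushforward f).obj G) hne
      exact Subsingleton.elim _ _

theorem exists_hom (T : W →+ W') (hT : ∀ (c : X.functionField) w, T (c • w) = c • T w)
    (h : ∀ x, ∀ w ∈ γ.lat x, T w ∈ δ.lat x) :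
    ∃ φ : F ⟶ G, ∀ V s, δ.γ V (φ.app V s) = T (γ.γ V s) := by
  obtain ⟨app, happ⟩ := γ.exists_app δ (𝟙 X) T h
  refine ⟨modHom app (fun V V' hV s => ?_) (fun V a s => ?_), happ⟩
  · by_cases hne : Nonempty V'
    · apply δ.inj V'
      refine (happ _ _).trans (Eq.trans ?_ (δ.γ_map hV (app V s)).symm)
      rw [γ.γ_map]
      exact (happ _ _).symm
    · have := subsingleton_sections G hne
      exact Subsingleton.elim _ _
  · by_cases hne : Nonempty V
    · apply δ.inj V
      refine (happ _ _).trans (Eq.trans ?_ (δ.γ_smul a (app V s)).symm)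
      rw [γ.γ_smul, hT]
      exact congrArg _ (happ _ _).symm
    · have := subsingleton_sections G hne
      exact Subsingleton.elim _ _

/-- A morphism to a direct image is determined by its effect on sections over an affine open set. -/
theorem app_eq_of_affine [IsLocallyPID X] [NoetherianSpace X] [FiniteDimensional X.functionField W]
    {r : ℕ} (hF : IsLocallyFreeOfRank F r) (hr : Module.finrank X.functionField W = r)
    (f : X ⟶ X) [Surjective f] (T : W →+ W') (hT : ∀ c w, T (c • w) = genMap f c • T w)
    (φ : F ⟶ (Scheme.Modules.pushforward f).obj G) {U : X.Opens} [Nonempty U] (hU : IsAffineOpen U)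
    (h : ∀ s, δ.γ (f ⁻¹ᵁ U) (φ.app U s) = T (γ.γ U s)) (V : X.Opens) (s : Γ(F, V)) :
    δ.γ (f ⁻¹ᵁ V) (φ.app V s) = T (γ.γ V s) := by
  by_cases hV : Nonempty V
  swap
  · have := subsingleton_sections F hV
    rw [Subsingleton.elim s 0, map_zero, map_zero, map_zero]; exact map_zero (δ.γ (f ⁻¹ᵁ V))
  have := nonempty_inf U V
  -- Some nonzero multiple `a • s` comes from a section over `U`, where the formula is known;
  -- afterwards one divides by the image of `a`.
  obtain ⟨a, ha, t, ht⟩ := γ.exists_smul_mem_range hF hr hU (genericPoint_mem U)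
    (γ.mem_lat_genericPoint hF hr (γ.γ V s))
  have ha0 := ((isUnit_germ_iff (genericPoint_mem U) a).1 ha).1
  have h1 : F.presheaf.map (homOfLE (inf_le_left : U ⊓ V ≤ U)).op t =
      X.presheaf.map (homOfLE (inf_le_left : U ⊓ V ≤ U)).op a •
        F.presheaf.map (homOfLE (inf_le_right : U ⊓ V ≤ V)).op s := by
    apply γ.inj
    rw [γ.γ_map, ht, γ.γ_smul, germ_map, γ.γ_map]
  have h2 := congrArg (fun y => δ.γ (f ⁻¹ᵁ (U ⊓ V)) (φ.app (U ⊓ V) y)) h1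
  simp only [app_map_apply, Scheme.Modules.Hom.app_smul] at h2
  have h3 := δ.γ_map (Scheme.Hom.preimage_mono f (inf_le_left : U ⊓ V ≤ U)) (φ.app U t)
  have h4 := δ.γ_map (Scheme.Hom.preimage_mono f (inf_le_right : U ⊓ V ≤ V)) (φ.app V s)
  have h5 := δ.γ_smul (V := f ⁻¹ᵁ (U ⊓ V)) (f.app (U ⊓ V)
    (X.presheaf.map (homOfLE (inf_le_left : U ⊓ V ≤ U)).op a))
    (G.presheaf.map (homOfLE (Scheme.Hom.preimage_mono f (inf_le_right : U ⊓ V ≤ V))).op (φ.app V s))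
  have h6 := h3.symm.trans (h2.trans h5)
  rw [h4, h, ht, hT, ← genMap_germ, germ_map] at h6
  exact (smul_right_injective W' ((map_ne_zero (genMap f)).2 ha0) h6).symm

end Maps

end GenEmb

end Frames

section Extension

lemma exists_common_denominator {R K : Type*} [CommRing R] [Field K] (ι : R →+* K)
    (hfrac : ∀ c : K, ∃ g h : R, ι h ≠ 0 ∧ c * ι h = ι g) {J : Type*} (s : Finset J) (c : J → K) :
    ∃ h : R, ι h ≠ 0 ∧ ∀ j ∈ s, ∃ g : R, c j * ι h = ι g := by
  classical
  induction s using Finset.induction_on with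
  | empty => exact ⟨1, by rw [map_one]; exact one_ne_zero, fun j hj => (Finset.notMem_empty j hj).elim⟩
  | insert i s hi ih =>
    obtain ⟨h, h0, hs⟩ := ih
    obtain ⟨g', h', h0', e'⟩ := hfrac (c i)
    refine ⟨h * h', by rw [map_mul]; exact mul_ne_zero h0 h0', fun j hj => ?_⟩
    rcases Finset.mem_insert.1 hj with rfl | hj
    · exact ⟨h * g', by rw [map_mul, map_mul, ← e']; ring⟩
    · obtain ⟨g, e⟩ := hs j hj
      exact ⟨g * h', by rw [map_mul, map_mul, ← e]; ring⟩

/-- A semilinear map on a module spanning a vector space extends to the vector space. -/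
theorem exists_semilinear_extension {R K M W W' : Type*} [CommRing R] [Field K] [AddCommGroup M]
    [Module R M] [AddCommGroup W] [Module K W] [AddCommGroup W'] [Module K W'] (ι : R →+* K)
    (hfrac : ∀ c : K, ∃ g h : R, ι h ≠ 0 ∧ c * ι h = ι g) (φ : K →+* K) (γ : M →+ W)
    (hγ : Function.Injective γ) (hsmul : ∀ a m, γ (a • m) = ι a • γ m)
    (hspan : Submodule.span K (Set.range γ) = ⊤) (T₀ : M →+ W')
    (hT₀ : ∀ a m, T₀ (a • m) = φ (ι a) • T₀ m) :
    ∃ T : W →+ W', (∀ c w, T (c • w) = φ c • T w) ∧ ∀ m, T (γ m) = T₀ m := by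
  classical
  -- A basis chosen inside the image of `γ` lets the semilinear map be prescribed by `T₀` on basis
  -- vectors. Clearing denominators then gives agreement with `T₀` on all of `M`.
  obtain ⟨b, hb⟩ : ∃ (J : Set W) (b : Module.Basis J K W), ∀ j, ∃ m, γ m = b j := by
    obtain ⟨J, hJ, h1, h2⟩ := exists_linearIndependent K (Set.range γ)
    refine ⟨J, Module.Basis.mk h2 ?_, fun j => ?_⟩
    · rw [Subtype.range_coe, h1, hspan]
    · rw [Module.Basis.mk_apply]; exact hJ j.2
  obtain ⟨b, hb⟩ := hb
  choose m hm using hb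
  let T : W →+ W' := AddMonoidHom.mk' (fun w => (b.repr w).sum fun j c => φ c • T₀ (m j))
    fun w w' => by
      rw [map_add]
      exact Finsupp.sum_add_index (by intros; rw [map_zero, zero_smul])
        (by intros; rw [map_add, add_smul])
  have hTdef : ∀ w, T w = (b.repr w).sum fun j c => φ c • T₀ (m j) := fun w => rfl
  refine ⟨T, fun c w => ?_, fun n => ?_⟩
  · rw [hTdef, hTdef, map_smul, Finsupp.sum_smul_index (by intros; rw [map_zero, zero_smul]),
      Finsupp.smul_sum]
    exact Finsupp.sum_congr fun j _ => by rw [map_mul, mul_smul]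
  · obtain ⟨h, h0, hg⟩ := exists_common_denominator ι hfrac (b.repr (γ n)).support (b.repr (γ n))
    choose! g hg using hg
    have h1 : h • n = ∑ j ∈ (b.repr (γ n)).support, g j • m j := by
      apply hγ
      rw [hsmul, map_sum]
      conv_lhs => rw [← b.linearCombination_repr (γ n), Finsupp.linearCombination_apply,
        Finsupp.sum, Finset.smul_sum]
      exact Finset.sum_congr rfl fun j hj => by rw [hsmul, hm, ← hg j hj, smul_smul, mul_comm]
    have h2 := congrArg T₀ h1
    rw [hT₀, map_sum] at h2
    refine smul_right_injective W' ((map_ne_zero φ).2 h0) ?_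
    refine Eq.trans ?_ h2.symm
    change φ (ι h) • T (γ n) = _
    rw [hTdef, Finsupp.sum, Finset.smul_sum]
    exact Finset.sum_congr rfl fun j hj => by
      rw [hT₀, ← hg j hj, smul_smul, map_mul, mul_comm]

end Extension

end

/-! ### Lattices of twists, and transport of embeddings. -/

noncomputable section

open PointedCurve (map_map_apply map_map_comm app_map_apply modHom modHom_app)

namespace GenEmb

section Twist

variable {Fq : Type u} [Field Fq] {C : PointedCurve Fq} {L : Type u} [Field L] [Algebra Fq L]
  {F : (C.CL L).Modules} {W : Type*} [AddCommGroup W] [Module (C.CL L).functionField W]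
  (γ : GenEmb F W)

/-- `V ∖ {∞}`. -/
abbrev cut (C : PointedCurve Fq) (V : (C.CL L).Opens) : (C.CL L).Opens := (C.UL L).ι ''ᵁ ((C.UL L).ι ⁻¹ᵁ V)

lemma cut_eq (V : (C.CL L).Opens) : cut C V = C.UL L ⊓ V := by
  rw [cut, Scheme.Hom.image_preimage_eq_opensRange_inf, Scheme.Opens.opensRange_ι]

lemma mem_cut {V : (C.CL L).Opens} {x : C.CL L} : x ∈ cut C V ↔ x ∈ C.UL L ∧ x ∈ V := by
  rw [cut_eq]; rfl

lemma cut_le (V : (C.CL L).Opens) : cut C V ≤ V := (C.UL L).ι.image_preimage_le V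

lemma cut_mono {V V' : (C.CL L).Opens} (h : V' ≤ V) : cut C V' ≤ cut C V :=
  Scheme.Hom.image_mono _ (Scheme.Hom.preimage_mono _ h)

instance nonempty_cut (V : (C.CL L).Opens) [Nonempty V] : Nonempty (cut C V) :=
  ⟨⟨genericPoint _, mem_cut.2 ⟨genericPoint_mem _, genericPoint_mem _⟩⟩⟩

/-- The embedding of sections away from `∞`. -/
def awayEmb : GenEmb ((C.away L).obj F) W where
  γ V := γ.γ (cut C V)
  γ_map {V V'} _ h s := γ.γ_map (cut_mono h) s
  γ_smul {V} _ a s := (congrArg (γ.γ (cut C V)) (C.away_smul F V a s)).trans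
    ((γ.γ_smul _ _).trans (by rw [germ_map]; rfl))
  inj V := γ.inj (cut C V)

lemma awayEmb_toAway {V : (C.CL L).Opens} [Nonempty V] (s : Γ(F, V)) :
    γ.awayEmb.γ V ((C.toAway L F).app V s) = γ.γ V s :=
  γ.γ_map (cut_le V) s

lemma exists_away_section (V : (C.CL L).Opens) [Nonempty V] {w : W}
    (h : ∀ y ∈ V, y ∈ C.UL L → w ∈ γ.lat y) : ∃ s, γ.awayEmb.γ V s = w :=
  γ.exists_section (cut C V) fun y hy => h y (mem_cut.1 hy).2 (mem_cut.1 hy).1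

lemma awayEmb_mem_lat {V : (C.CL L).Opens} {y : C.CL L} (hy : y ∈ V) (hyU : y ∈ C.UL L) (s) :
    γ.awayEmb.γ V s ∈ γ.lat y := γ.γ_mem_lat (V := cut C V) (mem_cut.2 ⟨hyU, hy⟩) s

end Twist

end GenEmb

namespace PointedCurve

variable {Fq : Type u} [Field Fq] {C : PointedCurve Fq} {L : Type u} [Field L] [Algebra Fq L]

lemma zpow_mem_of_unit {R : Subring (C.CL L).functionField} {u v : (C.CL L).functionField} (hu : u ∈ R)
    (hv : v ∈ R) (h : u * v = 1) (n : ℤ) : u ^ n ∈ R := by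
  cases n with
  | ofNat n => rw [Int.ofNat_eq_natCast, zpow_natCast]; exact pow_mem hu n
  | negSucc n =>
    rw [zpow_negSucc, ← inv_pow, inv_eq_of_mul_eq_one_right h]
    exact pow_mem hv _

lemma Uniformizer.exists_unit (z z' : C.Uniformizer) : ∃ u ∈ locRing (C.CL L) (C.infLPt L),
    ∃ v ∈ locRing (C.CL L) (C.infLPt L), z'.zK L = z.zK L * u ∧ u * v = 1 := by
  obtain ⟨u, hu, e⟩ := z.exists_eq_zK_mul (L := L) z'.val_zK_lt_one
  obtain ⟨v, hv, e'⟩ := z'.exists_eq_zK_mul (L := L) z.val_zK_lt_one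
  refine ⟨u, hu, v, hv, e, mul_left_cancel₀ z.zK_ne_zero (?_ : z.zK L * (u * v) = z.zK L * 1)⟩
  rw [← mul_assoc, ← e, ← e', mul_one]

lemma Uniformizer.zK_zpow_mem (z : C.Uniformizer) {y : C.CL L} (hy : y ∈ C.pr L ⁻¹ᵁ z.W)
    (hyU : y ∈ C.UL L) (n : ℤ) : z.zK L ^ n ∈ locRing (C.CL L) y := by
  have h := (isUnit_germ_iff hy ((C.pr L).app z.W z.z)).1 (by
    rw [z.basicOpen_onCL]; exact ⟨hy, hyU⟩)
  exact zpow_mem_of_unit (germ_mem_locRing _ hy _) h.2 (mul_inv_cancel₀ h.1) n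

end PointedCurve

namespace GenEmb

section Twist2

variable {Fq : Type u} [Field Fq] {C : PointedCurve Fq} {L : Type u} [Field L] [Algebra Fq L]
  {F : (C.CL L).Modules} {W : Type*} [AddCommGroup W] [Module (C.CL L).functionField W]
  (γ : GenEmb F W)

lemma zpow_smul_mem_of (z z' : C.Uniformizer) {n : ℤ} {w : W}
    (h : z.zK L ^ n • w ∈ γ.lat (C.infLPt L)) : z'.zK L ^ n • w ∈ γ.lat (C.infLPt L) := by
  obtain ⟨u, hu, v, hv, e, h1⟩ := z.exists_unit (L := L) z'
  rw [e, mul_zpow, mul_comm, mul_smul]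
  exact γ.smul_mem_lat (PointedCurve.zpow_mem_of_unit hu hv h1 n) h

lemma toNat_zpow {K : Type*} [Field K] {z : K} (hz : z ≠ 0) (n : ℤ) :
    z ^ (-n).toNat * z ^ n = z ^ n.toNat := by
  rw [← zpow_natCast, ← zpow_natCast, ← zpow_add₀ hz]
  congr 1; omega

/-- Two local equations of `∞` differ by a unit at `∞`, so one of them tests the condition for all.
The two truncated exponents in the definition combine to the single power `z ^ n`. -/
lemma inTwist_iff (z : C.Uniformizer) {n : ℤ} {V : (C.CL L).Opens} [Nonempty V]
    (s : Γ((C.away L).obj F, V)) : C.InTwist F n V s ↔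
      (C.infLPt L ∈ V → z.zK L ^ n • γ.awayEmb.γ V s ∈ γ.lat (C.infLPt L)) := by
  constructor
  · intro h hV
    obtain ⟨V', hx, hV', hz, t, e⟩ := h _ hV (C.infLPt_notMem L) z
    have : Nonempty V' := ⟨⟨_, hx⟩⟩
    have e1 := congrArg (γ.awayEmb.γ V') e
    rw [GenEmb.γ_smul, GenEmb.γ_smul, map_pow, map_pow, z.germ_onCL, γ.awayEmb_toAway,
      γ.awayEmb.γ_map, ← toNat_zpow z.zK_ne_zero n, mul_smul] at e1
    rw [← smul_right_injective W (pow_ne_zero _ z.zK_ne_zero) e1]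
    exact γ.γ_mem_lat hx t
  · intro h x hx hxU z'
    obtain rfl := not_not.1 (fun h => hxU ((C.mem_UL_iff L x).2 h))
    obtain ⟨V₁, hx₁, t, ht⟩ := γ.exists_of_mem_lat (γ.zpow_smul_mem_of z z' (h hx))
    let V' := V₁ ⊓ V ⊓ C.pr L ⁻¹ᵁ z'.W
    have hx' : C.infLPt L ∈ V' := ⟨⟨hx₁, hx⟩, z'.infLPt_mem⟩
    have : Nonempty V' := ⟨⟨_, hx'⟩⟩
    refine ⟨V', hx', inf_le_left.trans inf_le_right, inf_le_right,
      F.presheaf.map (homOfLE (inf_le_left.trans inf_le_left : V' ≤ V₁)).op t, ?_⟩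
    apply γ.awayEmb.inj
    rw [GenEmb.γ_smul, GenEmb.γ_smul, map_pow, map_pow, z'.germ_onCL, γ.awayEmb_toAway,
      γ.awayEmb.γ_map, ← toNat_zpow z'.zK_ne_zero n, mul_smul, γ.γ_map, ht]

/-- The embedding of the twist `F(n·∞)`. -/
def twistEmb (n : ℤ) : GenEmb ((C.twist n).obj F) W where
  γ V := (γ.awayEmb.γ V).comp ((C.twistIncl F n).app V).hom
  γ_map {V V'} _ h s := γ.awayEmb.γ_map h s.1
  γ_smul {V} _ a s := γ.awayEmb.γ_smul a s.1
  inj V := (γ.awayEmb.inj V).comp (C.twistIncl_injective F n V)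

lemma exists_twist_section (z : C.Uniformizer) {n : ℤ} (V : (C.CL L).Opens) [Nonempty V] {w : W}
    (h : ∀ y ∈ V, y ∈ C.UL L → w ∈ γ.lat y)
    (h' : C.infLPt L ∈ V → z.zK L ^ n • w ∈ γ.lat (C.infLPt L)) :
    ∃ s, (γ.twistEmb n).γ V s = w := by
  obtain ⟨s, rfl⟩ := γ.exists_away_section V h
  exact ⟨⟨s, (γ.inTwist_iff z s).2 h'⟩, rfl⟩

lemma mem_lat_twistEmb_of_mem_UL (n : ℤ) {x : C.CL L} (hx : x ∈ C.UL L) {w : W} :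
    w ∈ (γ.twistEmb n).lat x ↔ w ∈ γ.lat x := by
  constructor
  · intro h
    obtain ⟨V, hV, s, rfl⟩ := (γ.twistEmb n).exists_of_mem_lat h
    exact γ.awayEmb_mem_lat hV hx s.1
  · intro h
    obtain ⟨V, hV, s, rfl⟩ := γ.exists_of_mem_lat h
    have : Nonempty (V ⊓ C.UL L : (C.CL L).Opens) := ⟨⟨x, hV, hx⟩⟩
    obtain ⟨z⟩ := C.nonempty_uniformizer
    obtain ⟨t, ht⟩ := γ.exists_twist_section z (n := n) (V ⊓ C.UL L) (w := γ.γ V s)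
      (fun y hy _ => γ.γ_mem_lat hy.1 s) (fun h => (C.infLPt_notMem L h.2).elim)
    rw [← ht]
    exact (γ.twistEmb n).γ_mem_lat (V := V ⊓ C.UL L) ⟨hV, hx⟩ t

lemma mem_lat_twistEmb_inf (z : C.Uniformizer) (n : ℤ) {w : W} :
    w ∈ (γ.twistEmb n).lat (C.infLPt L) ↔ z.zK L ^ n • w ∈ γ.lat (C.infLPt L) := by
  constructor
  · intro h
    obtain ⟨V, hV, s, rfl⟩ := (γ.twistEmb n).exists_of_mem_lat h
    have : Nonempty V := ⟨⟨_, hV⟩⟩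
    exact (γ.inTwist_iff z s.1).1 s.2 hV
  · intro h
    obtain ⟨V, hV, s, hs⟩ := γ.exists_of_mem_lat h
    have hx : C.infLPt L ∈ V ⊓ C.pr L ⁻¹ᵁ z.W := ⟨hV, z.infLPt_mem⟩
    have : Nonempty (V ⊓ C.pr L ⁻¹ᵁ z.W : (C.CL L).Opens) := ⟨⟨_, hx⟩⟩
    obtain ⟨t, ht⟩ := γ.exists_twist_section z (n := n) (V ⊓ C.pr L ⁻¹ᵁ z.W) (w := w)
      -- Away from `∞` but inside the domain of `z`, both `z` and its inverse are regular, so the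
      -- factor `z ^ n` can be removed.
      (fun y hy hyU => by
        have h1 := γ.smul_mem_lat (z.zK_zpow_mem hy.2 hyU (-n)) (γ.γ_mem_lat hy.1 s)
        rwa [hs, smul_smul, ← zpow_add₀ z.zK_ne_zero, neg_add_cancel, zpow_zero, one_smul] at h1)
      (fun _ => h)
    rw [← ht]
    exact (γ.twistEmb n).γ_mem_lat hx t

lemma twistEmb_untwist (n : ℤ) (s : Γ((C.twist n).obj F, C.UL L)) :
    γ.γ (C.UL L) (C.untwist F n s) = (γ.twistEmb n).γ (C.UL L) s :=
  γ.γ_map (V := cut C (C.UL L)) _ s.1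

lemma twistEmb_map {G : (C.CL L).Modules} {W' : Type*} [AddCommGroup W']
    [Module (C.CL L).functionField W'] (δ : GenEmb G W') (f : F ⟶ G) (T : W → W')
    (h : ∀ V s, δ.γ V (f.app V s) = T (γ.γ V s)) (n : ℤ) (V : (C.CL L).Opens) (s) :
    (δ.twistEmb n).γ V (((C.twist n).map f).app V s) = T ((γ.twistEmb n).γ V s) :=
  h (cut C V) s.1

lemma twistEmb_twistSemi [Fintype Fq] {G : (C.CL L).Modules} {W' : Type*} [AddCommGroup W']
    [Module (C.CL L).functionField W'] (δ : GenEmb G W')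
    (φ : F ⟶ (Scheme.Modules.pushforward (C.sigma L)).obj G) (T : W → W')
    (h : ∀ V s, δ.γ (C.sigma L ⁻¹ᵁ V) (φ.app V s) = T (γ.γ V s)) (n : ℤ) (V : (C.CL L).Opens)
    [Nonempty V] (s) :
    (δ.twistEmb n).γ (C.sigma L ⁻¹ᵁ V) ((C.twistSemi n φ).app V s) = T ((γ.twistEmb n).γ V s) :=
  (δ.γ_map (V := C.sigma L ⁻¹ᵁ (cut C V)) (V' := cut C (C.sigma L ⁻¹ᵁ V)) (C.awayPush_le L V) _).trans
    (h (cut C V) s.1)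

end Twist2

section Transport

variable {Fq : Type u} [Field Fq] {C : PointedCurve Fq} {L : Type u} [Field L] [Algebra Fq L]
  {F G : (C.CL L).Modules} {W : Type*} [AddCommGroup W] [Module (C.CL L).functionField W]

/-- The restriction of an embedding along an injective map. -/
def comap (f : F ⟶ G) (hf : ∀ V, Function.Injective (f.app V)) (δ : GenEmb G W) : GenEmb F W where
  γ V := (δ.γ V).comp (f.app V).hom
  γ_map {V V'} _ h s := by
    change δ.γ V' (f.app V' _) = δ.γ V (f.app V s)
    rw [app_map_apply, δ.γ_map]
  γ_smul {V} _ a s := by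
    change δ.γ V (f.app V _) = _ • δ.γ V (f.app V s)
    rw [Scheme.Modules.Hom.app_smul, δ.γ_smul]
  inj V := (δ.inj V).comp (hf V)

variable (f : F ⟶ G) (U : (C.CL L).Opens)
  (hf : ∀ V ≤ U, Function.Bijective (f.app V)) (γ : GenEmb F W)

/-- The inverse of an isomorphism over `U`, on sections. -/
def invOn (V : (C.CL L).Opens) : Γ(G, V) →+ Γ(F, V ⊓ U) :=
  (AddEquiv.ofBijective (f.app (V ⊓ U)).hom (hf _ inf_le_right)).symm.toAddMonoidHom.comp
    (G.presheaf.map (homOfLE (inf_le_left : V ⊓ U ≤ V)).op).hom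

lemma app_invOn (V : (C.CL L).Opens) (s : Γ(G, V)) :
    f.app (V ⊓ U) (invOn f U hf V s) = G.presheaf.map (homOfLE (inf_le_left : V ⊓ U ≤ V)).op s :=
  (AddEquiv.ofBijective (f.app (V ⊓ U)).hom (hf _ inf_le_right)).apply_symm_apply _

lemma γ_invOn {V V' : (C.CL L).Opens} [Nonempty V'] (h : V' ≤ V) (hU : V' ≤ U) (s : Γ(G, V)) (t : Γ(F, V'))
    (e : f.app V' t = G.presheaf.map (homOfLE h).op s) :
    γ.γ (V ⊓ U) (invOn f U hf V s) = γ.γ V' t := by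
  rw [← γ.γ_map (le_inf h hU)]
  congr 1
  apply (hf _ hU).1
  rw [app_map_apply, app_invOn, e, map_map_apply]

/-- The transport of an embedding along a map that is an isomorphism over a nonempty open set. -/
def map [Nonempty U] {W' : Type*} [AddCommGroup W'] [Module (C.CL L).functionField W'] (δ : GenEmb G W') :
    GenEmb G W where
  γ V := (γ.γ (V ⊓ U)).comp (invOn f U hf V)
  γ_map {V V'} _ h s := by
    have := nonempty_inf V' U
    refine (γ_invOn f U hf γ (inf_le_left.trans h) inf_le_right s _ ?_).symm
    rw [app_invOn, map_map_apply]
  γ_smul {V} _ a s := by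
    have := nonempty_inf V U
    refine (γ_invOn f U hf γ inf_le_left inf_le_right (a • s)
      ((C.CL L).presheaf.map (homOfLE (inf_le_left : V ⊓ U ≤ V)).op a • invOn f U hf V s) ?_).trans ?_
    · rw [Scheme.Modules.Hom.app_smul, app_invOn, Scheme.Modules.map_smul]
    · rw [γ.γ_smul, germ_map]; rfl
  inj V := by
    rw [injective_iff_map_eq_zero]
    intro s hs
    by_cases hV : Nonempty V
    swap
    · have := subsingleton_sections G hV
      exact Subsingleton.elim _ _
    have := nonempty_inf V U
    -- The auxiliary embedding `δ` serves only here: it shows that a section of `G` vanishing on `V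
    -- ⊓ U` is zero.
    apply δ.inj
    rw [← δ.γ_map (inf_le_left : V ⊓ U ≤ V), ← app_invOn f U hf,
      (map_eq_zero_iff _ (γ.inj _)).1 hs, map_zero, map_zero, map_zero]

lemma map_γ [Nonempty U] {W' : Type*} [AddCommGroup W'] [Module (C.CL L).functionField W'] (δ : GenEmb G W')
    {V V' : (C.CL L).Opens} [Nonempty V'] (h : V' ≤ V) (hU : V' ≤ U) (s : Γ(G, V)) (t : Γ(F, V'))
    (e : f.app V' t = G.presheaf.map (homOfLE h).op s) :
    (map f U hf γ δ).γ V s = γ.γ V' t := γ_invOn f U hf γ h hU s t e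

end Transport

end GenEmb

end

/-! ### Compatible embeddings of the sheaves of a `τ`-sheaf. -/

noncomputable section

open PointedCurve (map_map_apply map_map_comm app_map_apply modHom modHom_app)

lemma app_injective_of_mono {X : Scheme.{u}} {F G : X.Modules} (f : F ⟶ G) [Mono f] (V : X.Opens) :
    Function.Injective (f.app V) := by
  have h1 : Mono ((Scheme.Modules.toPresheaf X).map f) := inferInstance
  have h2 : Mono (((Scheme.Modules.toPresheaf X).map f).app (op V)) := inferInstance
  exact (AddCommGrpCat.mono_iff_injective _).1 h2

variable {Fq : Type u} [Field Fq] [Fintype Fq] {C : PointedCurve Fq} {L : Type u} [Field L]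
  [Algebra Fq L]

/-- The map `F → σ_* G` adjoint to `σ^* F → G`. -/
abbrev adjσ {F G : (C.CL L).Modules} (τ : (Scheme.Modules.pullback (C.sigma L)).obj F ⟶ G) :
    F ⟶ (Scheme.Modules.pushforward (C.sigma L)).obj G :=
  (Scheme.Modules.pullbackPushforwardAdjunction (C.sigma L)).homEquiv _ _ τ

namespace TauSheafData

variable (S : TauSheafData C L)

/-- Compatible embeddings of the sheaves `F_i` into one vector space. -/
structure Embs (W : Type*) [AddCommGroup W] [Module (C.CL L).functionField W] where
  γ (i : ℤ) : GenEmb (S.F.obj i) W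
  compat {i j : ℤ} (h : i ≤ j) (V : (C.CL L).Opens) (s : Γ(S.F.obj i, V)) :
    (γ j).γ V ((S.F.map (homOfLE h)).app V s) = (γ i).γ V s

lemma comm_adj (i : ℤ) : S.Pi i ≫ adjσ (S.τ (i + 1)) =
    adjσ (S.τ i) ≫ (Scheme.Modules.pushforward (C.sigma L)).map (S.Pi (i + 1)) := by
  rw [adjσ, adjσ, ← Adjunction.homEquiv_naturality_left, ← Adjunction.homEquiv_naturality_right, S.comm]

lemma map_comp' {i j k : ℤ} (h : i ≤ j) (h' : j ≤ k) :
    S.F.map (homOfLE h) ≫ S.F.map (homOfLE h') = S.F.map (homOfLE (h.trans h')) := by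
  rw [← Functor.map_comp]; rfl

lemma map_app_app {i j k : ℤ} (h : i ≤ j) (h' : j ≤ k) (V : (C.CL L).Opens) (s : Γ(S.F.obj i, V)) :
    (S.F.map (homOfLE h')).app V ((S.F.map (homOfLE h)).app V s) =
      (S.F.map (homOfLE (h.trans h'))).app V s :=
  congr(($(S.map_comp' h h')).app V s)

lemma comm_map {i j : ℤ} (h : i ≤ j) : S.F.map (homOfLE h) ≫ adjσ (S.τ j) =
    adjσ (S.τ i) ≫ (Scheme.Modules.pushforward (C.sigma L)).map
      (S.F.map (homOfLE (add_le_add_left h 1))) := by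
  induction j, h using Int.leInduction with
  | base =>
    change S.F.map (𝟙 _) ≫ _ = _ ≫ (Scheme.Modules.pushforward (C.sigma L)).map (S.F.map (𝟙 _))
    rw [CategoryTheory.Functor.map_id, CategoryTheory.Functor.map_id, CategoryTheory.Functor.map_id, Category.id_comp, Category.comp_id]
  | succ j h ih =>
    rw [← S.map_comp' h (lt_add_one j).le, Category.assoc, S.comm_adj, ← Category.assoc, ih,
      Category.assoc, ← Functor.map_comp, S.map_comp']

variable {S} {W : Type*} [AddCommGroup W] [Module (C.CL L).functionField W] (γ : S.Embs W)

lemma Embs.lat_mono {i j : ℤ} (h : i ≤ j) {x : C.CL L} {w : W} (hw : w ∈ (γ.γ i).lat x) :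
    w ∈ (γ.γ j).lat x := by
  obtain ⟨V, hV, s, rfl⟩ := (γ.γ i).exists_of_mem_lat hw
  rw [← γ.compat h]
  exact (γ.γ j).γ_mem_lat hV _

lemma Embs.isPeriodic_iff (k l : ℕ) : S.IsPeriodic k l ↔
    ∀ (i : ℤ) (x : C.CL L) (w : W), w ∈ (γ.γ i).lat x ↔
      w ∈ ((γ.γ (i + l)).twistEmb (-(k : ℤ))).lat x := by
  have key : ∀ (i : ℤ) (V : (C.CL L).Opens) [Nonempty V] (t : Γ(S.F.obj i, V)),
      (γ.γ (i + l)).awayEmb.γ V ((S.F.map (homOfLE (show i ≤ i + l by omega)) ≫ C.toAway L _).app V t) =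
        (γ.γ i).γ V t := by
    intro i V _ t
    refine ((γ.γ (i + l)).awayEmb_toAway _).trans (γ.compat _ V t)
  constructor
  · intro h i x w
    constructor
    · intro hw
      obtain ⟨V, hV, s, rfl⟩ := (γ.γ i).exists_of_mem_lat hw
      have : Nonempty V := ⟨⟨x, hV⟩⟩
      have h1 : (S.F.map (homOfLE (show i ≤ i + l by omega)) ≫ C.toAway L _).app V s ∈
          {s | C.InTwist (S.F.obj (i + l)) (-(k : ℤ)) V s} := by rw [← h i V]; exact ⟨s, rfl⟩
      rw [← key]
      exact ((γ.γ (i + l)).twistEmb (-(k : ℤ))).γ_mem_lat hV ⟨_, h1⟩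
    · intro hw
      obtain ⟨V, hV, ⟨s, hs⟩, rfl⟩ := ((γ.γ (i + l)).twistEmb (-(k : ℤ))).exists_of_mem_lat hw
      have : Nonempty V := ⟨⟨x, hV⟩⟩
      have h1 : s ∈ {s | C.InTwist (S.F.obj (i + l)) (-(k : ℤ)) V s} := hs
      rw [← h i V] at h1
      obtain ⟨t, ht⟩ := h1
      have h2 := key i V t
      rw [ht] at h2
      change (γ.γ (i + l)).awayEmb.γ V s ∈ _
      rw [h2]
      exact (γ.γ i).γ_mem_lat hV t
  · intro h i V
    ext s
    by_cases hV : Nonempty V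
    · constructor
      · rintro ⟨t, rfl⟩
        obtain ⟨⟨s', hs'⟩, e⟩ := ((γ.γ (i + l)).twistEmb (-(k : ℤ))).exists_section V (w := (γ.γ i).γ V t)
          fun x hx => (h i x _).1 ((γ.γ i).γ_mem_lat hx t)
        rw [← key] at e
        rw [← (γ.γ (i + l)).awayEmb.inj V e]
        exact hs'
      · intro hs
        obtain ⟨t, e⟩ := (γ.γ i).exists_section V (w := (γ.γ (i + l)).awayEmb.γ V s)
          fun x hx => (h i x _).2 (((γ.γ (i + l)).twistEmb (-(k : ℤ))).γ_mem_lat hx ⟨s, hs⟩)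
        rw [← key] at e
        exact ⟨t, (γ.γ (i + l)).awayEmb.inj V e⟩
    · have := subsingleton_sections ((C.away L).obj (S.F.obj (i + l))) hV
      exact ⟨fun _ x hx => (hV ⟨⟨x, hx⟩⟩).elim, fun _ => ⟨0, Subsingleton.elim _ _⟩⟩

/-- Away from `∞` the twist changes nothing, so the increasing lattices repeat every `l` steps and
must be constant. -/
lemma Embs.mem_lat_iff_of_mem_UL {k l : ℕ} (hl : 0 < l) (h : S.IsPeriodic k l) {x : C.CL L}
    (hx : x ∈ C.UL L) (i j : ℤ) (w : W) : w ∈ (γ.γ i).lat x ↔ w ∈ (γ.γ j).lat x := by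
  have h1 : ∀ i, w ∈ (γ.γ i).lat x ↔ w ∈ (γ.γ (i + l)).lat x := fun i =>
    ((γ.isPeriodic_iff k l).1 h i x w).trans (GenEmb.mem_lat_twistEmb_of_mem_UL _ _ hx)
  have h2 : ∀ (i : ℤ) (n : ℕ), w ∈ (γ.γ i).lat x ↔ w ∈ (γ.γ (i + n * l)).lat x := by
    intro i n
    induction n with
    | zero => rw [Nat.cast_zero, zero_mul, add_zero]
    | succ n ih => rw [ih, h1, Nat.cast_succ, add_mul, one_mul, add_assoc]
  have h3 : ∀ i j, i ≤ j → (w ∈ (γ.γ i).lat x ↔ w ∈ (γ.γ j).lat x) := by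
    intro i j hij
    refine ⟨γ.lat_mono hij, fun hw => (h2 i (j - i).toNat).2 (γ.lat_mono ?_ hw)⟩
    have : (((j - i).toNat : ℕ) : ℤ) = j - i := Int.toNat_of_nonneg (by omega)
    rw [this]
    nlinarith
  rcases le_total i j with hij | hij
  · exact h3 i j hij
  · exact (h3 j i hij).symm

lemma Embs.mem_lat_inf_iff {k l : ℕ} (h : S.IsPeriodic k l) (z : C.Uniformizer)
    (i n : ℤ) (w : W) : w ∈ (γ.γ i).lat (C.infLPt L) ↔
      z.zK L ^ (-(n * k)) • w ∈ (γ.γ (i + n * l)).lat (C.infLPt L) := by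
  have h1 : ∀ i w, w ∈ (γ.γ i).lat (C.infLPt L) ↔
      z.zK L ^ (-(k : ℤ)) • w ∈ (γ.γ (i + l)).lat (C.infLPt L) := fun i w =>
    ((γ.isPeriodic_iff k l).1 h i _ w).trans (GenEmb.mem_lat_twistEmb_inf _ z _)
  induction n using Int.induction_on with
  | zero => rw [zero_mul, zero_mul, neg_zero, zpow_zero, one_smul, add_zero]
  | succ n ih =>
    refine ih.trans ?_
    rw [h1, smul_smul, ← zpow_add₀ z.zK_ne_zero]
    rw [show -(k : ℤ) + -((n : ℤ) * k) = -(((n : ℤ) + 1) * k) by ring,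
      show i + (n : ℤ) * l + l = i + ((n : ℤ) + 1) * l by ring]
  | pred n ih =>
    refine ih.trans ?_
    rw [h1 (i + (-(n : ℤ) - 1) * l), smul_smul, ← zpow_add₀ z.zK_ne_zero]
    rw [show -(k : ℤ) + -((-(n : ℤ) - 1) * k) = -(-(n : ℤ) * k) by ring,
      show i + (-(n : ℤ) - 1) * l + l = i + -(n : ℤ) * l by ring]

lemma mono_map (hm : ∀ i, Mono (S.Pi i)) {i j : ℤ} (h : i ≤ j) : Mono (S.F.map (homOfLE h)) := by
  induction j, h using Int.leInduction with
  | base => change Mono (S.F.map (𝟙 _)); rw [CategoryTheory.Functor.map_id]; infer_instance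
  | succ j h ih =>
    rw [← S.map_comp' h (lt_add_one j).le]
    have := hm j
    exact mono_comp _ _

/-- Over opens avoiding `∞` the condition defining the twist is empty, so a map over one period is
surjective. For general `i ≤ j` the map over enough periods to pass beyond `j` is surjective, and
injectivity of the remaining maps brings a preimage back to `j`. -/
lemma map_bijective (hm : ∀ i, Mono (S.Pi i)) {k l : ℕ} (hl : 0 < l) (h : S.IsPeriodic k l)
    {i j : ℤ} (hij : i ≤ j) (V : (C.CL L).Opens) (hV : V ≤ C.UL L) :
    Function.Bijective ((S.F.map (homOfLE hij)).app V) := by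
  have := mono_map hm hij
  refine ⟨app_injective_of_mono _ V, ?_⟩
  clear this
  have h1 : ∀ i : ℤ, Function.Surjective ((S.F.map (homOfLE (show i ≤ i + l by omega))).app V) := by
    intro i s
    have hs : (C.toAway L _).app V s ∈
        {s | C.InTwist (S.F.obj (i + l)) (-(k : ℤ)) V s} := fun x hx hxU => (hxU (hV hx)).elim
    rw [← h i V] at hs
    obtain ⟨t, ht⟩ := hs
    exact ⟨t, C.toAway_injective _ hV ht⟩
  have h2 : ∀ n : ℕ, ∀ i : ℤ, Function.Surjective
      ((S.F.map (homOfLE (show i ≤ i + n * l by nlinarith))).app V) := by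
    intro n
    induction n with
    | zero =>
      intro i s
      have : ∀ (j : ℤ) (hj : j = i) (h : i ≤ j) (s : Γ(S.F.obj j, V)),
          ∃ t, (S.F.map (homOfLE h)).app V t = s := by
        rintro j rfl h s
        refine ⟨s, ?_⟩
        change (S.F.map (𝟙 _)).app V s = s
        rw [CategoryTheory.Functor.map_id]; rfl
      exact this _ (by simp) _ s
    | succ n ih =>
      intro i s
      have : ∀ (j : ℤ) (hj : j = i + n * l + l) (h : i ≤ j) (s : Γ(S.F.obj j, V)),
          ∃ t, (S.F.map (homOfLE h)).app V t = s := by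
        rintro j rfl h s
        obtain ⟨t, rfl⟩ := h1 _ s
        obtain ⟨t, rfl⟩ := ih i t
        exact ⟨t, (S.map_app_app _ _ V t).symm⟩
      exact this _ (by push_cast; ring) _ s
  intro s
  obtain ⟨t, ht⟩ := h2 (j - i).toNat i ((S.F.map (homOfLE (show j ≤ i + (j - i).toNat * l by
    have : (((j - i).toNat : ℕ) : ℤ) = j - i := Int.toNat_of_nonneg (by omega)
    rw [this]; nlinarith))).app V s)
  refine ⟨t, ?_⟩
  have := mono_map hm (show j ≤ i + (j - i).toNat * l by
    have : (((j - i).toNat : ℕ) : ℤ) = j - i := Int.toNat_of_nonneg (by omega)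
    rw [this]; nlinarith)
  apply app_injective_of_mono (S.F.map (homOfLE (show j ≤ i + (j - i).toNat * l by
    have : (((j - i).toNat : ℕ) : ℤ) = j - i := Int.toNat_of_nonneg (by omega)
    rw [this]; nlinarith))) V
  rw [← ht, S.map_app_app]

/-- All `F_i` are placed in the generic fibre of `F_0` through `F_{min(i,0)}`, which maps to both
`F_i` and `F_0` isomorphically away from `∞`. -/
theorem exists_embs {r : ℕ} (hF : ∀ i, IsLocallyFreeOfRank (S.F.obj i) r)
    (hm : ∀ i, Mono (S.Pi i)) {k l : ℕ} (hl : 0 < l) (h : S.IsPeriodic k l) :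
    Nonempty (S.Embs (Fin r → (C.CL L).functionField)) := by
  have δ : ∀ i, GenEmb (S.F.obj i) (Fin r → (C.CL L).functionField) := fun i =>
    (exists_genEmb (hF i)).some
  have hinj : ∀ {i j : ℤ} (hij : i ≤ j) (V : (C.CL L).Opens),
      Function.Injective ((S.F.map (homOfLE hij)).app V) := fun hij V =>
    haveI := mono_map hm hij
    app_injective_of_mono _ V
  refine ⟨⟨fun i => GenEmb.map (S.F.map (homOfLE (min_le_left i 0))) (C.UL L)
    (fun V hV => map_bijective hm hl h _ V hV)
    (GenEmb.comap (S.F.map (homOfLE (min_le_right i 0))) (hinj _) (δ 0)) (δ i), ?_⟩⟩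
  intro i j hij V s
  by_cases hV : Nonempty V
  swap
  · have := subsingleton_sections (S.F.obj i) hV
    rw [Subsingleton.elim s 0, map_zero, map_zero, map_zero]
  have := nonempty_inf V (C.UL L)
  obtain ⟨t, ht⟩ := (map_bijective hm hl h (min_le_left i 0) (V ⊓ C.UL L) inf_le_right).2
    ((S.F.obj i).presheaf.map (homOfLE (inf_le_left : V ⊓ C.UL L ≤ V)).op s)
  rw [GenEmb.map_γ _ _ _ _ _ (inf_le_left : V ⊓ C.UL L ≤ V) inf_le_right s t ht,
    GenEmb.map_γ _ _ _ _ _ (inf_le_left : V ⊓ C.UL L ≤ V) inf_le_right _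
      ((S.F.map (homOfLE (min_le_min_right 0 hij))).app _ t)]
  · change (δ 0).γ _ _ = (δ 0).γ _ _
    rw [S.map_app_app]
  · rw [S.map_app_app, ← app_map_apply, ← ht, S.map_app_app]

end TauSheafData

end

/-! ### Extension of maps to the generic fibre, and the Frobenius of a `τ`-sheaf. -/

noncomputable section

open PointedCurve (map_map_apply map_map_comm app_map_apply modHom modHom_app)

variable {Fq : Type u} [Field Fq] {C : PointedCurve Fq} {L : Type u} [Field L]
  [Algebra Fq L]

namespace GenEmb

variable {F : (C.CL L).Modules} {W : Type*} [AddCommGroup W] [Module (C.CL L).functionField W]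
  (γ : GenEmb F W)

lemma γ_ALtoGamma_smul (a : C.AL L) (s : Γ(F, C.UL L)) :
    γ.γ (C.UL L) (C.ALtoGamma L a • s) = C.ALtoK L a • γ.γ (C.UL L) s := γ.γ_smul _ s

variable [FiniteDimensional (C.CL L).functionField W] {r : ℕ} (hF : IsLocallyFreeOfRank F r)
  (hr : Module.finrank (C.CL L).functionField W = r)

include hF hr

lemma exists_ALtoK_smul_mem_range {x : C.CL L} (hx : x ∈ C.UL L) {w : W} (hw : w ∈ γ.lat x) :
    ∃ a : C.AL L, C.ALtoK L a ≠ 0 ∧ (C.ALtoK L a)⁻¹ ∈ locRing (C.CL L) x ∧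
      ∃ s, γ.γ (C.UL L) s = C.ALtoK L a • w := by
  obtain ⟨a, ha, s, e⟩ := γ.exists_smul_mem_range hF hr (C.isAffineOpen_UL L) hx hw
  obtain ⟨a, rfl⟩ := (C.ALtoGamma_bijective L).2 a
  obtain ⟨h1, h2⟩ := (isUnit_germ_iff hx _).1 ha
  exact ⟨a, h1, h2, s, e⟩

lemma span_range : Submodule.span (C.CL L).functionField (Set.range (γ.γ (C.UL L))) = ⊤ := by
  refine eq_top_iff.2 fun w _ => ?_
  obtain ⟨a, h1, h2, s, e⟩ := γ.exists_ALtoK_smul_mem_range hF hr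
    (genericPoint_mem (C.UL L)) (γ.mem_lat_genericPoint hF hr w)
  rw [← inv_smul_smul₀ h1 w, ← e]
  exact Submodule.smul_mem _ _ (Submodule.subset_span ⟨s, rfl⟩)

/-- Semilinear maps on sections over `C_L ∖ {∞}` extend to the generic stalk. -/
theorem exists_extension {W' : Type*} [AddCommGroup W'] [Module (C.CL L).functionField W']
    (φ : (C.CL L).functionField →+* (C.CL L).functionField) (T₀ : Γ(F, C.UL L) →+ W')
    (hT₀ : ∀ (a : C.AL L) m, T₀ (C.ALtoGamma L a • m) = φ (C.ALtoK L a) • T₀ m) :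
    ∃ T : W →+ W', (∀ c w, T (c • w) = φ c • T w) ∧ ∀ m, T (γ.γ (C.UL L) m) = T₀ m := by
  letI : Module (C.AL L) Γ(F, C.UL L) := Module.compHom _ (C.ALtoGamma L)
  refine exists_semilinear_extension (C.ALtoK L) (fun c => ?_) φ (γ.γ (C.UL L)) (γ.inj _)
    γ.γ_ALtoGamma_smul (γ.span_range hF hr) T₀ hT₀
  obtain ⟨g, h, h0, e⟩ := C.exists_ALtoK_div c
  exact ⟨g, h, (map_ne_zero_iff _ C.ALtoK_injective).2 h0, e⟩

end GenEmb

variable [Fintype Fq]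

/-- This unwinds the definition of the motive: its semilinear map followed by `Π_0` is `τ_0` on
sections. -/
lemma apply_homEquiv_comp_inv {R : Type u} [CommRing R] (f : R →+* R) {M N : ModuleCat.{u} R}
    (φ : M ⟶ (ModuleCat.restrictScalars f).obj N) (g : M ⟶ N) [IsIso g] (m : M) :
    g ((ModuleCat.extendRestrictScalarsAdj f).homEquiv M M
      (((ModuleCat.extendRestrictScalarsAdj f).homEquiv _ _).symm φ ≫ inv g) m) = φ m := by
  have h : (ModuleCat.extendRestrictScalarsAdj f).homEquiv M M
      (((ModuleCat.extendRestrictScalarsAdj f).homEquiv _ _).symm φ ≫ inv g) ≫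
        (ModuleCat.restrictScalars f).map g = φ := by
    rw [Adjunction.homEquiv_naturality_right, Equiv.apply_symm_apply, Category.assoc,
      ← Functor.map_comp, IsIso.inv_hom_id, CategoryTheory.Functor.map_id, Category.comp_id]
  exact congr($h m)

namespace AbelianTauSheaf

variable {c : LPoint C L} {r d : ℕ} (S : AbelianTauSheaf c r d)

/-- The semilinear map of the motive on sections. -/
def frobSec : Γ(S.F.obj 0, C.UL L) →+ Γ(S.F.obj 0, C.UL L) :=
  AddMonoidHom.mk' (fun m => S.motive.semi m) (fun m m' => map_add S.motive.semi.hom m m')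

lemma frobSec_smul (a : C.AL L) (m : Γ(S.F.obj 0, C.UL L)) :
    S.frobSec (C.ALtoGamma L a • m) = C.ALtoGamma L (C.sigmaA L a) • S.frobSec m :=
  S.motive.semi.hom.map_smul a m

lemma Pi_frobSec (m : Γ(S.F.obj 0, C.UL L)) :
    (S.Pi 0).app (C.UL L) (S.frobSec m) =
      (S.F.obj (0 + 1)).presheaf.map (homOfLE (C.sigma_UL L).ge).op ((adjσ (S.τ 0)).app (C.UL L) m) :=
  haveI := S.isIso_Pi 0
  apply_homEquiv_comp_inv (C.sigmaA L) (C.gammaSemi (adjσ (S.τ 0))) ((C.gammaU L).map (S.Pi 0)) m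

/-- The operator is the extension of the semilinear map of the motive, that is of `τ_0` over `C_L ∖
{∞}`. Over that open set the `Π`'s are bijective and commute with the `τ`'s, so each `τ_i` has the
same extension; and a morphism is determined by its values over this affine open set. -/
theorem exists_frob {W : Type*} [AddCommGroup W] [Module (C.CL L).functionField W]
    [FiniteDimensional (C.CL L).functionField W] (γ : S.Embs W)
    (hr : Module.finrank (C.CL L).functionField W = r) :
    ∃ T : W →+ W, (∀ a w, T (a • w) = C.sigmaK L a • T w) ∧
      (∀ m : Γ(S.F.obj 0, C.UL L), T ((γ.γ 0).γ _ m) = (γ.γ 0).γ _ (S.frobSec m)) ∧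
      ∀ (i : ℤ) V s, (γ.γ (i + 1)).γ (C.sigma L ⁻¹ᵁ V) ((adjσ (S.τ i)).app V s) =
        T ((γ.γ i).γ V s) := by
  obtain ⟨T, hT, hT'⟩ := (γ.γ 0).exists_extension (S.isAbelian.locallyFree 0) hr (C.sigmaK L)
    (((γ.γ 0).γ (C.UL L)).comp S.frobSec) (fun a m => by
      rw [AddMonoidHom.comp_apply, S.frobSec_smul, GenEmb.γ_ALtoGamma_smul, ← C.sigmaK_ALtoK]
      rfl)
  refine ⟨T, hT, hT', fun i => ?_⟩
  apply GenEmb.app_eq_of_affine _ _ (S.isAbelian.locallyFree i) hr _ T hT _ (C.isAffineOpen_UL L)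
  obtain ⟨k, l, -, hl, -, h⟩ := S.isAbelian.periodic
  have hb := fun {i j : ℤ} (hij : i ≤ j) =>
    (TauSheafData.map_bijective S.isAbelian.mono_Pi hl h hij (C.UL L) le_rfl).2
  have h0 : ∀ s, (γ.γ (0 + 1)).γ (C.sigma L ⁻¹ᵁ (C.UL L)) ((adjσ (S.τ 0)).app (C.UL L) s) =
        T ((γ.γ 0).γ (C.UL L) s) := by
    intro s
    refine Eq.trans ?_ (hT' s).symm
    refine Eq.trans ?_ (γ.compat (lt_add_one 0).le _ _)
    refine Eq.trans ?_ (congrArg _ (S.Pi_frobSec s).symm)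
    exact ((γ.γ (0 + 1)).γ_map _ _).symm
  have hc : ∀ {i j : ℤ} (hij : i ≤ j) (s : Γ(S.F.obj i, C.UL L)),
      (γ.γ (j + 1)).γ (C.sigma L ⁻¹ᵁ (C.UL L)) ((adjσ (S.τ j)).app (C.UL L)
        ((S.F.map (homOfLE hij)).app _ s)) =
      (γ.γ (i + 1)).γ (C.sigma L ⁻¹ᵁ (C.UL L)) ((adjσ (S.τ i)).app (C.UL L) s) := by
    intro i j hij s
    refine Eq.trans ?_ (γ.compat (add_le_add_left hij 1) _ _)
    exact congrArg _ congr(($(S.comm_map hij)).app (C.UL L) s)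
  rcases le_total i 0 with hi | hi
  · intro s
    rw [← hc hi, h0, γ.compat]
  · intro s
    obtain ⟨s, rfl⟩ := hb hi s
    rw [hc hi, h0, γ.compat]

end AbelianTauSheaf

end

/-! ### Part 2: morphisms of motives extend up to a twist. -/

noncomputable section

open PointedCurve (map_map_apply map_map_comm app_map_apply modHom modHom_app)

variable {Fq : Type u} [Field Fq] [Fintype Fq] {C : PointedCurve Fq} {L : Type u} [Field L]
  [Algebra Fq L]

lemma TauModule.Hom.semi_comm {M N : TauModule C L} (f : M.Hom N) :
    M.semi ≫ (ModuleCat.restrictScalars (C.sigmaA L)).map f.f = f.f ≫ N.semi := by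
  rw [TauModule.semi, TauModule.semi, ← Adjunction.homEquiv_naturality_right,
    ← Adjunction.homEquiv_naturality_left, f.comm]

lemma semilinear_ext {K W W' : Type*} [Field K] [AddCommGroup W] [Module K W] [AddCommGroup W']
    [Module K W'] (φ : K →+* K) {s : Set W} (hs : Submodule.span K s = ⊤) {T T' : W →+ W'}
    (hT : ∀ c w, T (c • w) = φ c • T w) (hT' : ∀ c w, T' (c • w) = φ c • T' w)
    (h : ∀ w ∈ s, T w = T' w) (w : W) : T w = T' w := by
  have hw : w ∈ Submodule.span K s := by rw [hs]; trivial
  induction hw using Submodule.span_induction with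
  | mem x hx => exact h x hx
  | zero => rw [map_zero, map_zero]
  | add x y _ _ hx hy => rw [map_add, map_add, hx, hy]
  | smul c x _ hx => rw [hT, hT', hx]

namespace TauSheafData

lemma Embs.mem_lat_inf_shift {S : TauSheafData C L} {W : Type*} [AddCommGroup W] [Module (C.CL L).functionField W]
    (γ : S.Embs W) {k l : ℕ} (h : S.IsPeriodic k l) (z : C.Uniformizer) {i j : ℤ} {w : W} (n : ℤ)
    (hj : i + n * l = j) (hw : w ∈ (γ.γ i).lat (C.infLPt L)) :
    z.zK L ^ (-(n * k)) • w ∈ (γ.γ j).lat (C.infLPt L) :=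
  hj ▸ (γ.mem_lat_inf_iff h z i n w).1 hw

end TauSheafData

namespace AbelianTauSheaf

variable {c : LPoint C L} {r d r' d' : ℕ} (S : AbelianTauSheaf c r d) (T : AbelianTauSheaf c r' d')

/-- A morphism of motives on sections. -/
def homSec {S : AbelianTauSheaf c r d} {T : AbelianTauSheaf c r' d'} (f : S.motive.Hom T.motive) :
    Γ(S.F.obj 0, C.UL L) →+ Γ(T.F.obj 0, C.UL L) :=
  AddMonoidHom.mk' (fun m => f.f m) (fun m m' => map_add f.f.hom m m')

variable {S T} (f : S.motive.Hom T.motive)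

lemma homSec_smul (a : C.AL L) (m : Γ(S.F.obj 0, C.UL L)) :
    homSec f (C.ALtoGamma L a • m) = C.ALtoGamma L a • homSec f m :=
  f.f.hom.map_smul a m

lemma homSec_frobSec (m : Γ(S.F.obj 0, C.UL L)) : homSec f (S.frobSec m) = T.frobSec (homSec f m) :=
  congr($(f.semi_comm) m)

variable (S T) in
-- For nonzero rank the weight is `k / l`. If `r' ≠ 0`, then `l' d' = k' r'` forces a positive
-- weight, which rules out `r = 0` with its conventional weight zero.
lemma exists_periods (h : S.weight = T.weight) (hr' : r' ≠ 0) : ∃ k l k' l' : ℕ, 0 < l ∧ 0 < l' ∧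
    k * l' = k' * l ∧ S.IsPeriodic k l ∧ T.IsPeriodic k' l' := by
  obtain ⟨k, l, hk, hl, e, hS⟩ := S.isAbelian.periodic
  obtain ⟨k', l', hk', hl', e', hT⟩ := T.isAbelian.periodic
  refine ⟨k, l, k', l', hl, hl', ?_, hS, hT⟩
  rw [weight, weight, if_neg hr'] at h
  have hd' : (d' : ℚ) ≠ 0 := fun h0 => by
    have : d' = 0 := by exact_mod_cast h0
    rw [this, mul_zero] at e'
    rcases Nat.mul_eq_zero.1 e'.symm with h | h <;> omega
  have hr0 : (r' : ℚ) ≠ 0 := by exact_mod_cast hr'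
  have hr : r ≠ 0 := fun h0 => by
    rw [if_pos h0] at h
    exact div_ne_zero hd' hr0 h.symm
  rw [if_neg hr] at h
  have hr1 : (r : ℚ) ≠ 0 := by exact_mod_cast hr
  rw [div_eq_div_iff hr1 hr0] at h
  have h1 : (l : ℚ) * d = k * r := by exact_mod_cast e
  have h2 : (l' : ℚ) * d' = k' * r' := by exact_mod_cast e'
  have h3 : (k * l' : ℚ) * (r * r') = (k' * l) * (r * r') := by
    linear_combination (-l' * r' : ℚ) * h1 + (l * r : ℚ) * h2 + (l' * l : ℚ) * h
  exact_mod_cast mul_right_cancel₀ (mul_ne_zero hr1 hr0) h3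

/-- The content of Part 2. Away from `∞` sections generate the lattices and `t` preserves them. At
`∞` the index is reduced modulo the common period `l l'`; a shift by a multiple of that period
multiplies both chains by the same power of `z`, because the weights agree, and so changes no bound.
-/
theorem exists_lat_bound {W W' : Type*} [AddCommGroup W] [Module (C.CL L).functionField W]
    [FiniteDimensional (C.CL L).functionField W] [AddCommGroup W'] [Module (C.CL L).functionField W']
    [FiniteDimensional (C.CL L).functionField W']
    (γ : S.Embs W) (δ : T.Embs W') (hW : Module.finrank (C.CL L).functionField W = r)
    (hW' : Module.finrank (C.CL L).functionField W' = r') (t : W →ₗ[(C.CL L).functionField] W')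
    (ht : ∀ s, t ((γ.γ 0).γ _ s) = (δ.γ 0).γ _ (homSec f s)) (h : S.weight = T.weight) :
    ∃ m : ℤ, ∀ i x, ∀ w ∈ (γ.γ i).lat x, t w ∈ ((δ.γ i).twistEmb m).lat x := by
  by_cases hr' : r' = 0
  · have : Subsingleton W' := Module.finrank_zero_iff.1 (hW'.trans hr')
    refine ⟨0, fun i x w _ => ?_⟩
    rw [Subsingleton.elim (t w) 0]
    exact zero_mem _
  obtain ⟨k, l, k', l', hl, hl', e, hS, hT⟩ := exists_periods S T h hr'
  let z := C.nonempty_uniformizer.some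
  let P : ℤ := l * l'
  have hP : 0 < P := by positivity
  -- The extreme case is `t` from the lattice of index `P` to that of index `0`. Finitely many basis
  -- vectors give one pole bound `m`, and it serves all indices between.
  obtain ⟨V, hV, b, hb⟩ := (γ.γ P).exists_frame (S.isAbelian.locallyFree P) hW (C.infLPt L)
  choose N hN using fun j => (δ.γ 0).exists_pow_smul_mem_lat (T.isAbelian.locallyFree 0) hW'
    z.val_zK_lt_one (t (b j))
  obtain ⟨m, hm⟩ : ∃ m : ℕ, ∀ w ∈ (γ.γ P).lat (C.infLPt L),
      z.zK L ^ m • t w ∈ (δ.γ 0).lat (C.infLPt L) := by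
    refine ⟨Finset.univ.sup N, fun w hw => ?_⟩
    rw [← b.sum_repr w, map_sum, Finset.smul_sum]
    refine Submodule.sum_mem _ fun j _ => ?_
    rw [map_smul, smul_comm]
    exact (δ.γ 0).smul_mem_lat ((hb _ hV w).1 hw j) (hN j _ (Finset.le_sup (Finset.mem_univ j)))
  refine ⟨m, fun i x w hw => ?_⟩
  by_cases hx : x ∈ C.UL L
  · rw [GenEmb.mem_lat_twistEmb_of_mem_UL _ _ hx, δ.mem_lat_iff_of_mem_UL hl' hT hx i 0]
    rw [γ.mem_lat_iff_of_mem_UL hl hS hx i 0] at hw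
    obtain ⟨a, h1, h2, s, e⟩ := (γ.γ 0).exists_ALtoK_smul_mem_range (S.isAbelian.locallyFree 0) hW hx hw
    rw [← inv_smul_smul₀ h1 w, ← e, map_smul, ht]
    exact (δ.γ 0).smul_mem_lat h2 ((δ.γ 0).γ_mem_lat hx _)
  · obtain rfl : x = C.infLPt L := by
      by_contra h0
      exact hx ((C.mem_UL_iff L x).2 h0)
    rw [GenEmb.mem_lat_twistEmb_inf _ z]
    have h0 := Int.emod_nonneg i hP.ne'
    have h1 := Int.emod_lt_of_pos i hP
    have h2 : i % P + l * l' * (i / P) = i := Int.emod_add_mul_ediv i P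
    -- Shift `i` to its remainder modulo `P`, enlarge to the lattice of index `P`, apply the bound,
    -- enlarge the lattice of index `0` to that of the remainder, and shift back. The exponents of
    -- `z` from the two shifts cancel by `k l' = k' l`.
    have h3 := γ.mem_lat_inf_shift hS z (j := i % P) (-(i / P * l')) (by linear_combination -h2) hw
    have h4 := δ.lat_mono h0 (hm _ (γ.lat_mono h1.le h3))
    have h5 := δ.mem_lat_inf_shift hT z (j := i) (i / P * l) (by linear_combination h2) h4
    rw [map_smul, smul_comm (z.zK L ^ m), smul_smul, ← zpow_add₀ z.zK_ne_zero] at h5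
    have e' : (k : ℤ) * l' = k' * l := by exact_mod_cast e
    rw [show -(i / P * l * k') + -(-(i / P * l') * (k : ℤ)) = 0 by linear_combination (i / P) * e',
      zpow_zero, one_smul] at h5
    rw [zpow_natCast]
    exact h5

theorem exists_hom_twist (h : S.weight = T.weight) :
    ∃ (m : ℤ) (g : S.toTauSheafData.Hom (T.toTauSheafData.twist m)),
          ∀ s, f.f s = S.motiveMap T m g s := by
  obtain ⟨k, l, -, hl, -, hS⟩ := S.isAbelian.periodic
  obtain ⟨k', l', -, hl', -, hT⟩ := T.isAbelian.periodic
  obtain ⟨γ⟩ := TauSheafData.exists_embs S.isAbelian.locallyFree S.isAbelian.mono_Pi hl hS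
  obtain ⟨δ⟩ := TauSheafData.exists_embs T.isAbelian.locallyFree T.isAbelian.mono_Pi hl' hT
  have hr : Module.finrank (C.CL L).functionField (Fin r → (C.CL L).functionField) = r :=
    Module.finrank_fin_fun _
  have hr' : Module.finrank (C.CL L).functionField (Fin r' → (C.CL L).functionField) = r' :=
    Module.finrank_fin_fun _
  obtain ⟨T₁, hT₁, hT₁', hT₁''⟩ := S.exists_frob γ hr
  obtain ⟨T₂, hT₂, hT₂', hT₂''⟩ := T.exists_frob δ hr'
  obtain ⟨t₀, ht₀, ht⟩ := (γ.γ 0).exists_extension (S.isAbelian.locallyFree 0) hr (RingHom.id _)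
    (((δ.γ 0).γ (C.UL L)).comp (homSec f)) (fun a m => by
      rw [AddMonoidHom.comp_apply, homSec_smul, GenEmb.γ_ALtoGamma_smul]
      rfl)
  let t : (Fin r → (C.CL L).functionField) →ₗ[(C.CL L).functionField] (Fin r' → (C.CL L).functionField) :=
    { t₀ with map_smul' := ht₀ }
  -- Both composites are `σ`-semilinear and agree on the sections over `C_L ∖ {∞}`, which span the
  -- generic fibre.
  have hcomm : ∀ w, t (T₁ w) = T₂ (t w) := by
    refine semilinear_ext (C.sigmaK L) ((γ.γ 0).span_range (S.isAbelian.locallyFree 0) hr)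
      (T := t₀.comp T₁) (T' := T₂.comp t₀) (fun c w => ?_) (fun c w => ?_) ?_
    · rw [AddMonoidHom.comp_apply, hT₁, ht₀]; rfl
    · rw [AddMonoidHom.comp_apply, ht₀, hT₂]; rfl
    · rintro _ ⟨s, rfl⟩
      rw [AddMonoidHom.comp_apply, AddMonoidHom.comp_apply, hT₁', ht, ht, AddMonoidHom.comp_apply,
        AddMonoidHom.comp_apply, hT₂', homSec_frobSec]
  obtain ⟨m, hm⟩ := exists_lat_bound f γ δ hr hr' t ht h
  choose g hg using fun i => (γ.γ i).exists_hom ((δ.γ i).twistEmb m) t.toAddMonoidHom (t.map_smul) (hm i)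
  refine ⟨m, ⟨⟨g, fun i j hij => ?_⟩, fun i => ?_⟩, fun s => ?_⟩
  · ext V s
    apply ((δ.γ j).twistEmb m).inj V
    refine (hg j V _).trans ?_
    refine Eq.trans ?_ ((δ.γ i).twistEmb_map (δ.γ j) (T.F.map hij) id
      (fun V s => δ.compat (leOfHom hij) V s) m V _).symm
    exact (congrArg t (γ.compat (leOfHom hij) V s)).trans (hg i V s).symm
  · apply ((Scheme.Modules.pullbackPushforwardAdjunction (C.sigma L)).homEquiv _ _).injective
    rw [Adjunction.homEquiv_naturality_right, Adjunction.homEquiv_naturality_left]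
    have h2 : (Scheme.Modules.pullbackPushforwardAdjunction (C.sigma L)).homEquiv _ _
        ((T.toTauSheafData.twist m).τ i) = C.twistSemi m (adjσ (T.τ i)) :=
      Equiv.apply_symm_apply _ _
    rw [h2]
    ext V s
    by_cases hV : Nonempty V
    · apply ((δ.γ (i + 1)).twistEmb m).inj (C.sigma L ⁻¹ᵁ V)
      refine (hg (i + 1) (C.sigma L ⁻¹ᵁ V) _).trans ?_
      refine Eq.trans ?_ ((δ.γ i).twistEmb_twistSemi (δ.γ (i + 1)) (adjσ (T.τ i)) T₂
        (hT₂'' i) m V _).symm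
      exact (congrArg t (hT₁'' i V s)).trans ((hcomm _).trans (congrArg T₂ (hg i V s).symm))
    · have := subsingleton_sections (((T.toTauSheafData.twist m).F.obj (i + 1)))
        (V := C.sigma L ⁻¹ᵁ V) (fun ⟨x⟩ => hV ⟨⟨_, x.2⟩⟩)
      exact Subsingleton.elim (α := Γ((T.toTauSheafData.twist m).F.obj (i + 1), C.sigma L ⁻¹ᵁ V)) _ _
  · apply (δ.γ 0).inj
    refine Eq.trans ?_ ((δ.γ 0).twistEmb_untwist m _).symm
    exact (ht s).symm.trans (hg 0 _ s).symm

end AbelianTauSheaf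

end

/-! ### Subsheaves, and sections of images and kernels. -/

noncomputable section

open PointedCurve (map_map_apply map_map_comm app_map_apply modHom modHom_app)

section LocalSub

/-- A subsheaf of a sheaf of modules. -/
structure LocalSub {X : Scheme.{u}} (G : X.Modules) where
  carrier (V : X.Opens) : Submodule Γ(X, V) Γ(G, V)
  map_mem {V V' : X.Opens} (h : V' ≤ V) {s : Γ(G, V)} (hs : s ∈ carrier V) :
    G.presheaf.map (homOfLE h).op s ∈ carrier V'
  of_local {V : X.Opens} (s : Γ(G, V)) (hs : ∀ x ∈ V, ∃ (V' : X.Opens) (_ : x ∈ V') (hV : V' ≤ V),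
    G.presheaf.map (homOfLE hV).op s ∈ carrier V') : s ∈ carrier V

namespace LocalSub

variable {X Y : Scheme.{u}} {G : X.Modules} (N : LocalSub G)

/-- The corresponding presheaf of submodules. -/
def toPresheafSub : PresheafOfModules.Submodule G.val where
  obj V := N.carrier V.unop
  map f := fun _ hs => N.map_mem (leOfHom f.unop) hs

lemma isSheaf : Presheaf.IsSheaf (Opens.grothendieckTopology X)
    N.toPresheafSub.toPresheafOfModules.presheaf := by
  have hM : TopCat.Presheaf.IsSheafUniqueGluing G.presheaf :=
    (TopCat.Presheaf.isSheaf_iff_isSheafUniqueGluing _).1 G.isSheaf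
  refine (TopCat.Presheaf.isSheaf_iff_isSheafUniqueGluing
    N.toPresheafSub.toPresheafOfModules.presheaf).2 ?_
  intro ι V sf hsf
  obtain ⟨s, hs, hu⟩ := hM V (fun i => (sf i).1) (fun i j => congrArg Subtype.val (hsf i j))
  have hs' : s ∈ N.carrier (iSup V) := by
    apply N.of_local
    intro x hx
    obtain ⟨i, hi⟩ := Opens.mem_iSup.1 hx
    refine ⟨V i, hi, le_iSup V i, ?_⟩
    have e : G.presheaf.map (homOfLE (le_iSup V i)).op s = (sf i).1 := hs i
    rw [e]
    exact (sf i).2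
  refine ⟨⟨s, hs'⟩, fun i => Subtype.ext (hs i), ?_⟩
  intro y hy
  exact Subtype.ext (hu y.1 fun i => congrArg Subtype.val (hy i))

/-- The sheaf of modules of a subsheaf. -/
def obj : X.Modules :=
  (⟨N.toPresheafSub.toPresheafOfModules, N.isSheaf⟩ : SheafOfModules X.ringCatSheaf)

/-- The inclusion of a subsheaf. -/
def ι : N.obj ⟶ G :=
  (⟨N.toPresheafSub.ι⟩ : SheafOfModules.Hom (R := X.ringCatSheaf) _ _)

lemma ι_injective (V : X.Opens) : Function.Injective (N.ι.app V) := Subtype.val_injective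

lemma ι_mem {V : X.Opens} (s : Γ(N.obj, V)) : N.ι.app V s ∈ N.carrier V := s.2

lemma exists_ι_eq {V : X.Opens} {s : Γ(G, V)} (hs : s ∈ N.carrier V) : ∃ t, N.ι.app V t = s :=
  ⟨⟨s, hs⟩, rfl⟩

end LocalSub

lemma mono_of_app_injective {X : Scheme.{u}} {F G : X.Modules} (f : F ⟶ G)
    (h : ∀ V, Function.Injective (f.app V)) : Mono f := by
  refine ⟨fun a b e => ?_⟩
  ext V s
  exact h V congr(($e).app V s)

namespace LocalSub

variable {X Y : Scheme.{u}} {G : X.Modules} (N : LocalSub G)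

instance : Mono N.ι := mono_of_app_injective _ N.ι_injective

lemma exists_lift_push {F : Y.Modules} (f : X ⟶ Y) (ψ : F ⟶ (Scheme.Modules.pushforward f).obj G)
    (h : ∀ V s, ψ.app V s ∈ N.carrier (f ⁻¹ᵁ V)) :
    ∃ ψ' : F ⟶ (Scheme.Modules.pushforward f).obj N.obj,
      ψ' ≫ (Scheme.Modules.pushforward f).map N.ι = ψ := by
  refine ⟨modHom (N := (Scheme.Modules.pushforward f).obj N.obj)
    (fun V =>
      { toFun := fun s => ⟨ψ.app V s, h V s⟩
        map_zero' := Subtype.ext (map_zero (ψ.app V).hom)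
        map_add' := fun s s' => Subtype.ext (map_add (ψ.app V).hom s s') })
    (fun _ _ h s => Subtype.ext (app_map_apply ψ h s))
    (fun V r s => Subtype.ext (Scheme.Modules.Hom.app_smul (φ := ψ) (U := V) r s)), ?_⟩
  ext V s
  rfl

lemma exists_lift {F : X.Modules} (ψ : F ⟶ G) (h : ∀ V s, ψ.app V s ∈ N.carrier V) :
    ∃ ψ' : F ⟶ N.obj, ψ' ≫ N.ι = ψ := by
  refine ⟨modHom
    (fun V =>
      { toFun := fun s => ⟨ψ.app V s, h V s⟩
        map_zero' := Subtype.ext (map_zero (ψ.app V).hom)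
        map_add' := fun s s' => Subtype.ext (map_add (ψ.app V).hom s s') })
    (fun _ _ h s => Subtype.ext (app_map_apply ψ h s))
    (fun V r s => Subtype.ext (Scheme.Modules.Hom.app_smul (φ := ψ) (U := V) r s)), ?_⟩
  ext V s
  rfl

/-- A map from a pullback has values in a subsheaf if the adjoint map has. -/
lemma exists_lift_pullback {F : Y.Modules} (f : X ⟶ Y) (φ : (Scheme.Modules.pullback f).obj F ⟶ G)
    (h : ∀ V s, ((Scheme.Modules.pullbackPushforwardAdjunction f).homEquiv _ _ φ).app V s ∈
      N.carrier (f ⁻¹ᵁ V)) : ∃ φ', φ' ≫ N.ι = φ := by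
  obtain ⟨ψ', h'⟩ := N.exists_lift_push f _ h
  refine ⟨((Scheme.Modules.pullbackPushforwardAdjunction f).homEquiv _ _).symm ψ', ?_⟩
  apply ((Scheme.Modules.pullbackPushforwardAdjunction f).homEquiv _ _).injective
  rw [Adjunction.homEquiv_naturality_right, Equiv.apply_symm_apply, h']

end LocalSub

variable {X : Scheme.{u}}

/-- The subsheaf of sections that are locally in the image of a morphism. -/
def imageSub {G Q : X.Modules} (π : G ⟶ Q) : LocalSub Q where
  carrier V :=
    { carrier := {q | ∀ x ∈ V, ∃ (V' : X.Opens) (_ : x ∈ V') (hV : V' ≤ V) (s : Γ(G, V')),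
        π.app V' s = Q.presheaf.map (homOfLE hV).op q}
      zero_mem' := fun x hx => ⟨V, hx, le_rfl, 0, by rw [map_zero, map_zero]⟩
      add_mem' := by
        intro q q' h h' x hx
        obtain ⟨V₁, h1, hV1, s, e⟩ := h x hx
        obtain ⟨V₂, h2, hV2, s', e'⟩ := h' x hx
        refine ⟨V₁ ⊓ V₂, ⟨h1, h2⟩, inf_le_left.trans hV1,
          G.presheaf.map (homOfLE inf_le_left).op s + G.presheaf.map (homOfLE inf_le_right).op s', ?_⟩
        rw [map_add, map_add, app_map_apply, app_map_apply, e, e', map_map_apply, map_map_apply]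
      smul_mem' := by
        intro a q h x hx
        obtain ⟨V₁, h1, hV1, s, e⟩ := h x hx
        refine ⟨V₁, h1, hV1, X.presheaf.map (homOfLE hV1).op a • s, ?_⟩
        rw [Scheme.Modules.Hom.app_smul, e, Scheme.Modules.map_smul] }
  map_mem {V V'} hV q h x hx := by
    obtain ⟨V₁, h1, hV1, s, e⟩ := h x (hV hx)
    refine ⟨V₁ ⊓ V', ⟨h1, hx⟩, inf_le_right, G.presheaf.map (homOfLE inf_le_left).op s, ?_⟩
    rw [app_map_apply, e, map_map_apply, map_map_apply]
  of_local {V} q h x hx := by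
    obtain ⟨V₁, h1, hV1, h'⟩ := h x hx
    obtain ⟨V₂, h2, hV2, s, e⟩ := h' x h1
    exact ⟨V₂, h2, hV2.trans hV1, s, by rw [e, map_map_apply]⟩

/-- Epimorphisms of sheaves of modules are locally surjective. -/
theorem exists_local_preimage {G Q : X.Modules} (π : G ⟶ Q) [Epi π] {V : X.Opens} (q : Γ(Q, V))
    {x : X} (hx : x ∈ V) : ∃ (V' : X.Opens) (_ : x ∈ V') (hV : V' ≤ V) (s : Γ(G, V')),
        π.app V' s = Q.presheaf.map (homOfLE hV).op q := by
  obtain ⟨π', h⟩ := (imageSub π).exists_lift π (fun V s x hx =>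
    ⟨V, hx, le_rfl, s, (congr($(Q.presheaf.map_id (op V)) (π.app V s))).symm⟩)
  -- The epimorphism factors through the subsheaf of local images, whose inclusion is then both mono
  -- and epi, hence an isomorphism.
  have h1 : Epi (imageSub π).ι := by
    have : Epi (π' ≫ (imageSub π).ι) := by rw [h]; infer_instance
    exact epi_of_epi π' _
  have h2 : IsIso (imageSub π).ι := isIso_of_mono_of_epi _
  have h3 : IsIso ((imageSub π).ι.app V) := inferInstance
  obtain ⟨t, rfl⟩ := ((ConcreteCategory.isIso_iff_bijective ((imageSub π).ι.app V)).1 h3).2 q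
  exact (imageSub π).ι_mem t x hx

/-- A section in the kernel of the cokernel of a subsheaf lies in the subsheaf. -/
theorem mem_of_cokernel_π_eq_zero {F G : X.Modules} (ι : F ⟶ G) [Mono ι] {V : X.Opens} (s : Γ(G, V))
    (hs : (Limits.cokernel.π ι).app V s = 0) : ∃ t, ι.app V t = s := by
  let S : ShortComplex X.Modules := ShortComplex.mk ι (Limits.cokernel.π ι) (Limits.cokernel.condition ι)
  have h0 : S.Exact := ShortComplex.exact_cokernel ι
  -- Sections over `V` preserve kernels, so exactness of the sequence up to its cokernel survives on
  -- the left.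
  let Φ : X.Modules ⥤ Ab := Scheme.Modules.toPresheaf X ⋙ (evaluation _ _).obj (op V)
  have : Φ.PreservesZeroMorphisms := ⟨fun _ _ => rfl⟩
  have : Limits.PreservesLimit (Limits.parallelPair S.g 0) (Scheme.Modules.toPresheaf X) := inferInstance
  have : Limits.PreservesLimit (Limits.parallelPair S.g 0) Φ :=
    haveI : Limits.PreservesLimitsOfShape Limits.WalkingParallelPair
        ((evaluation (TopologicalSpace.Opens X)ᵒᵖ Ab.{u}).obj (op V)) :=
      Limits.evaluation_preservesLimitsOfShape _
    Limits.comp_preservesLimit (Scheme.Modules.toPresheaf X)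
      ((evaluation (TopologicalSpace.Opens X)ᵒᵖ Ab.{u}).obj (op V))
  have h1 : (S.map Φ).Exact := by
    have : Mono S.f := ‹Mono ι›
    exact h0.map_of_mono_of_preservesKernel Φ inferInstance inferInstance
  exact (ShortComplex.ab_exact_iff _).1 h1 s hs

end LocalSub

end

/-! ### Quotients of a sheaf described by lattices. -/

noncomputable section

open PointedCurve (map_map_apply map_map_comm app_map_apply modHom modHom_app)

namespace GenEmb

variable {X : Scheme.{u}} [IsIntegral X] {G : X.Modules} {W : Type*} [AddCommGroup W]
  [Module X.functionField W] (δ : GenEmb G W) (N : ∀ x : X, Submodule (locRing X x) W)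

/-- The subsheaf of sections whose germs lie in given submodules. -/
def latSub : LocalSub G where
  carrier V :=
    { carrier := {s | ∀ x ∈ V, δ.γ V s ∈ N x}
      zero_mem' := fun x _ => by rw [map_zero]; exact zero_mem _
      add_mem' := fun h h' x hx => by rw [map_add]; exact add_mem (h x hx) (h' x hx)
      smul_mem' := fun a s h x hx => by
        have : Nonempty V := ⟨⟨x, hx⟩⟩
        rw [δ.γ_smul]
        exact (N x).smul_mem ⟨_, germ_mem_locRing V hx a⟩ (h x hx) }
  map_mem {V V'} hV s h x hx := by
    have : Nonempty V' := ⟨⟨x, hx⟩⟩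
    rw [δ.γ_map]
    exact h x (hV hx)
  of_local {V} s h x hx := by
    obtain ⟨V', hx', hV', h'⟩ := h x hx
    have : Nonempty V' := ⟨⟨x, hx'⟩⟩
    rw [← δ.γ_map hV']
    exact h' x hx'

/-- The embedding of a subsheaf. -/
def subEmb (N : LocalSub G) : GenEmb N.obj W where
  γ V := (δ.γ V).comp (N.ι.app V).hom
  γ_map {V V'} _ h s := δ.γ_map h s.1
  γ_smul {V} _ a s := δ.γ_smul a s.1
  inj V := (δ.inj V).comp (N.ι_injective V)

lemma γ_eq_of_germ_eq {V V' : X.Opens} [Nonempty (V ⊓ V' : X.Opens)] {s : Γ(G, V)} {s' : Γ(G, V')} (h : δ.γ V s = δ.γ V' s') :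
    G.presheaf.map (homOfLE (inf_le_left : V ⊓ V' ≤ V)).op s =
      G.presheaf.map (homOfLE (inf_le_right : V ⊓ V' ≤ V')).op s' := by
  apply δ.inj
  rw [δ.γ_map, δ.γ_map, h]

lemma IsFrame.exists_comb {r : ℕ} {V : X.Opens} {b : Module.Basis (Fin r) X.functionField W}
    (hb : δ.IsFrame V b) {V' : X.Opens} [Nonempty V'] (h : V' ≤ V) {s : Fin r → Γ(G, V)}
    (hs : ∀ j, δ.γ V (s j) = b j) (t : Γ(G, V')) :
    ∃ c : Fin r → Γ(X, V'), t = ∑ j, c j • G.presheaf.map (homOfLE h).op (s j) := by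
  choose c hc using fun j => exists_section_of_forall_mem_locRing V' (a := b.repr (δ.γ V' t) j)
    fun y hy => (hb y (h hy) _).1 (δ.γ_mem_lat hy t) j
  refine ⟨c, δ.inj _ ?_⟩
  rw [map_sum, ← b.sum_repr (δ.γ V' t)]
  exact Finset.sum_congr rfl fun j _ => by rw [δ.γ_smul, δ.γ_map, hs, hc]

section Cokernel

variable {δ N} {Q : X.Modules} {π : G ⟶ Q} [Epi π]
  (hπ : ∀ V s, π.app V s = 0 ↔ ∀ x ∈ V, δ.γ V s ∈ N x)

include hπ

lemma eq_zero_of_local_germ {V : X.Opens} (q : Γ(Q, V))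
    (h : ∀ x ∈ V, ∀ (V' : X.Opens) (_ : x ∈ V') (hV : V' ≤ V) (s : Γ(G, V')),
      π.app V' s = Q.presheaf.map (homOfLE hV).op q → ∃ V'' : X.Opens, x ∈ V'' ∧ ∀ y ∈ V'', δ.γ V' s ∈ N y) :
    q = 0 := by
  refine section_eq_zero Q q fun x hx => ?_
  obtain ⟨V', hx', hV', s, e⟩ := exists_local_preimage π q hx
  obtain ⟨V'', hx'', h''⟩ := h x hx V' hx' hV' s e
  refine ⟨V' ⊓ V'', ⟨hx', hx''⟩, inf_le_left.trans hV', ?_⟩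
  rw [← map_map_apply Q hV' (inf_le_left : V' ⊓ V'' ≤ V'), ← e, ← app_map_apply, hπ]
  intro y hy
  have : Nonempty (V' ⊓ V'' : X.Opens) := ⟨⟨y, hy⟩⟩
  rw [δ.γ_map]
  exact h'' y hy.2

lemma smul_eq_zero_of_smul_lat {V : X.Opens} [Nonempty V] (a : Γ(X, V))
    (h : ∀ x ∈ V, ∀ w ∈ δ.lat x, X.germToFunctionField V a • w ∈ N x) (q : Γ(Q, V)) : a • q = 0 := by
  refine section_eq_zero Q _ fun x hx => ?_
  obtain ⟨V', hx', hV', s, e⟩ := exists_local_preimage π q hx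
  refine ⟨V', hx', hV', ?_⟩
  rw [Scheme.Modules.map_smul, ← e, ← Scheme.Modules.Hom.app_smul, hπ]
  intro y hy
  have : Nonempty V' := ⟨⟨y, hy⟩⟩
  rw [δ.γ_smul, germ_map]
  exact h y (hV' hy) _ (δ.γ_mem_lat hy s)

variable {p : X} (hp : IsClosed {p}) (hN : ∀ x ≠ p, ∀ w ∈ δ.lat x, w ∈ N x)
include hp hN

/-- Outside `p` the lattices contain all germs of `G`, so the quotient is supported at `p`, and a
section is determined by its restriction to a neighbourhood of `p`. -/
lemma eq_zero_of_map_eq_zero {V V₀ : X.Opens} (hV₀ : p ∈ V₀) (h : V₀ ≤ V) (q : Γ(Q, V))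
    (hq : Q.presheaf.map (homOfLE h).op q = 0) : q = 0 := by
  refine section_eq_zero Q q fun x hx => ?_
  by_cases hxp : x = p
  · subst hxp
    exact ⟨V₀, hV₀, h, hq⟩
  · refine ⟨V ⊓ ⟨_, hp.isOpen_compl⟩, ⟨hx, hxp⟩, inf_le_left, ?_⟩
    refine eq_zero_of_local_germ hπ _ fun y hy V' hy' hV' s _ => ⟨V' ⊓ ⟨_, hp.isOpen_compl⟩, ⟨hy', hy.2⟩, ?_⟩
    intro y' hy''
    exact hN y' hy''.2 _ (δ.γ_mem_lat hy''.1 s)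

omit [Epi π] in
/-- A germ at `p` defines a section of a quotient supported at `p`. -/
lemma exists_of_mem_lat_support {w : W} (hw : w ∈ δ.lat p) : ∃ q : Γ(Q, ⊤), ∃ (V : X.Opens) (_ : p ∈ V)
    (s : Γ(G, V)), δ.γ V s = w ∧ π.app V s = Q.presheaf.map (homOfLE (le_top : V ≤ ⊤)).op q := by
  obtain ⟨V, hV, s, rfl⟩ := δ.exists_of_mem_lat hw
  let P : X.Opens := ⟨_, hp.isOpen_compl⟩
  have hPV : Q.presheaf.map (homOfLE (inf_le_left : V ⊓ P ≤ V)).op (π.app V s) = 0 := by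
    rw [← app_map_apply, hπ]
    intro x hx
    have : Nonempty (V ⊓ P : X.Opens) := ⟨⟨x, hx⟩⟩
    rw [δ.γ_map]
    exact hN x hx.2 _ (δ.γ_mem_lat hx.1 s)
  have hPV' : Q.presheaf.map (homOfLE (inf_le_right : P ⊓ V ≤ V)).op (π.app V s) = 0 := by
    rw [← map_map_apply Q (inf_le_left : V ⊓ P ≤ V) (le_of_eq (inf_comm P V)), hPV, map_zero]
  -- The image of `s` vanishes on `V ∖ {p}`, so it glues with zero on the complement of `p`.
  obtain ⟨q, hq⟩ := exists_glue (V := ⊤) Q (fun i : ULift.{u} Bool => if i.down then V else P) (fun _ => le_top)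
    (fun x _ => Opens.mem_iSup.2 (by
      by_cases hx : x = p
      · exact ⟨⟨true⟩, hx ▸ hV⟩
      · exact ⟨⟨false⟩, hx⟩))
    (fun i => match i with
      | ⟨true⟩ => π.app V s
      | ⟨false⟩ => (0 : Γ(Q, P)))
    (fun i j => by
      rcases i with ⟨_ | _⟩ <;> rcases j with ⟨_ | _⟩
      · rfl
      · exact (map_zero _).trans hPV'.symm
      · exact hPV.trans (map_zero _).symm
      · rfl)
  exact ⟨q, V, hV, s, rfl, (hq ⟨true⟩).symm⟩

end Cokernel

end GenEmb

end

/-! ### Cokernels and injectivity of maps from a pullback sheaf. -/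

noncomputable section

open PointedCurve (map_map_apply map_map_comm app_map_apply modHom modHom_app)

namespace GenEmb

section Kernels

variable {X : Scheme.{u}} [IsIntegral X] {F G : X.Modules} {W : Type*} [AddCommGroup W]
  [Module X.functionField W] (γ : GenEmb F W) (δ : GenEmb G W)

lemma cokernel_π_eq_zero_iff (f : F ⟶ G) [Mono f] (h : ∀ V s, δ.γ V (f.app V s) = γ.γ V s)
    (V : X.Opens) (s : Γ(G, V)) :
    (Limits.cokernel.π f).app V s = 0 ↔ ∀ x ∈ V, δ.γ V s ∈ γ.lat x := by
  constructor
  · intro hs x hx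
    obtain ⟨t, rfl⟩ := mem_of_cokernel_π_eq_zero f s hs
    rw [h]
    exact γ.γ_mem_lat hx t
  · intro hs
    refine section_eq_zero _ _ fun x hx => ⟨V, hx, le_rfl, ?_⟩
    have : Nonempty V := ⟨⟨x, hx⟩⟩
    obtain ⟨t, ht⟩ := γ.exists_section V hs
    rw [← h] at ht
    rw [← δ.inj V ht]
    have := congr(($(Limits.cokernel.condition f)).app V t)
    exact (congrArg _ this).trans (map_zero _)

variable (f : X ⟶ X) (φ : (Scheme.Modules.pullback f).obj F ⟶ G)

/-- The `𝒪_x`-module generated by the image of germs at `f x`. -/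
def pullLat (T : W →+ W) (x : X) : Submodule (locRing X x) W :=
  Submodule.span (locRing X x) (T '' (γ.lat (f x) : Set W))

variable (T : W →+ W)
  (hφ : ∀ V s, δ.γ (f ⁻¹ᵁ V)
    (((Scheme.Modules.pullbackPushforwardAdjunction f).homEquiv _ _ φ).app V s) = T (γ.γ V s))

include hφ

lemma exists_lift_latSub : ∃ φ', φ' ≫ (δ.latSub (γ.pullLat f T)).ι = φ :=
  (δ.latSub (γ.pullLat f T)).exists_lift_pullback f φ fun V s x hx => by
    rw [hφ]
    exact Submodule.subset_span ⟨_, γ.γ_mem_lat (x := f x) hx s, rfl⟩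

lemma γ_app_mem_pullLat (V : X.Opens) (t : Γ((Scheme.Modules.pullback f).obj F, V)) (x : X) (hx : x ∈ V) :
    δ.γ V (φ.app V t) ∈ γ.pullLat f T x := by
  obtain ⟨φ', h⟩ := exists_lift_latSub γ δ f φ T hφ
  rw [← h]
  exact (δ.latSub (γ.pullLat f T)).ι_mem (φ'.app V t) x hx

/-- The sections of `f^* F` enter only through the adjoint of `φ`. In one direction `φ` factors
through the subsheaf with lattices `pullLat`, so the kernel of the cokernel map lies there. In the
other, the adjoint of `φ` followed by its cokernel is zero, which kills the generators `T w` of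
those lattices. -/
lemma cokernel_pullback_π_eq_zero_iff (V : X.Opens) (s : Γ(G, V)) :
    (Limits.cokernel.π φ).app V s = 0 ↔ ∀ x ∈ V, δ.γ V s ∈ γ.pullLat f T x := by
  constructor
  · intro hs
    obtain ⟨φ', h⟩ := exists_lift_latSub γ δ f φ T hφ
    let N := δ.latSub (γ.pullLat f T)
    have h1 : Limits.cokernel.π φ ≫ Limits.cokernel.desc φ (Limits.cokernel.π N.ι) (by
        rw [← h, Category.assoc, Limits.cokernel.condition, Limits.comp_zero]) =
          Limits.cokernel.π N.ι := Limits.cokernel.π_desc _ _ _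
    obtain ⟨t, rfl⟩ := mem_of_cokernel_π_eq_zero N.ι s (by
      rw [← h1, Scheme.Modules.Hom.comp_app, ConcreteCategory.comp_apply, hs, map_zero])
    exact N.ι_mem t
  · intro hs
    have key : ∀ x, ∀ w ∈ γ.pullLat f T x, ∃ (V' : X.Opens) (_ : x ∈ V') (t : Γ(G, V')),
        δ.γ V' t = w ∧ (Limits.cokernel.π φ).app V' t = 0 := by
      intro x w hw
      induction hw using Submodule.span_induction with
      | mem w hw =>
        obtain ⟨w, hw, rfl⟩ := hw
        obtain ⟨V', hV', t, rfl⟩ := γ.exists_of_mem_lat hw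
        refine ⟨f ⁻¹ᵁ V', hV', _, hφ V' t, ?_⟩
        have h1 := (Scheme.Modules.pullbackPushforwardAdjunction f).homEquiv_naturality_right φ
          (Limits.cokernel.π φ)
        rw [Limits.cokernel.condition] at h1
        have h2 : (Scheme.Modules.pullbackPushforwardAdjunction f).homEquiv F _
            (0 : _ ⟶ Limits.cokernel φ) = 0 := by
          rw [Adjunction.homEquiv_unit, Functor.map_zero, Limits.comp_zero]
        rw [h2] at h1
        exact congr(($h1.symm).app V' t)
      | zero => exact ⟨⊤, trivial, 0, map_zero _, map_zero _⟩
      | add w w' _ _ h h' =>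
        obtain ⟨V₁, h1, t, rfl, e⟩ := h
        obtain ⟨V₂, h2, t', rfl, e'⟩ := h'
        have : Nonempty (V₁ ⊓ V₂ : X.Opens) := ⟨⟨x, h1, h2⟩⟩
        refine ⟨V₁ ⊓ V₂, ⟨h1, h2⟩, G.presheaf.map (homOfLE inf_le_left).op t +
          G.presheaf.map (homOfLE inf_le_right).op t', ?_, ?_⟩
        · rw [map_add, δ.γ_map, δ.γ_map]
        · rw [map_add, app_map_apply, app_map_apply, e, e', map_zero, map_zero, add_zero]
      | smul a w _ h =>
        obtain ⟨V₁, h1, t, rfl, e⟩ := h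
        obtain ⟨V₂, h2, hne, b, hb⟩ := exists_germ_of_mem_locRing a.2
        have : Nonempty (V₁ ⊓ V₂ : X.Opens) := ⟨⟨x, h1, h2⟩⟩
        refine ⟨V₁ ⊓ V₂, ⟨h1, h2⟩, X.presheaf.map (homOfLE (inf_le_right : V₁ ⊓ V₂ ≤ V₂)).op b •
          G.presheaf.map (homOfLE (inf_le_left : V₁ ⊓ V₂ ≤ V₁)).op t, ?_, ?_⟩
        · rw [δ.γ_smul, δ.γ_map, germ_map, hb]; rfl
        · rw [Scheme.Modules.Hom.app_smul, app_map_apply, e, map_zero, smul_zero]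
    refine section_eq_zero _ _ fun x hx => ?_
    obtain ⟨V', hx', t, e, h0⟩ := key x _ (hs x hx)
    have : Nonempty (V ⊓ V' : X.Opens) := ⟨⟨x, hx, hx'⟩⟩
    refine ⟨V ⊓ V', ⟨hx, hx'⟩, inf_le_left, ?_⟩
    rw [← app_map_apply, δ.γ_eq_of_germ_eq e.symm, app_map_apply, h0, map_zero]

end Kernels

section MonoPullback

variable {X : Scheme.{u}} {F : X.Modules} (f : X ⟶ X)

/-- The pullback of sections. -/
def unitSec (F : X.Modules) (V : X.Opens) : Γ(F, V) →+ Γ((Scheme.Modules.pullback f).obj F, f ⁻¹ᵁ V) :=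
  (((Scheme.Modules.pullbackPushforwardAdjunction f).unit.app F).app V).hom

lemma unitSec_map {V V' : X.Opens} (h : V' ≤ V) (s : Γ(F, V)) :
    unitSec f F V' (F.presheaf.map (homOfLE h).op s) =
      ((Scheme.Modules.pullback f).obj F).presheaf.map (homOfLE (f.preimage_mono h)).op (unitSec f F V s) :=
  app_map_apply _ h s

lemma unitSec_smul {V : X.Opens} (a : Γ(X, V)) (s : Γ(F, V)) :
    unitSec f F V (a • s) = f.app V a • unitSec f F V s :=
  Scheme.Modules.Hom.app_smul (φ := (Scheme.Modules.pullbackPushforwardAdjunction f).unit.app F) a s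

lemma homEquiv_app {G : X.Modules} (φ : (Scheme.Modules.pullback f).obj F ⟶ G) (V : X.Opens) (s : Γ(F, V)) :
    ((Scheme.Modules.pullbackPushforwardAdjunction f).homEquiv _ _ φ).app V s =
      φ.app (f ⁻¹ᵁ V) (unitSec f F V s) := by
  rw [Adjunction.homEquiv_unit]
  rfl

/-- The sections of `F`, pulled back along `f` and restricted to `V`. -/
def unitSections (F : X.Modules) (V : X.Opens) : Set Γ((Scheme.Modules.pullback f).obj F, V) :=
  {t | ∃ (V₁ : X.Opens) (h : V ≤ f ⁻¹ᵁ V₁) (s : Γ(F, V₁)),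
    t = ((Scheme.Modules.pullback f).obj F).presheaf.map (homOfLE h).op
      (unitSec f F V₁ s)}

lemma map_mem_span_unitSections {V V' : X.Opens} (h : V' ≤ V)
    {t : Γ((Scheme.Modules.pullback f).obj F, V)} (ht : t ∈ Submodule.span Γ(X, V) (unitSections f F V)) :
    ((Scheme.Modules.pullback f).obj F).presheaf.map (homOfLE h).op t ∈
      Submodule.span Γ(X, V') (unitSections f F V') := by
  induction ht using Submodule.span_induction with
  | mem t ht =>
    obtain ⟨V₁, h₁, s, rfl⟩ := ht
    rw [map_map_apply]
    exact Submodule.subset_span ⟨V₁, h.trans h₁, s, rfl⟩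
  | zero => rw [map_zero]; exact zero_mem _
  | add t t' _ _ h h' => rw [map_add]; exact add_mem h h'
  | smul a t _ h => rw [Scheme.Modules.map_smul]; exact Submodule.smul_mem _ _ h

/-- The subsheaf generated by pulled back sections. -/
def unitSub (F : X.Modules) : LocalSub ((Scheme.Modules.pullback f).obj F) where
  carrier V :=
    { carrier := {t | ∀ x ∈ V, ∃ (V' : X.Opens) (_ : x ∈ V') (h : V' ≤ V),
        ((Scheme.Modules.pullback f).obj F).presheaf.map (homOfLE h).op t ∈
          Submodule.span Γ(X, V') (unitSections f F V')}
      zero_mem' := fun x hx => ⟨V, hx, le_rfl, by rw [map_zero]; exact zero_mem _⟩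
      add_mem' := by
        intro t t' h h' x hx
        obtain ⟨V₁, h1, hV1, m⟩ := h x hx
        obtain ⟨V₂, h2, hV2, m'⟩ := h' x hx
        refine ⟨V₁ ⊓ V₂, ⟨h1, h2⟩, inf_le_left.trans hV1, ?_⟩
        have e := map_mem_span_unitSections f (inf_le_left : V₁ ⊓ V₂ ≤ V₁) m
        have e' := map_mem_span_unitSections f (inf_le_right : V₁ ⊓ V₂ ≤ V₂) m'
        rw [map_map_apply] at e e'
        rw [map_add]
        exact add_mem e e'
      smul_mem' := by
        intro a t h x hx
        obtain ⟨V₁, h1, hV1, m⟩ := h x hx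
        refine ⟨V₁, h1, hV1, ?_⟩
        rw [Scheme.Modules.map_smul]
        exact Submodule.smul_mem _ _ m }
  map_mem {V V'} hV t h x hx := by
    obtain ⟨V₁, h1, hV1, m⟩ := h x (hV hx)
    refine ⟨V₁ ⊓ V', ⟨h1, hx⟩, inf_le_right, ?_⟩
    have e := map_mem_span_unitSections f (inf_le_left : V₁ ⊓ V' ≤ V₁) m
    rw [map_map_apply] at e
    rw [map_map_apply]
    exact e
  of_local {V} t h x hx := by
    obtain ⟨V₁, h1, hV1, h'⟩ := h x hx
    obtain ⟨V₂, h2, hV2, m⟩ := h' x h1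
    rw [map_map_apply] at m
    exact ⟨V₂, h2, hV2.trans hV1, m⟩

/-- The identity of `f^* F` has the unit as its adjoint, with values in the subsheaf generated by
pulled-back sections. So the identity factors through that subsheaf. -/
lemma exists_mem_span_unitSections {V : X.Opens} (t : Γ((Scheme.Modules.pullback f).obj F, V)) {x : X}
    (hx : x ∈ V) : ∃ (V' : X.Opens) (_ : x ∈ V') (h : V' ≤ V),
        ((Scheme.Modules.pullback f).obj F).presheaf.map (homOfLE h).op t ∈
          Submodule.span Γ(X, V') (unitSections f F V') := by
  obtain ⟨φ, h⟩ := (unitSub f F).exists_lift_pullback f (𝟙 _) (fun V s x hx =>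
    ⟨f ⁻¹ᵁ V, hx, le_rfl, Submodule.subset_span ⟨V, le_rfl, s,
      congrArg _ (homEquiv_app f (𝟙 _) V s)⟩⟩)
  have h1 : (unitSub f F).ι.app V (φ.app V t) = t := congr(($h).app V t)
  have h2 := (unitSub f F).ι_mem (φ.app V t)
  rw [h1] at h2
  exact h2 x hx

variable [IsIntegral X] {G : X.Modules} {W W' : Type*} [AddCommGroup W]
  [Module X.functionField W] [AddCommGroup W'] [Module X.functionField W'] (γ : GenEmb F W) (δ : GenEmb G W')
  (φ : (Scheme.Modules.pullback f).obj F ⟶ G) (T : W →+ W')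
  (hφ : ∀ V s, δ.γ (f ⁻¹ᵁ V)
    (((Scheme.Modules.pullbackPushforwardAdjunction f).homEquiv _ _ φ).app V s) = T (γ.γ V s))

include hφ

/-- Near `x` the pullback is generated by the pulled-back frame at `f x`. A combination of these
generators killed by `φ` has zero coefficients, because the images `T (b j)` are independent over
`K`. -/
theorem mono_of_linearIndependent {r : ℕ}
    (hF : ∀ x, ∃ (V : X.Opens) (_ : x ∈ V) (b : Module.Basis (Fin r) X.functionField W), γ.IsFrame V b)
    (hT : ∀ b : Module.Basis (Fin r) X.functionField W, LinearIndependent X.functionField fun j => T (b j)) :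
    Mono φ := by
  refine mono_of_app_injective _ fun V => (injective_iff_map_eq_zero (φ.app V).hom).2 fun t ht => ?_
  refine section_eq_zero _ _ fun x hx => ?_
  obtain ⟨V₁, h1, hV1, m⟩ := exists_mem_span_unitSections f t hx
  obtain ⟨V₂, h2, b, hb⟩ := hF (f x)
  have hne : Nonempty V₂ := ⟨⟨_, h2⟩⟩
  choose s hs using fun j => γ.exists_section V₂ (w := b j) fun y hy => hb.basis_mem hy j
  let V' := V₁ ⊓ f ⁻¹ᵁ V₂
  have hne' : Nonempty V' := ⟨⟨x, h1, h2⟩⟩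
  refine ⟨V', ⟨h1, h2⟩, inf_le_left.trans hV1, ?_⟩
  let P := (Scheme.Modules.pullback f).obj F
  let e : Fin r → Γ(P, V') := fun j => P.presheaf.map (homOfLE (inf_le_right : V' ≤ f ⁻¹ᵁ V₂)).op
    (unitSec f F V₂ (s j))
  have hspan : P.presheaf.map (homOfLE (inf_le_left.trans hV1 : V' ≤ V)).op t ∈
      Submodule.span Γ(X, V') (Set.range e) := by
    have m' := map_mem_span_unitSections f (inf_le_left : V' ≤ V₁) m
    rw [map_map_apply] at m'
    refine Submodule.span_le.2 ?_ m'
    rintro _ ⟨V₃, h3, s', rfl⟩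
    have hne3 : Nonempty (V₃ ⊓ V₂ : X.Opens) := ⟨⟨f x, h3 ⟨h1, h2⟩, h2⟩⟩
    obtain ⟨c, hc⟩ := IsFrame.exists_comb γ hb (inf_le_right : V₃ ⊓ V₂ ≤ V₂) hs
      (F.presheaf.map (homOfLE (inf_le_left : V₃ ⊓ V₂ ≤ V₃)).op s')
    have hle : V' ≤ f ⁻¹ᵁ (V₃ ⊓ V₂) := fun y hy => ⟨h3 hy, hy.2⟩
    have e1 : P.presheaf.map (homOfLE h3).op (unitSec f F V₃ s') =
        P.presheaf.map (homOfLE hle).op (unitSec f F (V₃ ⊓ V₂)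
          (F.presheaf.map (homOfLE (inf_le_left : V₃ ⊓ V₂ ≤ V₃)).op s')) := by
      rw [unitSec_map, map_map_apply]
    rw [SetLike.mem_coe, e1, hc, map_sum, map_sum]
    refine Submodule.sum_mem _ fun j _ => ?_
    have e2 : P.presheaf.map (homOfLE hle).op (unitSec f F (V₃ ⊓ V₂)
        (c j • F.presheaf.map (homOfLE (inf_le_right : V₃ ⊓ V₂ ≤ V₂)).op (s j))) =
        X.presheaf.map (homOfLE hle).op (f.app _ (c j)) • e j := by
      rw [unitSec_smul, Scheme.Modules.map_smul, unitSec_map, map_map_apply]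
    rw [e2]
    exact Submodule.smul_mem _ _ (Submodule.subset_span ⟨j, rfl⟩)
  obtain ⟨c, hc⟩ := (Submodule.mem_span_range_iff_exists_fun _).1 hspan
  have he : ∀ j, δ.γ V' (φ.app V' (e j)) = T (b j) := by
    intro j
    rw [← hs, ← hφ, homEquiv_app, ← δ.γ_map (inf_le_right : V' ≤ f ⁻¹ᵁ V₂), ← app_map_apply]
  have h0 : δ.γ V' (φ.app V' (∑ j, c j • e j)) = 0 := by
    rw [hc, app_map_apply]
    have ht' : φ.app V t = 0 := ht
    rw [ht', map_zero, map_zero]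
  simp only [map_sum, Scheme.Modules.Hom.app_smul, δ.γ_smul, he] at h0
  have h3 := Fintype.linearIndependent_iff.1 (hT b) _ h0
  refine hc.symm.trans (Finset.sum_eq_zero fun j _ => ?_)
  rw [(map_eq_zero_iff _ (Scheme.germToFunctionField_injective X V')).1 (h3 j), zero_smul]

end MonoPullback

end GenEmb

end

/-! ### The `L`-dimension of a quotient supported at one point. -/

noncomputable section

open PointedCurve (map_map_apply map_map_comm app_map_apply modHom modHom_app)

namespace GenEmb

variable {Fq : Type u} [Field Fq] {C : PointedCurve Fq} {L : Type u} [Field L]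
  [Algebra Fq L] {G Q : (C.CL L).Modules} {W : Type*} [AddCommGroup W]
  [Module (C.CL L).functionField W] {δ : GenEmb G W} {N : ∀ x : C.CL L, Submodule (locRing (C.CL L) x) W}
  {π : G ⟶ Q} [Epi π]

lemma γ_toGammaL_smul {V : (C.CL L).Opens} [Nonempty V] (a : L) (s : Γ(G, V)) :
    δ.γ V (C.toGammaL L V a • s) = kToK (C.prL L) a • δ.γ V s := by
  rw [δ.γ_smul]
  congr 1
  exact germ_structMap (C.prL L) V a

/-- The dimension of a quotient that is supported at one point. -/
theorem lDim_eq_rank (hπ : ∀ V s, π.app V s = 0 ↔ ∀ x ∈ V, δ.γ V s ∈ N x) {p : C.CL L}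
    (hp : IsClosed {p}) (hN : ∀ x ≠ p, ∀ w ∈ δ.lat x, w ∈ N x) {V₀ : Type u} [AddCommGroup V₀] [Module L V₀]
    (K₀ : Submodule L V₀) (g : V₀ →+ W) (hg : ∀ (a : L) v, g (a • v) = kToK (C.prL L) a • g v)
    (h1 : ∀ v, g v ∈ δ.lat p) (h2 : ∀ v, g v ∈ N p ↔ v ∈ K₀) (h3 : ∀ w ∈ δ.lat p, ∃ v, w - g v ∈ N p) :
    C.lDim L Q = Module.rank L (V₀ ⧸ K₀) := by
  -- Each vector defines a global section of the quotient by extension by zero. Uniqueness of this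
  -- section gives additivity and `L`-linearity of `v ↦ q v`.
  choose q V hV s hs hq using fun v => exists_of_mem_lat_support hπ hp hN (h1 v)
  have huniq : ∀ (v : V₀) (q' : Γ(Q, ⊤)) (V' : (C.CL L).Opens) (_ : p ∈ V') (s' : Γ(G, V')),
      δ.γ V' s' = g v → π.app V' s' = Q.presheaf.map (homOfLE (le_top : V' ≤ ⊤)).op q' → q' = q v := by
    intro v q' V' hV' s' hs' hq'
    have : Nonempty (V' ⊓ V v : (C.CL L).Opens) := ⟨⟨p, hV', hV v⟩⟩
    rw [← sub_eq_zero]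
    refine eq_zero_of_map_eq_zero hπ hp hN (V₀ := V' ⊓ V v) ⟨hV', hV v⟩ le_top _ ?_
    have e := δ.γ_eq_of_germ_eq (hs'.trans (hs v).symm)
    have e1 := congrArg (π.app (V' ⊓ V v)) e
    rw [app_map_apply, app_map_apply, hq', hq, map_map_apply, map_map_apply] at e1
    rw [map_sub, e1, sub_self]
  let : Module L Γ(Q, ⊤) := Module.compHom Γ(Q, ⊤) (C.toGammaL L ⊤)
  let Θ : V₀ →ₗ[L] Γ(Q, ⊤) :=
    { toFun := q
      map_add' := fun v v' => by
        have : Nonempty (V v ⊓ V v' : (C.CL L).Opens) := ⟨⟨p, hV v, hV v'⟩⟩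
        refine (huniq _ _ (V v ⊓ V v') ⟨hV v, hV v'⟩
          (G.presheaf.map (homOfLE (inf_le_left : V v ⊓ V v' ≤ V v)).op (s v) +
            G.presheaf.map (homOfLE (inf_le_right : V v ⊓ V v' ≤ V v')).op (s v')) ?_ ?_).symm
        · rw [map_add, map_add, δ.γ_map, δ.γ_map, hs, hs]
        · rw [map_add, map_add, app_map_apply, app_map_apply, hq, hq, map_map_apply, map_map_apply]
      map_smul' := fun a v => by
        have : Nonempty (V v) := ⟨⟨p, hV v⟩⟩
        refine (huniq _ _ (V v) (hV v) (C.toGammaL L (V v) a • s v) ?_ ?_).symm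
        · rw [γ_toGammaL_smul, hs, hg]
        · rw [Scheme.Modules.Hom.app_smul, hq]
          refine Eq.trans ?_ (Scheme.Modules.map_smul Q (homOfLE (le_top : V v ≤ ⊤)) (C.toGammaL L ⊤ a) (q v)).symm
          congr 1
          exact (structMap_map (C.prL L) (le_top : V v ≤ ⊤) a).symm }
  have hker : LinearMap.ker Θ = K₀ := by
    ext v
    rw [LinearMap.mem_ker, ← h2]
    constructor
    · intro h0
      have h0 : q v = 0 := h0
      have h4 := hq v
      rw [h0, map_zero, hπ] at h4
      rw [← hs]
      exact h4 p (hV v)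
    · intro h0
      refine eq_zero_of_map_eq_zero hπ hp hN (hV v) le_top (q v) ?_
      rw [← hq, hπ]
      intro x hx
      by_cases hxp : x = p
      · subst hxp
        rw [hs]; exact h0
      · exact hN x hxp _ (δ.γ_mem_lat hx _)
  have hsurj : Function.Surjective Θ := by
    intro q'
    obtain ⟨V', hV', hle, s', e⟩ := exists_local_preimage π q' (x := p) trivial
    obtain ⟨v, hv⟩ := h3 _ (δ.γ_mem_lat hV' s')
    refine ⟨v, ?_⟩
    have : Nonempty (V' ⊓ V v : (C.CL L).Opens) := ⟨⟨p, hV', hV v⟩⟩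
    change q v = q'
    rw [← sub_eq_zero, ← neg_sub, neg_eq_zero]
    refine eq_zero_of_map_eq_zero hπ hp hN (V₀ := V' ⊓ V v) ⟨hV', hV v⟩ le_top _ ?_
    have e1 : π.app (V' ⊓ V v) (G.presheaf.map (homOfLE (inf_le_left : V' ⊓ V v ≤ V')).op s' -
        G.presheaf.map (homOfLE (inf_le_right : V' ⊓ V v ≤ V v)).op (s v)) = 0 := by
      rw [hπ]
      intro x hx
      have : Nonempty (V' ⊓ V v : (C.CL L).Opens) := ⟨⟨x, hx⟩⟩
      rw [map_sub, δ.γ_map, δ.γ_map]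
      by_cases hxp : x = p
      · subst hxp
        rw [hs]; exact hv
      · exact hN x hxp _ (sub_mem (δ.γ_mem_lat hx.1 _) (δ.γ_mem_lat hx.2 _))
    rw [map_sub, app_map_apply, app_map_apply, e, hq, map_map_apply, map_map_apply] at e1
    rw [map_sub]
    exact e1
  have h5 := (Θ.quotKerEquivOfSurjective hsurj).rank_eq
  rw [hker] at h5
  exact h5.symm

end GenEmb

end

/-! ### Semilinear maps and filtrations over `L`. -/

section

section Semilinear

variable {L U U' : Type*} [Field L] [AddCommGroup U] [Module L U] [AddCommGroup U'] [Module L U']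
  (φ : L →+* L) (θ : U →+ U') (hθ : ∀ (a : L) u, θ (a • u) = φ a • θ u)

include hθ

lemma semilinear_mem_span {s : Set U} {u : U} (hu : u ∈ Submodule.span L s) :
    θ u ∈ Submodule.span L (θ '' s) := by
  induction hu using Submodule.span_induction with
  | mem u hu => exact Submodule.subset_span ⟨u, hu, rfl⟩
  | zero => rw [map_zero]; exact zero_mem _
  | add u u' _ _ h h' => rw [map_add]; exact add_mem h h'
  | smul a u _ h => rw [hθ]; exact Submodule.smul_mem _ _ h

variable [FiniteDimensional L U] (hspan : Submodule.span L (Set.range θ) = ⊤)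
include hspan

omit [FiniteDimensional L U] in
lemma semilinear_span_basis {ι : Type*} (b : Module.Basis ι L U) :
    ⊤ ≤ Submodule.span L (Set.range fun i => θ (b i)) := by
  rw [← hspan, Submodule.span_le]
  rintro _ ⟨u, rfl⟩
  have h := semilinear_mem_span φ θ hθ (u := u) (s := Set.range b) (by rw [b.span_eq]; trivial)
  rwa [← Set.range_comp] at h

lemma semilinear_finrank_le : Module.finrank L U' ≤ Module.finrank L U := by
  have h := semilinear_span_basis φ θ hθ hspan (Module.finBasis L U)
  have h1 := finrank_range_le_card (R := L) (fun i => θ (Module.finBasis L U i))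
  rw [Set.finrank, top_le_iff.1 h, finrank_top, Fintype.card_fin] at h1
  exact h1

/-- Extend the family to a basis. The images of the basis span a space of the same dimension, so
they are independent. No surjectivity of Frobenius on `L` is needed. -/
lemma semilinear_linearIndependent (hd : Module.finrank L U' = Module.finrank L U) {ι : Type*}
    {v : ι → U} (hv : LinearIndependent L v) : LinearIndependent L fun i => θ (v i) := by
  let b := Module.Basis.sumExtend hv
  have : Fintype (ι ⊕ Module.Basis.sumExtendIndex hv) := FiniteDimensional.fintypeBasisIndex b
  have h1 : LinearIndependent L fun i => θ (b i) :=
    linearIndependent_of_top_le_span_of_card_eq_finrank (semilinear_span_basis φ θ hθ hspan b)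
      (by rw [hd, Module.finrank_eq_card_basis b])
  have h2 := h1.comp Sum.inl Sum.inl_injective
  convert h2 using 2 with i
  simp [b, Module.Basis.sumExtend]
  rfl

end Semilinear

section Filtration

variable {L W : Type*} [Field L] [AddCommGroup W] [Module L W]

/-- The dimension of the image of `B` modulo `A`. -/
noncomputable def relDim (A B : Submodule L W) : ℕ := Module.finrank L (B.map A.mkQ)

lemma finrank_map_mkQ_add (A B : Submodule L W) [FiniteDimensional L B] :
    relDim A B + Module.finrank L (A ⊓ B : Submodule L W) = Module.finrank L B := by
  have h := LinearMap.finrank_range_add_finrank_ker (A.mkQ.comp B.subtype)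
  rw [LinearMap.range_comp, Submodule.range_subtype] at h
  rw [relDim, ← h]
  congr 1
  refine LinearEquiv.finrank_eq ?_
  refine (Submodule.equivSubtypeMap B _).trans (LinearEquiv.ofEq _ _ ?_) |>.symm
  ext w
  simp only [Submodule.mem_map, LinearMap.mem_ker, LinearMap.comp_apply, Submodule.subtype_apply,
    Submodule.mkQ_apply, Submodule.Quotient.mk_eq_zero, Submodule.mem_inf]
  constructor
  · rintro ⟨b, h, rfl⟩; exact ⟨h, b.2⟩
  · rintro ⟨h, h'⟩; exact ⟨⟨w, h'⟩, h, rfl⟩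

lemma relDim_add {A A' B : Submodule L W} (hA : A ≤ A') (hB : A' ≤ B)
    [FiniteDimensional L (B.map A.mkQ)] : relDim A A' + relDim A' B = relDim A B := by
  have h := LinearMap.finrank_range_add_finrank_ker ((A.mapQ A' LinearMap.id hA).comp (B.map A.mkQ).subtype)
  rw [LinearMap.range_comp, Submodule.range_subtype, ← Submodule.map_comp] at h
  rw [relDim, relDim, relDim, add_comm, ← h]
  congr 1
  refine LinearEquiv.finrank_eq ?_
  refine ((Submodule.equivSubtypeMap (B.map A.mkQ) _).trans (LinearEquiv.ofEq _ _ ?_)).symm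
  ext w
  constructor
  · rintro ⟨⟨_, b, hb, rfl⟩, h, rfl⟩
    have h' : A'.mkQ b = 0 := h
    exact ⟨b, (Submodule.Quotient.mk_eq_zero A').1 h', rfl⟩
  · rintro ⟨b, hb, rfl⟩
    exact ⟨⟨_, b, hB hb, rfl⟩, (Submodule.Quotient.mk_eq_zero A').2 hb, rfl⟩

variable (φ : L →+* L) (T : W →+ W) (hT : ∀ (a : L) w, T (a • w) = φ a • T w)

section Step

variable {A B A' B' : Submodule L W} [FiniteDimensional L (B.map A.mkQ)]
  (hA : ∀ w ∈ A, T w ∈ A') (hB : ∀ w ∈ B, T w ∈ B') (hspan : B' ≤ Submodule.span L (T '' B) ⊔ A')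

omit [FiniteDimensional L (B.map A.mkQ)] in
include hA hB in
lemma exists_relMap : ∃ θ : B.map A.mkQ →+ B'.map A'.mkQ, ∀ (b : W) (hb : b ∈ B),
    (θ ⟨A.mkQ b, b, hb, rfl⟩ : W ⧸ A') = A'.mkQ (T b) := by
  let θ₀ : W ⧸ A →+ W ⧸ A' := QuotientAddGroup.map A.toAddSubgroup A'.toAddSubgroup T hA
  have h0 : ∀ b, θ₀ (A.mkQ b) = A'.mkQ (T b) := fun b => rfl
  refine ⟨(θ₀.comp (B.map A.mkQ).toAddSubgroup.subtype).codRestrict (B'.map A'.mkQ).toAddSubgroup ?_,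
    fun b hb => h0 b⟩
  rintro ⟨_, b, hb, rfl⟩
  exact ⟨T b, hB b hb, rfl⟩

include hA hB hspan hT

omit [FiniteDimensional L (B.map A.mkQ)] in
lemma exists_relMap_span : ∃ θ : B.map A.mkQ →+ B'.map A'.mkQ, (∀ (a : L) u, θ (a • u) = φ a • θ u) ∧
    Submodule.span L (Set.range θ) = ⊤ ∧ ∀ (b : W) (hb : b ∈ B),
    (θ ⟨A.mkQ b, b, hb, rfl⟩ : W ⧸ A') = A'.mkQ (T b) := by
  obtain ⟨θ, h⟩ := exists_relMap T hA hB
  refine ⟨θ, ?_, ?_, h⟩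
  · rintro a ⟨_, b, hb, rfl⟩
    apply Subtype.ext
    rw [Submodule.coe_smul, h b hb, ← map_smul, ← hT, ← h _ (B.smul_mem a hb)]
    rfl
  · refine eq_top_iff.2 ?_
    rintro ⟨_, b, hb, rfl⟩ -
    obtain ⟨x, hx, y, hy, rfl⟩ := Submodule.mem_sup.1 (hspan hb)
    have h1 : A'.mkQ (x + y) = A'.mkQ x := by
      rw [map_add, (Submodule.Quotient.mk_eq_zero A' (x := y)).2 hy |> fun h => (h : A'.mkQ y = 0), add_zero]
    have h2 : ∀ x ∈ Submodule.span L (T '' B), ∃ u ∈ Submodule.span L (Set.range θ), (u : W ⧸ A') = A'.mkQ x := by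
      intro x hx
      induction hx using Submodule.span_induction with
      | mem x hx =>
        obtain ⟨b, hb, rfl⟩ := hx
        exact ⟨_, Submodule.subset_span ⟨_, rfl⟩, h b hb⟩
      | zero => exact ⟨0, zero_mem _, (map_zero _).symm⟩
      | add x y _ _ hx hy =>
        obtain ⟨u, hu, e⟩ := hx
        obtain ⟨u', hu', e'⟩ := hy
        exact ⟨u + u', add_mem hu hu', by rw [map_add, ← e, ← e']; rfl⟩
      | smul a x _ hx =>
        obtain ⟨u, hu, e⟩ := hx
        exact ⟨a • u, Submodule.smul_mem _ _ hu, by rw [map_smul, ← e]; rfl⟩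
    obtain ⟨u, hu, e⟩ := h2 x hx
    rw [show (⟨A'.mkQ (x + y), x + y, hb, rfl⟩ : B'.map A'.mkQ) = u from Subtype.ext (h1.trans e.symm)]
    exact hu

lemma relDim_le : relDim A' B' ≤ relDim A B := by
  obtain ⟨θ, h1, h2, -⟩ := exists_relMap_span φ T hT hA hB hspan
  exact semilinear_finrank_le φ θ h1 h2

lemma linearIndependent_mkQ_comp (hd : relDim A' B' = relDim A B) {ι : Type*} {v : ι → W}
    (hvB : ∀ i, v i ∈ B) (hv : LinearIndependent L fun i => A.mkQ (v i)) :
    LinearIndependent L fun i => A'.mkQ (T (v i)) := by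
  obtain ⟨θ, h1, h2, h⟩ := exists_relMap_span φ T hT hA hB hspan
  let v' : ι → B.map A.mkQ := fun i => ⟨A.mkQ (v i), v i, hvB i, rfl⟩
  have hv' : LinearIndependent L v' := LinearIndependent.of_comp (B.map A.mkQ).subtype hv
  have h3 := semilinear_linearIndependent φ θ h1 h2 hd hv'
  have h4 := h3.map' (B'.map A'.mkQ).subtype (Submodule.ker_subtype _)
  rwa [show (B'.map A'.mkQ).subtype ∘ (fun i => θ (v' i)) = fun i => A'.mkQ (T (v i)) from
    funext fun i => h _ (hvB i)] at h4

end Step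

/-- A filtration on which `T` acts with constant relative dimensions. -/
structure IsTauFiltration (Λ : ℤ → Submodule L W) (l : ℕ) : Prop where
  smul (a : L) (w : W) : T (a • w) = φ a • T w
  pos : 0 < l
  mono : Monotone Λ
  map_mem (i : ℤ) : ∀ w ∈ Λ i, T w ∈ Λ (i + 1)
  le_span (i j : ℤ) : Λ (j + 1) ≤ Submodule.span L (T '' Λ j) ⊔ Λ i
  finite (i j : ℤ) : FiniteDimensional L ((Λ j).map (Λ i).mkQ)
  periodic (i j : ℤ) : relDim (Λ (i + l)) (Λ (j + l)) = relDim (Λ i) (Λ j)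

namespace IsTauFiltration

variable {φ T} {Λ : ℤ → Submodule L W} {l : ℕ} (h : IsTauFiltration φ T Λ l)

include h

lemma relDim_succ_le (i j : ℤ) : relDim (Λ (i + 1)) (Λ (j + 1)) ≤ relDim (Λ i) (Λ j) :=
  haveI := h.finite i j
  relDim_le φ T h.smul (h.map_mem i) (h.map_mem j) (h.le_span (i + 1) j)

lemma relDim_add_nat_le (n : ℕ) (i j : ℤ) : relDim (Λ (i + n)) (Λ (j + n)) ≤ relDim (Λ i) (Λ j) := by
  induction n with
  | zero => rw [Nat.cast_zero, add_zero, add_zero]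
  | succ n ih =>
    rw [Nat.cast_succ, ← add_assoc, ← add_assoc]
    exact (h.relDim_succ_le _ _).trans ih

/-- The induced semilinear maps have spanning images, so relative dimensions cannot grow under a
shift. After `l` shifts they have their original value, so none has dropped. -/
lemma relDim_succ (i j : ℤ) : relDim (Λ (i + 1)) (Λ (j + 1)) = relDim (Λ i) (Λ j) := by
  refine le_antisymm (h.relDim_succ_le i j) ?_
  rw [← h.periodic i j]
  have h1 := h.relDim_add_nat_le (l - 1) (i + 1) (j + 1)
  have h2 : ((l - 1 : ℕ) : ℤ) = l - 1 := by have := h.pos; omega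
  rw [h2, show i + 1 + ((l : ℤ) - 1) = i + l by ring, show j + 1 + ((l : ℤ) - 1) = j + l by ring] at h1
  exact h1

lemma relDim_eq (i : ℤ) : relDim (Λ i) (Λ (i + 1)) = relDim (Λ 0) (Λ 1) := by
  induction i using Int.induction_on with
  | zero => rfl
  | succ n ih => rw [h.relDim_succ, ih]
  | pred n ih =>
    have h1 := h.relDim_succ (-(n : ℤ) - 1) (-(n : ℤ) - 1 + 1)
    rw [sub_add_cancel] at h1
    rw [sub_add_cancel, ← h1, ih]

lemma relDim_zero_nat (n : ℕ) : relDim (Λ 0) (Λ n) = n * relDim (Λ 0) (Λ 1) := by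
  induction n with
  | zero =>
    rw [zero_mul, relDim, Nat.cast_zero]
    have : (Λ 0).map (Λ 0).mkQ = ⊥ := by
      rw [eq_bot_iff]
      rintro _ ⟨w, hw, rfl⟩
      exact (Submodule.Quotient.mk_eq_zero (Λ 0)).2 hw
    rw [this, finrank_bot]
  | succ n ih =>
    have := h.finite 0 (n + 1)
    rw [Nat.cast_succ, ← relDim_add (h.mono (show (0 : ℤ) ≤ n by omega)) (h.mono (show (n : ℤ) ≤ n + 1 by omega)),
      ih, h.relDim_eq]
    ring

lemma linearIndependent {i j : ℤ} {ι : Type*} {v : ι → W} (hv : ∀ a, v a ∈ Λ j)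
    (hli : LinearIndependent L fun a => (Λ i).mkQ (v a)) :
    LinearIndependent L fun a => (Λ (i + 1)).mkQ (T (v a)) :=
  haveI := h.finite i j
  linearIndependent_mkQ_comp φ T h.smul (h.map_mem i) (h.map_mem j) (h.le_span (i + 1) j)
    (h.relDim_succ i j) hv hli

variable {M : Submodule L W} (hM : ∀ m ∈ M, T m ∈ M) (hex : ∀ m ∈ M, ∃ i, m ∈ Λ i)

include hM

lemma span_image_le (j : ℤ) : Submodule.span L (T '' (M ⊓ Λ j : Submodule L W)) ≤ M ⊓ Λ (j + 1) := by
  rw [Submodule.span_le]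
  rintro _ ⟨m, hm, rfl⟩
  exact ⟨hM m hm.1, h.map_mem j m hm.2⟩

include hex

/-- Strictness of `T` on `M` for the filtration. It follows from preservation by `T` of independence
modulo the filtration. -/
lemma inf_span_image (j : ℤ) : Λ (j + 1) ⊓ Submodule.span L (T '' M) =
    Submodule.span L (T '' (M ⊓ Λ j : Submodule L W)) := by
  apply le_antisymm
  swap
  · exact le_inf ((h.span_image_le hM j).trans inf_le_right)
      (Submodule.span_mono (Set.image_mono inf_le_left))
  rintro x ⟨hx, hxN⟩
  obtain ⟨j', hj, hx'⟩ : ∃ j', j ≤ j' ∧ x ∈ Submodule.span L (T '' (M ⊓ Λ j' : Submodule L W)) := by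
    have hmono : ∀ {a b : ℤ}, a ≤ b → Submodule.span L (T '' (M ⊓ Λ a : Submodule L W)) ≤
        Submodule.span L (T '' (M ⊓ Λ b : Submodule L W)) := fun hab =>
      Submodule.span_mono (Set.image_mono (inf_le_inf_left M (h.mono hab)))
    clear hx
    induction hxN using Submodule.span_induction with
    | mem x hx =>
      obtain ⟨m, hm, rfl⟩ := hx
      obtain ⟨i, hi⟩ := hex m hm
      exact ⟨max i j, le_max_right _ _, Submodule.subset_span ⟨m, ⟨hm, h.mono (le_max_left _ _) hi⟩, rfl⟩⟩
    | zero => exact ⟨j, le_rfl, zero_mem _⟩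
    | add x y _ _ hx hy =>
      obtain ⟨a, ha, hx⟩ := hx
      obtain ⟨b, hb, hy⟩ := hy
      exact ⟨max a b, ha.trans (le_max_left _ _), add_mem (hmono (le_max_left _ _) hx) (hmono (le_max_right _ _) hy)⟩
    | smul c x _ hx =>
      obtain ⟨a, ha, hx⟩ := hx
      exact ⟨a, ha, Submodule.smul_mem _ _ hx⟩
  have hfin : FiniteDimensional L ((M ⊓ Λ j' : Submodule L W).map (Λ j).mkQ) :=
    haveI := h.finite j j'
    Submodule.finiteDimensional_of_le (Submodule.map_mono inf_le_right)
  -- Representatives in `M` of a basis of `M ∩ Λ_{j'}` modulo `Λ_j`: an element of the span of the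
  -- images is a combination of the `T (v a)` plus an element of the span of `T(M ∩ Λ_j)`. Lying in
  -- `Λ_{j+1}` forces the coefficients to vanish.
  let b := Module.finBasis L ((M ⊓ Λ j' : Submodule L W).map (Λ j).mkQ)
  choose v hv hv' using fun a => (b a).2
  have hli : LinearIndependent L fun a => (Λ j).mkQ (v a) := by
    have h1 := b.linearIndependent.map' (Submodule.subtype _) (Submodule.ker_subtype _)
    rwa [show Submodule.subtype _ ∘ b = fun a => (Λ j).mkQ (v a) from funext fun a => (hv' a).symm] at h1
  have hli' := h.linearIndependent (fun a => (hv a).2) hli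
  let P := Submodule.span L (T '' (M ⊓ Λ j : Submodule L W))
  obtain ⟨c, y, hy, rfl⟩ : ∃ (c : Fin _ → L), ∃ y ∈ P, ∑ a, c a • T (v a) + y = x := by
    clear hx hxN
    induction hx' using Submodule.span_induction with
    | mem x hx =>
      obtain ⟨m, hm, rfl⟩ := hx
      let u : (M ⊓ Λ j' : Submodule L W).map (Λ j).mkQ := ⟨(Λ j).mkQ m, m, hm, rfl⟩
      have h1 := congrArg Subtype.val (b.sum_repr u)
      have h2 : (Λ j).mkQ (m - ∑ a, b.repr u a • v a) = 0 := by
        rw [map_sub, map_sum, sub_eq_zero]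
        refine h1.symm.trans ?_
        rw [AddSubmonoidClass.coe_finsetSum]
        refine Finset.sum_congr rfl fun a _ => ?_
        rw [map_smul, hv']; rfl
      have h3 : m - ∑ a, b.repr u a • v a ∈ (M ⊓ Λ j : Submodule L W) :=
        ⟨M.sub_mem hm.1 (M.sum_mem fun a _ => M.smul_mem _ (hv a).1),
          (Submodule.Quotient.mk_eq_zero _).1 h2⟩
      refine ⟨fun a => φ (b.repr u a), T (m - ∑ a, b.repr u a • v a), Submodule.subset_span ⟨_, h3, rfl⟩, ?_⟩
      rw [map_sub, map_sum]
      simp only [h.smul]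
      rw [add_sub_cancel]
    | zero => exact ⟨0, 0, zero_mem _, by simp⟩
    | add x x' _ _ hx hx' =>
      obtain ⟨c, y, hy, rfl⟩ := hx
      obtain ⟨c', y', hy', rfl⟩ := hx'
      refine ⟨c + c', y + y', add_mem hy hy', ?_⟩
      simp only [Pi.add_apply, add_smul, Finset.sum_add_distrib]
      abel
    | smul a x _ hx =>
      obtain ⟨c, y, hy, rfl⟩ := hx
      refine ⟨a • c, a • y, P.smul_mem a hy, ?_⟩
      simp only [Pi.smul_apply, smul_eq_mul, mul_smul, smul_add, Finset.smul_sum]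
  have hy' : y ∈ Λ (j + 1) := ((h.span_image_le hM j) hy).2
  have h4 : ∑ a, c a • T (v a) ∈ Λ (j + 1) := by
    have := sub_mem hx hy'
    rwa [add_sub_cancel_right] at this
  have h5 : ∑ a, c a • (Λ (j + 1)).mkQ (T (v a)) = 0 := by
    have := (Submodule.Quotient.mk_eq_zero (Λ (j + 1))).2 h4
    rw [← this]
    exact ((map_sum (Λ (j + 1)).mkQ _ _).trans (Finset.sum_congr rfl fun a _ => map_smul _ _ _)).symm
  have h6 := Fintype.linearIndependent_iff.1 hli' c h5
  rw [Finset.sum_eq_zero (fun a _ => by rw [h6 a, zero_smul]), zero_add]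
  exact hy

/-- Comparison of the cokernel of `T` on `M` with the graded pieces of the filtration. -/
theorem relDim_eq_finrank {i₀ i₁ : ℤ} (hbot : M ⊓ Λ i₀ = ⊥) (htop : M ⊔ Λ i₁ = ⊤)
    [hfd : FiniteDimensional L (M.map (Submodule.span L (T '' M)).mkQ)] (i : ℤ) :
    relDim (Λ i) (Λ (i + 1)) = relDim (Submodule.span L (T '' M)) M := by
  set N := Submodule.span L (T '' M) with hN
  have hfinM : ∀ j, FiniteDimensional L (M ⊓ Λ j : Submodule L W) := by
    intro j
    have := h.finite i₀ j
    have h1 : Function.Injective ((Λ i₀).mkQ.comp (M ⊓ Λ j : Submodule L W).subtype) := by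
      rw [← LinearMap.ker_eq_bot, LinearMap.ker_eq_bot']
      rintro ⟨m, hm⟩ h0
      have h2 : m ∈ M ⊓ Λ i₀ := ⟨hm.1, (Submodule.Quotient.mk_eq_zero _).1 h0⟩
      rw [hbot] at h2
      exact Subtype.ext h2
    have h2 : FiniteDimensional L (LinearMap.range ((Λ i₀).mkQ.comp (M ⊓ Λ j : Submodule L W).subtype)) := by
      refine Submodule.finiteDimensional_of_le (S₂ := (Λ j).map (Λ i₀).mkQ) ?_
      rintro _ ⟨m, rfl⟩
      exact ⟨m, m.2.2, rfl⟩
    exact (LinearEquiv.ofInjective _ h1).symm.finiteDimensional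
  -- Since `M ∩ Λ_{i₀} = 0`, a basis of `M ∩ Λ_j` is independent modulo `Λ_{i₀}`, and `T` keeps it
  -- independent.
  have h1 : ∀ j, Module.finrank L (Submodule.span L (T '' (M ⊓ Λ j : Submodule L W))) =
      Module.finrank L (M ⊓ Λ j : Submodule L W) := by
    intro j
    have := hfinM j
    let b := Module.finBasis L (M ⊓ Λ j : Submodule L W)
    have hli : LinearIndependent L fun a => (Λ i₀).mkQ (b a : W) := by
      have h2 := b.linearIndependent.map' ((Λ i₀).mkQ.comp (M ⊓ Λ j : Submodule L W).subtype) (by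
        rw [LinearMap.ker_eq_bot']
        rintro ⟨m, hm⟩ h0
        have h2 : m ∈ M ⊓ Λ i₀ := ⟨hm.1, (Submodule.Quotient.mk_eq_zero _).1 h0⟩
        rw [hbot] at h2
        exact Subtype.ext h2)
      exact h2
    have hli' := LinearIndependent.of_comp (Λ (i₀ + 1)).mkQ (h.linearIndependent (fun a => (b a).2.2) hli)
    have h3 : Submodule.span L (T '' (M ⊓ Λ j : Submodule L W)) = Submodule.span L (Set.range fun a => T (b a)) := by
      apply le_antisymm
      · rw [Submodule.span_le]
        rintro _ ⟨m, hm, rfl⟩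
        have h4 : m ∈ Submodule.span L (Set.range fun a => (b a : W)) := by
          have := congrArg (Submodule.map (M ⊓ Λ j : Submodule L W).subtype) b.span_eq
          rw [Submodule.map_span, Submodule.map_top, Submodule.range_subtype, ← Set.range_comp] at this
          exact this.symm ▸ hm
        have h5 := semilinear_mem_span φ T h.smul h4
        rwa [← Set.range_comp] at h5
      · refine Submodule.span_mono ?_
        rintro _ ⟨a, rfl⟩
        exact ⟨_, (b a).2, rfl⟩
    rw [h3, finrank_span_eq_card hli', Fintype.card_fin]
  obtain ⟨j, hj, hj'⟩ : ∃ j, i₁ ≤ j ∧ (M ⊓ Λ (j + 1) : Submodule L W).map N.mkQ = M.map N.mkQ := by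
    let b := Module.finBasis L (M.map N.mkQ)
    choose v hv hv' using fun a => (b a).2
    choose k hk using fun a => hex (v a) (hv a)
    -- The adjoined element `none` makes the index set nonempty and forces the supremum to be at
    -- least `i₁`.
    let K := Finset.univ.sup' (Finset.univ_nonempty (α := Option (Fin _))) (fun a => a.elim i₁ k)
    have hK : ∀ a, Option.elim a i₁ k ≤ K := fun a =>
      Finset.le_sup' (fun a => Option.elim a i₁ k) (Finset.mem_univ a)
    refine ⟨K, hK none, le_antisymm (Submodule.map_mono inf_le_left) ?_⟩
    intro x hx
    have h2 := congrArg Subtype.val (b.sum_repr ⟨x, hx⟩)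
    rw [AddSubmonoidClass.coe_finsetSum] at h2
    have h2 : _ = x := h2
    rw [← h2]
    refine Submodule.sum_mem _ fun a _ => Submodule.smul_mem _ _ ⟨v a, ⟨hv a, ?_⟩, hv' a⟩
    exact h.mono ((hK (some a)).trans (by omega)) (hk a)
  have := hfinM (j + 1)
  -- For this large `j` the dimension of `M ∩ Λ_{j+1}` is counted in two ways: modulo the span of
  -- `T(M)`, with kernel of dimension `dim (M ∩ Λ_j)` by strictness, and modulo `Λ_j`, with kernel
  -- `M ∩ Λ_j`. The two images have dimension `dim M / span T(M)` and `dim Λ_{j+1} / Λ_j`.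
  have e1 := finrank_map_mkQ_add N (M ⊓ Λ (j + 1))
  have e2 := finrank_map_mkQ_add (Λ j) (M ⊓ Λ (j + 1))
  have hNM : N ≤ M := by
    rw [hN, Submodule.span_le]
    rintro _ ⟨m, hm, rfl⟩
    exact hM m hm
  rw [show N ⊓ (M ⊓ Λ (j + 1)) = Λ (j + 1) ⊓ N by
    rw [← inf_assoc, inf_eq_left.2 hNM, inf_comm], h.inf_span_image hM hex, h1] at e1
  rw [show Λ j ⊓ (M ⊓ Λ (j + 1)) = M ⊓ Λ j by
    rw [inf_left_comm, inf_eq_left.2 (h.mono (show j ≤ j + 1 by omega))]] at e2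
  have e3 : relDim (Λ j) (M ⊓ Λ (j + 1)) = relDim (Λ j) (Λ (j + 1)) := by
    rw [relDim, relDim, show (M ⊓ Λ (j + 1)).map (Λ j).mkQ = (Λ (j + 1)).map (Λ j).mkQ from ?_]
    refine le_antisymm (Submodule.map_mono inf_le_right) ?_
    rintro _ ⟨w, hw, rfl⟩
    obtain ⟨m, hm, y, hy, e⟩ := Submodule.mem_sup.1 (show w ∈ M ⊔ Λ i₁ by rw [htop]; trivial)
    have hy' := h.mono hj hy
    refine ⟨m, ⟨hm, ?_⟩, ?_⟩
    · rw [eq_sub_of_add_eq e]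
      exact sub_mem hw (h.mono (show j ≤ j + 1 by omega) hy')
    · rw [← e, map_add, (Submodule.Quotient.mk_eq_zero (Λ j) (x := y)).2 hy' |> fun h => (h : (Λ j).mkQ y = 0),
        add_zero]
  have e4 : relDim N (M ⊓ Λ (j + 1)) = relDim N M := by rw [relDim, hj', relDim]
  rw [h.relDim_eq, ← h.relDim_eq j, ← e3, ← e4]
  omega

end IsTauFiltration

end Filtration

end

/-! ### Lattices over a local ring with Frobenius. -/

noncomputable section

section LocalLattice

variable {K L W : Type*} [Field K] [Field L] [AddCommGroup W] [Module K W] [Module L W]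

/-- A subring `O` of a field with coefficient field `L`, uniformizer `z` and a Frobenius `σ`, and a `σ`-semilinear map `T`. -/
structure LocalFrob (O : Subring K) (σ : K →+* K) (φ : L →+* L) (ι : L →+* K) (z : K) (T : W →+ W) : Prop where
  σ_mem : ∀ a ∈ O, σ a ∈ O
  ι_mem : ∀ a, ι a ∈ O
  σ_ι : ∀ a, σ (ι a) = ι (φ a)
  z_mem : z ∈ O
  z_ne : z ≠ 0
  σ_z : σ z = z
  res : ∀ c ∈ O, ∃ a, ∃ c' ∈ O, c = ι a + z * c'
  res_unique : ∀ a, ι a * z⁻¹ ∈ O → a = 0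
  smul : ∀ (a : L) (w : W), a • w = ι a • w
  T_smul : ∀ (a : K) (w : W), T (a • w) = σ a • T w

/-- The lattice `c • Λ`. -/
def scaleLat {O : Subring K} (c : K) (Λ : Submodule O W) : Submodule O W :=
  Λ.map ({ toFun := fun w => c • w, map_add' := smul_add c, map_smul' := fun a w => smul_comm c (a : K) w } : W →ₗ[O] W)

lemma mem_scaleLat {O : Subring K} {c : K} (hc : c ≠ 0) {Λ : Submodule O W} {w : W} :
    w ∈ scaleLat c Λ ↔ c⁻¹ • w ∈ Λ := by
  constructor
  · rintro ⟨v, hv, rfl⟩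
    change c⁻¹ • c • v ∈ Λ
    rwa [inv_smul_smul₀ hc]
  · intro h
    exact ⟨_, h, smul_inv_smul₀ hc w⟩

lemma smul_mem_scaleLat {O : Subring K} (c : K) {Λ : Submodule O W} {w : W} (h : w ∈ Λ) :
    c • w ∈ scaleLat c Λ := ⟨w, h, rfl⟩

lemma scaleLat_scaleLat {O : Subring K} (c c' : K) (Λ : Submodule O W) :
    scaleLat c (scaleLat c' Λ) = scaleLat (c * c') Λ := by
  rw [scaleLat, scaleLat, scaleLat, ← Submodule.map_comp]
  congr 1
  ext w
  exact (mul_smul c c' w).symm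

lemma scaleLat_one {O : Subring K} (Λ : Submodule O W) : scaleLat 1 Λ = Λ := by
  ext w
  rw [mem_scaleLat one_ne_zero, inv_one, one_smul]

lemma scaleLat_iSup {O : Subring K} {ι : Sort*} (c : K) (Λ : ι → Submodule O W) :
    scaleLat c (⨆ i, Λ i) = ⨆ i, scaleLat c (Λ i) := Submodule.map_iSup _ _

lemma scaleLat_mono {O : Subring K} (c : K) {Λ Λ' : Submodule O W} (h : Λ ≤ Λ') :
    scaleLat c Λ ≤ scaleLat c Λ' := Submodule.map_mono h

lemma scaleLat_le {O : Subring K} {c : K} (hc : c ∈ O) (Λ : Submodule O W) : scaleLat c Λ ≤ Λ := by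
  rintro _ ⟨w, hw, rfl⟩
  exact Λ.smul_mem ⟨c, hc⟩ hw

variable (O : Subring K) (T : W →+ W) in
/-- The module generated by the image under `T`. -/
def frobSpan (Λ : Submodule O W) : Submodule O W := Submodule.span O (T '' Λ)

namespace LocalFrob

variable {O : Subring K} {σ : K →+* K} {φ : L →+* L} {ι : L →+* K} {z : K} {T : W →+ W}

variable (h : LocalFrob O σ φ ι z T)
include h

lemma T_mem_span {s : Set W} {w : W} (hw : w ∈ Submodule.span O s) : T w ∈ Submodule.span O (T '' s) := by
  induction hw using Submodule.span_induction with
  | mem w hw => exact Submodule.subset_span ⟨w, hw, rfl⟩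
  | zero => rw [map_zero]; exact zero_mem _
  | add w w' _ _ hw hw' => rw [map_add]; exact add_mem hw hw'
  | smul a w _ hw =>
    have : T (a • w) = (⟨σ a, h.σ_mem _ a.2⟩ : O) • T w := h.T_smul a w
    rw [this]
    exact Submodule.smul_mem _ _ hw

lemma frobSpan_span (s : Set W) : frobSpan O T (Submodule.span O s) = Submodule.span O (T '' s) := by
  apply le_antisymm
  · refine Submodule.span_le.2 ?_
    rintro _ ⟨w, hw, rfl⟩
    exact h.T_mem_span hw
  · exact Submodule.span_mono (Set.image_mono Submodule.subset_span)

lemma frobSpan_iterate (Λ : Submodule O W) (n : ℕ) :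
    (frobSpan O T)^[n] Λ = Submodule.span O (T^[n] '' Λ) := by
  induction n with
  | zero => rw [Function.iterate_zero, Function.iterate_zero, Set.image_id, Submodule.span_eq]; rfl
  | succ n ih =>
    rw [Function.iterate_succ_apply', ih, h.frobSpan_span, Function.iterate_succ', Set.image_comp]

lemma frobSpan_scaleLat {c : K} (hc : σ c = c) (Λ : Submodule O W) :
    frobSpan O T (scaleLat c Λ) = scaleLat c (frobSpan O T Λ) := by
  rw [frobSpan, frobSpan, scaleLat, scaleLat, Submodule.map_span, Submodule.map_coe, Set.image_image, Set.image_image]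
  congr 1
  refine Set.image_congr fun w _ => ?_
  change T (c • w) = c • T w
  rw [h.T_smul, hc]

lemma frobSpan_iterate_scaleLat {c : K} (hc : σ c = c) (Λ : Submodule O W) (n : ℕ) :
    (frobSpan O T)^[n] (scaleLat c Λ) = scaleLat c ((frobSpan O T)^[n] Λ) := by
  induction n with
  | zero => rfl
  | succ n ih => rw [Function.iterate_succ_apply', ih, h.frobSpan_scaleLat hc, Function.iterate_succ_apply']

lemma frobSpan_iSup {J : Type*} (Λ : J → Submodule O W) : frobSpan O T (⨆ j, Λ j) = ⨆ j, frobSpan O T (Λ j) := by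
  have e : ⨆ j, Λ j = Submodule.span O (⋃ j, (Λ j : Set W)) := by
    rw [Submodule.span_iUnion]; simp
  rw [e, h.frobSpan_span, Set.image_iUnion, Submodule.span_iUnion]
  rfl

lemma frobSpan_fg {Λ : Submodule O W} (hΛ : Λ.FG) : (frobSpan O T Λ).FG := by
  obtain ⟨s, hs⟩ := Submodule.fg_def.1 hΛ
  rw [← hs.2, h.frobSpan_span]
  exact Submodule.fg_span (hs.1.image T)

lemma scaleLat_zpow_le {a b : ℤ} (hab : b ≤ a) (Λ : Submodule O W) :
    scaleLat (z ^ a) Λ ≤ scaleLat (z ^ b) Λ := by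
  have : z ^ a = z ^ b * z ^ (a - b).toNat := by
    rw [← zpow_natCast, ← zpow_add₀ h.z_ne]
    congr 1; omega
  rw [this, ← scaleLat_scaleLat]
  exact scaleLat_mono _ (scaleLat_le (pow_mem h.z_mem _) Λ)

lemma σ_zpow (a : ℤ) : σ (z ^ a) = z ^ a := by rw [map_zpow₀, h.σ_z]

/-- Expansion in powers of the uniformizer. -/
lemma exists_expansion (n : ℕ) {c : K} (hc : c ∈ O) :
    ∃ (a : ℕ → L), ∃ c' ∈ O, c = ∑ i ∈ Finset.range n, ι (a i) * z ^ i + z ^ n * c' := by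
  induction n with
  | zero => exact ⟨0, c, hc, by simp⟩
  | succ n ih =>
    obtain ⟨a, c', hc', e⟩ := ih
    obtain ⟨b, c'', hc'', e'⟩ := h.res c' hc'
    refine ⟨Function.update a n b, c'', hc'', ?_⟩
    rw [Finset.sum_range_succ, Function.update_self]
    rw [Finset.sum_congr rfl fun i hi => by
      rw [Function.update_of_ne (Finset.mem_range.1 hi).ne]]
    rw [e, e']
    ring

end LocalFrob

end LocalLattice

end

/-! ### Periodic chains of lattices generated by Frobenius. -/

noncomputable section

section LocalLattice

variable {K L W : Type*} [Field K] [Field L] [AddCommGroup W] [Module K W] [Module L W]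

namespace LocalFrob

variable {O : Subring K} {σ : K →+* K} {φ : L →+* L} {ι : L →+* K} {z : K} {T : W →+ W}

variable (T z) in
/-- The lattices `∑_j z ^ ⌊(j - i) k / l⌋ • τ^j Λ`. -/
def iterLat (Λ : Submodule O W) (k l : ℕ) (i : ℤ) : Submodule O W :=
  ⨆ j : ℕ, scaleLat (z ^ ((j - i) * k / l : ℤ)) ((frobSpan O T)^[j] Λ)

variable (O T z) in
/-- A chain of lattices on which `T` is the shift and that is periodic up to powers of `z`. -/
structure IsLatChain (Λ : ℤ → Submodule O W) (k l : ℕ) : Prop where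
  pos : 0 < k
  pos' : 0 < l
  mono : Monotone Λ
  fg (i : ℤ) : (Λ i).FG
  frob (i : ℤ) : frobSpan O T (Λ i) = Λ (i + 1)
  scale (i : ℤ) : Λ (i + l) = scaleLat (z ^ (-k : ℤ)) (Λ i)
  exhaust (w : W) : ∃ i, w ∈ Λ i

variable (h : LocalFrob O σ φ ι z T)
include h

lemma T_L_smul (a : L) (w : W) : T (a • w) = φ a • T w := by
  rw [h.smul, h.T_smul, h.σ_ι, ← h.smul]

section Iter

variable {Λ : Submodule O W} {k l g : ℕ} (hl : 0 < l)
  (hΛ : (frobSpan O T)^[g * l] Λ = scaleLat (z ^ (-(g * k : ℕ) : ℤ)) Λ)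

include hl hΛ in
-- Raising `j` by `g l` multiplies the scalar by `z ^ (g k)` and, by the purity hypothesis, the
-- lattice by its inverse. So only finitely many terms are distinct, and the first terms may be
-- omitted.
lemma iterLat_term (i : ℤ) (j : ℕ) :
    scaleLat (z ^ (((j + g * l : ℕ) - i) * k / l : ℤ)) ((frobSpan O T)^[j + g * l] Λ) =
      scaleLat (z ^ ((j - i) * k / l : ℤ)) ((frobSpan O T)^[j] Λ) := by
  have hl' : (l : ℤ) ≠ 0 := by omega
  rw [Function.iterate_add_apply, hΛ, h.frobSpan_iterate_scaleLat (h.σ_zpow _), scaleLat_scaleLat,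
    ← zpow_add₀ h.z_ne]
  congr 2
  push_cast
  rw [show ((j : ℤ) + g * l - i) * k = (j - i) * k + (g * k) * l by ring, Int.add_mul_ediv_right _ _ hl']
  ring

lemma iterLat_mono : Monotone (iterLat z T Λ k l) := by
  intro i i' hi
  refine iSup_mono fun j => h.scaleLat_zpow_le ?_ _
  rcases Nat.eq_zero_or_pos l with rfl | hl
  · simp
  exact Int.ediv_le_ediv (by omega) (mul_le_mul_of_nonneg_right (by omega) (by omega))

include hl in
lemma iterLat_scale (i : ℤ) : iterLat z T Λ k l (i + l) = scaleLat (z ^ (-k : ℤ)) (iterLat z T Λ k l i) := by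
  have hl' : (l : ℤ) ≠ 0 := by omega
  rw [iterLat, iterLat, scaleLat_iSup]
  refine iSup_congr fun j => ?_
  rw [scaleLat_scaleLat, ← zpow_add₀ h.z_ne]
  congr 2
  rw [show ((j : ℤ) - (i + l)) * k = (j - i) * k + (-k) * l by ring, Int.add_mul_ediv_right _ _ hl']
  ring

include hl hΛ in
lemma iterLat_frob (hg : 0 < g) (i : ℤ) :
    frobSpan O T (iterLat z T Λ k l i) = iterLat z T Λ k l (i + 1) := by
  have e : ∀ j : ℕ, frobSpan O T (scaleLat (z ^ (((j : ℤ) - i) * k / l : ℤ)) ((frobSpan O T)^[j] Λ)) =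
      scaleLat (z ^ (((j + 1 : ℕ) - (i + 1)) * k / l : ℤ)) ((frobSpan O T)^[j + 1] Λ) := by
    intro j
    rw [h.frobSpan_scaleLat (h.σ_zpow _), Function.iterate_succ_apply',
      show (((j + 1 : ℕ) : ℤ) - (i + 1)) = j - i by push_cast; ring]
  rw [iterLat, h.frobSpan_iSup]
  apply le_antisymm
  · refine iSup_le fun j => ?_
    rw [e]
    exact le_iSup (fun j : ℕ => scaleLat (z ^ (((j : ℤ) - (i + 1)) * k / l : ℤ)) ((frobSpan O T)^[j] Λ)) (j + 1)
  · refine iSup_le fun j => ?_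
    -- Frobenius turns the term `j` into the term `j + 1` and thus misses the term `0`; periodicity
    -- replaces it by a term of positive index.
    rw [← h.iterLat_term hl hΛ (i + 1) j]
    obtain ⟨m, hm⟩ : ∃ m, j + g * l = m + 1 :=
      ⟨j + g * l - 1, by have := Nat.mul_pos hg hl; omega⟩
    rw [hm, ← e]
    exact le_iSup (fun j : ℕ => frobSpan O T (scaleLat (z ^ (((j : ℤ) - i) * k / l : ℤ)) ((frobSpan O T)^[j] Λ))) m

omit [Field L] [Module L W] h in
lemma scaleLat_fg (c : K) (hf : Λ.FG) : (scaleLat c Λ).FG := Submodule.FG.map _ hf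

include hl hΛ in
lemma iterLat_fg (hg : 0 < g) (hf : Λ.FG) (i : ℤ) : (iterLat z T Λ k l i).FG := by
  have hgl := Nat.mul_pos hg hl
  have e : iterLat z T Λ k l i = ⨆ j : Fin (g * l),
      scaleLat (z ^ (((j : ℕ) - i) * k / l : ℤ)) ((frobSpan O T)^[(j : ℕ)] Λ) := by
    apply le_antisymm
    · refine iSup_le fun j => ?_
      have : scaleLat (z ^ (((j : ℕ) - i) * k / l : ℤ)) ((frobSpan O T)^[j] Λ) =
          scaleLat (z ^ (((j % (g * l) : ℕ) - i) * k / l : ℤ)) ((frobSpan O T)^[j % (g * l)] Λ) := by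
        induction j using Nat.strong_induction_on with
        | _ j ih =>
          by_cases hj : j < g * l
          · rw [Nat.mod_eq_of_lt hj]
          · have h1 := ih (j - g * l) (by omega)
            rw [← Nat.mod_eq_sub_mod (by omega)] at h1
            rw [← h1, ← h.iterLat_term hl hΛ i (j - g * l), Nat.sub_add_cancel (by omega)]
      rw [this]
      exact le_iSup (fun j : Fin (g * l) =>
        scaleLat (z ^ (((j : ℕ) - i) * k / l : ℤ)) ((frobSpan O T)^[(j : ℕ)] Λ)) ⟨_, Nat.mod_lt _ hgl⟩
    · exact iSup_le fun j => le_iSup (fun j : ℕ =>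
        scaleLat (z ^ (((j : ℕ) - i) * k / l : ℤ)) ((frobSpan O T)^[j] Λ)) (j : ℕ)
  rw [e]
  refine Submodule.fg_iSup _ fun j => scaleLat_fg _ ?_
  generalize (j : ℕ) = n
  induction n with
  | zero => exact hf
  | succ n ih => rw [Function.iterate_succ_apply']; exact h.frobSpan_fg ih

omit [Field L] [Module L W] h in
lemma le_iterLat_zero : Λ ≤ iterLat z T Λ k l 0 := by
  refine le_trans (le_of_eq ?_) (le_iSup _ 0)
  rw [Function.iterate_zero]
  simp [scaleLat_one]

include hl hΛ in
theorem isLatChain_iterLat (hk : 0 < k) (hg : 0 < g) (hf : Λ.FG) (hex : ∀ w, ∃ n : ℕ, z ^ n • w ∈ Λ) :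
    IsLatChain O z T (iterLat z T Λ k l) k l where
  pos := hk
  pos' := hl
  mono := h.iterLat_mono
  fg := h.iterLat_fg hl hΛ hg hf
  frob := h.iterLat_frob hl hΛ hg
  scale := h.iterLat_scale hl
  exhaust w := by
    obtain ⟨n, hn⟩ := hex w
    have hs : ∀ n : ℕ, iterLat z T Λ k l ((n * l : ℕ) : ℤ) = scaleLat (z ^ (-(n * k : ℕ) : ℤ)) (iterLat z T Λ k l 0) := by
      intro n
      induction n with
      | zero => simp [scaleLat_one]
      | succ n ih =>
        rw [show (((n + 1) * l : ℕ) : ℤ) = (n * l : ℕ) + l by push_cast; ring, h.iterLat_scale hl, ih, scaleLat_scaleLat,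
          ← zpow_add₀ h.z_ne]
        congr 2
        push_cast; ring
    -- After `n` periods the lattice is `z ^ (-n k)` times that of index `0`; this contains `z ^
    -- (-n) Λ` because `k ≥ 1`.
    refine ⟨(n * l : ℕ), ?_⟩
    rw [hs, mem_scaleLat (zpow_ne_zero _ h.z_ne), zpow_neg, inv_inv, zpow_natCast]
    have : n * k = n * (k - 1) + n := by obtain ⟨m, rfl⟩ := Nat.exists_eq_succ_of_ne_zero hk.ne'; simp; ring
    rw [this, pow_add, mul_smul]
    exact (iterLat z T Λ k l 0).smul_mem ⟨_, pow_mem h.z_mem _⟩ (le_iterLat_zero hn)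

end Iter

/-- A lattice as a subspace over the coefficient field. -/
def lSub (Λ : Submodule O W) : Submodule L W where
  carrier := Λ
  add_mem' := Λ.add_mem
  zero_mem' := Λ.zero_mem
  smul_mem' a w hw := by
    rw [h.smul]
    exact Λ.smul_mem ⟨ι a, h.ι_mem a⟩ hw

/-- Expand coefficients in `z` up to order `n`; the tails fall into `Λ`. This reduces generation
over the local ring to generation over `L` by the finitely many multiples `z ^ m • w` of each
generator. -/
lemma lSub_span_le (s : Set W) (n : ℕ) (Λ : Submodule O W) (hs : ∀ w ∈ s, z ^ n • w ∈ Λ) :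
    h.lSub (Submodule.span O s) ≤ Submodule.span L {v | ∃ m < n, ∃ w ∈ s, v = z ^ m • w} ⊔ h.lSub Λ := by
  intro x hx
  set Y := Submodule.span L {v | ∃ m < n, ∃ w ∈ s, v = z ^ m • w} ⊔ h.lSub Λ
  suffices H : ∀ c ∈ O, c • x ∈ Y by simpa using H 1 O.one_mem
  replace hx : x ∈ Submodule.span O s := hx
  induction hx using Submodule.span_induction with
  | mem w hw =>
    intro c hc
    obtain ⟨a, c', hc', rfl⟩ := h.exists_expansion n hc
    rw [add_smul, Finset.sum_smul]
    refine Y.add_mem (Y.sum_mem fun m hm => ?_) ?_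
    · rw [mul_smul, ← h.smul]
      exact Y.smul_mem _ (Submodule.mem_sup_left (Submodule.subset_span ⟨m, Finset.mem_range.1 hm, w, hw, rfl⟩))
    · rw [mul_comm, mul_smul]
      exact Submodule.mem_sup_right (Λ.smul_mem ⟨c', hc'⟩ (hs w hw))
  | zero => intro c _; rw [smul_zero]; exact Y.zero_mem
  | add x y _ _ hx hy => intro c hc; rw [smul_add]; exact Y.add_mem (hx c hc) (hy c hc)
  | smul a x _ hx =>
    intro c hc
    change c • (a : K) • x ∈ Y
    rw [smul_smul]
    exact hx _ (O.mul_mem hc a.2)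

lemma relDim_scaleLat {c : K} (hc : c ≠ 0) (A B : Submodule O W) :
    relDim (h.lSub (scaleLat c A)) (h.lSub (scaleLat c B)) = relDim (h.lSub A) (h.lSub B) := by
  let e : W ≃ₗ[L] W :=
    { toFun := fun w => c • w
      map_add' := smul_add c
      map_smul' := fun a w => by
        rw [RingHom.id_apply, h.smul, h.smul, smul_comm]
      invFun := fun w => c⁻¹ • w
      left_inv := inv_smul_smul₀ hc
      right_inv := smul_inv_smul₀ hc }
  have he : ∀ A : Submodule O W, (h.lSub A).map (e : W →ₗ[L] W) = h.lSub (scaleLat c A) := by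
    intro A
    ext w
    exact Iff.rfl
  let E := Submodule.Quotient.equiv (h.lSub A) (h.lSub (scaleLat c A)) e (he A)
  have : (h.lSub (scaleLat c B)).map (h.lSub (scaleLat c A)).mkQ =
      ((h.lSub B).map (h.lSub A).mkQ).map (E : _ →ₗ[L] _) := by
    rw [← he B, ← Submodule.map_comp, ← Submodule.map_comp]
    rfl
  rw [relDim, this, relDim, LinearEquiv.finrank_map_eq]

namespace IsLatChain

variable {Λ : ℤ → Submodule O W} {k l : ℕ} (hc : IsLatChain O z T Λ k l)

include hc

lemma scale_nat (i : ℤ) (n : ℕ) : Λ (i + (n * l : ℕ)) = scaleLat (z ^ (-(n * k : ℕ) : ℤ)) (Λ i) := by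
  induction n with
  | zero => simp [scaleLat_one]
  | succ n ih =>
    rw [show i + (((n + 1) * l : ℕ) : ℤ) = i + (n * l : ℕ) + l by push_cast; ring, hc.scale, ih, scaleLat_scaleLat,
      ← zpow_add₀ h.z_ne]
    congr 2
    push_cast; ring

lemma exists_pow_smul_mem (i j : ℤ) : ∃ n : ℕ, ∀ w ∈ Λ j, z ^ n • w ∈ Λ i := by
  refine ⟨(j - i).toNat * k, fun w hw => ?_⟩
  have h1 : w ∈ Λ (i + ((j - i).toNat * l : ℕ)) := by
    refine hc.mono ?_ hw
    have := Nat.le_mul_of_pos_right (j - i).toNat hc.pos'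
    omega
  rw [hc.scale_nat h, mem_scaleLat (zpow_ne_zero _ h.z_ne), zpow_neg, inv_inv, zpow_natCast] at h1
  exact h1

theorem isTauFiltration : IsTauFiltration φ T (fun i => h.lSub (Λ i)) l where
  smul := h.T_L_smul
  pos := hc.pos'
  mono i j hij := fun w hw => hc.mono hij hw
  map_mem i w hw := by
    change T w ∈ Λ (i + 1)
    rw [← hc.frob]
    exact Submodule.subset_span ⟨w, hw, rfl⟩
  le_span i j := by
    obtain ⟨n, hn⟩ := hc.exists_pow_smul_mem h i (j + 1)
    rw [← hc.frob]
    -- Because `σ z = z`, the vector `z ^ m • T w` equals `T (z ^ m • w)` and is again an image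
    -- under `T`.
    refine (h.lSub_span_le _ n (Λ i) ?_).trans (sup_le_sup_right (Submodule.span_mono ?_) _)
    · rintro _ ⟨w, hw, rfl⟩
      refine hn _ ?_
      rw [← hc.frob]
      exact Submodule.subset_span ⟨w, hw, rfl⟩
    · rintro _ ⟨m, -, _, ⟨w, hw, rfl⟩, rfl⟩
      refine ⟨z ^ m • w, (Λ j).smul_mem ⟨_, pow_mem h.z_mem m⟩ hw, ?_⟩
      rw [h.T_smul, map_pow, h.σ_z]
  finite i j := by
    obtain ⟨n, hn⟩ := hc.exists_pow_smul_mem h i j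
    obtain ⟨s, hs⟩ := hc.fg j
    have h1 := h.lSub_span_le (s : Set W) n (Λ i) fun w hw => hn w (by rw [← hs]; exact Submodule.subset_span hw)
    rw [hs] at h1
    have hfin : {v | ∃ m < n, ∃ w ∈ (s : Set W), v = z ^ m • w}.Finite := by
      refine (((Finset.range n).finite_toSet.prod s.finite_toSet).image (fun p => z ^ p.1 • p.2)).subset ?_
      rintro _ ⟨m, hm, w, hw, rfl⟩
      exact ⟨(m, w), ⟨Finset.mem_coe.2 (Finset.mem_range.2 hm), hw⟩, rfl⟩
    have := FiniteDimensional.span_of_finite L hfin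
    have h2 := Submodule.map_mono (f := (h.lSub (Λ i)).mkQ) h1
    rw [Submodule.map_sup, Submodule.mkQ_map_self, sup_bot_eq] at h2
    exact Submodule.finiteDimensional_of_le h2
  periodic i j := by
    rw [hc.scale, hc.scale, h.relDim_scaleLat (zpow_ne_zero _ h.z_ne)]

end IsLatChain

/-- The residue field is `L`, so the vectors `z⁻¹ • b j` form an `L`-basis of the quotient. -/
lemma relDim_scaleLat_inv {r : ℕ} {b : Fin r → W} (hb : LinearIndependent K b) :
    relDim (h.lSub (Submodule.span O (Set.range b))) (h.lSub (scaleLat z⁻¹ (Submodule.span O (Set.range b)))) = r := by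
  set A := h.lSub (Submodule.span O (Set.range b))
  have hli : LinearIndependent L fun j => A.mkQ (z⁻¹ • b j) := by
    rw [Fintype.linearIndependent_iff]
    intro a ha i
    have h1 : ∑ j, a j • z⁻¹ • b j ∈ Submodule.span O (Set.range b) := by
      refine (Submodule.Quotient.mk_eq_zero A).1 ?_
      rw [← ha]
      exact (map_sum A.mkQ _ _).trans (Finset.sum_congr rfl fun j _ => map_smul _ _ _)
    obtain ⟨c, hc⟩ := (Submodule.mem_span_range_iff_exists_fun O).1 h1
    have h2 : ∑ j, ((c j : K) - ι (a j) * z⁻¹) • b j = 0 := by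
      simp only [sub_smul, Finset.sum_sub_distrib]
      rw [sub_eq_zero]
      refine Eq.trans hc (Finset.sum_congr rfl fun j _ => ?_)
      rw [h.smul, mul_smul]
    refine h.res_unique _ ?_
    rw [← sub_eq_zero.1 (Fintype.linearIndependent_iff.1 hb _ h2 i)]
    exact (c i).2
  have hspan : (h.lSub (scaleLat z⁻¹ (Submodule.span O (Set.range b)))).map A.mkQ =
      Submodule.span L (Set.range fun j => A.mkQ (z⁻¹ • b j)) := by
    apply le_antisymm
    · rintro _ ⟨w, hw, rfl⟩
      have hw : w ∈ scaleLat z⁻¹ (Submodule.span O (Set.range b)) := hw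
      rw [mem_scaleLat (inv_ne_zero h.z_ne), inv_inv] at hw
      obtain ⟨c, hc⟩ := (Submodule.mem_span_range_iff_exists_fun O).1 hw
      choose a c' hc' e using fun j => h.res (c j : K) (c j).2
      have h1 : w = ∑ j, a j • z⁻¹ • b j + ∑ j, (⟨c' j, hc' j⟩ : O) • b j := by
        rw [← inv_smul_smul₀ h.z_ne w, ← hc, Finset.smul_sum, ← Finset.sum_add_distrib]
        refine Finset.sum_congr rfl fun j _ => ?_
        change z⁻¹ • (c j : K) • b j = a j • z⁻¹ • b j + c' j • b j
        rw [e, h.smul, smul_smul, smul_smul, ← add_smul]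
        congr 1
        field_simp [h.z_ne]
      have h2 : A.mkQ (∑ j, (⟨c' j, hc' j⟩ : O) • b j) = 0 :=
        (Submodule.Quotient.mk_eq_zero A).2 (show _ ∈ Submodule.span O (Set.range b) from
          Submodule.sum_mem _ fun j _ => Submodule.smul_mem _ _ (Submodule.subset_span ⟨j, rfl⟩))
      rw [h1, map_add, h2, add_zero, map_sum]
      refine Submodule.sum_mem _ fun j _ => ?_
      rw [map_smul]
      exact Submodule.smul_mem _ _ (Submodule.subset_span ⟨j, rfl⟩)
    · rw [Submodule.span_le]
      rintro _ ⟨j, rfl⟩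
      exact ⟨_, smul_mem_scaleLat _ (Submodule.subset_span ⟨j, rfl⟩), rfl⟩
  rw [relDim, hspan, finrank_span_eq_card hli, Fintype.card_fin]

/-- The relative dimension of the steps of a chain. -/
theorem IsLatChain.mul_relDim_eq {Λ : ℤ → Submodule O W} {k l r : ℕ} (hc : IsLatChain O z T Λ k l)
    {b : Fin r → W} (hb : LinearIndependent K b) (hΛ : Λ 0 = Submodule.span O (Set.range b)) :
    l * relDim (h.lSub (Λ 0)) (h.lSub (Λ 1)) = k * r := by
  rw [← (hc.isTauFiltration h).relDim_zero_nat]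
  -- Multiplying the free lattice `Λ 0` by `z⁻¹` adds dimension `r` each time. At `n = k` this is
  -- the dimension of `l` steps of the chain.
  have h0 : ∀ n : ℕ, n ≤ k → relDim (h.lSub (Λ 0)) (h.lSub (scaleLat (z ^ (-n : ℤ)) (Λ 0))) = n * r := by
    intro n hn
    have hfin := (hc.isTauFiltration h).finite 0 l
    induction n with
    | zero =>
      have : (h.lSub (Λ 0)).map (h.lSub (Λ 0)).mkQ = ⊥ := Submodule.mkQ_map_self _
      rw [Nat.cast_zero, neg_zero, zpow_zero, scaleLat_one, relDim, this, finrank_bot, zero_mul]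
    | succ n ih =>
      have hle : ∀ {a b : ℤ}, b ≤ a → h.lSub (scaleLat (z ^ a) (Λ 0)) ≤ h.lSub (scaleLat (z ^ b) (Λ 0)) :=
        fun hab w hw => h.scaleLat_zpow_le hab _ hw
      have h1 : h.lSub (Λ 0) ≤ h.lSub (scaleLat (z ^ (-n : ℤ)) (Λ 0)) := by
        have := hle (show -(n : ℤ) ≤ 0 by omega)
        rwa [zpow_zero, scaleLat_one] at this
      have : FiniteDimensional L ((h.lSub (scaleLat (z ^ (-(n + 1 : ℕ) : ℤ)) (Λ 0))).map (h.lSub (Λ 0)).mkQ) := by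
        refine Submodule.finiteDimensional_of_le (S₂ := (h.lSub (Λ l)).map (h.lSub (Λ 0)).mkQ) (Submodule.map_mono ?_)
        rw [show (l : ℤ) = 0 + l by ring, hc.scale]
        exact hle (by omega)
      rw [← relDim_add h1 (hle (show -((n + 1 : ℕ) : ℤ) ≤ -(n : ℤ) by omega)), ih (by omega),
        show (-((n + 1 : ℕ) : ℤ)) = -n + -1 by push_cast; ring, zpow_add₀ h.z_ne, ← scaleLat_scaleLat,
        h.relDim_scaleLat (zpow_ne_zero _ h.z_ne), zpow_neg_one, hΛ, h.relDim_scaleLat_inv hb]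
      ring
  have h1 := h0 k le_rfl
  rw [← hc.scale, zero_add] at h1
  exact h1

end LocalFrob

end LocalLattice

end

/-! ### Bases of lattices, and finite codimension at a rational point. -/

noncomputable section

open PointedCurve (map_map_apply map_map_comm app_map_apply modHom modHom_app)

section LocalBasis

variable {X : Scheme.{u}} [IsIntegral X] {W : Type*} [AddCommGroup W] [Module X.functionField W]

lemma mem_span_range_basis_iff {x : X} {r : ℕ} (b : Module.Basis (Fin r) X.functionField W) (w : W) :
    w ∈ Submodule.span (locRing X x) (Set.range b) ↔ ∀ j, b.repr w j ∈ locRing X x := by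
  rw [Submodule.mem_span_range_iff_exists_fun]
  constructor
  · rintro ⟨c, rfl⟩ j
    have : ∑ i, c i • b i = ∑ i, (c i : X.functionField) • b i := rfl
    rw [this, b.repr_sum_self]
    exact (c j).2
  · intro h
    refine ⟨fun j => ⟨_, h j⟩, ?_⟩
    exact b.sum_repr w

variable {F : X.Modules} {γ : GenEmb F W}

lemma GenEmb.IsFrame.lat_eq_span {r : ℕ} {V : X.Opens} {b : Module.Basis (Fin r) X.functionField W}
    (h : γ.IsFrame V b) {x : X} (hx : x ∈ V) : γ.lat x = Submodule.span (locRing X x) (Set.range b) := by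
  ext w
  rw [h x hx, mem_span_range_basis_iff]

lemma exists_basis_of_fg [IsLocallyPID X] [FiniteDimensional X.functionField W] {r : ℕ}
    (hr : Module.finrank X.functionField W = r) {x : X} (Λ : Submodule (locRing X x) W) (hf : Λ.FG)
    (hs : Submodule.span X.functionField (Λ : Set W) = ⊤) :
    ∃ b : Module.Basis (Fin r) X.functionField W, Λ = Submodule.span (locRing X x) (Set.range b) := by
  have : IsPrincipalIdealRing (locRing X x) :=
    IsPrincipalIdealRing.of_surjective (locRingEquiv x) (locRingEquiv x).surjective
  have : IsFractionRing (locRing X x) X.functionField :=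
    inferInstanceAs (IsFractionRing (locVal x) X.functionField)
  have : Submodule.IsLattice X.functionField Λ := ⟨hf, hs⟩
  have : Module.IsTorsionFree (locRing X x) X.functionField :=
    Module.isTorsionFree_iff_algebraMap_injective.2 Subtype.val_injective
  have : Module.Free (locRing X x) Λ := Submodule.IsLattice.free (K := X.functionField) Λ
  have : Module.Finite (locRing X x) Λ := Module.Finite.iff_fg.2 hf
  let b₀ := Module.Free.chooseBasis (locRing X x) Λ
  let b₁ := b₀.extendOfIsLattice X.functionField
  let e : Module.Free.ChooseBasisIndex (locRing X x) Λ ≃ Fin r := Fintype.equivFinOfCardEq (by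
    rw [← hr, Module.finrank_eq_card_basis b₁])
  refine ⟨b₁.reindex e, ?_⟩
  have h1 : Set.range (b₁.reindex e) = Λ.subtype '' Set.range b₀ := by
    rw [Module.Basis.range_reindex, ← Set.range_comp]
    congr 1
    ext i
    exact Module.Basis.extendOfIsLattice_apply _ b₀ i
  rw [h1, ← Submodule.map_span, b₀.span_eq, Submodule.map_top, Submodule.range_subtype]

/-- The functions have finitely many poles, and all of them except possibly `x` can be removed. -/
lemma exists_open_forall_ne_mem_locRing [IsLocallyPID X] [NoetherianSpace X] {ι : Type*} [Finite ι]
    (c : ι → X.functionField) (x : X) :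
    ∃ (V : X.Opens) (_ : x ∈ V), ∀ y ∈ V, y ≠ x → ∀ j, c j ∈ locRing X y := by
  let Z : Set X := ⋃ j, {y : X | c j ∉ locRing X y}
  have hc : IsClosed Z := isClosed_iUnion_of_finite fun j => isClosed_notMem_locRing (c j)
  have hg : genericPoint X ∉ Z := by
    intro hx
    obtain ⟨j, hj⟩ := Set.mem_iUnion.1 hx
    exact hj (by rw [locRing_genericPoint]; trivial)
  have hfin := finite_of_genericPoint_notMem hc hg
  have hc' : IsClosed (Z \ {x}) := by
    rw [← Set.biUnion_of_singleton (Z \ {x})]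
    refine (hfin.subset Set.sdiff_subset).isClosed_biUnion fun y hy => ?_
    exact isClosed_singleton_of_ne_genericPoint (fun e => hg (e ▸ hy.1))
  refine ⟨⟨_, hc'.isOpen_compl⟩, fun h => h.2 rfl, fun y hy hyx j => ?_⟩
  by_contra hj
  exact hy ⟨Set.mem_iUnion.2 ⟨j, hj⟩, hyx⟩

/-- If the stalk of `φ : f^* F → G` at `x` is an isomorphism, its image is the whole stalk of `G`. -/
theorem GenEmb.lat_eq_pullLat {G : X.Modules} (γ : GenEmb F W) (δ : GenEmb G W) (f : X ⟶ X)
    (φ : (Scheme.Modules.pullback f).obj F ⟶ G) (T : W →+ W)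
    (hφ : ∀ V s, δ.γ (f ⁻¹ᵁ V) (((Scheme.Modules.pullbackPushforwardAdjunction f).homEquiv _ _ φ).app V s) =
      T (γ.γ V s)) (x : X)
    (h : IsIso ((Scheme.Modules.toPresheaf X ⋙ TopCat.Presheaf.stalkFunctor AddCommGrpCat.{u} x).map φ)) :
    δ.lat x = γ.pullLat f T x := by
  apply le_antisymm
  · intro w hw
    obtain ⟨V, hx, t, rfl⟩ := δ.exists_of_mem_lat hw
    obtain ⟨q, hq⟩ := (ConcreteCategory.isIso_iff_bijective _).1 h |>.2
      (TopCat.Presheaf.germ G.presheaf V x hx t)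
    obtain ⟨V', hx', t', rfl⟩ := TopCat.Presheaf.exists_germ_eq _ q
    have h1 : TopCat.Presheaf.germ G.presheaf V' x hx' (φ.app V' t') = TopCat.Presheaf.germ G.presheaf V x hx t := by
      refine Eq.trans ?_ hq
      exact (TopCat.Presheaf.stalkFunctor_map_germ_apply (C := AddCommGrpCat.{u}) V' x hx'
        ((Scheme.Modules.toPresheaf X).map φ) t').symm
    obtain ⟨V₁, hx₁, i, i', e⟩ := TopCat.Presheaf.germ_eq _ x hx' hx _ _ h1
    have : Nonempty V₁ := ⟨⟨x, hx₁⟩⟩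
    have h2 := congrArg (δ.γ V₁) e
    have h3 : δ.γ V' (φ.app V' t') = δ.γ V t :=
      (δ.γ_map (leOfHom i) _).symm.trans (h2.trans (δ.γ_map (leOfHom i') _))
    rw [← h3]
    exact γ.γ_app_mem_pullLat δ f φ T hφ V' t' x hx'
  · refine Submodule.span_le.2 ?_
    rintro _ ⟨w, hw, rfl⟩
    obtain ⟨V, hx, s, rfl⟩ := γ.exists_of_mem_lat hw
    rw [← hφ]
    exact δ.γ_mem_lat (V := f ⁻¹ᵁ V) hx _

end LocalBasis

section RiemannRoch

open Polynomial
open scoped IntermediateField IntermediateField.algebraAdjoinAdjoin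

variable {k : Type u} [Field k] {X : Scheme.{u}} [IsIntegral X] (f : X ⟶ Spec (CommRingCat.of k))
  (s : Spec (CommRingCat.of k) ⟶ X)

/-- The functions with poles only at a rational point together with the functions regular there
have finite codimension in the function field. -/
theorem exists_finset_sub_germ_mem_locRing [IsProper f] [SmoothOfRelativeDimension 1 f] (hs : s ≫ f = 𝟙 _)
    (U : X.Opens) [Nonempty U] (hU : ∀ x, x ∈ U ↔ x ≠ ratPt s) :
    ∃ S : Finset X.functionField, ∀ c, ∃ (a : Γ(X, U)) (g : X.functionField → k),
      c - X.germToFunctionField U a - ∑ e ∈ S, kToK f (g e) * e ∈ locRing X (ratPt s) := by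
  have := isLocallyPID_of_smooth f
  obtain ⟨a, ha⟩ := exists_section_notMem_locRing f s hs U hU
  obtain ⟨V₀, hV₀, hx₀, z₀, hz₀, hmax₀⟩ := exists_coordinate f s hs
  have : Nonempty V₀ := ⟨⟨_, hx₀⟩⟩
  letI := (kToK f).toAlgebra
  obtain ⟨-, hess, htrdeg⟩ := transcendental_of_etale f hV₀ z₀ hz₀
  let K := X.functionField
  -- A function whose only pole is the rational point. Thus `M` below consists of the functions
  -- regular on `U` and `O` is the local ring at that point.
  set y : K := X.germToFunctionField U a
  have hy1 : 1 < (locVal (ratPt s)).valuation y := by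
    rw [← not_le, locVal_val_le_one_iff]; exact ha
  have hval : ∀ (x : X) (c : k), (locVal x).valuation (algebraMap k K c) ≤ 1 := fun x c =>
    locVal_val_le_one_iff.2 (kToK_mem_locRing f c x)
  have hy : Transcendental k y := by
    rw [transcendental_iff]
    intro p hp
    by_contra hp0
    have := Valuation.map_aeval_eq _ (hval (ratPt s)) hy1 hp0
    rw [hp, map_zero] at this
    exact pow_ne_zero _ (zero_lt_one.trans hy1).ne' this.symm
  have hfin := finite_adjoin_of_trdeg_le_one htrdeg hy
  obtain ⟨n, e, he, hint⟩ := exists_integral_span (k := k) (y := y)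
  have hsub : ∀ (x : X) (c : k) (a : K), a ∈ locRing X x → c • a ∈ locRing X x := fun x c a ha => by
    rw [Algebra.smul_def]; exact mul_mem (kToK_mem_locRing f c x) ha
  let M : Submodule k K :=
    { carrier := {a | ∀ x ∈ U, a ∈ locRing X x}
      add_mem' := fun ha hb x hx => add_mem (ha x hx) (hb x hx)
      zero_mem' := fun x _ => zero_mem _
      smul_mem' := fun c a ha x hx => hsub x c a (ha x hx) }
  let O : Submodule k K :=
    { carrier := {a | a ∈ locRing X (ratPt s)}
      add_mem' := fun ha hb => (locRing X (ratPt s)).add_mem ha hb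
      zero_mem' := (locRing X (ratPt s)).zero_mem
      smul_mem' := fun c a ha => hsub _ c a ha }
  have hpoly : ∀ (x : X) (a : K) (p : k[X]), a ∈ locRing X x → aeval a p ∈ locRing X x := by
    intro x a p ha
    rw [aeval_eq_sum_range]
    exact sum_mem fun i _ => hsub x _ _ (pow_mem ha i)
  have hM : ∀ i (p : k[X]), aeval y p * e i ∈ M := by
    intro i p x hx
    have hyx : y ∈ locRing X x := germ_mem_locRing U hx a
    refine mul_mem (hpoly x y p hyx) ?_
    refine mem_locRing_of_isIntegral x (Algebra.adjoin k {y}).toSubring (fun a ha => ?_) (hint i)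
    have ha' : a ∈ Algebra.adjoin k {y} := ha
    rw [Algebra.adjoin_singleton_eq_range_aeval] at ha'
    obtain ⟨p, rfl⟩ := ha'
    exact hpoly x y p hyx
  obtain ⟨N, hN⟩ : ∃ N, ∀ i, (locVal (ratPt s)).valuation (y⁻¹ ^ N * e i) < 1 := by
    have h1 : ∀ p : Fin n, ∃ N, ∀ m ≥ N, (locVal (ratPt s)).valuation (y⁻¹ ^ m * e p) < 1 :=
      fun p => exists_pow_mul_val_lt_one _ _ _ (by
        rw [map_inv₀]; exact inv_lt_one_of_one_lt₀ hy1)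
    choose N hN using h1
    exact ⟨Finset.univ.sup N, fun i => hN i _ (Finset.le_sup (f := N) (Finset.mem_univ _))⟩
  have hO : ∀ i (p q : k[X]), q ≠ 0 → p.natDegree ≤ q.natDegree →
      aeval y p / aeval y q * (y⁻¹ ^ N * e i) ∈ O := by
    intro i p q hq hpq
    refine (locRing X (ratPt s)).mul_mem ?_ (locVal_val_le_one_iff.1 (hN i).le)
    rcases eq_or_ne p 0 with rfl | hp
    · simp [zero_mem]
    · rw [← locVal_val_le_one_iff, map_div₀, Valuation.map_aeval_eq _ (hval _) hy1 hp,
        Valuation.map_aeval_eq _ (hval _) hy1 hq]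
      exact (div_le_one₀ (pow_pos (zero_lt_one.trans hy1) _)).2 (pow_le_pow_right₀ hy1.le hpq)
  have hq := finite_quotient_of_ratfunc hy M O e he hM N hO
  obtain ⟨S, hS⟩ := hq.fg_top
  classical
  refine ⟨S.image Quotient.out, fun c => ?_⟩
  have h1 : Submodule.Quotient.mk c ∈ Submodule.span k (S : Set (K ⧸ (M ⊔ O))) := by rw [hS]; trivial
  obtain ⟨g, -, hg⟩ := Submodule.mem_span_finset.1 h1
  have h2 : c - ∑ t ∈ S, g t • (Quotient.out t : K) ∈ M ⊔ O := by
    rw [← Submodule.Quotient.mk_eq_zero, Submodule.Quotient.mk_sub, ← hg, sub_eq_zero]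
    rw [← Submodule.mkQ_apply, map_sum]
    refine Finset.sum_congr rfl fun t _ => ?_
    rw [map_smul, Submodule.mkQ_apply]
    congr 1
    exact (Quotient.out_eq t).symm
  obtain ⟨m, hm, o, ho, hmo⟩ := Submodule.mem_sup.1 h2
  obtain ⟨b, hb⟩ := exists_section_of_forall_mem_locRing U hm
  refine ⟨b, fun v => g (Submodule.Quotient.mk v), ?_⟩
  have h3 : ∑ e ∈ S.image Quotient.out, kToK f (g (Submodule.Quotient.mk e)) * e =
      ∑ t ∈ S, g t • (Quotient.out t : K) := by
    rw [Finset.sum_image (fun a _ b _ h => Quotient.out_injective h)]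
    refine Finset.sum_congr rfl fun t _ => ?_
    rw [show (Submodule.Quotient.mk (Quotient.out t) : K ⧸ (M ⊔ O)) = t from Quotient.out_eq t]
    rfl
  have h4 : c - X.germToFunctionField U b - ∑ e ∈ S.image Quotient.out, kToK f (g (Submodule.Quotient.mk e)) * e = o := by
    rw [h3, hb, sub_right_comm, ← hmo, add_sub_cancel_left]
  rw [h4]
  exact ho

end RiemannRoch

end

/-! ### The motive near `∞`: finiteness, purity and the local Frobenius. -/

noncomputable section

open PointedCurve (map_map_apply map_map_comm app_map_apply modHom modHom_app)

variable {Fq : Type u} [Field Fq] {C : PointedCurve Fq} {L : Type u} [Field L] [Algebra Fq L]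

section Infinity

variable {E : (C.CL L).Modules} {W : Type*} [AddCommGroup W] [Module (C.CL L).functionField W]

open PointedCurve

/-- A vanishing of `H¹(𝒪(n·∞))`: finitely many representatives modulo `A_L` and the local ring at
`∞` suffice, and their poles at `∞` have bounded order. -/
lemma PointedCurve.Uniformizer.exists_sub_ALtoK_mem (z : C.Uniformizer) : ∃ n : ℕ, ∀ c : (C.CL L).functionField,
    ∃ a : C.AL L, z.zK L ^ n * (c - C.ALtoK L a) ∈ locRing (C.CL L) (C.infLPt L) := by
  obtain ⟨S, hS⟩ := exists_finset_sub_germ_mem_locRing (C.prL L) (C.infL L) (C.infL_prL L) (C.UL L) (C.mem_UL_iff L)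
  choose N hN using fun e : (C.CL L).functionField =>
    exists_pow_mul_val_lt_one (C.infLPt L) (z.zK L) e z.val_zK_lt_one
  refine ⟨S.sup N, fun c => ?_⟩
  obtain ⟨a, g, h⟩ := hS c
  obtain ⟨a, rfl⟩ := (C.ALtoGamma_bijective L).2 a
  refine ⟨a, ?_⟩
  have h' : c - C.ALtoK L a - ∑ e ∈ S, kToK (C.prL L) (g e) * e ∈ locRing (C.CL L) (C.infLPt L) := h
  have e1 : z.zK L ^ S.sup N * (c - C.ALtoK L a) =
      z.zK L ^ S.sup N * (c - C.ALtoK L a - ∑ e ∈ S, kToK (C.prL L) (g e) * e) +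
        ∑ e ∈ S, kToK (C.prL L) (g e) * (z.zK L ^ S.sup N * e) := by
    rw [mul_sub _ (c - C.ALtoK L a), Finset.mul_sum, sub_add]
    rw [eq_comm, sub_eq_self, sub_eq_zero]
    exact Finset.sum_congr rfl fun e _ => by ring
  rw [e1]
  refine add_mem (mul_mem (pow_mem z.zK_mem _) h') (sum_mem fun e he => mul_mem (kToK_mem_locRing _ _ _) ?_)
  exact locVal_val_le_one_iff.1 (hN e _ (Finset.le_sup (f := N) he)).le

variable (γ : GenEmb E W) {M : Type*} [AddCommGroup M] [Module (C.AL L) M] (μ : M →+ W)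
  (hμ : ∀ (a : C.AL L) m, μ (a • m) = C.ALtoK L a • μ m)

lemma GenEmb.pow_smul_mem_lat_inf (z : C.Uniformizer) {n n' : ℕ} (h : n ≤ n') {w : W}
    (hw : z.zK L ^ n • w ∈ γ.lat (C.infLPt L)) : z.zK L ^ n' • w ∈ γ.lat (C.infLPt L) := by
  rw [← Nat.sub_add_cancel h, pow_add, mul_smul]
  exact γ.smul_mem_lat (pow_mem z.zK_mem _) hw

variable [FiniteDimensional (C.CL L).functionField W] {r : ℕ} (hF : IsLocallyFreeOfRank E r)
  (hr : Module.finrank (C.CL L).functionField W = r)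
include hμ hF hr

/-- The analogous vanishing of `H¹` for a module spanning the generic fibre. The bound for multiples
of one vector of the image combines that for functions with a power of `z` bringing the vector into
the lattice; a basis gives a uniform bound. -/
theorem exists_pow_smul_sub_mem_lat_inf (hs : Submodule.span (C.CL L).functionField (Set.range μ) = ⊤) (z : C.Uniformizer) :
    ∃ n : ℕ, ∀ w, ∃ m, z.zK L ^ n • (w - μ m) ∈ γ.lat (C.infLPt L) := by
  obtain ⟨n₀, hn₀⟩ := z.exists_sub_ALtoK_mem (L := L)
  have key : ∀ v, ∃ n : ℕ, ∀ c : (C.CL L).functionField, ∃ m, z.zK L ^ n • (c • v - μ m) ∈ γ.lat (C.infLPt L) := by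
    intro v
    have hv : v ∈ Submodule.span (C.CL L).functionField (Set.range μ) := by rw [hs]; trivial
    induction hv using Submodule.span_induction with
    | mem v hv =>
      obtain ⟨m, rfl⟩ := hv
      obtain ⟨N, hN⟩ := γ.exists_pow_smul_mem_lat hF hr (z.val_zK_lt_one (L := L)) (μ m)
      refine ⟨n₀ + N, fun c => ?_⟩
      obtain ⟨a, ha⟩ := hn₀ c
      refine ⟨a • m, ?_⟩
      rw [hμ, ← sub_smul, pow_add, smul_smul, mul_right_comm, mul_smul]
      exact γ.smul_mem_lat ha (hN N le_rfl)
    | zero => exact ⟨0, fun c => ⟨0, by rw [smul_zero, map_zero, sub_zero, smul_zero]; exact zero_mem _⟩⟩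
    | add v v' _ _ h h' =>
      obtain ⟨n, h⟩ := h
      obtain ⟨n', h'⟩ := h'
      refine ⟨max n n', fun c => ?_⟩
      obtain ⟨m, hm⟩ := h c
      obtain ⟨m', hm'⟩ := h' c
      refine ⟨m + m', ?_⟩
      rw [smul_add, map_add, add_sub_add_comm, smul_add]
      exact add_mem (γ.pow_smul_mem_lat_inf z (le_max_left _ _) hm) (γ.pow_smul_mem_lat_inf z (le_max_right _ _) hm')
    | smul a v _ h =>
      obtain ⟨n, h⟩ := h
      refine ⟨n, fun c => ?_⟩
      obtain ⟨m, hm⟩ := h (c * a)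
      exact ⟨m, by rwa [← mul_smul]⟩
  let b := Module.finBasis (C.CL L).functionField W
  choose n hn using fun j => key (b j)
  refine ⟨Finset.univ.sup n, fun w => ?_⟩
  choose m hm using fun j => hn j (b.repr w j)
  refine ⟨∑ j, m j, ?_⟩
  conv => enter [2, 2, 1]; rw [← b.sum_repr w]
  rw [map_sum, ← Finset.sum_sub_distrib, Finset.smul_sum]
  exact sum_mem fun j _ => γ.pow_smul_mem_lat_inf z (Finset.le_sup (f := n) (Finset.mem_univ j)) (hm j)

/-- Vanishing of `H⁰` for a very negative twist. Finite generation gives a common denominator `h` in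
`A_L` for the coordinates of all `μ m` in a frame at `∞`. If `z ^ n` outweighs the pole of `h`, the
numerators are elements of `A_L` that vanish at `∞`, hence zero. -/
theorem exists_eq_zero_of_eq_pow_smul [Module.Finite (C.AL L) M] (z : C.Uniformizer) :
    ∃ n : ℕ, ∀ m, ∀ v ∈ γ.lat (C.infLPt L), μ m = z.zK L ^ n • v → μ m = 0 := by
  obtain ⟨V, hV, b, hb⟩ := γ.exists_frame hF hr (C.infLPt L)
  obtain ⟨S, hS⟩ := Module.Finite.fg_top (R := C.AL L) (M := M)
  classical
  obtain ⟨h, hh0, hh⟩ := exists_common_denominator (C.ALtoK L)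
    (fun c => by
      obtain ⟨g, h, h0, e⟩ := exists_ALtoK_div c
      exact ⟨g, h, (map_ne_zero_iff _ C.ALtoK_injective).2 h0, e⟩)
    (S ×ˢ (Finset.univ : Finset (Fin r))) (fun p => b.repr (μ p.1) p.2)
  have key : ∀ m j, ∃ g : C.AL L, b.repr (μ m) j * C.ALtoK L h = C.ALtoK L g := by
    intro m j
    have hm : m ∈ Submodule.span (C.AL L) (S : Set M) := by rw [hS]; trivial
    induction hm using Submodule.span_induction with
    | mem m hm => exact hh (m, j) (Finset.mem_product.2 ⟨hm, Finset.mem_univ _⟩)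
    | zero => exact ⟨0, by simp⟩
    | add m m' _ _ h h' =>
      obtain ⟨g, h⟩ := h
      obtain ⟨g', h'⟩ := h'
      refine ⟨g + g', ?_⟩
      rw [map_add, map_add, map_add, Finsupp.add_apply, add_mul, h, h']
    | smul a m _ h =>
      obtain ⟨g, h⟩ := h
      refine ⟨a * g, ?_⟩
      rw [hμ, map_smul, map_mul, Finsupp.smul_apply, smul_eq_mul, mul_assoc, h]
  obtain ⟨n, hn⟩ := exists_pow_mul_val_lt_one (C.infLPt L) (z.zK L) (C.ALtoK L h) z.val_zK_lt_one
  refine ⟨n, fun m v hv e => ?_⟩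
  have h0 : ∀ j, b.repr (μ m) j = 0 := by
    intro j
    obtain ⟨g, hg⟩ := key m j
    have h1 : C.ALtoK L g = (z.zK L ^ n * C.ALtoK L h) * b.repr v j := by
      rw [← hg, e, map_smul, Finsupp.smul_apply, smul_eq_mul]; ring
    have h2 : (locVal (C.infLPt L)).valuation (C.ALtoK L g) < 1 := by
      rw [h1, map_mul]
      exact mul_lt_one_of_lt_of_le (hn n le_rfl) (locVal_val_le_one_iff.2 ((hb _ hV v).1 hv j))
    rw [ALtoK_eq_zero h2, map_zero] at hg
    exact (mul_eq_zero.1 hg).resolve_right hh0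
  rw [← b.sum_repr (μ m)]
  exact Finset.sum_eq_zero fun j _ => by rw [h0, zero_smul]

end Infinity

variable [Fintype Fq]

/-- The structure of the local ring of `C_L` at `∞`. -/
lemma PointedCurve.Uniformizer.localFrob (z : C.Uniformizer) {W : Type*} [AddCommGroup W]
    [Module (C.CL L).functionField W] [Module L W] (hL : ∀ (a : L) (w : W), a • w = kToK (C.prL L) a • w)
    {T : W →+ W} (hT : ∀ a w, T (a • w) = C.sigmaK L a • T w) :
    LocalFrob (locRing (C.CL L) (C.infLPt L)) (C.sigmaK L) (FiniteField.frobeniusAlgHom Fq L).toRingHom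
      (kToK (C.prL L)) (z.zK L) T where
  σ_mem a ha := genMap_mem_locRing _ (by rwa [C.sigma_infLPt])
  ι_mem a := kToK_mem_locRing _ _ _
  σ_ι := C.sigmaK_kToK
  z_mem := z.zK_mem
  z_ne := z.zK_ne_zero
  σ_z := C.sigmaK_zK z
  res c hc := by
    obtain ⟨a, ha⟩ := C.exists_residue hc
    obtain ⟨b, hb, e⟩ := z.exists_eq_zK_mul ha
    exact ⟨a, b, hb, by rw [← e]; ring⟩
  res_unique a ha := by
    refine C.kToK_val ?_
    rw [show kToK (C.prL L) a = z.zK L * (kToK (C.prL L) a * (z.zK L)⁻¹) by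
      field_simp [z.zK_ne_zero (L := L)], map_mul]
    exact mul_lt_one_of_lt_of_le z.val_zK_lt_one (locVal_val_le_one_iff.2 ha)
  smul := hL
  T_smul := hT

namespace TauModule

variable (M : TauModule C L)

/-- The semilinear endomorphism of the module `M`. -/
def semiSec : M.M →+ M.M := (M.semi.hom : M.M →+ (ModuleCat.restrictScalars (C.sigmaA L)).obj M.M)

lemma semiSec_smul (a : C.AL L) (m : M.M) : M.semiSec (a • m) = C.sigmaA L a • M.semiSec m :=
  M.semi.hom.map_smul a m

variable {M} {E : (C.CL L).Modules} (e : M.M ≅ (C.gammaU L).obj E)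
  {W : Type*} [AddCommGroup W] [Module (C.CL L).functionField W] (γ : GenEmb E W)

/-- The map from `M` to sections over `C_L ∖ {∞}`. -/
def toSec : M.M →+ Γ(E, C.UL L) := (e.hom.hom : M.M →+ (C.gammaU L).obj E)

/-- The map in the opposite direction. -/
def ofSec : Γ(E, C.UL L) →+ M.M := (e.inv.hom : (C.gammaU L).obj E →+ M.M)

lemma toSec_ofSec (s : Γ(E, C.UL L)) : toSec e (ofSec e s) = s := congr(($e.inv_hom_id) s)

lemma ofSec_toSec (m : M.M) : ofSec e (toSec e m) = m := congr(($e.hom_inv_id) m)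

lemma toSec_smul (a : C.AL L) (m : M.M) : toSec e (a • m) = C.ALtoGamma L a • toSec e m :=
  e.hom.hom.map_smul a m

lemma ofSec_smul (a : C.AL L) (s : Γ(E, C.UL L)) : ofSec e (C.ALtoGamma L a • s) = a • ofSec e s :=
  e.inv.hom.map_smul a s

/-- The embedding of `M` into the generic fibre of `E`. -/
def emb : M.M →+ W := (γ.γ (C.UL L)).comp (toSec e)

lemma emb_apply (m : M.M) : emb e γ m = γ.γ (C.UL L) (toSec e m) := rfl

lemma emb_smul (a : C.AL L) (m : M.M) : emb e γ (a • m) = C.ALtoK L a • emb e γ m := by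
  rw [emb_apply, toSec_smul, γ.γ_ALtoGamma_smul]; rfl

lemma emb_injective : Function.Injective (emb e γ) := fun m m' h => by
  rw [← ofSec_toSec e m, γ.inj _ h, ofSec_toSec]

lemma range_emb : Set.range (emb e γ) = Set.range (γ.γ (C.UL L)) := by
  ext w
  constructor
  · rintro ⟨m, rfl⟩; exact ⟨_, rfl⟩
  · rintro ⟨s, rfl⟩; exact ⟨ofSec e s, by rw [emb_apply, toSec_ofSec]⟩

variable [FiniteDimensional (C.CL L).functionField W] {r : ℕ} (hF : IsLocallyFreeOfRank E r)
  (hr : Module.finrank (C.CL L).functionField W = r)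

include hF hr in
theorem exists_frobK : ∃ T : W →+ W, (∀ a w, T (a • w) = C.sigmaK L a • T w) ∧
    ∀ m, T (emb e γ m) = emb e γ (M.semiSec m) := by
  obtain ⟨T, hT, h⟩ := γ.exists_extension hF hr (C.sigmaK L)
    ((emb e γ).comp (M.semiSec.comp (ofSec e))) (fun a s => by
      rw [AddMonoidHom.comp_apply, AddMonoidHom.comp_apply, ofSec_smul, semiSec_smul, emb_smul, C.sigmaK_ALtoK]
      rfl)
  refine ⟨T, hT, fun m => ?_⟩
  refine (h _).trans ?_
  rw [AddMonoidHom.comp_apply, AddMonoidHom.comp_apply, ofSec_toSec]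

variable {e γ} {T : W →+ W} (hT : ∀ a w, T (a • w) = C.sigmaK L a • T w)
  (hTe : ∀ m, T (emb e γ m) = emb e γ (M.semiSec m))

omit [FiniteDimensional (C.CL L).functionField W] in
include hTe in
lemma iterate_emb (n : ℕ) (m : M.M) : T^[n] (emb e γ m) = emb e γ (M.semiSec^[n] m) := by
  induction n with
  | zero => rfl
  | succ n ih => rw [Function.iterate_succ_apply', ih, hTe, Function.iterate_succ_apply']

include hr hT hTe in
-- Purity in terms of lattices. The map `φ` is given by `T^l` over the affine part, hence
-- everywhere, and its bijectivity on stalks at `∞` identifies the module generated by `T^l` of the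
-- lattice with the lattice of the twist.
theorem IsPurityExtension.frobSpan_iterate {k l : ℕ} (h : M.IsPurityExtension r k l E e) (z : C.Uniformizer)
    [Module L W] (hL : ∀ (a : L) (w : W), a • w = kToK (C.prL L) a • w) :
    (frobSpan (locRing (C.CL L) (C.infLPt L)) T)^[l] (γ.lat (C.infLPt L)) =
      scaleLat (z.zK L ^ (-k : ℤ)) (γ.lat (C.infLPt L)) := by
  obtain ⟨φ, hφ, hiso⟩ := h.exists_iso
  rw [(z.localFrob hL hT).frobSpan_iterate]
  let T' : AddMonoid.End W := T
  let Tl : W →+ W := (T' ^ l : AddMonoid.End W)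
  have hTl : ∀ w, Tl w = T^[l] w := fun w => congrFun (AddMonoid.End.coe_pow W T' l) w
  have hTls : ∀ c w, Tl (c • w) = genMap (C.sigmaIter L l) c • Tl w := by
    intro c w
    rw [hTl, hTl, C.genMap_sigmaIter]
    generalize l = n
    induction n with
    | zero => rfl
    | succ n ih => rw [Function.iterate_succ_apply', Function.iterate_succ_apply', Function.iterate_succ_apply', ih, hT]
  have h1 := γ.app_eq_of_affine (γ.twistEmb k) h.locallyFree hr (C.sigmaIter L l) Tl hTls
    ((Scheme.Modules.pullbackPushforwardAdjunction (C.sigmaIter L l)).homEquiv _ _ φ) (C.isAffineOpen_UL L) (by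
      intro s
      have h2 := congrArg (γ.γ (C.UL L)) (hφ (ofSec e s))
      rw [γ.twistEmb_untwist] at h2
      have h3 : γ.γ (C.UL L) (e.hom (M.semi^[l] (ofSec e s))) = Tl (γ.γ (C.UL L) s) := by
        rw [hTl]
        refine (iterate_emb hTe l (ofSec e s)).symm.trans ?_
        rw [emb_apply, toSec_ofSec]
      refine Eq.trans ?_ (h2.trans h3)
      refine ((γ.twistEmb k).γ_map (C.sigmaIter_UL l).ge _).symm.trans ?_
      exact congrArg (fun s => (γ.twistEmb k).γ (C.UL L) (((C.twist k).obj E).presheaf.map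
        (homOfLE (C.sigmaIter_UL l).ge).op (((Scheme.Modules.pullbackPushforwardAdjunction (C.sigmaIter L l)).homEquiv _ _ φ).app
        (C.UL L) s))) (toSec_ofSec e s).symm)
  have h2 := γ.lat_eq_pullLat (γ.twistEmb k) _ φ Tl h1 (C.infLPt L) hiso
  rw [GenEmb.pullLat, C.sigmaIter_infLPt] at h2
  have h3 : (Tl : W → W) = T^[l] := funext hTl
  rw [h3] at h2
  rw [← h2]
  ext w
  rw [GenEmb.mem_lat_twistEmb_inf _ z, mem_scaleLat (zpow_ne_zero _ z.zK_ne_zero), zpow_neg, inv_inv]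

end TauModule

end

/-! ### Modifying a sheaf at `∞` along a chain of lattices. -/

noncomputable section

open PointedCurve (map_map_apply map_map_comm app_map_apply modHom modHom_app)

namespace LocalSub

variable {X : Scheme.{u}} {G : X.Modules}

lemma exists_incl (N N' : LocalSub G) (h : ∀ V, N.carrier V ≤ N'.carrier V) :
    ∃ f : N.obj ⟶ N'.obj, f ≫ N'.ι = N.ι := N'.exists_lift N.ι fun V s => h V (N.ι_mem s)

/-- The inclusion of subsheaves. -/
def incl (N N' : LocalSub G) (h : ∀ V, N.carrier V ≤ N'.carrier V) : N.obj ⟶ N'.obj :=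
  (exists_incl N N' h).choose

lemma incl_ι (N N' : LocalSub G) (h : ∀ V, N.carrier V ≤ N'.carrier V) : incl N N' h ≫ N'.ι = N.ι :=
  (exists_incl N N' h).choose_spec

end LocalSub

variable {Fq : Type u} [Field Fq] {C : PointedCurve Fq} {L : Type u} [Field L] [Algebra Fq L]

section Chain

variable {E : (C.CL L).Modules} {W : Type*} [AddCommGroup W] [Module (C.CL L).functionField W]
  (γ : GenEmb E W) (Λ : ℤ → Submodule (locRing (C.CL L) (C.infLPt L)) W)

/-- The lattices of `E` away from `∞`, and `Λ_i` at `∞`. -/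
def chainLat (i : ℤ) (x : C.CL L) : Submodule (locRing (C.CL L) x) W where
  carrier := {w | (x ∈ C.UL L → w ∈ γ.lat x) ∧ (x = C.infLPt L → w ∈ Λ i)}
  zero_mem' := ⟨fun _ => zero_mem _, fun _ => zero_mem _⟩
  add_mem' h h' := ⟨fun hx => add_mem (h.1 hx) (h'.1 hx), fun hx => add_mem (h.2 hx) (h'.2 hx)⟩
  smul_mem' a w h := by
    refine ⟨fun hx => (γ.lat x).smul_mem a (h.1 hx), fun hx => ?_⟩
    subst hx
    exact (Λ i).smul_mem a (h.2 rfl)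

lemma mem_chainLat_of_mem_UL (i : ℤ) {x : C.CL L} (hx : x ∈ C.UL L) {w : W} :
    w ∈ chainLat γ Λ i x ↔ w ∈ γ.lat x :=
  ⟨fun h => h.1 hx, fun h => ⟨fun _ => h, fun e => absurd e ((C.mem_UL_iff L x).1 hx)⟩⟩

lemma mem_chainLat_inf (i : ℤ) {w : W} : w ∈ chainLat γ Λ i (C.infLPt L) ↔ w ∈ Λ i :=
  ⟨fun h => h.2 rfl, fun h => ⟨fun e => absurd e (C.infLPt_notMem L), fun _ => h⟩⟩

/-- The modification of `E` at `∞` along the lattice `Λ_i`. -/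
def chainSub (i : ℤ) : LocalSub ((C.away L).obj E) := γ.awayEmb.latSub (chainLat γ Λ i)

/-- The embedding of the modification of `E` in the generic fibre. -/
def chainEmb (i : ℤ) : GenEmb (chainSub γ Λ i).obj W := γ.awayEmb.subEmb (chainSub γ Λ i)

variable [FiniteDimensional (C.CL L).functionField W] {r : ℕ} (hF : IsLocallyFreeOfRank E r)
  (hr : Module.finrank (C.CL L).functionField W = r)

-- A vector of `Λ i` must extend to a section near `∞`. Its coordinates in a frame of `E` have
-- finitely many poles, so it lies in the lattices of `E` at all nearby points other than `∞`.
include hF hr in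
lemma mem_chainEmb_lat (i : ℤ) (x : C.CL L) (w : W) : w ∈ (chainEmb γ Λ i).lat x ↔ w ∈ chainLat γ Λ i x := by
  constructor
  · intro hw
    obtain ⟨V, hx, s, rfl⟩ := GenEmb.exists_of_mem_lat _ hw
    exact (chainSub γ Λ i).ι_mem s x hx
  · intro hw
    suffices h : ∃ V : (C.CL L).Opens, x ∈ V ∧ ∀ y ∈ V, w ∈ chainLat γ Λ i y by
      obtain ⟨V, hx, hV⟩ := h
      have : Nonempty V := ⟨⟨x, hx⟩⟩
      obtain ⟨s, hs⟩ := γ.exists_away_section V fun y hy hyU => (hV y hy).1 hyU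
      obtain ⟨t, ht⟩ := (chainSub γ Λ i).exists_ι_eq (s := s) fun y hy => by
        rw [hs]; exact hV y hy
      have e : (chainEmb γ Λ i).γ V t = w := by
        refine Eq.trans ?_ hs
        exact congrArg (γ.awayEmb.γ V) ht
      rw [← e]
      exact (chainEmb γ Λ i).γ_mem_lat hx t
    by_cases hx : x ∈ C.UL L
    · obtain ⟨V, hxV, s, rfl⟩ := γ.exists_of_mem_lat (hw.1 hx)
      exact ⟨V ⊓ C.UL L, ⟨hxV, hx⟩, fun y hy => (mem_chainLat_of_mem_UL γ Λ i hy.2).2 (γ.γ_mem_lat hy.1 s)⟩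
    · obtain rfl : x = C.infLPt L := by
        by_contra h; exact hx ((C.mem_UL_iff L x).2 h)
      obtain ⟨V, hV, b, hb⟩ := γ.exists_frame hF hr (C.infLPt L)
      obtain ⟨V', hV', h'⟩ := exists_open_forall_ne_mem_locRing (fun j => b.repr w j) (C.infLPt L)
      refine ⟨V ⊓ V', ⟨hV, hV'⟩, fun y hy => ?_⟩
      by_cases hy' : y = C.infLPt L
      · rw [hy']; exact hw
      · rw [mem_chainLat_of_mem_UL γ Λ i ((C.mem_UL_iff L y).2 hy'), hb y hy.1]
        exact h' y hy.2 hy'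

-- At `∞` a basis of `Λ i` serves. The matrices of base change between it and a frame of `E` have
-- finitely many poles, so near `∞`, but away from `∞` itself, both bases generate the same
-- lattices.
include hF hr in
lemma exists_chainEmb_frame (i : ℤ) (hΛ : (Λ i).FG)
    (hs : Submodule.span (C.CL L).functionField (Λ i : Set W) = ⊤) (x : C.CL L) :
    ∃ (V : (C.CL L).Opens) (_ : x ∈ V) (b : Module.Basis (Fin r) (C.CL L).functionField W),
      (chainEmb γ Λ i).IsFrame V b := by
  obtain ⟨V, hV, b, hb⟩ := γ.exists_frame hF hr x
  by_cases hx : x ∈ C.UL L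
  · refine ⟨V ⊓ C.UL L, ⟨hV, hx⟩, b, fun y hy w => ?_⟩
    rw [mem_chainEmb_lat γ Λ hF hr, mem_chainLat_of_mem_UL γ Λ i hy.2, hb y hy.1]
  · obtain rfl : x = C.infLPt L := by
      by_contra h; exact hx ((C.mem_UL_iff L x).2 h)
    obtain ⟨b', hb'⟩ := exists_basis_of_fg hr (Λ i) hΛ hs
    obtain ⟨V', hV', h'⟩ := exists_open_forall_ne_mem_locRing
      (Sum.elim (fun p : Fin r × Fin r => b.repr (b' p.1) p.2) fun p : Fin r × Fin r => b'.repr (b p.1) p.2) (C.infLPt L)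
    refine ⟨V ⊓ V', ⟨hV, hV'⟩, b', fun y hy w => ?_⟩
    rw [mem_chainEmb_lat γ Λ hF hr]
    by_cases hy' : y = C.infLPt L
    · subst hy'
      rw [mem_chainLat_inf, hb', mem_span_range_basis_iff]
    · have hc := h' y hy.2 hy'
      have key : ∀ b₁ b₂ : Module.Basis (Fin r) (C.CL L).functionField W,
          (∀ j i, b₂.repr (b₁ j) i ∈ locRing (C.CL L) y) → (∀ j, b₁.repr w j ∈ locRing (C.CL L) y) →
            ∀ j, b₂.repr w j ∈ locRing (C.CL L) y := by
        intro b₁ b₂ h12 h1 j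
        rw [← b₁.sum_repr w, map_sum, Finsupp.finsetSum_apply]
        refine sum_mem fun i _ => ?_
        rw [map_smul, Finsupp.smul_apply]
        exact mul_mem (h1 i) (h12 i j)
      rw [mem_chainLat_of_mem_UL γ Λ i ((C.mem_UL_iff L y).2 hy'), hb y hy.1]
      exact ⟨key b b' fun j i => hc (Sum.inr (j, i)), key b' b fun j i => hc (Sum.inl (j, i))⟩

omit [FiniteDimensional (C.CL L).functionField W] in
lemma chainSub_le (hΛ : Monotone Λ) {i j : ℤ} (hij : i ≤ j) (V : (C.CL L).Opens) :
    (chainSub γ Λ i).carrier V ≤ (chainSub γ Λ j).carrier V :=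
  fun _ hs x hx => ⟨(hs x hx).1, fun e => hΛ hij ((hs x hx).2 e)⟩

omit [FiniteDimensional (C.CL L).functionField W] in
/-- The sequence of the modifications of `E` and their inclusions. -/
def chainFunctor (hΛ : Monotone Λ) : ℤ ⥤ (C.CL L).Modules where
  obj i := (chainSub γ Λ i).obj
  map f := LocalSub.incl _ _ (chainSub_le γ Λ hΛ (leOfHom f))
  map_id i := by rw [← cancel_mono (chainSub γ Λ i).ι, LocalSub.incl_ι, Category.id_comp]
  map_comp {i j k} f g := by
    rw [← cancel_mono (chainSub γ Λ k).ι, Category.assoc, LocalSub.incl_ι, LocalSub.incl_ι, LocalSub.incl_ι]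

omit [FiniteDimensional (C.CL L).functionField W] in
lemma chainEmb_map (hΛ : Monotone Λ) {i j : ℤ} (f : i ⟶ j) (V : (C.CL L).Opens)
    (s : Γ((chainFunctor γ Λ hΛ).obj i, V)) :
    (chainEmb γ Λ j).γ V (((chainFunctor γ Λ hΛ).map f).app V s) = (chainEmb γ Λ i).γ V s := by
  have h := congr(($(LocalSub.incl_ι _ _ (chainSub_le γ Λ hΛ (leOfHom f)))).app V s)
  exact congrArg (γ.awayEmb.γ V) h

end Chain

variable [Fintype Fq] {M : TauModule C L} {E : (C.CL L).Modules} {e : M.M ≅ (C.gammaU L).obj E}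
  {W : Type*} [AddCommGroup W] [Module (C.CL L).functionField W]
  {γ : GenEmb E W} {T : W →+ W} {z : C.Uniformizer}
  {Λ : ℤ → Submodule (locRing (C.CL L) (C.infLPt L)) W} {r k l : ℕ}

open TauModule

variable (e γ T z Λ r k l) in
/-- A `τ`-module with an extension `E` to `∞` and a chain of lattices at `∞`. -/
structure IsTauChain [Module L W] : Prop where
  free : IsLocallyFreeOfRank E r
  rank : Module.finrank (C.CL L).functionField W = r
  L_smul (a : L) (w : W) : a • w = kToK (C.prL L) a • w
  T_smul (a : (C.CL L).functionField) (w : W) : T (a • w) = C.sigmaK L a • T w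
  T_emb (m : M.M) : T (emb e γ m) = emb e γ (M.semiSec m)
  chain : LocalFrob.IsLatChain (locRing (C.CL L) (C.infLPt L)) (z.zK L) T Λ k l

variable (γ T Λ) in
/-- A sequence of subsheaves of the generic fibre with given lattices. -/
structure IsChainModel {S : TauSheafData C L} (η : S.Embs W) : Prop where
  lat_UL (i : ℤ) {x : C.CL L} (hx : x ∈ C.UL L) (w : W) : w ∈ (η.γ i).lat x ↔ w ∈ γ.lat x
  lat_inf (i : ℤ) (w : W) : w ∈ (η.γ i).lat (C.infLPt L) ↔ w ∈ Λ i
  τ (i : ℤ) (V : (C.CL L).Opens) (s : Γ(S.F.obj i, V)) :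
    (η.γ (i + 1)).γ (C.sigma L ⁻¹ᵁ V) ((adjσ (S.τ i)).app V s) = T ((η.γ i).γ V s)
  frame (i : ℤ) (x : C.CL L) : ∃ (V : (C.CL L).Opens) (_ : x ∈ V)
    (b : Module.Basis (Fin r) (C.CL L).functionField W), (η.γ i).IsFrame V b

lemma TauSheafData.Embs.mono_Pi {S : TauSheafData C L} (η : S.Embs W) (i : ℤ) : Mono (S.Pi i) :=
  mono_of_app_injective _ fun V s s' e => by
    apply (η.γ i).inj V
    rw [← η.compat (lt_add_one i).le V s, ← η.compat (lt_add_one i).le V s']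
    exact congrArg _ e

namespace IsTauChain

variable [Module L W] [FiniteDimensional (C.CL L).functionField W] (h : IsTauChain e γ T z Λ r k l)
include h

omit [FiniteDimensional (C.CL L).functionField W] in
lemma localFrob : LocalFrob (locRing (C.CL L) (C.infLPt L)) (C.sigmaK L) (FiniteField.frobeniusAlgHom Fq L).toRingHom
      (kToK (C.prL L)) (z.zK L) T := z.localFrob h.L_smul h.T_smul

lemma T_mem_lat {x : C.CL L} (hx : x ∈ C.UL L) {w : W} (hw : w ∈ γ.lat (C.sigma L x)) : T w ∈ γ.lat x := by
  obtain ⟨a, ha, ha', s, hs⟩ := γ.exists_ALtoK_smul_mem_range h.free h.rank ((C.sigma_mem_UL_iff L x).2 hx) hw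
  have h1 : T w = C.sigmaK L (C.ALtoK L a)⁻¹ • T (γ.γ (C.UL L) s) := by
    rw [← h.T_smul, hs, inv_smul_smul₀ ha]
  rw [h1, ← toSec_ofSec e s, ← emb_apply, h.T_emb, emb_apply]
  exact γ.smul_mem_lat (genMap_mem_locRing _ ha') (γ.γ_mem_lat hx _)

omit [FiniteDimensional (C.CL L).functionField W] in
lemma span_lat (i : ℤ) : Submodule.span (C.CL L).functionField (Λ i : Set W) = ⊤ := by
  rw [eq_top_iff]
  intro w _
  obtain ⟨j, hj⟩ := h.chain.exhaust w
  obtain ⟨n, hn⟩ := h.chain.exists_pow_smul_mem (z.localFrob h.L_smul h.T_smul) i j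
  rw [← inv_smul_smul₀ (pow_ne_zero n (z.zK_ne_zero (L := L))) w]
  exact Submodule.smul_mem _ _ (Submodule.subset_span (hn w hj))

/-- `T` carries the lattice of index `i` at `σ x` into that of index `i + 1` at `x`: away from `∞`
because it preserves `M`, at `∞` because it is the shift of the chain. This gives the `τ_i`, and
their compatibility holds because all of them are the same operator on `W`. -/
theorem exists_model : ∃ (S : TauSheafData C L) (η : S.Embs W), IsChainModel γ T Λ (r := r) η := by
  have hlat := mem_chainEmb_lat γ Λ h.free h.rank
  have hτ : ∀ i, ∃ φ : (chainSub γ Λ i).obj ⟶ (Scheme.Modules.pushforward (C.sigma L)).obj (chainSub γ Λ (i + 1)).obj,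
      ∀ V s, (chainEmb γ Λ (i + 1)).γ (C.sigma L ⁻¹ᵁ V) (φ.app V s) = T ((chainEmb γ Λ i).γ V s) := by
    intro i
    refine GenEmb.exists_homPush (chainEmb γ Λ i) (chainEmb γ Λ (i + 1)) (C.sigma L) T h.T_smul fun x w hw => ?_
    rw [hlat] at hw ⊢
    by_cases hx : x ∈ C.UL L
    · rw [mem_chainLat_of_mem_UL _ _ _ hx]
      rw [mem_chainLat_of_mem_UL _ _ _ ((C.sigma_mem_UL_iff L x).2 hx)] at hw
      exact h.T_mem_lat hx hw
    · obtain rfl : x = C.infLPt L := by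
        by_contra h; exact hx ((C.mem_UL_iff L x).2 h)
      rw [mem_chainLat_inf, ← h.chain.frob]
      exact Submodule.subset_span ⟨w, hw.2 (C.sigma_infLPt L), rfl⟩
  choose τ' hτ' using hτ
  let F := chainFunctor γ Λ h.chain.mono
  let τ (i : ℤ) : (Scheme.Modules.pullback (C.sigma L)).obj (F.obj i) ⟶ F.obj (i + 1) :=
    ((Scheme.Modules.pullbackPushforwardAdjunction (C.sigma L)).homEquiv _ _).symm (τ' i)
  have hadj : ∀ i, adjσ (τ i) = τ' i := fun i => Equiv.apply_symm_apply _ _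
  let S : TauSheafData C L :=
    { F := F
      τ := τ
      comm := fun i => by
        apply ((Scheme.Modules.pullbackPushforwardAdjunction (C.sigma L)).homEquiv _ _).injective
        rw [Adjunction.homEquiv_naturality_left, Adjunction.homEquiv_naturality_right]
        change _ ≫ adjσ (τ (i + 1)) = adjσ (τ i) ≫ _
        rw [hadj, hadj]
        ext V s
        apply (chainEmb γ Λ (i + 1 + 1)).inj (C.sigma L ⁻¹ᵁ V)
        have e1 := hτ' (i + 1) V ((F.map (homOfLE (lt_add_one i).le)).app V s)
        rw [chainEmb_map] at e1
        refine e1.trans ?_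
        rw [← hτ' i V s]
        exact (chainEmb_map γ Λ h.chain.mono (homOfLE (lt_add_one (i + 1)).le) (C.sigma L ⁻¹ᵁ V) _).symm }
  let η : S.Embs W :=
    { γ := chainEmb γ Λ
      compat := fun hij V s => chainEmb_map γ Λ h.chain.mono (homOfLE hij) V s }
  refine ⟨S, η, ⟨fun i x hx w => ?_, fun i w => ?_, fun i V s => ?_, fun i x => ?_⟩⟩
  · exact (hlat i x w).trans (mem_chainLat_of_mem_UL γ Λ i hx)
  · exact (hlat i _ w).trans (mem_chainLat_inf γ Λ i)
  · refine Eq.trans ?_ (hτ' i V s)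
    exact congrArg (fun f : (chainSub γ Λ i).obj ⟶ (Scheme.Modules.pushforward (C.sigma L)).obj (chainSub γ Λ (i + 1)).obj =>
      (chainEmb γ Λ (i + 1)).γ (C.sigma L ⁻¹ᵁ V) (f.app V s)) (hadj i)
  · exact exists_chainEmb_frame γ Λ h.free h.rank i (h.chain.fg i) (h.span_lat i) x

variable {S : TauSheafData C L} {η : S.Embs W} (hη : IsChainModel γ T Λ (r := r) η)

omit [FiniteDimensional (C.CL L).functionField W] in
include hη in
lemma isPeriodic : S.IsPeriodic k l := by
  rw [η.isPeriodic_iff]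
  intro i x w
  by_cases hx : x ∈ C.UL L
  · rw [GenEmb.mem_lat_twistEmb_of_mem_UL _ _ hx, hη.lat_UL i hx, hη.lat_UL _ hx]
  · obtain rfl : x = C.infLPt L := by
      by_contra h; exact hx ((C.mem_UL_iff L x).2 h)
    rw [GenEmb.mem_lat_twistEmb_inf _ z, hη.lat_inf, hη.lat_inf, h.chain.scale,
      mem_scaleLat (zpow_ne_zero _ z.zK_ne_zero), inv_smul_smul₀ (zpow_ne_zero _ z.zK_ne_zero)]

-- The lattices generated by images of `T` exhaust `W`, so the `r` vectors `T (b j)` span it.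
omit [FiniteDimensional (C.CL L).functionField W] in
lemma linearIndependent_T (b : Module.Basis (Fin r) (C.CL L).functionField W) :
    LinearIndependent (C.CL L).functionField fun j => T (b j) := by
  refine linearIndependent_of_top_le_span_of_card_eq_finrank ?_ (by rw [Fintype.card_fin, h.rank])
  have h1 : ∀ w, T w ∈ Submodule.span (C.CL L).functionField (Set.range fun j => T (b j)) := by
    intro w
    rw [← b.sum_repr w, map_sum]
    refine Submodule.sum_mem _ fun j _ => ?_
    rw [h.T_smul]
    exact Submodule.smul_mem _ _ (Submodule.subset_span ⟨j, rfl⟩)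
  intro w _
  obtain ⟨i, hi⟩ := h.chain.exhaust w
  rw [← sub_add_cancel i 1, ← h.chain.frob] at hi
  induction hi using Submodule.span_induction with
  | mem w hw =>
    obtain ⟨v, -, rfl⟩ := hw
    exact h1 v
  | zero => exact zero_mem _
  | add w w' _ _ hw hw' => exact add_mem (hw trivial) (hw' trivial)
  | smul a w _ hw => exact Submodule.smul_mem _ (a : (C.CL L).functionField) (hw trivial)

omit [FiniteDimensional (C.CL L).functionField W] in
include hη in
lemma mono_τ (i : ℤ) : Mono (S.τ i) :=
  GenEmb.mono_of_linearIndependent (C.sigma L) (η.γ i) (η.γ (i + 1)) (S.τ i) T (hη.τ i) (hη.frame i) h.linearIndependent_T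

end IsTauChain

end

/-! ### The dimension of the cokernels of the `Π_i`. -/

noncomputable section

open PointedCurve (map_map_apply map_map_comm app_map_apply modHom modHom_app)

variable {Fq : Type u} [Field Fq] {C : PointedCurve Fq} {L : Type u} [Field L] [Algebra Fq L] [Fintype Fq]
namespace TauModule
variable (M : TauModule C L)

instance : Module L M.M := Module.compHom M.M (Algebra.TensorProduct.includeRight : L →ₐ[Fq] C.AL L).toRingHom

lemma L_smul_def (a : L) (m : M.M) : a • m = (TensorProduct.tmul Fq (1 : C.A) a : C.AL L) • m := rfl

lemma semiSec_mem_range (m : M.M) : M.semiSec m ∈ LinearMap.range M.τ.hom := ⟨_, rfl⟩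

lemma range_τ : LinearMap.range M.τ.hom = Submodule.span (C.AL L) (Set.range M.semiSec) := by
  apply le_antisymm
  · let R := Submodule.span (C.AL L) (Set.range M.semiSec)
    let q : M.M ⟶ ModuleCat.of (C.AL L) (M.M ⧸ R) := ModuleCat.ofHom R.mkQ
    have h : M.τ ≫ q = 0 := by
      apply ((ModuleCat.extendRestrictScalarsAdj (C.sigmaA L)).homEquiv _ _).injective
      rw [Adjunction.homEquiv_naturality_right]
      ext m
      exact (Submodule.Quotient.mk_eq_zero R).2 (Submodule.subset_span ⟨m, rfl⟩)
    rintro _ ⟨x, rfl⟩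
    exact (Submodule.Quotient.mk_eq_zero R).1 congr(($h) x)
  · rw [Submodule.span_le]
    rintro _ ⟨m, rfl⟩
    exact M.semiSec_mem_range m

lemma sigmaA_tmul_one (x : C.A) : C.sigmaA L (TensorProduct.tmul Fq x (1 : L)) = TensorProduct.tmul Fq x (1 : L) := by
  change TensorProduct.tmul Fq x (FiniteField.frobeniusAlgHom Fq L 1) = _
  rw [map_one]

/-- The image of `τ` as a subspace over `L`. -/
def rangeL : Submodule L M.M where
  carrier := LinearMap.range M.τ.hom
  add_mem' := (LinearMap.range M.τ.hom).add_mem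
  zero_mem' := (LinearMap.range M.τ.hom).zero_mem
  smul_mem' a _ h := (LinearMap.range M.τ.hom).smul_mem (TensorProduct.tmul Fq (1 : C.A) a : C.AL L) h

lemma mem_rangeL {m : M.M} : m ∈ M.rangeL ↔ m ∈ LinearMap.range M.τ.hom := Iff.rfl

/-- The elements `x ⊗ 1` are fixed by `σ^*` and can be moved inside the semilinear map; so the
`A_L`-span of its image is already the `L`-span. -/
lemma rangeL_eq_span : M.rangeL = Submodule.span L (Set.range M.semiSec) := by
  apply le_antisymm
  · intro m hm
    rw [mem_rangeL, range_τ] at hm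
    induction hm using Submodule.span_induction with
    | mem m hm => exact Submodule.subset_span hm
    | zero => exact zero_mem _
    | add m m' _ _ h h' => exact add_mem h h'
    | smul a m hm h =>
      clear hm
      induction a using TensorProduct.induction_on with
      | zero => rw [zero_smul]; exact zero_mem _
      | add a b ha hb => rw [add_smul]; exact add_mem ha hb
      | tmul x y =>
        have e : (TensorProduct.tmul Fq x y : C.AL L) = TensorProduct.tmul Fq 1 y * TensorProduct.tmul Fq x 1 := by
          rw [Algebra.TensorProduct.tmul_mul_tmul, one_mul, mul_one]
        rw [e, mul_smul, ← L_smul_def]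
        refine Submodule.smul_mem _ _ ?_
        clear e
        induction h using Submodule.span_induction with
        | mem m hm =>
          obtain ⟨m, rfl⟩ := hm
          refine Submodule.subset_span ⟨(TensorProduct.tmul Fq x (1 : L) : C.AL L) • m, ?_⟩
          rw [semiSec_smul, sigmaA_tmul_one]
        | zero => rw [smul_zero]; exact zero_mem _
        | add m m' _ _ h h' => rw [smul_add]; exact add_mem h h'
        | smul a m _ h =>
          rw [L_smul_def, smul_smul, mul_comm, ← smul_smul, ← L_smul_def]
          exact Submodule.smul_mem _ _ h
  · rw [Submodule.span_le]
    rintro _ ⟨m, rfl⟩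
    exact M.semiSec_mem_range m

lemma rank_eq_of_ker_eq {V Q₁ Q₂ : Type u} [AddCommGroup V] [Module L V] [AddCommGroup Q₁] [Module L Q₁]
    [AddCommGroup Q₂] [Module L Q₂] (f : V →ₗ[L] Q₁) (g : V →ₗ[L] Q₂) (hf : Function.Surjective f)
    (hg : Function.Surjective g) (h : ∀ v, f v = 0 ↔ g v = 0) : Module.rank L Q₁ = Module.rank L Q₂ := by
  have e : LinearMap.ker f = LinearMap.ker g := by ext v; exact h v
  exact ((f.quotKerEquivOfSurjective hf).symm.trans
    ((Submodule.quotEquivOfEq _ _ e).trans (g.quotKerEquivOfSurjective hg))).rank_eq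

lemma IsPureAMotive.rank_quotient {M : TauModule C L} {cstar : C.A →ₐ[Fq] L} {r d : ℕ} (h : M.IsPureAMotive cstar r d) :
    Module.rank L (M.M ⧸ M.rangeL) = d := by
  rw [← h.dim_coker]
  let : Module L (M.M ⧸ LinearMap.range M.τ.hom) :=
      Module.compHom _ (Algebra.TensorProduct.includeRight : L →ₐ[Fq] C.AL L).toRingHom
  let g : M.M →ₗ[L] M.M ⧸ LinearMap.range M.τ.hom :=
    { toFun := Submodule.Quotient.mk
      map_add' := fun _ _ => rfl
      map_smul' := fun _ _ => rfl }
  have hg : Function.Surjective g := fun q => by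
    obtain ⟨m, rfl⟩ := Submodule.Quotient.mk_surjective _ q
    exact ⟨m, rfl⟩
  refine rank_eq_of_ker_eq M.rangeL.mkQ g (Submodule.mkQ_surjective _) hg fun v => ?_
  refine (Submodule.Quotient.mk_eq_zero M.rangeL).trans ?_
  exact (Submodule.Quotient.mk_eq_zero (LinearMap.range M.τ.hom)).symm
end TauModule

namespace IsTauChain

open TauModule

variable {M : TauModule C L} {E : (C.CL L).Modules} {e : M.M ≅ (C.gammaU L).obj E}
  {W : Type u} [AddCommGroup W] [Module (C.CL L).functionField W]
  {γ : GenEmb E W} {T : W →+ W} {z : C.Uniformizer}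
  {Λ : ℤ → Submodule (locRing (C.CL L) (C.infLPt L)) W} {r k l : ℕ}
  [Module L W] (h : IsTauChain e γ T z Λ r k l)
include h

/-- The embedding of `M` in the generic fibre as an `L`-linear map. -/
def embL : M.M →ₗ[L] W where
  toFun := emb e γ
  map_add' := (emb e γ).map_add
  map_smul' a m := by rw [RingHom.id_apply, L_smul_def, emb_smul, C.ALtoK_tmul_one, h.L_smul]

lemma span_image_range_embL : Submodule.span L (T '' (LinearMap.range h.embL : Set W)) = M.rangeL.map h.embL := by
  rw [rangeL_eq_span, Submodule.map_span]
  congr 1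
  ext w
  constructor
  · rintro ⟨_, ⟨m, rfl⟩, rfl⟩
    exact ⟨_, ⟨m, rfl⟩, (h.T_emb m).symm⟩
  · rintro ⟨_, ⟨m, rfl⟩, rfl⟩
    exact ⟨_, ⟨m, rfl⟩, h.T_emb m⟩

lemma rank_map_range {cstar : C.A →ₐ[Fq] L} {d : ℕ} (hM : M.IsPureAMotive cstar r d) :
    Module.rank L ((LinearMap.range h.embL).map (Submodule.span L (T '' (LinearMap.range h.embL : Set W))).mkQ) = d := by
  rw [← hM.rank_quotient]
  set N := Submodule.span L (T '' (LinearMap.range h.embL : Set W)) with hN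
  let g : M.M →ₗ[L] (LinearMap.range h.embL).map N.mkQ :=
    (N.mkQ.comp h.embL).codRestrict _ fun m => ⟨_, ⟨m, rfl⟩, rfl⟩
  refine rank_eq_of_ker_eq g M.rangeL.mkQ ?_ (Submodule.mkQ_surjective _) fun v => ?_
  · rintro ⟨_, _, ⟨m, rfl⟩, rfl⟩
    exact ⟨m, rfl⟩
  · have h1 : g v = 0 ↔ h.embL v ∈ N := by
      rw [Subtype.ext_iff]
      exact Submodule.Quotient.mk_eq_zero N
    rw [h1, hN, h.span_image_range_embL]
    refine Iff.trans ?_ (Submodule.Quotient.mk_eq_zero M.rangeL).symm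
    constructor
    · rintro ⟨m, hm, e'⟩
      rwa [← emb_injective e γ e']
    · exact fun hv => ⟨v, hv, rfl⟩

variable [FiniteDimensional (C.CL L).functionField W]

lemma exists_inf_eq_bot [Module.Finite (C.AL L) M.M] :
    ∃ i, LinearMap.range h.embL ⊓ h.localFrob.lSub (Λ i) = ⊥ := by
  obtain ⟨n, hn⟩ := exists_eq_zero_of_eq_pow_smul γ (emb e γ) (emb_smul e γ) h.free h.rank z
  obtain ⟨N, hN⟩ : ∃ N : ℕ, ∀ w ∈ Λ 0, z.zK L ^ N • w ∈ γ.lat (C.infLPt L) := by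
    obtain ⟨s, hs⟩ := h.chain.fg 0
    choose N hN using fun w => γ.exists_pow_smul_mem_lat h.free h.rank (z.val_zK_lt_one (L := L)) w
    refine ⟨s.sup N, fun w hw => ?_⟩
    rw [← hs] at hw
    induction hw using Submodule.span_induction with
    | mem w hw => exact hN w _ (Finset.le_sup (f := N) hw)
    | zero => rw [smul_zero]; exact zero_mem _
    | add w w' _ _ h h' => rw [smul_add]; exact add_mem h h'
    | smul a w _ h =>
      rw [smul_comm]
      exact (γ.lat _).smul_mem a h
  -- Going down `N + n` periods multiplies `Λ 0` by `z ^ ((N + n) k)`. As `k ≥ 1`, this is deep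
  -- enough to lie in `z ^ n` times the lattice of `E`, where no nonzero element of `M` is found.
  have h1 := h.chain.scale_nat h.localFrob (-((N + n) * l : ℕ)) (N + n)
  rw [neg_add_cancel] at h1
  refine ⟨-((N + n) * l : ℕ), ?_⟩
  rw [Submodule.eq_bot_iff]
  rintro _ ⟨⟨m, rfl⟩, hm⟩
  have h2 : z.zK L ^ (-((N + n) * k : ℕ) : ℤ) • h.embL m ∈ Λ 0 := by
    rw [h1]; exact smul_mem_scaleLat _ hm
  have h3 := hN _ h2
  refine hn m _ (γ.smul_mem_lat (pow_mem z.zK_mem ((N + n) * (k - 1))) h3) ?_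
  have hz := z.zK_ne_zero (L := L)
  rw [smul_smul, smul_smul, smul_smul, ← pow_add, ← pow_add, ← zpow_natCast, ← zpow_add₀ hz]
  have : (((n + (N + n) * (k - 1) + N : ℕ) : ℤ) + -((N + n) * k : ℕ)) = 0 := by
    obtain ⟨k', hk⟩ := Nat.exists_eq_succ_of_ne_zero h.chain.pos.ne'
    rw [hk, Nat.succ_sub_one]
    push_cast
    ring
  rw [this, zpow_zero, one_smul]
  rfl

lemma exists_sup_eq_top : ∃ i, LinearMap.range h.embL ⊔ h.localFrob.lSub (Λ i) = ⊤ := by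
  obtain ⟨n, hn⟩ := exists_pow_smul_sub_mem_lat_inf γ (emb e γ) (emb_smul e γ) h.free h.rank
    (by rw [range_emb]; exact γ.span_range h.free h.rank) z
  obtain ⟨V, hV, b, hb⟩ := γ.exists_frame h.free h.rank (C.infLPt L)
  choose j hj using fun a => h.chain.exhaust (b a)
  obtain ⟨J, hJ⟩ : ∃ J, ∀ a, j a ≤ J := by
    obtain ⟨J, hJ⟩ := (Set.finite_range j).bddAbove
    exact ⟨J, fun a => hJ ⟨a, rfl⟩⟩
  have hle : γ.lat (C.infLPt L) ≤ Λ J := by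
    rw [hb.lat_eq_span hV, Submodule.span_le]
    rintro _ ⟨a, rfl⟩
    exact h.chain.mono (hJ a) (hj a)
  -- `Λ J` contains the lattice of `E`, and `n` further periods allow poles of order at least `n`,
  -- which suffices to correct any vector by an element of `M`.
  refine ⟨J + (n * l : ℕ), ?_⟩
  rw [eq_top_iff]
  intro w _
  obtain ⟨m, hm⟩ := hn w
  rw [← add_sub_cancel (emb e γ m) w]
  refine Submodule.add_mem_sup ⟨m, rfl⟩ ?_
  change _ ∈ Λ _
  have hz := z.zK_ne_zero (L := L)
  rw [h.chain.scale_nat h.localFrob, mem_scaleLat (zpow_ne_zero _ hz), zpow_neg, inv_inv, zpow_natCast]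
  obtain ⟨k', hk⟩ := Nat.exists_eq_succ_of_ne_zero h.chain.pos.ne'
  rw [hk, Nat.mul_succ, pow_add, mul_smul]
  exact (Λ J).smul_mem ⟨_, pow_mem z.zK_mem _⟩ (hle hm)

/-- The steps of the chain have the dimension of the motive. -/
theorem relDim_eq {cstar : C.A →ₐ[Fq] L} {d : ℕ} (hM : M.IsPureAMotive cstar r d) (i : ℤ) :
    relDim (h.localFrob.lSub (Λ i)) (h.localFrob.lSub (Λ (i + 1))) = d := by
  have := hM.finite
  have hr := h.rank_map_range hM
  obtain ⟨i₀, h₀⟩ := h.exists_inf_eq_bot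
  obtain ⟨i₁, h₁⟩ := h.exists_sup_eq_top
  have hfin : FiniteDimensional L
      ((LinearMap.range h.embL).map (Submodule.span L (T '' (LinearMap.range h.embL : Set W))).mkQ) :=
    Module.rank_lt_aleph0_iff.1 (hr ▸ Cardinal.natCast_lt_aleph0)
  have h1 := (h.chain.isTauFiltration h.localFrob).relDim_eq_finrank (M := LinearMap.range h.embL)
    (by rintro _ ⟨m, rfl⟩; exact ⟨_, (h.T_emb m).symm⟩) (fun m _ => h.chain.exhaust m) h₀ h₁ i
  rw [h1, relDim, Module.finrank, hr, Cardinal.toNat_natCast]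

variable {S : TauSheafData C L} {η : S.Embs W} (hη : IsChainModel γ T Λ (r := r) η)
include hη

theorem lDim_cokernel_Pi {cstar : C.A →ₐ[Fq] L} {d : ℕ} (hM : M.IsPureAMotive cstar r d) (i : ℤ) :
    C.lDim L (Limits.cokernel (S.Pi i)) = d := by
  have := η.mono_Pi i
  let A := h.localFrob.lSub (Λ i)
  let B := h.localFrob.lSub (Λ (i + 1))
  have h1 := GenEmb.lDim_eq_rank (δ := η.γ (i + 1)) (π := Limits.cokernel.π (S.Pi i))
    ((η.γ i).cokernel_π_eq_zero_iff (η.γ (i + 1)) (S.Pi i) (fun V s => η.compat (lt_add_one i).le V s))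
    (isClosed_singleton_of_ne_genericPoint (C.infLPt_ne_genericPoint L))
    (fun x hx w hw => by
      rw [hη.lat_UL _ ((C.mem_UL_iff L x).2 hx)] at hw ⊢
      exact hw)
    (A.comap B.subtype) B.subtype.toAddMonoidHom (fun a v => h.L_smul a v)
    (fun v => (hη.lat_inf _ _).2 v.2) (fun v => hη.lat_inf _ _)
    (fun w hw => ⟨⟨w, (hη.lat_inf _ _).1 hw⟩, by
      rw [LinearMap.toAddMonoidHom_coe, Submodule.subtype_apply, sub_self]; exact zero_mem _⟩)
  have hfin : FiniteDimensional L (B.map A.mkQ) := (h.chain.isTauFiltration h.localFrob).finite i (i + 1)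
  let g : B →ₗ[L] B.map A.mkQ := (A.mkQ.comp B.subtype).codRestrict _ fun b => ⟨b, b.2, rfl⟩
  have h2 : Module.rank L (B ⧸ A.comap B.subtype) = Module.rank L (B.map A.mkQ) := by
    refine rank_eq_of_ker_eq (A.comap B.subtype).mkQ g (Submodule.mkQ_surjective _) ?_ fun v => ?_
    · rintro ⟨_, b, hb, rfl⟩
      exact ⟨⟨b, hb⟩, rfl⟩
    · refine (Submodule.Quotient.mk_eq_zero _).trans ?_
      rw [Subtype.ext_iff]
      exact (Submodule.Quotient.mk_eq_zero A).symm
  rw [h1, h2, ← Module.finrank_eq_rank]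
  exact congrArg Nat.cast (h.relDim_eq hM i)

-- By freeness over the local ring, `Λ 0` has a basis; the `l` steps from `Λ 0` to `z ^ (-k) Λ 0`,
-- each of dimension `d`, make up dimension `k r`.
omit hη in
theorem mul_eq_mul {cstar : C.A →ₐ[Fq] L} {d : ℕ} (hM : M.IsPureAMotive cstar r d) : l * d = k * r := by
  obtain ⟨b, hb⟩ := exists_basis_of_fg h.rank (Λ 0) (h.chain.fg 0) (h.span_lat 0)
  have h1 := h.chain.mul_relDim_eq h.localFrob b.linearIndependent hb
  have h2 := h.relDim_eq hM 0
  rw [zero_add] at h2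
  rwa [h2] at h1

end IsTauChain

end

/-! ### The characteristic point and the ideal `J`. -/

noncomputable section

open PointedCurve (map_map_apply map_map_comm app_map_apply modHom modHom_app)

lemma isClosed_ratPt {k : Type u} [Field k] {X : Scheme.{u}} (f : X ⟶ Spec (CommRingCat.of k)) [IsSeparated f]
    (s : Spec (CommRingCat.of k) ⟶ X) (hs : s ≫ f = 𝟙 _) : IsClosed ({ratPt s} : Set X) := by
  have : IsClosedImmersion (s ≫ f) := by rw [hs]; infer_instance
  have : IsClosedImmersion s := MorphismProperty.of_postcomp (W := @IsClosedImmersion)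
    (W' := @IsSeparated) s f inferInstance inferInstance
  convert s.isClosedEmbedding.isClosed_range
  ext x
  constructor
  · rintro rfl
    exact ⟨_, rfl⟩
  · rintro ⟨y, rfl⟩
    have : y = IsLocalRing.closedPoint k := Subsingleton.elim (α := PrimeSpectrum k) _ _
    rw [this]; rfl

variable {Fq : Type u} [Field Fq] {C : PointedCurve Fq} {L : Type u} [Field L] [Algebra Fq L]

namespace LPoint

lemma fromSpec_str : C.isAffineOpen_U.fromSpec ≫ C.str =
    Spec.map (CommRingCat.ofHom (R := Fq) (S := Γ(C.X, C.U)) C.toA) := by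
  conv_lhs => rw [← toSpecOf_structMap C.str, toSpecOf, ← Category.assoc, IsAffineOpen.fromSpec_toSpecΓ, ← Spec.map_comp]
  congr 1
  ext x
  exact structMap_map C.str le_top x

/-- The ring homomorphism underlying `c^*`. -/
def ringMap (cstar : C.A →ₐ[Fq] L) : Γ(C.X, C.U) ⟶ CommRingCat.of L :=
  CommRingCat.ofHom (R := Γ(C.X, C.U)) (S := L) cstar.toRingHom

/-- The composite `Spec L → Spec A ⊂ C`. -/
def ofAlgHom (cstar : C.A →ₐ[Fq] L) : LPoint C L where
  c := Spec.map (ringMap cstar) ≫ C.isAffineOpen_U.fromSpec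
  c_str := by
    rw [Category.assoc, fromSpec_str, ← Spec.map_comp]
    refine congrArg Spec.map ?_
    ext x
    exact cstar.commutes x

lemma isSpecOf_ofAlgHom (cstar : C.A →ₐ[Fq] L) : (ofAlgHom cstar).IsSpecOf cstar := by
  have h : (⊤ : (Spec (CommRingCat.of L)).Opens) ≤ (ofAlgHom cstar).c ⁻¹ᵁ C.U := by
    change ⊤ ≤ Spec.map _ ⁻¹ᵁ (C.isAffineOpen_U.fromSpec ⁻¹ᵁ C.U)
    rw [IsAffineOpen.fromSpec_preimage_self]
    exact le_rfl
  refine ⟨h, fun a => ?_⟩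
  have e : ∀ h', (Spec.map (ringMap cstar) ≫ C.isAffineOpen_U.fromSpec).appLE C.U ⊤ h' =
      (Scheme.ΓSpecIso Γ(C.X, C.U)).inv ≫ (Spec.map (ringMap cstar)).appTop := fun h' => by
    rw [Scheme.Hom.comp_appLE, IsAffineOpen.fromSpec_app_self, Category.assoc]
    refine congrArg _ ((Scheme.Hom.map_appLE (Spec.map (ringMap cstar)) _ _).trans ?_)
    exact (congrArg _ ((Spec (CommRingCat.of L)).presheaf.map_id _)).trans (Category.comp_id _)
  have e2 := (e h).trans (Scheme.ΓSpecIso_inv_naturality (ringMap cstar)).symm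
  refine (congrArg (Scheme.ΓSpecIso (CommRingCat.of L)).hom congr($e2 a)).trans ?_
  exact congr($((Scheme.ΓSpecIso (CommRingCat.of L)).inv_hom_id) (cstar a))

variable (c : LPoint C L)

lemma graph_prL : c.graph ≫ C.prL L = 𝟙 _ := Limits.pullback.lift_snd _ _ _

lemma graph_pr : c.graph ≫ C.pr L = c.c := Limits.pullback.lift_fst _ _ _

/-- The point of `C_L` defined by `c`. -/
def pt : C.CL L := ratPt c.graph

lemma isClosed_pt : IsClosed ({c.pt} : Set (C.CL L)) := isClosed_ratPt (C.prL L) c.graph c.graph_prL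

variable {c} {cstar : C.A →ₐ[Fq] L} (h : c.IsSpecOf cstar)
include h

lemma IsSpecOf.pt_mem_UL : ratPt c.graph ∈ C.UL L := by
  obtain ⟨h, -⟩ := h
  have := h (x := IsLocalRing.closedPoint L) trivial
  change (c.graph ≫ C.pr L) _ ∈ C.U
  rw [c.graph_pr]
  exact this

/-- Evaluation of elements of `A_L` at the point of `C_L` defined by `c`. -/
def IsSpecOf.evalAL : C.AL L →+* L := (evalAt c.graph (C.UL L) h.pt_mem_UL).comp (C.ALtoGamma L)

lemma IsSpecOf.evalAL_tmul (x : C.A) (y : L) : h.evalAL (TensorProduct.tmul Fq x y) = cstar x * y := by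
  change evalAt c.graph (C.UL L) h.pt_mem_UL (C.ALtoGamma L (TensorProduct.tmul Fq x y)) = _
  rw [C.ALtoGamma_tmul, map_mul]
  congr 1
  · obtain ⟨h', h2⟩ := id h
    refine Eq.trans ?_ (h2 x)
    change (Scheme.ΓSpecIso (CommRingCat.of L)).hom (c.graph.appLE (C.UL L) ⊤ _ ((C.pr L).app C.U x)) = _
    have : ∀ (g : Spec (CommRingCat.of L) ⟶ C.X) (hg : c.graph ≫ C.pr L = g) (h1) (h2),
        (C.pr L).app C.U ≫ c.graph.appLE (C.UL L) ⊤ h1 = g.appLE C.U ⊤ h2 := by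
      rintro _ rfl h1 h2
      exact (Scheme.Hom.comp_appLE c.graph (C.pr L) C.U ⊤ h2).symm
    exact congrArg (Scheme.ΓSpecIso (CommRingCat.of L)).hom congr($(this _ c.graph_pr _ h') x)
  · exact evalAt_structMap (C.prL L) c.graph c.graph_prL (C.UL L) h.pt_mem_UL y

/-- Modulo `J` an element is congruent to its value at the point `c`. So `J` contains, and is seen
to be large enough to detect, everything vanishing there. -/
lemma IsSpecOf.sub_mem_idealJ (a : C.AL L) :
    a - TensorProduct.tmul Fq (1 : C.A) (h.evalAL a) ∈ TauModule.idealJ cstar := by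
  induction a using TensorProduct.induction_on with
  | zero => rw [map_zero, TensorProduct.tmul_zero, sub_zero]; exact zero_mem _
  | add a b ha hb =>
    rw [map_add, TensorProduct.tmul_add, add_sub_add_comm]
    exact add_mem ha hb
  | tmul x y =>
    have e : (TensorProduct.tmul Fq x y : C.AL L) - TensorProduct.tmul Fq 1 (cstar x * y) =
        TensorProduct.tmul Fq 1 y * (TensorProduct.tmul Fq x 1 - TensorProduct.tmul Fq 1 (cstar x)) := by
      rw [mul_sub, Algebra.TensorProduct.tmul_mul_tmul, Algebra.TensorProduct.tmul_mul_tmul, one_mul, one_mul,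
        mul_one, mul_comm]
    rw [h.evalAL_tmul, e]
    exact Ideal.mul_mem_left _ _ (Ideal.subset_span ⟨x, rfl⟩)

lemma IsSpecOf.mem_idealJ_of_evalAL_eq_zero {a : C.AL L} (ha : h.evalAL a = 0) : a ∈ TauModule.idealJ cstar := by
  have := h.sub_mem_idealJ a
  rwa [ha, TensorProduct.tmul_zero, sub_zero] at this

lemma IsSpecOf.exists_one_sub_mul_mem (d : ℕ) {a : C.AL L} (ha : h.evalAL a ≠ 0) :
    ∃ u, 1 - u * a ∈ TauModule.idealJ cstar ^ d := by
  let v : C.AL L := TensorProduct.tmul Fq (1 : C.A) (h.evalAL a)⁻¹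
  let j := 1 - v * a
  have hj : j ∈ TauModule.idealJ cstar := h.mem_idealJ_of_evalAL_eq_zero (by
    rw [map_sub, map_one, map_mul, h.evalAL_tmul, map_one, one_mul, inv_mul_cancel₀ ha, sub_self])
  -- The element `j = 1 - v * a` lies in `J`, and `1 - j = v * a` divides `1 - j ^ d`; thus `a` is
  -- invertible modulo `J ^ d`.
  obtain ⟨w, hw⟩ := sub_dvd_pow_sub_pow (1 : C.AL L) j d
  refine ⟨w * v, ?_⟩
  have e : 1 - w * v * a = j ^ d := by
    have : (1 : C.AL L) - j = v * a := sub_sub_cancel _ _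
    rw [one_pow, this] at hw
    rw [mul_assoc, mul_comm w, ← hw, sub_sub_cancel]
  rw [e]
  exact Ideal.pow_mem_pow hj d

lemma IsSpecOf.inv_ALtoK_mem_iff (a : C.AL L) :
    h.evalAL a ≠ 0 ↔ C.ALtoK L a ≠ 0 ∧ (C.ALtoK L a)⁻¹ ∈ locRing (C.CL L) (ratPt c.graph) := by
  refine (ratPt_mem_basicOpen c.graph h.pt_mem_UL (C.ALtoGamma L a)).symm.trans ?_
  exact isUnit_germ_iff h.pt_mem_UL (C.ALtoGamma L a)

/-- The graph is a closed point, so some function is invertible at `x` and vanishes there; by the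
description of `J` this function lies in `J`. -/
lemma IsSpecOf.exists_mem_idealJ {x : C.CL L} (hx : x ∈ C.UL L) (hxp : x ≠ ratPt c.graph) :
    ∃ a ∈ TauModule.idealJ cstar, C.ALtoK L a ≠ 0 ∧ (C.ALtoK L a)⁻¹ ∈ locRing (C.CL L) x := by
  let V : (C.CL L).Opens := ⟨_, c.isClosed_pt.isOpen_compl⟩
  obtain ⟨f, hf, hxf⟩ := (C.isAffineOpen_UL L).exists_basicOpen_le (V := V) ⟨x, hxp⟩ hx
  obtain ⟨a, rfl⟩ := (C.ALtoGamma_bijective L).2 f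
  refine ⟨a, h.mem_idealJ_of_evalAL_eq_zero ?_, (isUnit_germ_iff hx _).1 hxf⟩
  by_contra hne
  exact hf ((ratPt_mem_basicOpen c.graph h.pt_mem_UL _).2 hne) rfl

/-- The local equations of the graph lie in the ideal generated by `J`. -/
lemma IsSpecOf.germ_eq_of_evalAt_eq_zero {V : (C.CL L).Opens} (hV : ratPt c.graph ∈ V) [Nonempty V]
    {b : Γ(C.CL L, V)} (hb : evalAt c.graph V hV b = 0) : ∃ g ∈ TauModule.idealJ cstar, ∃ a,
      h.evalAL a ≠ 0 ∧ (C.CL L).germToFunctionField V b * C.ALtoK L a = C.ALtoK L g := by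
  obtain ⟨g, a, ha, ha', e⟩ := PointedCurve.exists_ALtoK_div_of_mem h.pt_mem_UL (germ_mem_locRing V hV b)
  refine ⟨g, h.mem_idealJ_of_evalAL_eq_zero ?_, a, (h.inv_ALtoK_mem_iff a).2
    ⟨(map_ne_zero_iff _ C.ALtoK_injective).2 ha, ha'⟩, e⟩
  have hp : ratPt c.graph ∈ V ⊓ C.UL L := ⟨hV, h.pt_mem_UL⟩
  have : Nonempty (V ⊓ C.UL L : (C.CL L).Opens) := ⟨⟨_, hp⟩⟩
  have e1 : (C.CL L).presheaf.map (homOfLE (inf_le_left : V ⊓ C.UL L ≤ V)).op b *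
      (C.CL L).presheaf.map (homOfLE (inf_le_right : V ⊓ C.UL L ≤ C.UL L)).op (C.ALtoGamma L a) =
      (C.CL L).presheaf.map (homOfLE (inf_le_right : V ⊓ C.UL L ≤ C.UL L)).op (C.ALtoGamma L g) := by
    apply Scheme.germToFunctionField_injective (C.CL L) (V ⊓ C.UL L)
    rw [map_mul, germ_map, germ_map, germ_map]
    exact e
  have e2 := congrArg (evalAt c.graph _ hp) e1
  rw [map_mul, evalAt_map, evalAt_map, evalAt_map, hb, zero_mul] at e2
  exact e2.symm

end LPoint

end

/-! ### The cokernels of the `τ_i`. -/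

noncomputable section

open PointedCurve (map_map_apply map_map_comm app_map_apply modHom modHom_app)

variable {Fq : Type u} [Field Fq] {C : PointedCurve Fq} {L : Type u} [Field L] [Algebra Fq L] [Fintype Fq]

lemma inv_mul_smul_mem {K W : Type*} [Field K] [AddCommGroup W] [Module K W] {O : Subring K} {N : Submodule O W}
    {a : K} (ha : a ≠ 0) (ha' : a⁻¹ ∈ O) {w : W} (h : a • w ∈ N) : w ∈ N := by
  have : w = (⟨a⁻¹, ha'⟩ : O) • a • w := (inv_smul_smul₀ ha w).symm
  rw [this]
  exact N.smul_mem _ h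

namespace IsTauChain

open TauModule LocalFrob

variable {M : TauModule C L} {E : (C.CL L).Modules} {e : M.M ≅ (C.gammaU L).obj E}
  {W : Type u} [AddCommGroup W] [Module (C.CL L).functionField W] {γ : GenEmb E W} {T : W →+ W}
  {z : C.Uniformizer} {Λ : ℤ → Submodule (locRing (C.CL L) (C.infLPt L)) W} {r k l : ℕ} [Module L W]
  [FiniteDimensional (C.CL L).functionField W] (h : IsTauChain e γ T z Λ r k l)
include h

lemma exists_smul_eq_emb {x : C.CL L} (hx : x ∈ C.UL L) {w : W} (hw : w ∈ γ.lat x) : ∃ a : C.AL L,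
    C.ALtoK L a ≠ 0 ∧ (C.ALtoK L a)⁻¹ ∈ locRing (C.CL L) x ∧ ∃ m, C.ALtoK L a • w = emb e γ m := by
  obtain ⟨a, ha, ha', s, hs⟩ := γ.exists_ALtoK_smul_mem_range h.free h.rank hx hw
  refine ⟨a, ha, ha', ofSec e s, ?_⟩
  rw [emb_apply, toSec_ofSec, hs]

omit [FiniteDimensional (C.CL L).functionField W] [Module L W] h in
lemma emb_mem_lat {x : C.CL L} (hx : x ∈ C.UL L) (m : M.M) : emb e γ m ∈ γ.lat x := γ.γ_mem_lat hx _

variable {S : TauSheafData C L} {η : S.Embs W} (hη : IsChainModel γ T Λ (r := r) η)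
include hη

/-- Away from `∞` the image of `τ` is generated by the image of the motive. -/
lemma pullLat_eq_span (i : ℤ) {x : C.CL L} (hx : x ∈ C.UL L) : (η.γ i).pullLat (C.sigma L) T x =
    Submodule.span (locRing (C.CL L) x) (Set.range fun m => emb e γ (M.semiSec m)) := by
  have hx' := (C.sigma_mem_UL_iff L x).2 hx
  refine le_antisymm (Submodule.span_le.2 ?_) (Submodule.span_le.2 ?_)
  · rintro _ ⟨w, hw, rfl⟩
    obtain ⟨a, ha, ha', m, hm⟩ := h.exists_smul_eq_emb hx' ((hη.lat_UL i hx' w).1 hw)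
    refine inv_mul_smul_mem (a := C.sigmaK L (C.ALtoK L a)) ((map_ne_zero _).2 ha) ?_ ?_
    · rw [← map_inv₀]
      exact genMap_mem_locRing (C.sigma L) ha'
    · rw [← h.T_smul, hm, h.T_emb]
      exact Submodule.subset_span ⟨m, rfl⟩
  · rintro _ ⟨m, rfl⟩
    change emb e γ (M.semiSec m) ∈ _
    rw [← h.T_emb]
    exact Submodule.subset_span ⟨_, (hη.lat_UL i hx' _).2 (emb_mem_lat hx' m), rfl⟩

lemma emb_mem_pullLat (i : ℤ) {x : C.CL L} (hx : x ∈ C.UL L) {m : M.M} (hm : m ∈ LinearMap.range M.τ.hom) :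
    emb e γ m ∈ (η.γ i).pullLat (C.sigma L) T x := by
  rw [h.pullLat_eq_span hη i hx]
  rw [M.range_τ] at hm
  induction hm using Submodule.span_induction with
  | mem m hm =>
    obtain ⟨m, rfl⟩ := hm
    exact Submodule.subset_span ⟨m, rfl⟩
  | zero => rw [map_zero]; exact zero_mem _
  | add m m' _ _ hm hm' => rw [map_add]; exact add_mem hm hm'
  | smul a m _ hm =>
    rw [emb_smul]
    exact Submodule.smul_mem _ (⟨_, PointedCurve.ALtoK_mem_locRing hx a⟩ : locRing (C.CL L) x) hm

lemma exists_smul_mem_range_τ (i : ℤ) {x : C.CL L} (hx : x ∈ C.UL L) {w : W}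
    (hw : w ∈ (η.γ i).pullLat (C.sigma L) T x) : ∃ a : C.AL L, C.ALtoK L a ≠ 0 ∧
      (C.ALtoK L a)⁻¹ ∈ locRing (C.CL L) x ∧ ∃ m ∈ LinearMap.range M.τ.hom, C.ALtoK L a • w = emb e γ m := by
  rw [h.pullLat_eq_span hη i hx] at hw
  induction hw using Submodule.span_induction with
  | mem w hw =>
    obtain ⟨m, rfl⟩ := hw
    refine ⟨1, ?_, ?_, M.semiSec m, M.semiSec_mem_range m, ?_⟩
    · rw [map_one]; exact one_ne_zero
    · rw [map_one, inv_one]; exact one_mem _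
    · rw [map_one, one_smul]
  | zero =>
    refine ⟨1, ?_, ?_, 0, zero_mem _, ?_⟩
    · rw [map_one]; exact one_ne_zero
    · rw [map_one, inv_one]; exact one_mem _
    · rw [map_zero, smul_zero]
  | add w w' _ _ hw hw' =>
    obtain ⟨a, ha, hax, m, hm, e⟩ := hw
    obtain ⟨a', ha', hax', m', hm', e'⟩ := hw'
    refine ⟨a * a', ?_, ?_, a' • m + a • m', add_mem (Submodule.smul_mem _ _ hm) (Submodule.smul_mem _ _ hm'), ?_⟩
    · rw [map_mul]; exact mul_ne_zero ha ha'
    · rw [map_mul, mul_inv]; exact mul_mem hax hax'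
    · rw [map_add, emb_smul, emb_smul, ← e, ← e', map_mul, smul_add, smul_smul, smul_smul, mul_comm (C.ALtoK L a')]
  | smul b w _ hw =>
    obtain ⟨a, ha, hax, m, hm, e⟩ := hw
    obtain ⟨g, a', ha', hax', e'⟩ := PointedCurve.exists_ALtoK_div_of_mem hx b.2
    refine ⟨a * a', ?_, ?_, g • m, Submodule.smul_mem _ _ hm, ?_⟩
    · rw [map_mul]; exact mul_ne_zero ha ((map_ne_zero_iff _ PointedCurve.ALtoK_injective).2 ha')
    · rw [map_mul, mul_inv]; exact mul_mem hax hax'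
    · rw [emb_smul, ← e, map_mul, ← e', smul_smul]
      change (C.ALtoK L a * C.ALtoK L a') • (b : (C.CL L).functionField) • w = _
      rw [smul_smul]
      congr 1
      ring

variable {cstar : C.A →ₐ[Fq] L} {d : ℕ} (hM : M.IsPureAMotive cstar r d) {c : LPoint C L} (hc : c.IsSpecOf cstar)

omit [FiniteDimensional (C.CL L).functionField W] h hη [Module L W] in
include hM in
lemma smul_mem_range_τ {a : C.AL L} (ha : a ∈ idealJ cstar ^ d) (m : M.M) : a • m ∈ LinearMap.range M.τ.hom :=
  (Submodule.Quotient.mk_eq_zero _).1 (hM.annihilated a (Submodule.Quotient.mk m) ha)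

include hM hc

/-- The cokernel of `τ_i` is supported at the point `c`. Elsewhere in the affine part the `d`-th
power of an element of `J` invertible at `x` annihilates `coker τ`; at `∞` the operator `T`
generates the next lattice of the chain. -/
lemma mem_pullLat_of_ne (i : ℤ) {x : C.CL L} (hxp : x ≠ ratPt c.graph) {w : W}
    (hw : w ∈ (η.γ (i + 1)).lat x) : w ∈ (η.γ i).pullLat (C.sigma L) T x := by
  by_cases hx : x ∈ C.UL L
  · obtain ⟨a, ha, hax, m, hm⟩ := h.exists_smul_eq_emb hx ((hη.lat_UL _ hx w).1 hw)
    obtain ⟨b, hbJ, hb, hbx⟩ := hc.exists_mem_idealJ hx hxp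
    refine inv_mul_smul_mem ha hax ?_
    rw [hm]
    refine inv_mul_smul_mem (a := C.ALtoK L (b ^ d)) ?_ ?_ ?_
    · rw [map_pow]; exact pow_ne_zero _ hb
    · rw [map_pow, ← inv_pow]; exact pow_mem hbx _
    · rw [← emb_smul]
      exact h.emb_mem_pullLat hη i hx (smul_mem_range_τ hM (Ideal.pow_mem_pow hbJ d) m)
  · have : x = C.infLPt L := by
      by_contra hne
      exact hx ((C.mem_UL_iff L x).2 hne)
    subst this
    have h1 : frobSpan (locRing (C.CL L) (C.infLPt L)) T (Λ i) ≤
        (η.γ i).pullLat (C.sigma L) T (C.infLPt L) := by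
      refine Submodule.span_mono (Set.image_mono fun v hv => ?_)
      rw [C.sigma_infLPt L]
      exact (hη.lat_inf i v).2 hv
    rw [h.chain.frob] at h1
    exact h1 ((hη.lat_inf _ w).1 hw)

/-- Lying in the image of `τ` can be tested locally at `c`. If `a • m` is in the image with `a`
invertible at `c`, then `1 - u * a` lies in `J ^ d` for some `u`, and both `(1 - u * a) • m` and `u
• a • m` are in the image. -/
lemma emb_mem_pullLat_iff (i : ℤ) (m : M.M) :
    emb e γ m ∈ (η.γ i).pullLat (C.sigma L) T (ratPt c.graph) ↔ m ∈ M.rangeL := by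
  refine ⟨fun hm => ?_, fun hm => h.emb_mem_pullLat hη i hc.pt_mem_UL hm⟩
  obtain ⟨a, ha, hax, m', hm', e'⟩ := h.exists_smul_mem_range_τ hη i hc.pt_mem_UL hm
  rw [← emb_smul] at e'
  have e2 := emb_injective e γ e'
  obtain ⟨u, hu⟩ := hc.exists_one_sub_mul_mem d ((hc.inv_ALtoK_mem_iff a).2 ⟨ha, hax⟩)
  have e3 : m = (1 - u * a) • m + u • a • m := by rw [sub_smul, one_smul, mul_smul, sub_add_cancel]
  change m ∈ LinearMap.range M.τ.hom
  rw [e3, e2]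
  exact add_mem (smul_mem_range_τ hM hu m) (Submodule.smul_mem _ _ hm')

lemma smul_mem_pullLat (i : ℤ) {a : C.AL L} (ha : a ∈ idealJ cstar ^ d) {w : W}
    (hw : w ∈ γ.lat (ratPt c.graph)) : C.ALtoK L a • w ∈ (η.γ i).pullLat (C.sigma L) T (ratPt c.graph) := by
  obtain ⟨b, hb, hbx, m, hm⟩ := h.exists_smul_eq_emb hc.pt_mem_UL hw
  refine inv_mul_smul_mem hb hbx ?_
  rw [smul_comm, hm, ← emb_smul]
  exact h.emb_mem_pullLat hη i hc.pt_mem_UL (smul_mem_range_τ hM ha m)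

lemma exists_sub_emb_mem_pullLat (i : ℤ) {w : W} (hw : w ∈ γ.lat (ratPt c.graph)) :
    ∃ m, w - emb e γ m ∈ (η.γ i).pullLat (C.sigma L) T (ratPt c.graph) := by
  obtain ⟨a, ha, hax, m, hm⟩ := h.exists_smul_eq_emb hc.pt_mem_UL hw
  obtain ⟨u, hu⟩ := hc.exists_one_sub_mul_mem d ((hc.inv_ALtoK_mem_iff a).2 ⟨ha, hax⟩)
  refine ⟨u • m, ?_⟩
  convert h.smul_mem_pullLat hη hM hc i hu hw using 1
  rw [emb_smul, ← hm, map_sub, map_one, map_mul, sub_smul, one_smul, mul_smul]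

/-- The cokernel is supported at `c`, and there its germs are the classes of `M` modulo the image of
`τ`. -/
theorem lDim_cokernel_τ (i : ℤ) : C.lDim L (Limits.cokernel (S.τ i)) = d := by
  have h1 := GenEmb.lDim_eq_rank (δ := η.γ (i + 1)) (π := Limits.cokernel.π (S.τ i))
    ((η.γ i).cokernel_pullback_π_eq_zero_iff (η.γ (i + 1)) (C.sigma L) (S.τ i) T (hη.τ i)) c.isClosed_pt
    (fun x hx w hw => h.mem_pullLat_of_ne hη hM hc i hx hw) M.rangeL (emb e γ) (fun a m => h.embL.map_smul a m |>.trans (h.L_smul a _))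
    (fun m => (hη.lat_UL _ hc.pt_mem_UL _).2 (emb_mem_lat hc.pt_mem_UL m)) (h.emb_mem_pullLat_iff hη hM hc i)
    (fun w hw => h.exists_sub_emb_mem_pullLat hη hM hc i ((hη.lat_UL _ hc.pt_mem_UL w).1 hw))
  rw [h1, hM.rank_quotient]

lemma germ_smul_mem_pullLat (i : ℤ) {V : (C.CL L).Opens} [Nonempty V] (hV : ratPt c.graph ∈ V) {a : Γ(C.CL L, V)}
    (ha : a ∈ RingHom.ker (evalAt c.graph V hV) ^ d) {w : W} (hw : w ∈ γ.lat (ratPt c.graph)) :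
    (C.CL L).germToFunctionField V a • w ∈ (η.γ i).pullLat (C.sigma L) T (ratPt c.graph) := by
  let R := locRing (C.CL L) (ratPt c.graph)
  let θ : Γ(C.CL L, V) →+* R := ((C.CL L).germToFunctionField V).hom.codRestrict R (germ_mem_locRing V hV)
  let α : C.AL L →+* R := (C.ALtoK L).codRestrict R (PointedCurve.ALtoK_mem_locRing hc.pt_mem_UL)
  -- Functions vanishing at `c` generate, in the local ring, nothing more than `J` does. So their
  -- `d`-th powers act like `J ^ d`.
  have h1 : RingHom.ker (evalAt c.graph V hV) ≤ ((idealJ cstar).map α).comap θ := fun b hb => by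
    obtain ⟨g, hg, a, ha, e⟩ := hc.germ_eq_of_evalAt_eq_zero hV hb
    obtain ⟨ha, hax⟩ := (hc.inv_ALtoK_mem_iff a).1 ha
    have e2 : θ b = ⟨_, hax⟩ * α g := Subtype.ext (by
      change (C.CL L).germToFunctionField V b = (C.ALtoK L a)⁻¹ * C.ALtoK L g
      rw [← e, mul_comm, mul_inv_cancel_right₀ ha])
    rw [Ideal.mem_comap, e2]
    exact Ideal.mul_mem_left _ _ (Ideal.mem_map_of_mem α hg)
  have h2 := Ideal.pow_right_mono h1 d ha
  have h3 : θ a ∈ (idealJ cstar ^ d).map α := by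
    rw [Ideal.map_pow]
    exact Ideal.le_comap_pow θ d h2
  change θ a • w ∈ _
  generalize θ a = b at h3
  induction h3 using Submodule.span_induction with
  | mem b hb =>
    obtain ⟨j, hj, rfl⟩ := hb
    exact h.smul_mem_pullLat hη hM hc i hj hw
  | zero => rw [zero_smul]; exact zero_mem _
  | add b b' _ _ hb hb' => rw [add_smul]; exact add_mem hb hb'
  | smul b b' _ hb => rw [smul_eq_mul, mul_smul]; exact Submodule.smul_mem _ b hb

theorem annihilated (i : ℤ) (V : (C.CL L).affineOpens) (a : Γ(C.CL L, V.1))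
    (x : Γ(Limits.cokernel (S.τ i), V.1)) (ha : a ∈ (Scheme.Hom.ker c.graph).ideal V ^ d) : a • x = 0 := by
  by_cases hV : Nonempty V.1
  swap
  · have := subsingleton_sections (Limits.cokernel (S.τ i)) hV
    exact Subsingleton.elim _ _
  refine GenEmb.smul_eq_zero_of_smul_lat (δ := η.γ (i + 1)) (π := Limits.cokernel.π (S.τ i))
    ((η.γ i).cokernel_pullback_π_eq_zero_iff (η.γ (i + 1)) (C.sigma L) (S.τ i) T (hη.τ i)) a ?_ x
  intro y hy w hw
  by_cases hyp : y = ratPt c.graph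
  · subst hyp
    refine h.germ_smul_mem_pullLat hη hM hc i hy (Ideal.pow_right_mono ?_ d ha) ((hη.lat_UL _ hc.pt_mem_UL w).1 hw)
    intro b hb
    rw [Scheme.Hom.ker_apply, RingHom.mem_ker] at hb
    rw [RingHom.mem_ker]
    change (Scheme.ΓSpecIso (CommRingCat.of L)).hom ((c.graph.app V.1 ≫ _) b) = 0
    rw [CommRingCat.comp_apply]
    have : c.graph.app V.1 b = 0 := hb
    rw [this, map_zero, map_zero]
  · exact Submodule.smul_mem _ (⟨_, germ_mem_locRing V.1 hy a⟩ : locRing (C.CL L) y)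
      (h.mem_pullLat_of_ne hη hM hc i hyp hw)

end IsTauChain

end

/-! ### Part 1: every pure motive comes from an abelian `τ`-sheaf. -/

noncomputable section

open PointedCurve (map_map_apply map_map_comm app_map_apply modHom modHom_app)

variable {Fq : Type u} [Field Fq] {C : PointedCurve Fq} {L : Type u} [Field L] [Algebra Fq L] [Fintype Fq]

namespace IsTauChain

open TauModule LocalFrob

variable {M : TauModule C L} {E : (C.CL L).Modules} {e : M.M ≅ (C.gammaU L).obj E}
  {W : Type u} [AddCommGroup W] [Module (C.CL L).functionField W] {γ : GenEmb E W} {T : W →+ W}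
  {z : C.Uniformizer} {Λ : ℤ → Submodule (locRing (C.CL L) (C.infLPt L)) W} {r k l : ℕ} [Module L W]
  [FiniteDimensional (C.CL L).functionField W] (h : IsTauChain e γ T z Λ r k l)
  {S : TauSheafData C L} {η : S.Embs W} (hη : IsChainModel γ T Λ (r := r) η)
  {cstar : C.A →ₐ[Fq] L} {d : ℕ} {c : LPoint C L}
include h hη

theorem isAbelian (hM : M.IsPureAMotive cstar r d) (hc : c.IsSpecOf cstar) : S.IsAbelian c r d where
  locallyFree i := (η.γ i).isLocallyFreeOfRank (hη.frame i)
  mono_Pi := η.mono_Pi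
  mono_τ := h.mono_τ hη
  periodic := ⟨k, l, h.chain.pos, h.chain.pos', h.mul_eq_mul hM, h.isPeriodic hη⟩
  dim_coker_Pi := h.lDim_cokernel_Pi hη hM
  dim_coker_τ := h.lDim_cokernel_τ hη hM hc
  annihilated := h.annihilated hη hM hc

omit [FiniteDimensional (C.CL L).functionField W] [Module L W] h in
lemma exists_γ_eq_emb (m : M.M) : ∃ t : Γ(S.F.obj 0, C.UL L), (η.γ 0).γ (C.UL L) t = emb e γ m :=
  (η.γ 0).exists_section (C.UL L) fun _ hx => (hη.lat_UL 0 hx _).2 (emb_mem_lat hx m)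

end IsTauChain

lemma TauModule.exists_iso {M N : TauModule C L} (f : M.M →ₗ[C.AL L] N.M) (hf : Function.Bijective f)
    (h : ∀ m, f (M.semiSec m) = N.semiSec (f m)) : Nonempty (M.Iso N) := by
  let e : M.M ≅ N.M := (LinearEquiv.ofBijective f hf).toModuleIso
  refine ⟨e, ((ModuleCat.extendRestrictScalarsAdj (C.sigmaA L)).homEquiv _ _).injective ?_⟩
  rw [Adjunction.homEquiv_naturality_right, Adjunction.homEquiv_naturality_left]
  ext m
  exact h m

namespace IsTauChain

open TauModule LocalFrob

variable {M : TauModule C L} {E : (C.CL L).Modules} {e : M.M ≅ (C.gammaU L).obj E}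
  {W : Type u} [AddCommGroup W] [Module (C.CL L).functionField W] {γ : GenEmb E W} {T : W →+ W}
  {z : C.Uniformizer} {Λ : ℤ → Submodule (locRing (C.CL L) (C.infLPt L)) W} {r k l : ℕ} [Module L W]
  (h : IsTauChain e γ T z Λ r k l)
  {c : LPoint C L} {d : ℕ} {S : AbelianTauSheaf c r d} {η : S.Embs W} (hη : IsChainModel γ T Λ (r := r) η)
include h hη

omit [Module L W] h in
lemma γ_frobSec (m : Γ(S.F.obj 0, C.UL L)) :
    (η.γ 0).γ (C.UL L) (S.frobSec m) = T ((η.γ 0).γ (C.UL L) m) := by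
  rw [← hη.τ 0 (C.UL L) m]
  refine (η.compat (lt_add_one 0).le (C.UL L) (S.frobSec m)).symm.trans ?_
  refine (congrArg _ (S.Pi_frobSec m)).trans ?_
  exact (η.γ (0 + 1)).γ_map _ _

/-- `M` and the sections of `F_0` over `C_L ∖ {∞}` have the same image in the generic fibre, and
both semilinear maps are the restriction of `T`. -/
theorem nonempty_iso : Nonempty (M.Iso S.motive) := by
  choose f hf using exists_γ_eq_emb (e := e) hη
  have hinj := (η.γ 0).inj (C.UL L)
  let g : M.M →ₗ[C.AL L] S.motive.M :=
    { toFun := f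
      map_add' := fun m m' => hinj ((hf _).trans (by
        rw [map_add, ← hf, ← hf]
        exact (map_add ((η.γ 0).γ (C.UL L)) _ _).symm))
      map_smul' := fun a m => hinj ((hf _).trans (by
        rw [emb_smul, ← hf]
        exact ((η.γ 0).γ_ALtoGamma_smul a (f m)).symm)) }
  refine exists_iso g ⟨fun m m' hm => ?_, fun s => ?_⟩ fun m => ?_
  · refine emb_injective e γ ?_
    rw [← hf, ← hf]
    exact congrArg _ hm
  · obtain ⟨t, ht⟩ := γ.exists_section (C.UL L) (w := (η.γ 0).γ (C.UL L) s) fun x hx =>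
      (hη.lat_UL 0 hx _).1 ((η.γ 0).γ_mem_lat hx s)
    refine ⟨ofSec e t, hinj ((hf _).trans ?_)⟩
    rw [emb_apply, toSec_ofSec, ht]
  · refine hinj ((hf _).trans ?_)
    rw [← h.T_emb, ← hf]
    exact (γ_frobSec hη (f m)).symm

end IsTauChain

open TauModule LocalFrob

theorem TauModule.IsPureAMotive.exists_abelianTauSheaf {M : TauModule C L} {cstar : C.A →ₐ[Fq] L} {r d : ℕ}
    (hM : M.IsPureAMotive cstar r d) : ∃ c : LPoint C L, c.IsSpecOf cstar ∧ ∃ S : AbelianTauSheaf c r d,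
      Nonempty (M.Iso S.motive) ∧
      ∃ k l : ℕ, 0 < k ∧ 0 < l ∧ k.Coprime l ∧ l * d = k * r ∧ S.IsPeriodic k l := by
  obtain ⟨E, e, k₀, l₀, hk₀, hl₀, hE⟩ := hM.pure
  -- The common factor `g` is divided out of the purity exponents. The chain built below has the
  -- reduced period, although purity is known only for `g k` and `g l`.
  obtain ⟨g, k, l, hg, hkl, rfl, rfl⟩ : ∃ g k l : ℕ, 0 < g ∧ k.Coprime l ∧ k₀ = g * k ∧ l₀ = g * l := by
    obtain ⟨k, l, h, h1, h2⟩ := Nat.exists_coprime k₀ l₀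
    exact ⟨k₀.gcd l₀, k, l, Nat.gcd_pos_of_pos_left _ hk₀, h, h1.trans (mul_comm _ _), h2.trans (mul_comm _ _)⟩
  have hk := Nat.pos_of_mul_pos_left hk₀
  have hl := Nat.pos_of_mul_pos_left hl₀
  let W := Fin r → (C.CL L).functionField
  have hr : Module.finrank (C.CL L).functionField W = r := Module.finrank_fin_fun _
  let : Module L W := Module.compHom W (kToK (C.prL L))
  have hL : ∀ (a : L) (w : W), a • w = kToK (C.prL L) a • w := fun _ _ => rfl
  obtain ⟨γ⟩ := exists_genEmb hE.locallyFree
  obtain ⟨z⟩ := PointedCurve.nonempty_uniformizer (C := C)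
  obtain ⟨T, hT, hTe⟩ := exists_frobK e γ hE.locallyFree hr
  have hΛ := hE.frobSpan_iterate hr hT hTe z hL
  obtain ⟨V, hV, b, hb⟩ := γ.exists_frame hE.locallyFree hr (C.infLPt L)
  have hfg : (γ.lat (C.infLPt L)).FG := by
    rw [hb.lat_eq_span hV]
    exact Submodule.fg_span (Set.finite_range b)
  have h : IsTauChain e γ T z (iterLat (z.zK L) T (γ.lat (C.infLPt L)) k l) r k l :=
    { free := hE.locallyFree
      rank := hr
      L_smul := hL
      T_smul := hT
      T_emb := hTe
      chain := (z.localFrob hL hT).isLatChain_iterLat hl hΛ hk hg hfg fun w =>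
        let ⟨n, hn⟩ := γ.exists_pow_smul_mem_lat hE.locallyFree hr z.val_zK_lt_one w
        ⟨n, hn n le_rfl⟩ }
  obtain ⟨S, η, hη⟩ := h.exists_model
  have hc := LPoint.isSpecOf_ofAlgHom cstar
  let S' : AbelianTauSheaf (LPoint.ofAlgHom cstar) r d := ⟨S, h.isAbelian hη hM hc⟩
  exact ⟨_, hc, S', h.nonempty_iso (S := S') hη, k, l, hk, hl, hkl, h.mul_eq_mul hM, h.isPeriodic hη⟩

end

theorem mainTheorem2 {Fq : Type u} [Field Fq] [Fintype Fq] (C : PointedCurve Fq)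
    (L : Type u) [Field L] [Algebra Fq L] :
    (∀ (cstar : C.A →ₐ[Fq] L) (r d : ℕ) (M : TauModule C L), M.IsPureAMotive cstar r d →
      ∃ c : LPoint C L, c.IsSpecOf cstar ∧ ∃ S : AbelianTauSheaf c r d,
        Nonempty (M.Iso S.motive) ∧
        ∃ k l : ℕ, 0 < k ∧ 0 < l ∧ k.Coprime l ∧ l * d = k * r ∧ S.IsPeriodic k l) ∧
    (∀ (c : LPoint C L) (r d r' d' : ℕ) (S : AbelianTauSheaf c r d) (T : AbelianTauSheaf c r' d'),
      S.weight = T.weight → ∀ f₀ : S.motive.Hom T.motive,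
        ∃ (m : ℤ) (f : S.toTauSheafData.Hom (T.toTauSheafData.twist m)),
          ∀ s, f₀.f s = S.motiveMap T m f s) := by
  exact ⟨fun _ _ _ _ hM => hM.exists_abelianTauSheaf, fun _ _ _ _ _ _ _ h f₀ =>
    AbelianTauSheaf.exists_hom_twist f₀ h⟩
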